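/- Let $X$ be a uniformly discrete metric space of bounded geometry (there is $\delta>0$ with $d(x,y)\ge\delta$ for all $x\ne y$, and for every $r>0$ the number of points in balls of radius $r$ is bounded), and let $\mathcal H_0$ be a separable infinite-dimensional complex Hilbert space. A matrix $T=(T(x,y))_{x,y\in X}$ has finite propagation if there is $S>0$ with $T(x,y)=0$ whenever $d(x,y)\ge S$. Define the following objects. * $\mathbb C_u[X]$ is the $*$-algebra of $X$-by-$X$ complex matrices of finite propagation with uniformly bounded entries, represented on $\ell^2(X)$. * $U\mathbb C[X]$ is the $*$-algebra of finite propagation $X$-by-$X$ matrices $T$ with entries in $\mathcal K(\mathcal H_0)$ such that for every $\varepsilon>0$ there are $N\in\mathbb N$ and a finite propagation matrix $T_0$ with uniformly bounded entries of rank at most $N$ and $\|T_0(x,y)-T(x,y)\|<\varepsilon$ for all $x,y$; it is represented on $\ell^2(X,\mathcal H_0)$. * $C^*_{u,\sim}(X)$ and $UC^*_\sim(X)$ are the completions of $\mathbb C_u[X]$ and $U\mathbb C[X]$, both in the norm of these representations (the reduced case) or both in the maximal norm, that is, the supremum of $\|\pi(T)\|$ over all $*$-representations $\pi$ on Hilbert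 spaces (the maximal case). * $E_{alg}$ is the space of finite propagation $X$-by-$X$ matrices $\xi=(\xi_{xy})$ with uniformly bounded entries in $\mathcal H_0$, with its right action of $\mathbb C_u[X]$ by matrix multiplication and the $\mathbb C_u[X]$-valued inner product $(\xi\,|\,\eta)_{zw}=\sum_{y}\langle\xi_{yz},\eta_{yw}\rangle$ (inner products are linear in the second variable). Its completion $E_\sim$ is a Hilbert $C^*_{u,\sim}(X)$-module, on which $UC^*_\sim(X)$ acts on the left by the extension of $(T\xi)_{xy}=\sum_z T(x,z)\,\xi_{zy}$. Put $K_1(A)=K_0(C_0(\mathbb R,A))$ and $K_*=K_0\oplus K_1$. Let $E_*:K_*(UC^*_\sim(X))\to K_*(C^*_{u,\sim}(X))$ be the homomorphism of Exel induced by the bimodule $E=E_\sim$: on $K_0$, if $F:M\to N$ is a Fredholm operator between right Hilbert $UC^*_\sim(X)$-modules, then $E_*$ sends the index of $F$ to the index of $F\otimes 1:M\otimes_{UC^*_\sim(X)}E\to N\otimes_{UC^*_\sim(X)}E$, and every element of $K_0(UC^*_\sim(X))$ is the index of such an $F$; on $K_1$, it is the map so defined by the suspended bimodule $C_0(\mathbb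 R,E)$ on the suspensions of the two algebras. For unit vectors $\eta_x\in\mathcal H_0$ $(x\in X)$, let $i_P:C^*_{u,\sim}(X)\to UC^*_\sim(X)$ be the $*$-homomorphism that extends $\mathbb C_u[X]\to U\mathbb C[X]$, $[i_P(T)](x,y)=T(x,y)\,\theta_{\eta_x,\eta_y}$, where $\theta_{\eta,\eta'}(v)=\eta\,\langle\eta',v\rangle$. Then, in both the reduced and the maximal case, $E_*$ is a well-defined isomorphism $K_*(UC^*_\sim(X))\cong K_*(C^*_{u,\sim}(X))$, and for every choice of the unit vectors $(\eta_x)_{x\in X}$ the map $$i_{P*}:K_*(C^*_{u,\sim}(X))\to K_*(UC^*_\sim(X))$$ is its inverse. -/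

import Mathlib

noncomputable section

open UniformSpace
open scoped ZeroAtInfty

universe u v w

namespace UniformRoe

set_option linter.unusedSectionVars false

/-! ### Extension of bounded (semi)bilinear maps to completions -/

section Extension

variable {P Q R : Type*} [SeminormedAddCommGroup P] [NormedSpace ℂ P]
  [SeminormedAddCommGroup Q] [NormedSpace ℂ Q] [NormedAddCommGroup R] [NormedSpace ℂ R]
  [CompleteSpace R] {σ : ℂ →+* ℂ} [RingHomIsometric σ]

theorem norm_fromCompletion_le (f : Q →L[ℂ] R) (x : Completion Q) :
    ‖f.fromCompletion x‖ ≤ ‖f‖ * ‖x‖ := by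
  induction x using Completion.induction_on with
  | hp => exact isClosed_le (by fun_prop) (by fun_prop)
  | ih a => simpa using f.le_opNorm a

/-- A bounded bilinear map (semilinear in the first variable) into a complete space, extended to
the completions in both variables. -/
def extendBilin (f : P →SL[σ] Q →L[ℂ] R) : Completion P →SL[σ] Completion Q →L[ℂ] R :=
  ContinuousLinearMap.fromCompletion
    (LinearMap.mkContinuous
      { toFun := fun p => (f p).fromCompletion
        map_add' := fun p p' => by
          ext q
          induction q using Completion.induction_on with
          | hp => exact isClosed_eq (by fun_prop) (by fun_prop)
          | ih a => simp
        map_smul' := fun c p => by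
          ext q
          induction q using Completion.induction_on with
          | hp => exact isClosed_eq (by fun_prop) (by fun_prop)
          | ih a => simp }
      ‖f‖ (fun p => ContinuousLinearMap.opNorm_le_bound _ (by positivity) fun q =>
        (norm_fromCompletion_le (f p) q).trans
          (mul_le_mul_of_nonneg_right (f.le_opNorm p) (norm_nonneg _))))

@[simp]
theorem extendBilin_coe (f : P →SL[σ] Q →L[ℂ] R) (p : P) (q : Q) :
    extendBilin f (p : Completion P) (q : Completion Q) = f p q := by
  simp [extendBilin]

end Extension

/-! ### C*-seminorms on *-algebras and their C*-completions -/

/-- A C*-seminorm on a (not necessarily unital) complex *-algebra. -/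
structure CStarSeminorm (𝒜 : Type*) [NonUnitalRing 𝒜] [StarRing 𝒜] [Module ℂ 𝒜] where
  toFun : 𝒜 → ℝ
  add_le : ∀ a b, toFun (a + b) ≤ toFun a + toFun b
  smul_eq : ∀ (c : ℂ) a, toFun (c • a) = ‖c‖ * toFun a
  mul_le : ∀ a b, toFun (a * b) ≤ toFun a * toFun b
  star_eq : ∀ a, toFun (star a) = toFun a
  cstar : ∀ a, toFun (star a * a) = toFun a * toFun a

namespace CStarSeminorm

variable {𝒜 : Type*} [NonUnitalRing 𝒜] [StarRing 𝒜] [Module ℂ 𝒜]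

/-- The *-algebra `𝒜`, seen as a seminormed space through a C*-seminorm. -/
@[nolint unusedArguments]
def Pre (_N : CStarSeminorm 𝒜) : Type _ := 𝒜

variable (N : CStarSeminorm 𝒜)

instance : NonUnitalRing N.Pre := inferInstanceAs (NonUnitalRing 𝒜)
instance : StarRing N.Pre := inferInstanceAs (StarRing 𝒜)
instance : Module ℂ N.Pre := inferInstanceAs (Module ℂ 𝒜)
instance [IsScalarTower ℂ 𝒜 𝒜] : IsScalarTower ℂ N.Pre N.Pre :=
  inferInstanceAs (IsScalarTower ℂ 𝒜 𝒜)
instance [SMulCommClass ℂ 𝒜 𝒜] : SMulCommClass ℂ N.Pre N.Pre :=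
  inferInstanceAs (SMulCommClass ℂ 𝒜 𝒜)
instance [StarModule ℂ 𝒜] : StarModule ℂ N.Pre := inferInstanceAs (StarModule ℂ 𝒜)

/-- The identity map from `𝒜` to its seminormed copy. -/
def toPre (a : 𝒜) : N.Pre := a

theorem zero_eq : N.toFun 0 = 0 := by
  simpa using N.smul_eq 0 0

instance : SeminormedAddCommGroup N.Pre :=
  AddGroupSeminorm.toSeminormedAddCommGroup
    { toFun := N.toFun
      map_zero' := N.zero_eq
      add_le' := N.add_le
      neg' := fun a => by
        have := N.smul_eq (-1) (a : 𝒜)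
        rw [norm_neg, norm_one, one_mul] at this
        exact (congrArg N.toFun (neg_one_smul ℂ (a : 𝒜))).symm.trans this }

theorem norm_def (a : N.Pre) : ‖a‖ = N.toFun a := rfl

instance : NormedSpace ℂ N.Pre where
  norm_smul_le c a := (N.smul_eq c a).le

variable [IsScalarTower ℂ 𝒜 𝒜] [SMulCommClass ℂ 𝒜 𝒜] [StarModule ℂ 𝒜]

/-- The C*-algebra obtained by (separation and) completion of `𝒜` for a C*-seminorm. -/
def Compl : Type _ := Completion N.Pre

instance : NormedAddCommGroup N.Compl := inferInstanceAs (NormedAddCommGroup (Completion N.Pre))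
instance : NormedSpace ℂ N.Compl := inferInstanceAs (NormedSpace ℂ (Completion N.Pre))
instance : CompleteSpace N.Compl := inferInstanceAs (CompleteSpace (Completion N.Pre))

/-- The canonical map from `𝒜` to its C*-completion. -/
def ofPre (a : N.Pre) : N.Compl := (a : Completion N.Pre)

theorem continuous_ofPre : Continuous N.ofPre := Completion.continuous_coe _

theorem denseRange_ofPre : DenseRange N.ofPre := Completion.denseRange_coe

theorem norm_ofPre (a : N.Pre) : ‖N.ofPre a‖ = N.toFun a := Completion.norm_coe a

theorem ofPre_add (a b : N.Pre) : N.ofPre (a + b) = N.ofPre a + N.ofPre b :=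
  Completion.coe_add a b

theorem ofPre_smul (c : ℂ) (a : N.Pre) : N.ofPre (c • a) = c • N.ofPre a :=
  Completion.coe_smul c a

/-- The canonical map from `𝒜` to its C*-completion, as a bounded linear map. -/
def ofPreL : N.Pre →L[ℂ] N.Compl where
  toFun := N.ofPre
  map_add' := N.ofPre_add
  map_smul' := N.ofPre_smul
  cont := N.continuous_ofPre

/-- Left-and-right multiplication, as a bounded bilinear map on the completion. -/
def mulL : N.Compl →L[ℂ] N.Compl →L[ℂ] N.Compl :=
  extendBilin (P := N.Pre) (Q := N.Pre) (R := N.Compl)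
    (LinearMap.mkContinuous₂ (LinearMap.mk₂ ℂ (fun a b => N.ofPre (a * b))
      (fun a a' b => by rw [add_mul, ofPre_add])
      (fun c a b => by rw [smul_mul_assoc, ofPre_smul])
      (fun a b b' => by rw [mul_add, ofPre_add])
      (fun c a b => by rw [mul_smul_comm, ofPre_smul])) 1
      (fun a b => by
        rw [one_mul]
        exact (N.norm_ofPre _).trans_le (N.mul_le a b)))

theorem mulL_ofPre (a b : N.Pre) : N.mulL (N.ofPre a) (N.ofPre b) = N.ofPre (a * b) :=
  extendBilin_coe _ a b

/-- The involution, as a bounded conjugate-linear map on the completion. -/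
def starL : N.Compl →SL[starRingEnd ℂ] N.Compl :=
  ContinuousLinearMap.fromCompletion (α := N.Pre) (β := N.Compl)
    (LinearMap.mkContinuous
      { toFun := fun a => N.ofPre (star a)
        map_add' := fun a b => by rw [star_add, ofPre_add]
        map_smul' := fun c a => by rw [star_smul, ofPre_smul]; rfl } 1
      (fun a => by
        rw [one_mul]
        exact (N.norm_ofPre _).trans_le (N.star_eq a).le))

theorem starL_ofPre (a : N.Pre) : N.starL (N.ofPre a) = N.ofPre (star a) :=
  ContinuousLinearMap.fromCompletion_apply_coe _ a

instance : Mul N.Compl := ⟨fun a b => N.mulL a b⟩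
instance : Star N.Compl := ⟨fun a => N.starL a⟩

theorem ofPre_mul (a b : N.Pre) : N.ofPre (a * b) = N.ofPre a * N.ofPre b :=
  (N.mulL_ofPre a b).symm

theorem ofPre_star (a : N.Pre) : N.ofPre (star a) = star (N.ofPre a) :=
  (N.starL_ofPre a).symm

theorem continuous_mul' : Continuous fun p : N.Compl × N.Compl => p.1 * p.2 :=
  (N.mulL.continuous.comp continuous_fst).clm_apply continuous_snd

theorem continuous_star' : Continuous fun a : N.Compl => star a := N.starL.continuous

variable {N} in
@[elab_as_elim]
theorem induction_on {p : N.Compl → Prop} (a : N.Compl) (hp : IsClosed {a | p a})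
    (h : ∀ a, p (N.ofPre a)) : p a :=
  Completion.induction_on (α := N.Pre) a hp h

instance : ContinuousMul N.Compl := ⟨N.continuous_mul'⟩
instance : ContinuousStar N.Compl := ⟨N.continuous_star'⟩

instance : NonUnitalRing N.Compl where
  left_distrib a b c := map_add (N.mulL a) b c
  right_distrib a b c := by
    change N.mulL (a + b) c = N.mulL a c + N.mulL b c
    simp
  zero_mul a := by
    change N.mulL 0 a = 0
    simp
  mul_zero a := (N.mulL a).map_zero
  mul_assoc a b c := by
    refine induction_on a (isClosed_eq ?_ ?_) fun a => ?_
    · fun_prop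
    · fun_prop
    refine induction_on b (isClosed_eq ?_ ?_) fun b => ?_
    · fun_prop
    · fun_prop
    refine induction_on c (isClosed_eq ?_ ?_) fun c => ?_
    · fun_prop
    · fun_prop
    simp only [← ofPre_mul, mul_assoc]

instance : StarRing N.Compl where
  star_involutive a := by
    refine induction_on a (isClosed_eq ?_ ?_) fun a => ?_
    · fun_prop
    · fun_prop
    simp only [← ofPre_star, star_star]
  star_mul a b := by
    refine induction_on a (isClosed_eq ?_ ?_) fun a => ?_
    · fun_prop
    · fun_prop
    refine induction_on b (isClosed_eq ?_ ?_) fun b => ?_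
    · fun_prop
    · fun_prop
    simp only [← ofPre_star, ← ofPre_mul, star_mul]
  star_add a b := map_add N.starL a b

instance : NonUnitalNormedRing N.Compl where
  __ := (inferInstance : NonUnitalRing N.Compl)
  __ := (inferInstance : NormedAddCommGroup N.Compl)
  norm_mul_le a b := by
    refine induction_on a (isClosed_le ?_ ?_) fun a => ?_
    · fun_prop
    · fun_prop
    refine induction_on b (isClosed_le ?_ ?_) fun b => ?_
    · fun_prop
    · fun_prop
    rw [← ofPre_mul, norm_ofPre, norm_ofPre, norm_ofPre]
    exact N.mul_le a b

instance : NonUnitalCStarAlgebra N.Compl where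
  norm_mul_self_le a := by
    refine induction_on a (isClosed_le ?_ ?_) fun a => ?_
    · fun_prop
    · fun_prop
    rw [← ofPre_star, ← ofPre_mul, norm_ofPre, norm_ofPre]
    exact (N.cstar a).ge
  smul_assoc c a b := by
    change N.mulL (c • a) b = c • N.mulL a b
    simp
  smul_comm c a b := by
    change c • N.mulL a b = N.mulL a (c • b)
    simp
  star_smul c a := by
    exact N.starL.map_smulₛₗ c a

/-- The canonical *-homomorphism from `𝒜` to its C*-completion. -/
def ι : 𝒜 →⋆ₙₐ[ℂ] N.Compl where
  toFun a := N.ofPre (N.toPre a)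
  map_smul' c a := N.ofPre_smul c a
  map_zero' := N.ofPreL.map_zero
  map_add' a b := N.ofPre_add a b
  map_mul' a b := N.ofPre_mul a b
  map_star' a := N.ofPre_star a

theorem norm_ι (a : 𝒜) : ‖N.ι a‖ = N.toFun a := N.norm_ofPre a

theorem denseRange_ι : DenseRange N.ι := N.denseRange_ofPre

variable {ℬ : Type*} [NonUnitalRing ℬ] [StarRing ℬ] [Module ℂ ℬ] [IsScalarTower ℂ ℬ ℬ]
  [SMulCommClass ℂ ℬ ℬ] [StarModule ℂ ℬ]

/-- The extension to the completions of a *-homomorphism that is contractive for the given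
C*-seminorms. -/
def extend (N : CStarSeminorm 𝒜) (N' : CStarSeminorm ℬ) (φ : 𝒜 →⋆ₙₐ[ℂ] ℬ)
    (h : ∀ a, N'.toFun (φ a) ≤ N.toFun a) : N.Compl →⋆ₙₐ[ℂ] N'.Compl :=
  let f : N.Compl →L[ℂ] N'.Compl :=
    ContinuousLinearMap.fromCompletion (α := N.Pre) (β := N'.Compl)
      (LinearMap.mkContinuous
        { toFun := fun a : N.Pre => N'.ι (φ a)
          map_add' := fun a b => by
            exact (congrArg N'.ι (map_add φ (a : 𝒜) b)).trans (map_add N'.ι _ _)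
          map_smul' := fun c a => by
            exact (congrArg N'.ι (map_smul φ c (a : 𝒜))).trans (map_smul N'.ι _ _) } 1
        (fun a => by
          rw [one_mul]
          exact (N'.norm_ι _).trans_le (h a)))
  have hf : ∀ a : 𝒜, f (N.ofPre a) = N'.ι (φ a) := fun a =>
    ContinuousLinearMap.fromCompletion_apply_coe _ (N.toPre a)
  have hfc : Continuous f := f.continuous
  { toFun := f
    map_smul' := fun c a => map_smul f c a
    map_zero' := f.map_zero
    map_add' := fun a b => map_add f a b
    map_mul' := fun a b => by
      refine induction_on a (isClosed_eq ?_ ?_) fun a => ?_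
      · fun_prop
      · fun_prop
      refine induction_on b (isClosed_eq ?_ ?_) fun b => ?_
      · fun_prop
      · fun_prop
      rw [← ofPre_mul]
      exact (hf (a * b)).trans ((congrArg N'.ι (map_mul φ a b)).trans
        ((map_mul N'.ι _ _).trans (congrArg₂ (· * ·) (hf a).symm (hf b).symm)))
    map_star' := fun a => by
      refine induction_on a (isClosed_eq ?_ ?_) fun a => ?_
      · fun_prop
      · fun_prop
      rw [← ofPre_star]
      exact (hf (star a)).trans ((congrArg N'.ι (map_star φ a)).trans
        ((map_star N'.ι _).trans (congrArg star (hf a).symm))) }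

theorem extend_ι (N : CStarSeminorm 𝒜) (N' : CStarSeminorm ℬ) (φ : 𝒜 →⋆ₙₐ[ℂ] ℬ)
    (h : ∀ a, N'.toFun (φ a) ≤ N.toFun a) (a : 𝒜) :
    extend N N' φ h (N.ι a) = N'.ι (φ a) :=
  ContinuousLinearMap.fromCompletion_apply_coe _ (N.toPre a)

end CStarSeminorm

/-! ### Bounded geometry -/

/-- A metric space has bounded geometry if, for every `r > 0`, the number of points in balls of
radius `r` is uniformly bounded. -/
class BoundedGeometry (X : Type*) [MetricSpace X] : Prop where
  exists_bound : ∀ r : ℝ, 0 < r → ∃ N : ℕ, ∀ x : X, (Metric.ball x r).encard ≤ N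

/-- A metric space is uniformly discrete if the distances between distinct points are bounded below
by a positive constant. -/
class UniformlyDiscrete (X : Type*) [MetricSpace X] : Prop where
  exists_le_dist : ∃ δ : ℝ, 0 < δ ∧ ∀ x y : X, x ≠ y → δ ≤ dist x y

/-! ### Operators on `ℓ²(X, K)` and their matrices -/

/-- The Hilbert space `ℓ²(X, K)`; in particular `ℓ²(X) = L2 X ℂ`. -/
abbrev L2 (X K : Type*) [NormedAddCommGroup K] : Type _ := lp (fun _ : X => K) 2

section Entries

variable {X : Type*} {K K' K'' : Type*}
  [NormedAddCommGroup K] [InnerProductSpace ℂ K]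
  [NormedAddCommGroup K'] [InnerProductSpace ℂ K']
  [NormedAddCommGroup K''] [InnerProductSpace ℂ K'']

open scoped Classical in
/-- The inclusion of `K` in `ℓ²(X, K)` as the summand at the point `y`. -/
def incl (K : Type*) [NormedAddCommGroup K] [InnerProductSpace ℂ K] (y : X) : K →L[ℂ] L2 X K :=
  lp.singleContinuousLinearMap ℂ (fun _ : X => K) 2 y

/-- The coordinate at the point `x`, as a map from `ℓ²(X, K)` to `K`. -/
def coord (K : Type*) [NormedAddCommGroup K] [InnerProductSpace ℂ K] (x : X) : L2 X K →L[ℂ] K :=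
  lp.evalCLM ℂ (fun _ : X => K) 2 x

/-- The `(x, y)` entry `T(x, y) : K → K'` of the matrix of a bounded operator
`T : ℓ²(X, K) → ℓ²(X, K')`. -/
def entry (T : L2 X K →L[ℂ] L2 X K') (x y : X) : K →L[ℂ] K' :=
  coord K' x ∘L T ∘L incl K y

theorem coord_apply (x : X) (f : L2 X K) : coord K x f = f x := rfl

theorem coord_incl_self (x : X) (k : K) : coord K x (incl K x k) = k := by
  classical
  simp [coord_apply, incl]

theorem coord_incl_ne {x y : X} (h : x ≠ y) (k : K) : coord K x (incl K y k) = 0 := by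
  classical
  simp [coord_apply, incl, h]

theorem entry_apply (T : L2 X K →L[ℂ] L2 X K') (x y : X) (k : K) :
    entry T x y k = T (incl K y k) x := rfl

theorem hasSum_incl (f : L2 X K) : HasSum (fun z => incl K z (f z)) f := by
  classical
  simpa only [incl, lp.singleContinuousLinearMap_apply] using! lp.hasSum_single (by simp) f

theorem norm_incl (x : X) (k : K) : ‖incl K x k‖ = ‖k‖ := by
  classical
  exact lp.norm_single (E := fun _ : X => K) (p := 2) (by simp) x k

theorem inner_incl_left (x : X) (k : K) (f : L2 X K) : inner ℂ (incl K x k) f = inner ℂ k (f x) := by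
  classical
  exact lp.inner_single_left (𝕜 := ℂ) (G := fun _ : X => K) x k f

theorem inner_incl_right (x : X) (k : K) (f : L2 X K) : inner ℂ f (incl K x k) = inner ℂ (f x) k := by
  classical
  exact lp.inner_single_right (𝕜 := ℂ) (G := fun _ : X => K) x k f

theorem norm_entry_le (T : L2 X K →L[ℂ] L2 X K') (x y : X) : ‖entry T x y‖ ≤ ‖T‖ := by
  refine ContinuousLinearMap.opNorm_le_bound _ (norm_nonneg T) fun k => ?_
  rw [entry_apply]
  calc ‖T (incl K y k) x‖ ≤ ‖T (incl K y k)‖ := lp.norm_apply_le_norm (by simp) _ _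
    _ ≤ ‖T‖ * ‖incl K y k‖ := T.le_opNorm _
    _ = ‖T‖ * ‖k‖ := by rw [norm_incl]

theorem ext_incl {F : Type*} [NormedAddCommGroup F] [NormedSpace ℂ F]
    {S T : L2 X K →L[ℂ] F} (h : ∀ y k, S (incl K y k) = T (incl K y k)) : S = T := by
  ext1 f
  have h1 := (hasSum_incl f).mapL S
  have h2 := (hasSum_incl f).mapL T
  simp only [h] at h1
  exact h1.unique h2

theorem ext_entry {S T : L2 X K →L[ℂ] L2 X K'} (h : ∀ x y, entry S x y = entry T x y) : S = T := by
  refine ext_incl fun y k => ?_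
  ext x
  exact congrArg (fun F => F k) (h x y)

@[simp]
theorem entry_zero (x y : X) : entry (0 : L2 X K →L[ℂ] L2 X K') x y = 0 := by
  ext k
  simp [entry]

@[simp]
theorem entry_add (S T : L2 X K →L[ℂ] L2 X K') (x y : X) :
    entry (S + T) x y = entry S x y + entry T x y := by
  ext k
  simp [entry]

@[simp]
theorem entry_sub (S T : L2 X K →L[ℂ] L2 X K') (x y : X) :
    entry (S - T) x y = entry S x y - entry T x y := by
  ext k
  simp [entry]

@[simp]
theorem entry_smul (c : ℂ) (T : L2 X K →L[ℂ] L2 X K') (x y : X) :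
    entry (c • T) x y = c • entry T x y := by
  ext k
  simp [entry]

theorem entry_sum {ι : Type*} (s : Finset ι) (T : ι → L2 X K →L[ℂ] L2 X K') (x y : X) :
    entry (∑ i ∈ s, T i) x y = ∑ i ∈ s, entry (T i) x y := by
  classical
  induction s using Finset.induction_on with
  | empty => simp
  | insert a s ha ih => rw [Finset.sum_insert ha, Finset.sum_insert ha, entry_add, ih]

theorem hasSum_entry_comp (T : L2 X K' →L[ℂ] L2 X K'') (S : L2 X K →L[ℂ] L2 X K') (x y : X)
    (k : K) : HasSum (fun z => entry T x z (entry S z y k)) (entry (T ∘L S) x y k) :=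
  (hasSum_incl (S (incl K y k))).mapL (coord K'' x ∘L T)

variable [CompleteSpace K] [CompleteSpace K']

theorem entry_adjoint (T : L2 X K →L[ℂ] L2 X K') (x y : X) :
    entry (ContinuousLinearMap.adjoint T) x y = ContinuousLinearMap.adjoint (entry T y x) := by
  rw [ContinuousLinearMap.eq_adjoint_iff]
  intro k k'
  rw [entry_apply, entry_apply, ← inner_incl_right, ContinuousLinearMap.adjoint_inner_left,
    inner_incl_left]

end Entries

/-! ### Finite propagation -/

section FinProp

variable {X : Type*} [MetricSpace X] {K K' K'' : Type*}
  [NormedAddCommGroup K] [InnerProductSpace ℂ K]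
  [NormedAddCommGroup K'] [InnerProductSpace ℂ K']
  [NormedAddCommGroup K''] [InnerProductSpace ℂ K'']

/-- An `X`-by-`X` matrix has finite propagation if there is `S > 0` such that its entries `a x y`
vanish whenever `d(x, y) ≥ S`. -/
def FinitePropagation {V : Type*} [Zero V] (a : X → X → V) : Prop :=
  ∃ S : ℝ, 0 < S ∧ ∀ x y, S ≤ dist x y → a x y = 0

theorem FinitePropagation.zero : FinitePropagation (entry (0 : L2 X K →L[ℂ] L2 X K')) :=
  ⟨1, one_pos, fun x y _ => entry_zero x y⟩

theorem FinitePropagation.add {S T : L2 X K →L[ℂ] L2 X K'} (hS : FinitePropagation (entry S))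
    (hT : FinitePropagation (entry T)) : FinitePropagation (entry (S + T)) := by
  obtain ⟨s, hs, hs'⟩ := hS
  obtain ⟨t, ht, ht'⟩ := hT
  refine ⟨max s t, lt_max_of_lt_left hs, fun x y h => ?_⟩
  rw [entry_add, hs' x y ((le_max_left _ _).trans h), ht' x y ((le_max_right _ _).trans h), add_zero]

theorem FinitePropagation.smul (c : ℂ) {T : L2 X K →L[ℂ] L2 X K'}
    (hT : FinitePropagation (entry T)) : FinitePropagation (entry (c • T)) := by
  obtain ⟨t, ht, ht'⟩ := hT
  exact ⟨t, ht, fun x y h => by rw [entry_smul, ht' x y h, smul_zero]⟩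

theorem FinitePropagation.comp {T : L2 X K' →L[ℂ] L2 X K''} {S : L2 X K →L[ℂ] L2 X K'}
    (hT : FinitePropagation (entry T)) (hS : FinitePropagation (entry S)) :
    FinitePropagation (entry (T ∘L S)) := by
  obtain ⟨s, hs, hs'⟩ := hS
  obtain ⟨t, ht, ht'⟩ := hT
  refine ⟨t + s, add_pos ht hs, fun x y h => ?_⟩
  ext k
  rw [zero_apply]
  refine (hasSum_entry_comp T S x y k).unique ?_
  convert hasSum_zero using 2 with z
  rcases le_or_gt t (dist x z) with h1 | h1
  · simp [ht' x z h1]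
  · have h2 : s ≤ dist z y := by
      have := dist_triangle x z y
      linarith
    simp [hs' z y h2]

theorem FinitePropagation.adjoint [CompleteSpace K] [CompleteSpace K']
    {T : L2 X K →L[ℂ] L2 X K'} (hT : FinitePropagation (entry T)) :
    FinitePropagation (entry (ContinuousLinearMap.adjoint T)) := by
  obtain ⟨t, ht, ht'⟩ := hT
  refine ⟨t, ht, fun x y h => ?_⟩
  rw [entry_adjoint, ht' y x (by rwa [dist_comm]), map_zero]

end FinProp

/-! ### Diagonal operators -/

section Diag

variable {X : Type*} {K K' K'' : Type*}
  [NormedAddCommGroup K] [InnerProductSpace ℂ K]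
  [NormedAddCommGroup K'] [InnerProductSpace ℂ K']
  [NormedAddCommGroup K''] [InnerProductSpace ℂ K'']

/-- The block diagonal operator with entries `A x : K → K'` on the diagonal. -/
def diagOp (A : X → K →L[ℂ] K') {C : ℝ} (hC : 0 ≤ C) (hA : ∀ x, ‖A x‖ ≤ C) :
    L2 X K →L[ℂ] L2 X K' :=
  lp.mapCLM 2 A hC hA

theorem diagOp_apply (A : X → K →L[ℂ] K') {C : ℝ} (hC : 0 ≤ C) (hA : ∀ x, ‖A x‖ ≤ C)
    (f : L2 X K) (x : X) : diagOp A hC hA f x = A x (f x) := rfl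

theorem norm_diagOp_le (A : X → K →L[ℂ] K') {C : ℝ} (hC : 0 ≤ C) (hA : ∀ x, ‖A x‖ ≤ C) :
    ‖diagOp A hC hA‖ ≤ C :=
  lp.norm_mapCLM_le 2 A hC hA

theorem diagOp_incl (A : X → K →L[ℂ] K') {C : ℝ} (hC : 0 ≤ C) (hA : ∀ x, ‖A x‖ ≤ C) (y : X)
    (k : K) : diagOp A hC hA (incl K y k) = incl K' y (A y k) := by
  ext x
  rw [diagOp_apply, ← coord_apply, ← coord_apply]
  by_cases h : x = y
  · subst h
    rw [coord_incl_self, coord_incl_self]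
  · rw [coord_incl_ne h, coord_incl_ne h, map_zero]

theorem entry_diagOp_comp (A : X → K' →L[ℂ] K'') {C : ℝ} (hC : 0 ≤ C) (hA : ∀ x, ‖A x‖ ≤ C)
    (T : L2 X K →L[ℂ] L2 X K') (x y : X) :
    entry (diagOp A hC hA ∘L T) x y = A x ∘L entry T x y := rfl

theorem entry_comp_diagOp (A : X → K →L[ℂ] K') {C : ℝ} (hC : 0 ≤ C) (hA : ∀ x, ‖A x‖ ≤ C)
    (T : L2 X K' →L[ℂ] L2 X K'') (x y : X) :
    entry (T ∘L diagOp A hC hA) x y = entry T x y ∘L A y := by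
  ext k
  change T (diagOp A hC hA (incl K y k)) x = _
  rw [diagOp_incl]
  rfl

theorem entry_diagOp_ne (A : X → K →L[ℂ] K') {C : ℝ} (hC : 0 ≤ C) (hA : ∀ x, ‖A x‖ ≤ C) {x y : X}
    (h : x ≠ y) : entry (diagOp A hC hA) x y = 0 := by
  ext k
  rw [entry_apply, diagOp_incl]
  exact coord_incl_ne h _

theorem entry_diagOp_self (A : X → K →L[ℂ] K') {C : ℝ} (hC : 0 ≤ C) (hA : ∀ x, ‖A x‖ ≤ C) (x : X) :
    entry (diagOp A hC hA) x x = A x := by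
  ext k
  rw [entry_apply, diagOp_incl]
  exact coord_incl_self x _

theorem finitePropagation_of_diag [MetricSpace X] {T : L2 X K →L[ℂ] L2 X K'}
    (h : ∀ x y, x ≠ y → entry T x y = 0) : FinitePropagation (entry T) :=
  ⟨1, one_pos, fun x y hxy => h x y fun e => by
    rw [e, dist_self] at hxy
    exact absurd hxy (by norm_num)⟩

end Diag

/-! ### Colourings and the boundedness of representations -/

section Colouring

theorem norm_star_mul_le {H : Type*} [NormedAddCommGroup H] [InnerProductSpace ℂ H]
    [CompleteSpace H] (T : H →L[ℂ] H) : ‖star T * T‖ ≤ ‖T‖ * ‖T‖ :=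
  (CStarRing.norm_star_mul_self (x := T)).le

theorem exists_colouring {X : Type*} [MetricSpace X] [BoundedGeometry X] (R : ℝ) (hR : 0 < R) :
    ∃ (N : ℕ) (c : X → Fin N), ∀ x y, c x = c y → dist x y < R → x = y := by
  classical
  obtain ⟨N, hN⟩ := BoundedGeometry.exists_bound (X := X) R hR
  have wf : WellFounded (WellOrderingRel (α := X)) := WellOrderingRel.isWellOrder.wf
  let F : ∀ x : X, (∀ y, WellOrderingRel y x → ℕ) → ℕ := fun x f =>
    sInf {n : ℕ | ∀ y (h : WellOrderingRel y x), dist y x < R → f y h ≠ n}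
  let c : X → ℕ := wf.fix F
  have hc : ∀ x, c x = sInf {n : ℕ | ∀ y, WellOrderingRel y x → dist y x < R → c y ≠ n} :=
    fun x => wf.fix_eq F x
  have key : ∀ x, ∃ n ≤ N, ∀ y, WellOrderingRel y x → dist y x < R → c y ≠ n := by
    intro x
    by_contra! hcon
    have hsub : ((Finset.range (N + 1) : Finset ℕ) : Set ℕ) ⊆ c '' Metric.ball x R := by
      intro n hn
      obtain ⟨y, -, hy, hyn⟩ := hcon n (by simpa [Nat.lt_succ_iff] using hn)
      exact ⟨y, hy, hyn⟩
    have h1 := (Set.encard_le_encard hsub).trans ((Set.encard_image_le c _).trans (hN x))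
    rw [Set.encard_coe_eq_coe_finsetCard, Finset.card_range] at h1
    have h2 : N + 1 ≤ N := by exact_mod_cast h1
    omega
  have hmem : ∀ x, ∀ y, WellOrderingRel y x → dist y x < R → c y ≠ c x := by
    intro x
    obtain ⟨n, -, hn⟩ := key x
    have := Nat.sInf_mem (s := {n : ℕ | ∀ y, WellOrderingRel y x → dist y x < R → c y ≠ n}) ⟨n, hn⟩
    rw [← hc x] at this
    exact this
  have hle : ∀ x, c x < N + 1 := by
    intro x
    obtain ⟨n, hn, hn'⟩ := key x
    rw [hc x]
    exact Nat.lt_succ_of_le ((Nat.sInf_le (m := n)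
      (s := {n | ∀ y, WellOrderingRel y x → dist y x < R → c y ≠ n}) hn').trans hn)
  refine ⟨N + 1, fun x => ⟨c x, hle x⟩, fun x y hxy hd => ?_⟩
  have hxy' : c x = c y := congrArg Fin.val hxy
  rcases trichotomous_of (WellOrderingRel (α := X)) x y with h | h | h
  · exact absurd hxy' (hmem y x h hd)
  · exact h
  · exact absurd hxy'.symm (hmem x y h (by rwa [dist_comm]))

variable {X : Type*} {K K' : Type*}
  [NormedAddCommGroup K] [InnerProductSpace ℂ K]
  [NormedAddCommGroup K'] [InnerProductSpace ℂ K']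

open scoped Classical in
/-- The projection of `ℓ²(X, K)` onto `ℓ²(s, K)`, for a subset `s` of `X`. -/
def cut (K : Type*) [NormedAddCommGroup K] [InnerProductSpace ℂ K] (s : Set X) :
    L2 X K →L[ℂ] L2 X K :=
  diagOp (fun x => if x ∈ s then ContinuousLinearMap.id ℂ K else 0) zero_le_one fun x => by
    split_ifs
    · exact ContinuousLinearMap.norm_id_le
    · simp

theorem norm_cut_le (s : Set X) : ‖cut K s‖ ≤ 1 := norm_diagOp_le _ _ _

open scoped Classical in
theorem entry_cut_comp_cut (T : L2 X K →L[ℂ] L2 X K') (s t : Set X) (x y : X) :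
    entry (cut K' s ∘L T ∘L cut K t) x y = if x ∈ s ∧ y ∈ t then entry T x y else 0 := by
  rw [cut, entry_diagOp_comp, cut, entry_comp_diagOp]
  by_cases hx : x ∈ s <;> by_cases hy : y ∈ t <;> simp [hx, hy]

theorem entry_cut_ne {s : Set X} {x y : X} (h : x ≠ y) : entry (cut K s) x y = 0 :=
  entry_diagOp_ne _ _ _ h

theorem sum_cut {N : ℕ} (c : X → Fin N) (T : L2 X K →L[ℂ] L2 X K') :
    ∑ i, ∑ j, cut K' (c ⁻¹' {i}) ∘L T ∘L cut K (c ⁻¹' {j}) = T := by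
  classical
  refine ext_entry fun x y => ?_
  simp only [entry_sum, entry_cut_comp_cut, Set.mem_preimage, Set.mem_singleton_iff, ite_and]
  simp

variable [CompleteSpace K] [CompleteSpace K']

theorem cut_diag [MetricSpace X] {T : L2 X K →L[ℂ] L2 X K'} {S : ℝ}
    (hT : ∀ x y, S ≤ dist x y → entry T x y = 0) {s t : Set X}
    (ht : ∀ x ∈ t, ∀ y ∈ t, dist x y < 2 * S → x = y) (x y : X) (hxy : x ≠ y) :
    entry (ContinuousLinearMap.adjoint (cut K' s ∘L T ∘L cut K t) ∘L (cut K' s ∘L T ∘L cut K t))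
      x y = 0 := by
  classical
  ext k
  rw [zero_apply]
  refine (hasSum_entry_comp _ _ x y k).unique ?_
  convert hasSum_zero using 2 with z
  rw [entry_adjoint, entry_cut_comp_cut, entry_cut_comp_cut]
  by_cases h1 : z ∈ s ∧ y ∈ t
  · by_cases h2 : z ∈ s ∧ x ∈ t
    · rcases le_or_gt S (dist z y) with h3 | h3
      · simp [hT z y h3]
      · rcases le_or_gt S (dist z x) with h4 | h4
        · simp [hT z x h4]
        · refine absurd (ht x h2.2 y h1.2 ?_) hxy
          have := dist_triangle_left x y z
          linarith
    · simp [h2]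
  · simp [h1]

/-- A *-algebra all of whose elements are uniformly bounded over its *-representations. -/
class HasMaximalNorm (𝒜 : Type w) [NonUnitalRing 𝒜] [StarRing 𝒜] [Module ℂ 𝒜] : Prop where
  exists_bound : ∀ a : 𝒜, ∃ C : ℝ, ∀ (H : Type w) [NormedAddCommGroup H] [InnerProductSpace ℂ H]
    [CompleteSpace H] (π : 𝒜 →⋆ₙₐ[ℂ] (H →L[ℂ] H)), ‖π a‖ ≤ C

theorem hasMaximalNorm_of_diag [MetricSpace X] [BoundedGeometry X]
    (𝒮 : NonUnitalStarSubalgebra ℂ (L2 X K →L[ℂ] L2 X K))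
    (h1 : ∀ T ∈ 𝒮, FinitePropagation (entry T))
    (h2 : ∀ T ∈ 𝒮, ∀ s t : Set X, cut K s ∘L T ∘L cut K t ∈ 𝒮)
    (h3 : IsClosed {T | T ∈ 𝒮 ∧ ∀ x y, x ≠ y → entry T x y = 0}) :
    HasMaximalNorm 𝒮 where
  exists_bound := by
    rintro ⟨T, hT⟩
    obtain ⟨S, hS, hS'⟩ := h1 T hT
    obtain ⟨N, c, hc⟩ := exists_colouring (X := X) (2 * S) (by positivity)
    refine ⟨∑ _i : Fin N, ∑ _j : Fin N, ‖T‖, ?_⟩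
    intro H _ _ _ π
    let V : Fin N → Fin N → 𝒮 := fun i j => ⟨cut K (c ⁻¹' {i}) ∘L T ∘L cut K (c ⁻¹' {j}),
      h2 T hT _ _⟩
    have hV : (⟨T, hT⟩ : 𝒮) = ∑ i, ∑ j, V i j := by
      apply Subtype.ext
      simp only [AddSubmonoidClass.coe_finsetSum]
      exact (sum_cut c T).symm
    let D : NonUnitalStarSubalgebra ℂ (L2 X K →L[ℂ] L2 X K) :=
      { carrier := {T | T ∈ 𝒮 ∧ ∀ x y, x ≠ y → entry T x y = 0}
        add_mem' := fun {A B} hA hB => ⟨add_mem hA.1 hB.1, fun x y h => by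
          rw [entry_add, hA.2 x y h, hB.2 x y h, add_zero]⟩
        zero_mem' := ⟨zero_mem _, fun x y _ => entry_zero x y⟩
        mul_mem' := fun {A B} hA hB => ⟨mul_mem hA.1 hB.1, fun x y h => by
          ext k
          rw [zero_apply]
          refine (hasSum_entry_comp _ _ x y k).unique ?_
          convert hasSum_zero using 2 with z
          by_cases hz : x = z
          · rw [hB.2 z y (hz ▸ h)]; simp
          · rw [hA.2 x z hz]; simp⟩
        smul_mem' := fun r A hA => ⟨SMulMemClass.smul_mem r hA.1, fun x y h => by
          rw [entry_smul, hA.2 x y h, smul_zero]⟩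
        star_mem' := fun {A} hA => ⟨star_mem hA.1, fun x y h => by
          rw [ContinuousLinearMap.star_eq_adjoint, entry_adjoint, hA.2 y x h.symm, map_zero]⟩ }
    have hD : IsClosed (D : Set (L2 X K →L[ℂ] L2 X K)) := h3
    let j : D →⋆ₙₐ[ℂ] 𝒮 :=
      { toFun := fun a => ⟨a.1, a.2.1⟩
        map_smul' := fun _ _ => rfl
        map_zero' := rfl
        map_add' := fun _ _ => rfl
        map_mul' := fun _ _ => rfl
        map_star' := fun _ => rfl }
    have hb : ∀ a : D, ‖π (j a)‖ ≤ ‖a‖ := fun a =>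
      NonUnitalStarAlgHom.norm_apply_le (π.comp j) a
    have hVn : ∀ i l, ‖(V i l : L2 X K →L[ℂ] L2 X K)‖ ≤ ‖T‖ := fun i l => by
      calc ‖cut K (c ⁻¹' {i}) ∘L T ∘L cut K (c ⁻¹' {l})‖
          ≤ ‖cut K (c ⁻¹' {i})‖ * (‖T‖ * ‖cut K (c ⁻¹' {l})‖) :=
            (ContinuousLinearMap.opNorm_comp_le _ _).trans
              (mul_le_mul_of_nonneg_left (ContinuousLinearMap.opNorm_comp_le _ _) (norm_nonneg _))
        _ ≤ 1 * (‖T‖ * 1) := by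
            gcongr
            · exact norm_cut_le _
            · exact norm_cut_le _
        _ = ‖T‖ := by ring
    have hπ : ∀ i l, ‖π (V i l)‖ ≤ ‖T‖ := by
      intro i l
      have hmem : ((star (V i l) * V i l : 𝒮) : L2 X K →L[ℂ] L2 X K) ∈ D := by
        refine ⟨(star (V i l) * V i l).2, fun x y hxy => ?_⟩
        exact cut_diag hS' (fun x hx y hy hd => hc x y (hx.trans hy.symm) hd) x y hxy
      have h5 : ‖π (V i l)‖ * ‖π (V i l)‖ ≤ ‖T‖ * ‖T‖ := by
        rw [← CStarRing.norm_star_mul_self, ← map_star, ← map_mul]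
        refine (hb ⟨_, hmem⟩).trans ?_
        change ‖star (V i l : L2 X K →L[ℂ] L2 X K) * (V i l : L2 X K →L[ℂ] L2 X K)‖ ≤ _
        refine (norm_star_mul_le _).trans ?_
        exact mul_le_mul (hVn i l) (hVn i l) (norm_nonneg _) (norm_nonneg _)
      exact abs_le_of_sq_le_sq' (by nlinarith) (norm_nonneg _) |>.2
    rw [hV, map_sum]
    refine (norm_sum_le _ _).trans (Finset.sum_le_sum fun i _ => ?_)
    rw [map_sum]
    exact (norm_sum_le _ _).trans (Finset.sum_le_sum fun l _ => hπ i l)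

end Colouring

/-! ### The reduced and the maximal norm -/

section Norms

/-- The norm of a *-algebra of bounded operators on a Hilbert space. -/
def reducedSeminorm {H : Type*} [NormedAddCommGroup H] [InnerProductSpace ℂ H] [CompleteSpace H]
    (𝒮 : NonUnitalStarSubalgebra ℂ (H →L[ℂ] H)) : CStarSeminorm 𝒮 where
  toFun a := ‖(a : H →L[ℂ] H)‖
  add_le a b := norm_add_le (a : H →L[ℂ] H) b
  smul_eq c a := norm_smul c (a : H →L[ℂ] H)
  mul_le a b := norm_mul_le (a : H →L[ℂ] H) b
  star_eq a := norm_star (a : H →L[ℂ] H)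
  cstar a := CStarRing.norm_star_mul_self (x := (a : H →L[ℂ] H))

variable (𝒜 : Type w) [NonUnitalRing 𝒜] [StarRing 𝒜] [Module ℂ 𝒜]

/-- The norms `‖π a‖` of the images of `a` under all *-representations `π` of a *-algebra by bounded
operators on Hilbert spaces. -/
def repNorms {𝒜 : Type w} [NonUnitalRing 𝒜] [StarRing 𝒜] [Module ℂ 𝒜] (a : 𝒜) : Set ℝ :=
  {r | ∃ (H : Type w) (_ : NormedAddCommGroup H) (_ : InnerProductSpace ℂ H) (_ : CompleteSpace H)
    (π : 𝒜 →⋆ₙₐ[ℂ] (H →L[ℂ] H)), r = ‖π a‖}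

theorem mem_repNorms {𝒜 : Type w} [NonUnitalRing 𝒜] [StarRing 𝒜] [Module ℂ 𝒜] {H : Type w}
    [NormedAddCommGroup H] [InnerProductSpace ℂ H] [CompleteSpace H]
    (π : 𝒜 →⋆ₙₐ[ℂ] (H →L[ℂ] H)) (a : 𝒜) : ‖π a‖ ∈ repNorms a :=
  ⟨H, _, _, _, π, rfl⟩

theorem repNorms_nonempty {𝒜 : Type w} [NonUnitalRing 𝒜] [StarRing 𝒜] [Module ℂ 𝒜] (a : 𝒜) :
    (repNorms a).Nonempty :=
  ⟨_, mem_repNorms (H := L2 PEmpty.{w + 1} ℂ) 0 a⟩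

variable {𝒜} [HasMaximalNorm 𝒜]

theorem repNorms_bddAbove (a : 𝒜) : BddAbove (repNorms a) := by
  obtain ⟨C, hC⟩ := HasMaximalNorm.exists_bound a
  refine ⟨C, ?_⟩
  rintro _ ⟨H, _, _, _, π, rfl⟩
  exact hC H π

theorem norm_rep_le (a : 𝒜) {H : Type w} [NormedAddCommGroup H] [InnerProductSpace ℂ H]
    [CompleteSpace H] (π : 𝒜 →⋆ₙₐ[ℂ] (H →L[ℂ] H)) : ‖π a‖ ≤ sSup (repNorms a) :=
  le_csSup (repNorms_bddAbove a) (mem_repNorms π a)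

theorem sSup_repNorms_le (a : 𝒜) {C : ℝ} (h : ∀ (H : Type w) [NormedAddCommGroup H]
    [InnerProductSpace ℂ H] [CompleteSpace H] (π : 𝒜 →⋆ₙₐ[ℂ] (H →L[ℂ] H)), ‖π a‖ ≤ C) :
    sSup (repNorms a) ≤ C := by
  refine csSup_le (repNorms_nonempty a) ?_
  rintro _ ⟨H, _, _, _, π, rfl⟩
  exact h H π

theorem sSup_repNorms_nonneg (a : 𝒜) : 0 ≤ sSup (repNorms a) :=
  (norm_nonneg _).trans (norm_rep_le a (H := L2 PEmpty.{w + 1} ℂ) 0)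

/-- A bounded *-representation on a pre-Hilbert space satisfies the bound by the maximal norm. -/
theorem norm_le_of_preRep {V : Type w} [SeminormedAddCommGroup V] [InnerProductSpace ℂ V]
    (L : 𝒜 → V →L[ℂ] V) (hadd : ∀ a b, L (a + b) = L a + L b) (hsmul : ∀ (c : ℂ) a, L (c • a) = c • L a)
    (hmul : ∀ a b, L (a * b) = L a ∘L L b)
    (hadj : ∀ a v w, inner ℂ (L a v) w = inner ℂ v (L (star a) w)) (a : 𝒜) (v : V) :
    ‖L a v‖ ≤ sSup (repNorms a) * ‖v‖ := by
  have hzero : L 0 = 0 := by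
    have := hsmul 0 0
    rwa [zero_smul, zero_smul] at this
  have hext : ∀ {f g : Completion V →L[ℂ] Completion V}, (∀ v : V, f v = g v) → f = g := by
    intro f g h
    ext1 x
    exact Completion.induction_on x (isClosed_eq f.continuous g.continuous) h
  have hc : ∀ (a : 𝒜) (v : V), (L a).completion v = (L a v : V) := fun a v =>
    ContinuousLinearMap.completion_apply_coe (L a) v
  let π : 𝒜 →⋆ₙₐ[ℂ] (Completion V →L[ℂ] Completion V) :=
    { toFun := fun a => (L a).completion
      map_smul' := fun c a => hext fun x => by
        rw [hc, hsmul]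
        exact (Completion.coe_smul c (L a x)).trans (congrArg (c • ·) (hc a x).symm)
      map_zero' := hext fun x => by
        rw [hc, hzero]
        rfl
      map_add' := fun a b => hext fun x => by
        rw [hc, hadd]
        exact (Completion.coe_add (L a x) (L b x)).trans
          (congrArg₂ (· + ·) (hc a x).symm (hc b x).symm)
      map_mul' := fun a b => hext fun x => by
        rw [hc, hmul]
        exact ((congrArg (L a).completion (hc b x)).trans (hc a (L b x))).symm
      map_star' := fun a => by
        rw [ContinuousLinearMap.star_eq_adjoint, ContinuousLinearMap.eq_adjoint_iff]
        intro x y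
        refine Completion.induction_on₂ x y (isClosed_eq ?_ ?_) fun x y => ?_
        · exact ((L (star a)).completion.continuous.comp continuous_fst).inner continuous_snd
        · exact continuous_fst.inner ((L a).completion.continuous.comp continuous_snd)
        rw [hc, hc, Completion.inner_coe, Completion.inner_coe, hadj, star_star] }
  have h := (π a).le_of_opNorm_le (norm_rep_le a π) (v : Completion V)
  have h2 : π a (v : Completion V) = (L a v : V) := hc a v
  rwa [h2, Completion.norm_coe, Completion.norm_coe] at h

/-- The bound by the maximal norm holds for representations on Hilbert spaces in any universe. -/
theorem norm_rep_le' [IsScalarTower ℂ 𝒜 𝒜] [SMulCommClass ℂ 𝒜 𝒜] (a : 𝒜) {H : Type*}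
    [NormedAddCommGroup H] [InnerProductSpace ℂ H]
    [CompleteSpace H] (π : 𝒜 →⋆ₙₐ[ℂ] (H →L[ℂ] H)) : ‖π a‖ ≤ sSup (repNorms a) := by
  have hadj : ∀ (a : 𝒜) (x y : H), inner ℂ (π a x) y = inner ℂ x (π (star a) y) := by
    intro a x y
    rw [map_star, ContinuousLinearMap.star_eq_adjoint, ContinuousLinearMap.adjoint_inner_right]
  have key : ∀ (h : H) (a b : 𝒜), ‖π (a * b) h‖ ≤ sSup (repNorms a) * ‖π b h‖ := by
    intro h a b
    let cd : PreInnerProductSpace.Core ℂ 𝒜 :=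
      { inner := fun a b => inner ℂ (π a h) (π b h)
        conj_inner_symm := fun a b => inner_conj_symm _ _
        re_inner_nonneg := fun a => inner_self_nonneg
        add_left := fun a b c => by simp
        smul_left := fun a b r => by simp [mul_comm] }
    let : SeminormedAddCommGroup 𝒜 := InnerProductSpace.Core.toSeminormedAddCommGroup (c := cd)
    let : InnerProductSpace ℂ 𝒜 := InnerProductSpace.ofCore cd
    have hn : ∀ a : 𝒜, ‖a‖ = ‖π a h‖ := fun a => by
      rw [@norm_eq_sqrt_re_inner ℂ, @norm_eq_sqrt_re_inner ℂ]
      rfl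
    let L : 𝒜 → 𝒜 →L[ℂ] 𝒜 := fun a => (LinearMap.mulLeft ℂ a).mkContinuous ‖π a‖ fun b => by
      rw [hn, hn, LinearMap.mulLeft_apply, map_mul]
      exact (π a).le_opNorm _
    have hfin := norm_le_of_preRep L (fun a b => by ext x; exact add_mul a b x)
      (fun c a => by ext x; exact smul_mul_assoc c a x) (fun a b => by ext x; exact mul_assoc a b x)
      (fun a v w => by
        change inner ℂ (π (a * v) h) (π w h) = inner ℂ (π v h) (π (star a * w) h)
        rw [map_mul, map_mul, mul_apply_eq_comp, hadj]
        rfl) a b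
    rwa [hn, hn] at hfin
  have h2 : ‖π a * star (π a)‖ ≤ sSup (repNorms a) * ‖star (π a)‖ := by
    refine ContinuousLinearMap.opNorm_le_bound _
      (mul_nonneg (sSup_repNorms_nonneg a) (norm_nonneg _)) fun h => ?_
    rw [← map_star, ← map_mul, mul_assoc]
    exact (key h a (star a)).trans
      (mul_le_mul_of_nonneg_left ((π (star a)).le_opNorm h) (sSup_repNorms_nonneg a))
  rw [CStarRing.norm_self_mul_star, norm_star] at h2
  by_cases h0 : ‖π a‖ = 0
  · rw [h0]
    exact sSup_repNorms_nonneg a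
  · exact le_of_mul_le_mul_right h2 (lt_of_le_of_ne (norm_nonneg _) (Ne.symm h0))

variable (𝒜)

/-- The maximal C*-seminorm of a *-algebra: the supremum of `‖π a‖` over all *-representations `π`
by bounded operators on Hilbert spaces. -/
def maximalSeminorm : CStarSeminorm 𝒜 where
  toFun a := sSup (repNorms a)
  add_le a b := sSup_repNorms_le _ fun H _ _ _ π => by
    rw [map_add]
    exact (norm_add_le _ _).trans (add_le_add (norm_rep_le a π) (norm_rep_le b π))
  smul_eq c a := by
    have key : ∀ (c : ℂ) (a : 𝒜), sSup (repNorms (c • a)) ≤ ‖c‖ * sSup (repNorms a) := fun c a =>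
      sSup_repNorms_le _ fun H _ _ _ π => by
        rw [map_smul, norm_smul]
        exact mul_le_mul_of_nonneg_left (norm_rep_le a π) (norm_nonneg _)
    refine le_antisymm (key c a) ?_
    by_cases hc : c = 0
    · subst hc
      simpa using sSup_repNorms_nonneg _
    · have := key c⁻¹ (c • a)
      rw [inv_smul_smul₀ hc, norm_inv] at this
      rwa [← div_eq_inv_mul, le_div_iff₀ (norm_pos_iff.mpr hc), mul_comm] at this
  mul_le a b := sSup_repNorms_le _ fun H _ _ _ π => by
    rw [map_mul]
    exact (norm_mul_le _ _).trans
      (mul_le_mul (norm_rep_le a π) (norm_rep_le b π) (norm_nonneg _) (sSup_repNorms_nonneg a))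
  star_eq a := by
    have key : ∀ a : 𝒜, sSup (repNorms (star a)) ≤ sSup (repNorms a) := fun a =>
      sSup_repNorms_le _ fun H _ _ _ π => by
        rw [map_star, norm_star]
        exact norm_rep_le a π
    refine le_antisymm (key a) ?_
    simpa using key (star a)
  cstar a := by
    refine le_antisymm (sSup_repNorms_le _ fun H _ _ _ π => ?_) ?_
    · rw [map_mul, map_star, CStarRing.norm_star_mul_self]
      exact mul_le_mul (norm_rep_le a π) (norm_rep_le a π) (norm_nonneg _) (sSup_repNorms_nonneg a)
    · have h : sSup (repNorms a) ≤ √(sSup (repNorms (star a * a))) :=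
        sSup_repNorms_le _ fun H _ _ _ π => by
          refine Real.le_sqrt_of_sq_le ?_
          rw [sq, ← CStarRing.norm_star_mul_self, ← map_star, ← map_mul]
          exact norm_rep_le _ π
      calc sSup (repNorms a) * sSup (repNorms a)
          ≤ √(sSup (repNorms (star a * a))) * √(sSup (repNorms (star a * a))) :=
            mul_le_mul h h (sSup_repNorms_nonneg a) (Real.sqrt_nonneg _)
        _ = _ := Real.mul_self_sqrt (sSup_repNorms_nonneg _)

end Norms

section Matrices

variable {X : Type*} [MetricSpace X] [BoundedGeometry X] {K K' : Type*}
  [NormedAddCommGroup K] [InnerProductSpace ℂ K]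
  [NormedAddCommGroup K'] [InnerProductSpace ℂ K']

/-- Every matrix of finite propagation with uniformly bounded entries is the matrix of a (unique)
bounded operator. Hence *-algebras and modules of such matrices may be described as spaces of bounded
operators. -/
theorem exists_operator_of_matrix (a : X → X → K →L[ℂ] K') (ha : FinitePropagation a) {C : ℝ}
    (hC : ∀ x y, ‖a x y‖ ≤ C) : ∃! T : L2 X K →L[ℂ] L2 X K', entry T = a := by
  classical
  obtain ⟨S, hS, hS'⟩ := ha
  obtain ⟨M, hM⟩ := BoundedGeometry.exists_bound (X := X) S hS
  have hfin : ∀ x : X, (Metric.ball x S).Finite := fun x =>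
    Set.encard_lt_top_iff.mp ((hM x).trans_lt (ENat.natCast_lt_top M))
  let b : X → Finset X := fun x => (hfin x).toFinset
  have hb : ∀ x y, y ∈ b x ↔ dist y x < S := fun x y => by simp [b]
  have hcard : ∀ x, (b x).card ≤ M := fun x => by
    have := hM x
    rw [(hfin x).encard_eq_coe_toFinset_card] at this
    exact_mod_cast this
  have h2 : (2 : ENNReal).toReal = 2 := by simp
  have h2' : 0 < (2 : ENNReal).toReal := by simp
  set D : ℝ := |C| * M with hD
  have hD0 : 0 ≤ D := by positivity
  have key : ∀ (f : L2 X K) (s : Finset X),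
      ∑ x ∈ s, ‖∑ y ∈ b x, a x y (f y)‖ ^ (2 : ENNReal).toReal
        ≤ (D * ‖f‖) ^ (2 : ENNReal).toReal := by
    intro f s
    rw [h2]
    simp only [Real.rpow_two]
    have h3 : ∀ x, ‖∑ y ∈ b x, a x y (f y)‖ ^ 2 ≤ C ^ 2 * M * ∑ y ∈ b x, ‖f y‖ ^ 2 := by
      intro x
      have h4 : ‖∑ y ∈ b x, a x y (f y)‖ ≤ ∑ y ∈ b x, |C| * ‖f y‖ :=
        norm_sum_le_of_le _ fun y _ => (a x y).le_of_opNorm_le ((hC x y).trans (le_abs_self C)) _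
      calc ‖∑ y ∈ b x, a x y (f y)‖ ^ 2 ≤ (∑ y ∈ b x, |C| * ‖f y‖) ^ 2 := by gcongr
        _ ≤ (b x).card * ∑ y ∈ b x, (|C| * ‖f y‖) ^ 2 := sq_sum_le_card_mul_sum_sq
        _ ≤ M * ∑ y ∈ b x, (|C| * ‖f y‖) ^ 2 := by
            gcongr
            exact hcard x
        _ = C ^ 2 * M * ∑ y ∈ b x, ‖f y‖ ^ 2 := by
            simp only [mul_pow, sq_abs, ← Finset.mul_sum]
            ring
    have h5 : ∑ x ∈ s, ∑ y ∈ b x, ‖f y‖ ^ 2 ≤ M * ‖f‖ ^ 2 := by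
      have h6 : ∑ x ∈ s, ∑ y ∈ b x, ‖f y‖ ^ 2
          = ∑ y ∈ s.biUnion b, ∑ x ∈ s with y ∈ b x, ‖f y‖ ^ 2 := by
        refine Finset.sum_comm' fun x y => ?_
        simp only [Finset.mem_biUnion, Finset.mem_filter]
        constructor
        · rintro ⟨h7, h8⟩
          exact ⟨⟨h7, h8⟩, x, h7, h8⟩
        · rintro ⟨⟨h7, h8⟩, -⟩
          exact ⟨h7, h8⟩
      rw [h6]
      have h7 : ∀ y ∈ s.biUnion b, ∑ x ∈ s with y ∈ b x, ‖f y‖ ^ 2 ≤ M * ‖f y‖ ^ 2 := by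
        intro y _
        rw [Finset.sum_const, nsmul_eq_mul]
        gcongr
        refine (Finset.card_le_card fun x hx => ?_).trans (hcard y)
        rw [Finset.mem_filter, hb] at hx
        rw [hb, dist_comm]
        exact hx.2
      refine (Finset.sum_le_sum h7).trans ?_
      rw [← Finset.mul_sum]
      have h8 := lp.sum_rpow_le_norm_rpow h2' f (s.biUnion b)
      rw [h2] at h8
      simp only [Real.rpow_two] at h8
      gcongr
    calc ∑ x ∈ s, ‖∑ y ∈ b x, a x y (f y)‖ ^ 2
        ≤ ∑ x ∈ s, C ^ 2 * M * ∑ y ∈ b x, ‖f y‖ ^ 2 := Finset.sum_le_sum fun x _ => h3 x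
      _ = C ^ 2 * M * ∑ x ∈ s, ∑ y ∈ b x, ‖f y‖ ^ 2 := by rw [← Finset.mul_sum]
      _ ≤ C ^ 2 * M * (M * ‖f‖ ^ 2) := by gcongr
      _ = (D * ‖f‖) ^ 2 := by
        rw [hD, mul_pow, mul_pow, sq_abs]
        ring
  let L : L2 X K →ₗ[ℂ] L2 X K' :=
    { toFun := fun f => ⟨fun x => ∑ y ∈ b x, a x y (f y), memℓp_gen' (key f)⟩
      map_add' := fun f g => by
        ext x
        change ∑ y ∈ b x, a x y (f y + g y) = ∑ y ∈ b x, a x y (f y) + ∑ y ∈ b x, a x y (g y)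
        simp [Finset.sum_add_distrib]
      map_smul' := fun c f => by
        ext x
        change ∑ y ∈ b x, a x y (c • f y) = c • ∑ y ∈ b x, a x y (f y)
        simp [Finset.smul_sum] }
  refine ⟨L.mkContinuous D fun f =>
    lp.norm_le_of_forall_sum_le h2' (mul_nonneg hD0 (norm_nonneg f)) (key f), ?_, ?_⟩
  · ext x y k
    change ∑ z ∈ b x, a x z (incl K y k z) = a x y k
    by_cases hy : y ∈ b x
    · rw [Finset.sum_eq_single_of_mem y hy fun z _ hz => ?_]
      · exact congrArg (a x y) (coord_incl_self y k)
      · exact (congrArg (a x z) (coord_incl_ne hz k)).trans (map_zero _)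
    · rw [Finset.sum_eq_zero fun z hz => ?_]
      · rw [hb, not_lt, dist_comm] at hy
        rw [hS' x y hy]
        rfl
      · have hzy : z ≠ y := fun h => hy (h ▸ hz)
        exact (congrArg (a x z) (coord_incl_ne hzy k)).trans (map_zero _)
  · intro T hT
    refine ext_entry fun x y => ?_
    rw [hT]
    ext k
    change a x y k = ∑ z ∈ b x, a x z (incl K y k z)
    by_cases hy : y ∈ b x
    · rw [Finset.sum_eq_single_of_mem y hy fun z _ hz => ?_]
      · exact (congrArg (a x y) (coord_incl_self y k)).symm
      · exact (congrArg (a x z) (coord_incl_ne hz k)).trans (map_zero _)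
    · rw [Finset.sum_eq_zero fun z hz => ?_]
      · rw [hb, not_lt, dist_comm] at hy
        rw [hS' x y hy]
        rfl
      · have hzy : z ≠ y := fun h => hy (h ▸ hz)
        exact (congrArg (a x z) (coord_incl_ne hzy k)).trans (map_zero _)

end Matrices

/-! ### The *-algebras `ℂ_u[X]` and `Uℂ[X]` -/

section Approx

variable {X : Type*} {K : Type*} [NormedAddCommGroup K] [InnerProductSpace ℂ K]

/-- A family of operators that can be approximated, uniformly in norm, by operators of uniformly
bounded finite rank. -/
def UniformlyApproximable (a : X → X → K →L[ℂ] K) : Prop :=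
  ∀ ε : ℝ, 0 < ε → ∃ N : ℕ, ∀ x y, ∃ F : K →L[ℂ] K,
    LinearMap.rank (F : K →ₗ[ℂ] K) ≤ (N : Cardinal) ∧ ‖F - a x y‖ < ε

theorem UniformlyApproximable.zero : UniformlyApproximable (fun _ _ => 0 : X → X → K →L[ℂ] K) :=
  fun ε hε => ⟨0, fun _ _ => ⟨0, by simp, by simpa using hε⟩⟩

theorem UniformlyApproximable.add {a b : X → X → K →L[ℂ] K} (ha : UniformlyApproximable a)
    (hb : UniformlyApproximable b) : UniformlyApproximable (fun x y => a x y + b x y) := by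
  intro ε hε
  obtain ⟨N, hN⟩ := ha (ε / 2) (half_pos hε)
  obtain ⟨M, hM⟩ := hb (ε / 2) (half_pos hε)
  refine ⟨N + M, fun x y => ?_⟩
  obtain ⟨F, hF, hF'⟩ := hN x y
  obtain ⟨G, hG, hG'⟩ := hM x y
  refine ⟨F + G, ?_, ?_⟩
  · rw [Nat.cast_add]
    exact (LinearMap.rank_add_le _ _).trans (add_le_add hF hG)
  · rw [add_sub_add_comm]
    exact (norm_add_le _ _).trans_lt (by linarith)

theorem rank_comp_right_le {F G : K →L[ℂ] K} {N : ℕ}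
    (h : LinearMap.rank (F : K →ₗ[ℂ] K) ≤ (N : Cardinal)) :
    LinearMap.rank ((F ∘L G : K →L[ℂ] K) : K →ₗ[ℂ] K) ≤ (N : Cardinal) :=
  (LinearMap.rank_comp_le_left (G : K →ₗ[ℂ] K) (F : K →ₗ[ℂ] K)).trans h

theorem rank_comp_left_le {F G : K →L[ℂ] K} {N : ℕ}
    (h : LinearMap.rank (F : K →ₗ[ℂ] K) ≤ (N : Cardinal)) :
    LinearMap.rank ((G ∘L F : K →L[ℂ] K) : K →ₗ[ℂ] K) ≤ (N : Cardinal) :=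
  (LinearMap.rank_comp_le_right (F : K →ₗ[ℂ] K) (G : K →ₗ[ℂ] K)).trans h

theorem UniformlyApproximable.smul (c : ℂ) {a : X → X → K →L[ℂ] K}
    (ha : UniformlyApproximable a) : UniformlyApproximable (fun x y => c • a x y) := by
  intro ε hε
  obtain ⟨N, hN⟩ := ha (ε / (‖c‖ + 1)) (by positivity)
  refine ⟨N, fun x y => ?_⟩
  obtain ⟨F, hF, hF'⟩ := hN x y
  refine ⟨c • F, ?_, ?_⟩
  · have : c • F = (c • ContinuousLinearMap.id ℂ K) ∘L F := by
      ext; simp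
    rw [this]
    exact rank_comp_left_le hF
  · rw [← smul_sub, norm_smul]
    calc ‖c‖ * ‖F - a x y‖ ≤ (‖c‖ + 1) * ‖F - a x y‖ := by gcongr; linarith
      _ < (‖c‖ + 1) * (ε / (‖c‖ + 1)) := by gcongr
      _ = ε := by field_simp

theorem rank_adjoint_le [CompleteSpace K] {F : K →L[ℂ] K} {N : ℕ}
    (h : LinearMap.rank (F : K →ₗ[ℂ] K) ≤ (N : Cardinal)) :
    LinearMap.rank ((ContinuousLinearMap.adjoint F : K →L[ℂ] K) : K →ₗ[ℂ] K) ≤ (N : Cardinal) := by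
  set R : Submodule ℂ K := LinearMap.range (F : K →ₗ[ℂ] K) with hR
  have hfin : Module.Finite ℂ R := by
    rw [← Module.rank_lt_aleph0_iff]
    exact h.trans_lt (Cardinal.natCast_lt_aleph0)
  have : FiniteDimensional ℂ R := hfin
  have hP : R.starProjection ∘L F = F := by
    ext k
    exact Submodule.starProjection_eq_self_iff.mpr ⟨k, rfl⟩
  have hadj : ContinuousLinearMap.adjoint F = ContinuousLinearMap.adjoint F ∘L R.starProjection := by
    conv_lhs => rw [← hP]
    rw [ContinuousLinearMap.adjoint_comp]
    congr 1
    exact isSelfAdjoint_starProjection R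
  rw [hadj]
  refine rank_comp_left_le (le_trans ?_ h)
  change Module.rank ℂ (LinearMap.range (R.starProjection : K →ₗ[ℂ] K)) ≤ _
  have : LinearMap.range (R.starProjection : K →ₗ[ℂ] K) ≤ R := by
    rintro _ ⟨k, rfl⟩
    exact Submodule.starProjection_apply_mem R k
  exact Submodule.rank_mono this

theorem UniformlyApproximable.adjoint [CompleteSpace K] {a : X → X → K →L[ℂ] K}
    (ha : UniformlyApproximable a) :
    UniformlyApproximable (fun x y => ContinuousLinearMap.adjoint (a y x)) := by
  intro ε hε
  obtain ⟨N, hN⟩ := ha ε hε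
  refine ⟨N, fun x y => ?_⟩
  obtain ⟨F, hF, hF'⟩ := hN y x
  refine ⟨ContinuousLinearMap.adjoint F, rank_adjoint_le hF, ?_⟩
  rwa [← map_sub, LinearIsometryEquiv.norm_map]

theorem UniformlyApproximable.comp [MetricSpace X] [BoundedGeometry X] {S T : L2 X K →L[ℂ] L2 X K}
    (hT : FinitePropagation (entry T)) (hT' : UniformlyApproximable (entry T)) :
    UniformlyApproximable (entry (T ∘L S)) := by
  classical
  intro ε hε
  obtain ⟨R, hR, hR'⟩ := hT
  obtain ⟨M, hM⟩ := BoundedGeometry.exists_bound (X := X) R hR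
  set δ : ℝ := ε / ((M + 1) * (‖S‖ + 1)) with hδ
  obtain ⟨N, hN⟩ := hT' δ (by positivity)
  refine ⟨M * N, fun x y => ?_⟩
  have hfin : (Metric.ball x R).Finite :=
    Set.encard_lt_top_iff.mp ((hM x).trans_lt (ENat.natCast_lt_top M))
  set s := hfin.toFinset with hs
  have hcard : s.card ≤ M := by
    have := hM x
    rw [hfin.encard_eq_coe_toFinset_card] at this
    exact_mod_cast this
  have hsum : entry (T ∘L S) x y = ∑ z ∈ s, entry T x z ∘L entry S z y := by
    ext k
    rw [sum_apply]
    refine (hasSum_entry_comp T S x y k).unique (hasSum_sum_of_ne_finset_zero fun z hz => ?_)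
    rw [hs, Set.Finite.mem_toFinset, Metric.mem_ball, not_lt, dist_comm] at hz
    rw [hR' x z hz]
    rfl
  choose F hF hF' using fun z => hN x z
  refine ⟨∑ z ∈ s, F z ∘L entry S z y, ?_, ?_⟩
  · have : ((∑ z ∈ s, F z ∘L entry S z y : K →L[ℂ] K) : K →ₗ[ℂ] K)
        = ∑ z ∈ s, ((F z ∘L entry S z y : K →L[ℂ] K) : K →ₗ[ℂ] K) := by
      ext k; simp
    rw [this]
    refine (LinearMap.rank_finsetSum_le _ _).trans ?_
    refine (Finset.sum_le_card_nsmul s _ (N : Cardinal) fun z _ => rank_comp_right_le (hF z)).trans ?_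
    rw [nsmul_eq_mul, Nat.cast_mul]
    gcongr
  · rw [hsum, ← Finset.sum_sub_distrib]
    have hterm : ∀ z ∈ s, ‖F z ∘L entry S z y - entry T x z ∘L entry S z y‖ ≤ δ * (‖S‖ + 1) := by
      intro z _
      rw [← ContinuousLinearMap.sub_comp]
      refine (ContinuousLinearMap.opNorm_comp_le _ _).trans ?_
      refine mul_le_mul (hF' z).le ((norm_entry_le S z y).trans (by linarith)) (norm_nonneg _) ?_
      positivity
    refine (norm_sum_le_of_le s hterm).trans_lt ?_
    rw [Finset.sum_const, nsmul_eq_mul]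
    have h1 : (s.card : ℝ) < M + 1 := by
      have : (s.card : ℝ) ≤ M := by exact_mod_cast hcard
      linarith
    calc (s.card : ℝ) * (δ * (‖S‖ + 1)) < (M + 1) * (δ * (‖S‖ + 1)) := by
          gcongr
      _ = ε := by rw [hδ]; field_simp

end Approx

section Algebras

variable (X : Type u) [MetricSpace X]

/-- The algebraic uniform Roe algebra `ℂ_u[X]`: the bounded operators on `ℓ²(X)` whose matrix has
finite propagation. -/
def Cu : NonUnitalStarSubalgebra ℂ (L2 X ℂ →L[ℂ] L2 X ℂ) where
  carrier := {T | FinitePropagation (entry T)}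
  add_mem' := FinitePropagation.add
  zero_mem' := FinitePropagation.zero
  mul_mem' := FinitePropagation.comp
  smul_mem' := fun c _ hT => FinitePropagation.smul c hT
  star_mem' := FinitePropagation.adjoint

variable (K : Type v) [NormedAddCommGroup K] [InnerProductSpace ℂ K]

/-- The condition that defines `Uℂ[X]`, for an operator on `ℓ²(X, K)`: the matrix has finite
propagation, and for every `ε > 0` its entries are within `ε` of those of a matrix of finite
propagation with uniformly bounded entries of uniformly bounded finite rank. -/
def IsUniform {X : Type u} [MetricSpace X] {K : Type v} [NormedAddCommGroup K]
    [InnerProductSpace ℂ K] (T : L2 X K →L[ℂ] L2 X K) : Prop :=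
  FinitePropagation (entry T) ∧ ∀ ε : ℝ, 0 < ε → ∃ T₀ : X → X → K →L[ℂ] K,
    FinitePropagation T₀ ∧ (∃ C : ℝ, ∀ x y, ‖T₀ x y‖ ≤ C) ∧
    (∃ N : ℕ, ∀ x y, LinearMap.rank (T₀ x y : K →ₗ[ℂ] K) ≤ (N : Cardinal)) ∧
    ∀ x y, ‖T₀ x y - entry T x y‖ < ε

variable {X K}

theorem isUniform_iff {T : L2 X K →L[ℂ] L2 X K} :
    IsUniform T ↔ FinitePropagation (entry T) ∧ UniformlyApproximable (entry T) := by
  classical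
  refine and_congr_right fun hT => ⟨fun h ε hε => ?_, fun h ε hε => ?_⟩
  · obtain ⟨T₀, -, -, ⟨N, hN⟩, h'⟩ := h ε hε
    exact ⟨N, fun x y => ⟨T₀ x y, hN x y, h' x y⟩⟩
  · obtain ⟨N, hN⟩ := h ε hε
    choose F hF hF' using hN
    obtain ⟨S, hS, hS'⟩ := hT
    have hclose : ∀ x y, ‖(if dist x y < S then F x y else 0) - entry T x y‖ < ε := by
      intro x y
      split_ifs with h1
      · exact hF' x y
      · simpa [hS' x y (not_lt.mp h1)] using hε
    refine ⟨fun x y => if dist x y < S then F x y else 0, ⟨S, hS, fun x y h1 => ?_⟩,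
      ⟨ε + ‖T‖, fun x y => ?_⟩, ⟨N, fun x y => ?_⟩, hclose⟩
    · exact if_neg (not_lt.mpr h1)
    · have h1 := norm_le_norm_add_norm_sub' (if dist x y < S then F x y else 0) (entry T x y)
      have h2 := norm_entry_le T x y
      have h3 := hclose x y
      linarith
    · dsimp only
      split_ifs
      · exact hF x y
      · simp

variable (X K) [BoundedGeometry X] [CompleteSpace K]

/-- The *-algebra `Uℂ[X]` of uniform operators on `ℓ²(X, K)`. -/
def UCalg : NonUnitalStarSubalgebra ℂ (L2 X K →L[ℂ] L2 X K) where
  carrier := {T | IsUniform T}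
  add_mem' := fun {S T} hS hT => by
    rw [Set.mem_ofPred_eq, isUniform_iff] at *
    refine ⟨hS.1.add hT.1, ?_⟩
    have := hS.2.add hT.2
    simpa only [← entry_add] using this
  zero_mem' := by
    rw [Set.mem_ofPred_eq, isUniform_iff]
    refine ⟨.zero, ?_⟩
    have h : entry (0 : L2 X K →L[ℂ] L2 X K) = fun _ _ => 0 := by
      ext x y k
      simp
    rw [h]
    exact .zero
  mul_mem' := fun {S T} hS hT => by
    rw [Set.mem_ofPred_eq, isUniform_iff] at *
    exact ⟨hS.1.comp hT.1, .comp hS.1 hS.2⟩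
  smul_mem' := fun c T hT => by
    rw [Set.mem_ofPred_eq, isUniform_iff] at *
    refine ⟨hT.1.smul c, ?_⟩
    have := hT.2.smul c
    simpa only [← entry_smul] using this
  star_mem' := fun {T} hT => by
    rw [Set.mem_ofPred_eq, isUniform_iff] at *
    refine ⟨hT.1.adjoint, ?_⟩
    have h : entry (star T) = fun x y => ContinuousLinearMap.adjoint (entry T y x) := by
      ext1 x
      ext1 y
      exact entry_adjoint T x y
    rw [h]
    exact hT.2.adjoint

variable {X K}

theorem mem_Cu {T : L2 X ℂ →L[ℂ] L2 X ℂ} : T ∈ Cu X ↔ FinitePropagation (entry T) := Iff.rfl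

theorem mem_UCalg {T : L2 X K →L[ℂ] L2 X K} : T ∈ UCalg X K ↔ IsUniform T := Iff.rfl

theorem mem_UCalg' {T : L2 X K →L[ℂ] L2 X K} :
    T ∈ UCalg X K ↔ FinitePropagation (entry T) ∧ UniformlyApproximable (entry T) := isUniform_iff

theorem finitePropagation_cut {K' : Type*} [NormedAddCommGroup K'] [InnerProductSpace ℂ K']
    {T : L2 X K →L[ℂ] L2 X K'} (hT : FinitePropagation (entry T)) (s t : Set X) :
    FinitePropagation (entry (cut K' s ∘L T ∘L cut K t)) := by
  classical
  obtain ⟨S, hS, hS'⟩ := hT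
  refine ⟨S, hS, fun x y h => ?_⟩
  rw [entry_cut_comp_cut, hS' x y h, ite_self]

theorem isClosed_diag {K' : Type*} [NormedAddCommGroup K'] [InnerProductSpace ℂ K'] :
    IsClosed {T : L2 X K →L[ℂ] L2 X K' | ∀ x y, x ≠ y → entry T x y = 0} := by
  simp only [Set.ofPred_forall]
  refine isClosed_iInter fun x => isClosed_iInter fun y => isClosed_iInter fun _ =>
    isClosed_eq ?_ continuous_const
  unfold entry
  fun_prop

instance : HasMaximalNorm (Cu X) := by
  refine hasMaximalNorm_of_diag _ (fun T hT => hT) (fun T hT s t => finitePropagation_cut hT s t) ?_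
  convert isClosed_diag (X := X) (K := ℂ) (K' := ℂ) using 2
  ext T
  exact ⟨fun h => h.2, fun h => ⟨finitePropagation_of_diag h, h⟩⟩

theorem isClosed_approximable : IsClosed {T : L2 X K →L[ℂ] L2 X K | UniformlyApproximable (entry T)} := by
  rw [← isSeqClosed_iff_isClosed]
  intro u T hu hT ε hε
  obtain ⟨n, hn⟩ := (Metric.tendsto_atTop.mp hT (ε / 2) (half_pos hε))
  have hn' := hn n le_rfl
  obtain ⟨N, hN⟩ := hu n (ε / 2) (half_pos hε)
  refine ⟨N, fun x y => ?_⟩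
  obtain ⟨F, hF, hF'⟩ := hN x y
  refine ⟨F, hF, ?_⟩
  have h1 := norm_entry_le (u n - T) x y
  rw [entry_sub] at h1
  rw [dist_eq_norm] at hn'
  have h2 := norm_add_le (F - entry (u n) x y) (entry (u n) x y - entry T x y)
  rw [sub_add_sub_cancel] at h2
  linarith

instance : HasMaximalNorm (UCalg X K) := by
  classical
  refine hasMaximalNorm_of_diag _ (fun T hT => hT.1) (fun T hT s t => ?_) ?_
  · rw [mem_UCalg'] at *
    refine ⟨finitePropagation_cut hT.1 s t, fun ε hε => ?_⟩
    obtain ⟨N, hN⟩ := hT.2 ε hε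
    refine ⟨N, fun x y => ?_⟩
    rw [entry_cut_comp_cut]
    split_ifs
    · exact hN x y
    · exact ⟨0, by simp, by simpa using hε⟩
  · convert (isClosed_diag (X := X) (K := K) (K' := K)).inter
      (isClosed_approximable (X := X) (K := K)) using 1
    ext T
    exact ⟨fun h => ⟨h.2, (isUniform_iff.mp h.1).2⟩,
      fun h => ⟨mem_UCalg'.mpr ⟨finitePropagation_of_diag h.1, h.2⟩, h.1⟩⟩

/-- The two flavours of completion: reduced and maximal. -/
inductive Variant
  | reduced
  | maximal

/-- The reduced or the maximal C*-seminorm of a *-algebra of operators on a Hilbert space. -/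
def Variant.seminorm (s : Variant) {H : Type w} [NormedAddCommGroup H] [InnerProductSpace ℂ H]
    [CompleteSpace H] (𝒮 : NonUnitalStarSubalgebra ℂ (H →L[ℂ] H)) [HasMaximalNorm 𝒮] :
    CStarSeminorm 𝒮 :=
  match s with
  | .reduced => reducedSeminorm 𝒮
  | .maximal => maximalSeminorm 𝒮

variable (X K)

/-- The (reduced or maximal) uniform Roe algebra of `X`. -/
abbrev CuStar (s : Variant) : Type u := (s.seminorm (Cu X)).Compl

/-- The (reduced or maximal) uniform algebra of `X`. -/
abbrev UCStar (s : Variant) : Type (max u v) := (s.seminorm (UCalg X K)).Compl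

end Algebras

/-! ### The corner embeddings `i_P` -/

section Corner

variable {X : Type u} [MetricSpace X] {K : Type v} [NormedAddCommGroup K] [InnerProductSpace ℂ K]

/-- The operator `ℓ²(X) → ℓ²(X, K)` that sends `δ_x` to `η_x` in the copy of `K` at `x`. -/
def colOp (η : X → K) (hη : ∀ x, ‖η x‖ ≤ 1) : L2 X ℂ →L[ℂ] L2 X K :=
  diagOp (fun x => ContinuousLinearMap.toSpanSingleton ℂ (η x)) zero_le_one fun x => by
    rw [ContinuousLinearMap.norm_toSpanSingleton]
    exact hη x

theorem entry_colOp_self (η : X → K) (hη : ∀ x, ‖η x‖ ≤ 1) (x : X) :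
    entry (colOp η hη) x x = ContinuousLinearMap.toSpanSingleton ℂ (η x) :=
  entry_diagOp_self _ _ _ x

theorem entry_colOp_ne (η : X → K) (hη : ∀ x, ‖η x‖ ≤ 1) {x y : X} (h : x ≠ y) :
    entry (colOp η hη) x y = 0 :=
  entry_diagOp_ne _ _ _ h

theorem finitePropagation_colOp (η : X → K) (hη : ∀ x, ‖η x‖ ≤ 1) :
    FinitePropagation (entry (colOp η hη)) :=
  finitePropagation_of_diag fun _ _ h => entry_colOp_ne η hη h

theorem norm_colOp_le (η : X → K) (hη : ∀ x, ‖η x‖ ≤ 1) : ‖colOp η hη‖ ≤ 1 :=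
  norm_diagOp_le _ _ _

variable [CompleteSpace K]

theorem entry_adjoint_colOp_comp {K' : Type*} [NormedAddCommGroup K'] [InnerProductSpace ℂ K']
    (η : X → K) (hη : ∀ x, ‖η x‖ ≤ 1) (T : L2 X K' →L[ℂ] L2 X K) (x y : X) (k : K') :
    entry (ContinuousLinearMap.adjoint (colOp η hη) ∘L T) x y k = inner ℂ (η x) (entry T x y k) := by
  have h1 : ∀ f : L2 X K, (ContinuousLinearMap.adjoint (colOp η hη) f : L2 X ℂ) x
      = inner ℂ (η x) (f x) := by
    intro f
    have h2 := inner_incl_left x (1 : ℂ) (ContinuousLinearMap.adjoint (colOp η hη) f)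
    rw [ContinuousLinearMap.adjoint_inner_right] at h2
    have h3 : colOp η hη (incl ℂ x 1) = incl K x (η x) := by
      rw [colOp, diagOp_incl]
      simp
    rw [h3, inner_incl_left] at h2
    simpa using h2.symm
  exact h1 _

theorem entry_comp_colOp {K' : Type*} [NormedAddCommGroup K'] [InnerProductSpace ℂ K']
    (η : X → K) (hη : ∀ x, ‖η x‖ ≤ 1) (T : L2 X K →L[ℂ] L2 X K') (x y : X) (c : ℂ) :
    entry (T ∘L colOp η hη) x y c = c • entry T x y (η y) := by
  rw [colOp, entry_comp_diagOp]
  simp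

theorem adjoint_colOp_comp_colOp (η : X → K) (hη : ∀ x, ‖η x‖ = 1) :
    ContinuousLinearMap.adjoint (colOp η fun x => (hη x).le) ∘L colOp η (fun x => (hη x).le)
      = ContinuousLinearMap.id ℂ (L2 X ℂ) := by
  refine ext_entry fun x y => ?_
  ext
  rw [entry_adjoint_colOp_comp]
  by_cases h : x = y
  · subst h
    rw [entry_colOp_self]
    have : entry (ContinuousLinearMap.id ℂ (L2 X ℂ)) x x 1 = 1 := coord_incl_self x 1
    rw [this]
    simp [hη x]
  · rw [entry_colOp_ne _ _ h]
    have : entry (ContinuousLinearMap.id ℂ (L2 X ℂ)) x y 1 = 0 := coord_incl_ne h 1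
    rw [this]
    simp

variable [BoundedGeometry X]

theorem colOp_conj_mem (η : X → K) (hη : ∀ x, ‖η x‖ ≤ 1) {T : L2 X ℂ →L[ℂ] L2 X ℂ}
    (hT : T ∈ Cu X) :
    colOp η hη ∘L T ∘L ContinuousLinearMap.adjoint (colOp η hη) ∈ UCalg X K := by
  rw [mem_UCalg']
  refine ⟨(finitePropagation_colOp η hη).comp
    (FinitePropagation.comp hT (finitePropagation_colOp η hη).adjoint), fun ε hε => ⟨1, fun x y =>
      ⟨_, ?_, (by simpa using hε : ‖entry (colOp η hη ∘L T ∘L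
        ContinuousLinearMap.adjoint (colOp η hη)) x y - _‖ < ε)⟩⟩⟩
  rw [colOp, entry_diagOp_comp]
  refine (LinearMap.rank_comp_le_left _ (ContinuousLinearMap.toSpanSingleton ℂ (η x) : ℂ →ₗ[ℂ] K)).trans ?_
  refine (Submodule.rank_mono (t := ℂ ∙ η x) ?_).trans ?_
  · rintro _ ⟨c, rfl⟩
    exact Submodule.mem_span_singleton.mpr ⟨c, rfl⟩
  · simpa using rank_span_le ({η x} : Set K)

/-- The *-homomorphism `i_P : ℂ_u[X] → Uℂ[X]` given by a choice of unit vectors `η_x`: the entries of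
`i_P(T)` are `T(x, y) θ_{η_x, η_y}`, where `θ_{η, ζ}` is the operator `ξ ↦ ⟨ζ, ξ⟩ η`. -/
def iPalg (η : X → K) (hη : ∀ x, ‖η x‖ = 1) : Cu X →⋆ₙₐ[ℂ] UCalg X K where
  toFun T := ⟨colOp η (fun x => (hη x).le) ∘L (T : L2 X ℂ →L[ℂ] L2 X ℂ) ∘L
    ContinuousLinearMap.adjoint (colOp η fun x => (hη x).le), colOp_conj_mem η _ T.2⟩
  map_smul' c T := by
    apply Subtype.ext
    ext f
    simp
  map_zero' := by
    apply Subtype.ext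
    ext f
    simp
  map_add' S T := by
    apply Subtype.ext
    ext f
    simp
  map_mul' S T := by
    apply Subtype.ext
    ext1 f
    have h : ∀ g, ContinuousLinearMap.adjoint (colOp η fun x => (hη x).le)
        (colOp η (fun x => (hη x).le) g) = g :=
      fun g => DFunLike.congr_fun (adjoint_colOp_comp_colOp η hη) g
    exact congrArg (fun g => colOp η (fun x => (hη x).le) ((S : L2 X ℂ →L[ℂ] L2 X ℂ) g)) (h _).symm
  map_star' T := by
    apply Subtype.ext
    change _ = ContinuousLinearMap.adjoint (colOp η _ ∘L (T : L2 X ℂ →L[ℂ] L2 X ℂ) ∘L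
      ContinuousLinearMap.adjoint (colOp η _))
    rw [ContinuousLinearMap.adjoint_comp, ContinuousLinearMap.adjoint_comp,
      ContinuousLinearMap.adjoint_adjoint]
    rfl

theorem entry_iPalg (η : X → K) (hη : ∀ x, ‖η x‖ = 1) (T : Cu X) (x y : X) (k : K) :
    entry (iPalg η hη T : L2 X K →L[ℂ] L2 X K) x y k
      = entry (T : L2 X ℂ →L[ℂ] L2 X ℂ) x y 1 • (inner ℂ (η y) k : ℂ) • η x := by
  change entry (colOp η _ ∘L ((T : L2 X ℂ →L[ℂ] L2 X ℂ) ∘L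
    ContinuousLinearMap.adjoint (colOp η fun x => (hη x).le))) x y k = _
  have h : ContinuousLinearMap.adjoint (colOp η fun x => (hη x).le) (incl K y k)
      = incl ℂ y (inner ℂ (η y) k : ℂ) := by
    ext z
    refine (entry_adjoint_colOp_comp η (fun x => (hη x).le) (ContinuousLinearMap.id ℂ _) z y k).trans ?_
    by_cases hz : z = y
    · subst hz
      exact (congrArg (inner ℂ (η z)) (coord_incl_self z k)).trans (coord_incl_self z _).symm
    · refine ((congrArg (inner ℂ (η z)) (coord_incl_ne hz k)).trans ?_).trans
        (coord_incl_ne hz _).symm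
      exact inner_zero_right _
  rw [colOp, entry_diagOp_comp]
  change (((T : L2 X ℂ →L[ℂ] L2 X ℂ) (ContinuousLinearMap.adjoint (colOp η fun x => (hη x).le)
    (incl K y k))) x) • η x = _
  rw [h]
  have h2 : (incl ℂ y (inner ℂ (η y) k : ℂ) : L2 X ℂ) = (inner ℂ (η y) k : ℂ) • incl ℂ y 1 := by
    rw [← map_smul, smul_eq_mul, mul_one]
  rw [h2, map_smul, smul_smul, mul_comm]
  rfl

theorem norm_iPalg_le (s : Variant) (η : X → K) (hη : ∀ x, ‖η x‖ = 1) (T : Cu X) :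
    (s.seminorm (UCalg X K)).toFun (iPalg η hη T) ≤ (s.seminorm (Cu X)).toFun T := by
  cases s with
  | reduced =>
    have h1 := norm_colOp_le η (fun x => (hη x).le)
    change ‖colOp η (fun x => (hη x).le) ∘L (T : L2 X ℂ →L[ℂ] L2 X ℂ) ∘L
      ContinuousLinearMap.adjoint (colOp η fun x => (hη x).le)‖ ≤ ‖(T : L2 X ℂ →L[ℂ] L2 X ℂ)‖
    calc _ ≤ ‖colOp η fun x => (hη x).le‖ * (‖(T : L2 X ℂ →L[ℂ] L2 X ℂ)‖ *
          ‖ContinuousLinearMap.adjoint (colOp η fun x => (hη x).le)‖) :=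
          (ContinuousLinearMap.opNorm_comp_le _ _).trans
            (mul_le_mul_of_nonneg_left (ContinuousLinearMap.opNorm_comp_le _ _) (norm_nonneg _))
      _ ≤ 1 * (‖(T : L2 X ℂ →L[ℂ] L2 X ℂ)‖ * 1) := by
          rw [LinearIsometryEquiv.norm_map]
          gcongr
      _ = _ := by ring
  | maximal =>
    refine sSup_repNorms_le _ fun H _ _ _ π => ?_
    exact norm_rep_le' T (π.comp (iPalg η hη))

/-- The *-homomorphism `i_P` from the uniform Roe algebra to the uniform algebra. -/
def iP (s : Variant) (η : X → K) (hη : ∀ x, ‖η x‖ = 1) : CuStar X s →⋆ₙₐ[ℂ] UCStar X K s :=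
  CStarSeminorm.extend _ _ (iPalg η hη) (norm_iPalg_le s η hη)

end Corner

/-! ### Hilbert modules and correspondences -/

section HilbertModules

/-- A (right) Hilbert module over a C*-algebra `A`: a Banach space `E` with a right action of `A` and
an `A`-valued inner product, linear in the second variable, with `‖ξ‖² = ‖⟨ξ, ξ⟩‖`. -/
class HilbertModule (A : Type*) (E : Type*) [NonUnitalCStarAlgebra A] [NormedAddCommGroup E]
    [NormedSpace ℂ E] [CompleteSpace E] where
  act : E →L[ℂ] A →L[ℂ] E
  inner : E →L⋆[ℂ] E →L[ℂ] A
  act_mul : ∀ ξ a b, act ξ (a * b) = act (act ξ a) b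
  inner_act : ∀ ξ η a, inner ξ (act η a) = inner ξ η * a
  star_inner : ∀ ξ η, star (inner ξ η) = inner η ξ
  inner_self : ∀ ξ, ∃ b, inner ξ ξ = star b * b
  norm_sq : ∀ ξ, ‖ξ‖ ^ 2 = ‖inner ξ ξ‖

/-- An `A`-`B`-correspondence: a Hilbert `B`-module `E` with a left action of `A` by adjointable
operators. -/
class Correspondence (A B : Type*) (E : Type*) [NonUnitalCStarAlgebra A] [NonUnitalCStarAlgebra B]
    [NormedAddCommGroup E] [NormedSpace ℂ E] [CompleteSpace E] [HilbertModule B E] where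
  left : A →L[ℂ] E →L[ℂ] E
  left_mul : ∀ a b ξ, left (a * b) ξ = left a (left b ξ)
  inner_left : ∀ a ξ η, HilbertModule.inner (A := B) (left a ξ) η
    = HilbertModule.inner (A := B) ξ (left (star a) η)

variable {𝒜 : Type*} [NonUnitalRing 𝒜] [StarRing 𝒜] [Module ℂ 𝒜]

/-- Sums of elements of the form `s* s`. -/
def AlgPos (a : 𝒜) : Prop := a ∈ AddSubmonoid.closure (Set.range fun s : 𝒜 => star s * s)

theorem AlgPos.add {a b : 𝒜} (ha : AlgPos a) (hb : AlgPos b) : AlgPos (a + b) := add_mem ha hb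

theorem AlgPos.sum {ι : Type*} (s : Finset ι) {a : ι → 𝒜} (h : ∀ i ∈ s, AlgPos (a i)) :
    AlgPos (∑ i ∈ s, a i) := sum_mem h

theorem AlgPos.star_mul_self (a : 𝒜) : AlgPos (star a * a) := AddSubmonoid.subset_closure ⟨a, rfl⟩

theorem AlgPos.map {ℬ : Type*} [NonUnitalRing ℬ] [StarRing ℬ] [Module ℂ ℬ] [PartialOrder ℬ]
    [StarOrderedRing ℬ] (φ : 𝒜 →⋆ₙₐ[ℂ] ℬ) {a : 𝒜} (ha : AlgPos a) : 0 ≤ φ a := by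
  induction ha using AddSubmonoid.closure_induction with
  | mem x hx =>
    obtain ⟨s, rfl⟩ := hx
    change 0 ≤ φ (star s * s)
    rw [map_mul, map_star]
    exact star_mul_self_nonneg _
  | zero => rw [map_zero]
  | add x y _ _ h1 h2 =>
    rw [map_add]
    exact add_nonneg h1 h2

/-- A pre-Hilbert module over a *-algebra `𝒜`. -/
structure PreHilbertModule (𝒜 V : Type*) [NonUnitalRing 𝒜] [StarRing 𝒜] [Module ℂ 𝒜]
    [AddCommGroup V] [Module ℂ V] where
  act : V →ₗ[ℂ] 𝒜 →ₗ[ℂ] V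
  inner : V →ₗ⋆[ℂ] V →ₗ[ℂ] 𝒜
  act_mul : ∀ ξ a b, act ξ (a * b) = act (act ξ a) b
  inner_act : ∀ ξ η a, inner ξ (act η a) = inner ξ η * a
  star_inner : ∀ ξ η, star (inner ξ η) = inner η ξ
  inner_self : ∀ ξ, AlgPos (inner ξ ξ)

namespace PreHilbertModule

variable [IsScalarTower ℂ 𝒜 𝒜] [SMulCommClass ℂ 𝒜 𝒜] [StarModule ℂ 𝒜]
  {V : Type*} [AddCommGroup V] [Module ℂ V] (P : PreHilbertModule 𝒜 V) (N : CStarSeminorm 𝒜)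

theorem act_inner (ξ η : V) (a : 𝒜) : P.inner (P.act ξ a) η = star a * P.inner ξ η := by
  rw [← P.star_inner, P.inner_act, star_mul, P.star_inner]

theorem nonneg_toFun (a : 𝒜) : 0 ≤ N.toFun a := by
  rw [← N.norm_ι]
  exact norm_nonneg _

theorem toFun_inner_sq_le (ξ η : V) :
    N.toFun (P.inner ξ η) ^ 2 ≤ N.toFun (P.inner ξ ξ) * N.toFun (P.inner η η) := by
  let := CStarAlgebra.spectralOrder N.Compl
  let := CStarAlgebra.spectralOrderedRing N.Compl
  have key : ∀ c : ℝ, N.toFun (P.inner ξ ξ) < c →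
      N.toFun (P.inner ξ η) ^ 2 ≤ c * N.toFun (P.inner η η) := by
    intro c hc
    have hc0 : 0 < c := (nonneg_toFun N _).trans_lt hc
    set a := P.inner ξ η with ha
    set x : V := P.act ξ a - (c : ℂ) • η with hx
    have h1 : P.inner x x = star a * P.inner ξ ξ * a - (c : ℂ) • (star a * a)
        - (c : ℂ) • (star a * a) + (c : ℂ) • (c : ℂ) • P.inner η η := by
      simp only [hx, map_sub, LinearMap.sub_apply, LinearMap.map_smulₛₗ, LinearMap.smul_apply,
        P.inner_act, P.act_inner, map_smul, Complex.conj_ofReal]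
      rw [← P.star_inner ξ η, ← ha]
      simp only [smul_sub, mul_assoc]
      abel
    have h2 : 0 ≤ N.ι (P.inner x x) := (P.inner_self x).map N.ι
    have h3 : star (N.ι a) * N.ι (P.inner ξ ξ) * N.ι a ≤ c • (star (N.ι a) * N.ι a) := by
      refine (CStarAlgebra.star_left_conjugate_le_norm_smul
        (hb := IsSelfAdjoint.of_nonneg ((P.inner_self ξ).map N.ι))).trans ?_
      refine smul_le_smul_of_nonneg_right ?_ (star_mul_self_nonneg _)
      rw [N.norm_ι]
      exact hc.le
    have h4 : c • (star (N.ι a) * N.ι a) ≤ c • c • N.ι (P.inner η η) := by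
      rw [h1] at h2
      have hs : ∀ b : 𝒜, N.ι ((c : ℂ) • b) = c • N.ι b := fun b => map_smul N.ι (c : ℂ) b
      simp only [map_add, map_sub, map_mul, map_star, hs] at h2
      have h5 : c • c • N.ι (P.inner η η) - c • (star (N.ι a) * N.ι a)
          = (star (N.ι a) * N.ι (P.inner ξ ξ) * N.ι a - c • (star (N.ι a) * N.ι a)
            - c • (star (N.ι a) * N.ι a) + c • c • N.ι (P.inner η η))
            + (c • (star (N.ι a) * N.ι a) - star (N.ι a) * N.ι (P.inner ξ ξ) * N.ι a) := by abel
      rw [← sub_nonneg, h5]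
      exact add_nonneg h2 (sub_nonneg.mpr h3)
    have h5 := CStarAlgebra.norm_le_norm_of_nonneg_of_le
      (smul_nonneg hc0.le (star_mul_self_nonneg (N.ι a))) h4
    rw [norm_smul, norm_smul, norm_smul, CStarRing.norm_star_mul_self, N.norm_ι, N.norm_ι,
      Real.norm_of_nonneg hc0.le] at h5
    rw [sq]
    exact le_of_mul_le_mul_left h5 hc0
  refine le_of_forall_pos_le_add fun ε hε => ?_
  have h0 := nonneg_toFun N (P.inner η η)
  refine (key (N.toFun (P.inner ξ ξ) + ε / (N.toFun (P.inner η η) + 1))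
    (lt_add_of_pos_right _ (by positivity))).trans ?_
  rw [add_mul]
  gcongr
  rw [div_mul_eq_mul_div, div_le_iff₀ (by positivity)]
  nlinarith

/-- The module `V`, seen as a seminormed space through `‖ξ‖ = N(⟨ξ, ξ⟩)^{1/2}`. -/
@[nolint unusedArguments]
def Pre (_P : PreHilbertModule 𝒜 V) (_N : CStarSeminorm 𝒜) : Type _ := V

instance : AddCommGroup (P.Pre N) := inferInstanceAs (AddCommGroup V)
instance : Module ℂ (P.Pre N) := inferInstanceAs (Module ℂ V)

theorem toFun_inner_le (ξ η : V) :
    N.toFun (P.inner ξ η) ≤ √(N.toFun (P.inner ξ ξ)) * √(N.toFun (P.inner η η)) := by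
  rw [← Real.sqrt_mul (nonneg_toFun N _)]
  exact Real.le_sqrt_of_sq_le (P.toFun_inner_sq_le N ξ η)

instance : SeminormedAddCommGroup (P.Pre N) :=
  AddGroupSeminorm.toSeminormedAddCommGroup
    { toFun := fun ξ : V => √(N.toFun (P.inner ξ ξ))
      map_zero' := by
        have : P.inner 0 0 = 0 := by simp
        exact (congrArg (fun a => √(N.toFun a)) this).trans (by rw [N.zero_eq, Real.sqrt_zero])
      add_le' := fun (ξ η : V) => by
        have h : P.inner (ξ + η) (ξ + η) = P.inner ξ ξ + P.inner ξ η + (P.inner η ξ + P.inner η η) := by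
          simp only [map_add, LinearMap.add_apply]
          abel
        refine Real.sqrt_le_iff.mpr ⟨by positivity, ?_⟩
        change N.toFun (P.inner (ξ + η) (ξ + η)) ≤ _
        rw [h]
        have h1 := P.toFun_inner_le N ξ η
        have h2 := P.toFun_inner_le N η ξ
        have h3 := Real.sq_sqrt (nonneg_toFun N (P.inner ξ ξ))
        have h4 := Real.sq_sqrt (nonneg_toFun N (P.inner η η))
        have h5 := N.add_le (P.inner ξ ξ + P.inner ξ η) (P.inner η ξ + P.inner η η)
        have h6 := N.add_le (P.inner ξ ξ) (P.inner ξ η)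
        have h7 := N.add_le (P.inner η ξ) (P.inner η η)
        nlinarith
      neg' := fun (ξ : V) => by
        have : P.inner (-ξ) (-ξ) = P.inner ξ ξ := by simp
        exact congrArg (fun a => √(N.toFun a)) this }

theorem norm_def (ξ : P.Pre N) : ‖ξ‖ = √(N.toFun (P.inner (ξ : V) (ξ : V))) := rfl

theorem norm_sq_def (ξ : P.Pre N) : ‖ξ‖ ^ 2 = N.toFun (P.inner (ξ : V) (ξ : V)) :=
  Real.sq_sqrt (nonneg_toFun N _)

instance : NormedSpace ℂ (P.Pre N) where
  norm_smul_le c ξ := by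
    have h : ∀ ξ : V, P.inner (c • ξ) (c • ξ) = (starRingEnd ℂ c) • c • P.inner ξ ξ := fun ξ => by
      rw [map_smul, LinearMap.map_smulₛₗ, LinearMap.smul_apply, smul_comm]
    refine le_of_eq ?_
    rw [norm_def]
    refine (congrArg (fun a => √(N.toFun a)) (h ξ)).trans ?_
    rw [N.smul_eq, N.smul_eq, RCLike.norm_conj, ← mul_assoc, Real.sqrt_mul (by positivity),
      Real.sqrt_mul_self (norm_nonneg c)]
    rfl

/-- The completion of a pre-Hilbert module for a C*-seminorm on its *-algebra of coefficients. -/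
def Compl : Type _ := Completion (P.Pre N)

instance : NormedAddCommGroup (P.Compl N) :=
  inferInstanceAs (NormedAddCommGroup (Completion (P.Pre N)))
instance : NormedSpace ℂ (P.Compl N) := inferInstanceAs (NormedSpace ℂ (Completion (P.Pre N)))
instance : CompleteSpace (P.Compl N) := inferInstanceAs (CompleteSpace (Completion (P.Pre N)))

/-- The canonical map from a pre-Hilbert module to its completion. -/
def ofPreL : P.Pre N →L[ℂ] P.Compl N := Completion.toComplL

/-- The canonical map from a pre-Hilbert module to its completion. -/
def toCompl : V →ₗ[ℂ] P.Compl N where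
  toFun ξ := P.ofPreL N ξ
  map_add' _ _ := map_add (P.ofPreL N) _ _
  map_smul' _ _ := map_smul (P.ofPreL N) _ _

theorem norm_toCompl (ξ : V) : ‖P.toCompl N ξ‖ = √(N.toFun (P.inner ξ ξ)) :=
  Completion.norm_coe (E := P.Pre N) ξ

theorem norm_toCompl_sq (ξ : V) : ‖P.toCompl N ξ‖ ^ 2 = N.toFun (P.inner ξ ξ) := by
  rw [norm_toCompl, Real.sq_sqrt (nonneg_toFun N _)]

theorem denseRange_toCompl : DenseRange (P.toCompl N) :=
  Completion.denseRange_coe (α := P.Pre N)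

variable {P N} in
@[elab_as_elim]
theorem induction_on {p : P.Compl N → Prop} (ξ : P.Compl N) (hp : IsClosed {ξ | p ξ})
    (h : ∀ ξ : V, p (P.toCompl N ξ)) : p ξ :=
  Completion.induction_on (α := P.Pre N) ξ hp h

variable {N} in
@[elab_as_elim]
theorem induction_on_coeff {p : N.Compl → Prop} (a : N.Compl) (hp : IsClosed {a | p a})
    (h : ∀ a : 𝒜, p (N.ι a)) : p a :=
  Completion.induction_on (α := N.Pre) a hp h

theorem inner_act_self (ξ : V) (a : 𝒜) :
    N.toFun (P.inner (P.act ξ a) (P.act ξ a)) ≤ (√(N.toFun (P.inner ξ ξ)) * N.toFun a) ^ 2 := by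
  rw [P.inner_act, P.act_inner, mul_pow, Real.sq_sqrt (nonneg_toFun N _)]
  have h1 := N.mul_le (star a * P.inner ξ ξ) a
  have h2 := N.mul_le (star a) (P.inner ξ ξ)
  rw [N.star_eq] at h2
  have h3 := nonneg_toFun N a
  nlinarith

/-- The right action on the completion. -/
def actL : P.Compl N →L[ℂ] N.Compl →L[ℂ] P.Compl N :=
  extendBilin (P := P.Pre N) (Q := N.Pre) (R := P.Compl N)
    (LinearMap.mkContinuous₂ (LinearMap.mk₂ ℂ (fun (ξ : P.Pre N) (a : N.Pre) =>
        P.toCompl N (P.act (ξ : V) (a : 𝒜)))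
      (fun ξ ξ' a => by
        exact (congrArg (P.toCompl N) (LinearMap.map_add₂ P.act (ξ : V) ξ' (a : 𝒜))).trans
          (map_add (P.toCompl N) _ _))
      (fun c ξ a => by
        exact (congrArg (P.toCompl N) (LinearMap.map_smul₂ P.act c (ξ : V) (a : 𝒜))).trans
          (map_smul (P.toCompl N) _ _))
      (fun ξ a a' => by
        exact (congrArg (P.toCompl N) (map_add (P.act (ξ : V)) (a : 𝒜) a')).trans
          (map_add (P.toCompl N) _ _))
      (fun c ξ a => by
        exact (congrArg (P.toCompl N) (map_smul (P.act (ξ : V)) c (a : 𝒜))).trans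
          (map_smul (P.toCompl N) _ _))) 1
      (fun ξ a => by
        rw [one_mul]
        exact (P.norm_toCompl N _).trans_le (Real.sqrt_le_iff.mpr
          ⟨mul_nonneg (Real.sqrt_nonneg _) (nonneg_toFun N _), P.inner_act_self N ξ a⟩)))

theorem actL_toCompl (ξ : V) (a : 𝒜) :
    P.actL N (P.toCompl N ξ) (N.ι a) = P.toCompl N (P.act ξ a : V) :=
  extendBilin_coe (P := P.Pre N) (Q := N.Pre) _ (ξ : P.Pre N) (a : N.Pre)

/-- The inner product on the completion. -/
def innerL : P.Compl N →L⋆[ℂ] P.Compl N →L[ℂ] N.Compl :=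
  extendBilin (P := P.Pre N) (Q := P.Pre N) (R := N.Compl)
    (LinearMap.mkContinuous₂ (LinearMap.mk₂'ₛₗ (starRingEnd ℂ) (RingHom.id ℂ)
      (fun (ξ η : P.Pre N) => N.ι (P.inner (ξ : V) (η : V)))
      (fun ξ ξ' η => by
        exact (congrArg N.ι (LinearMap.map_add₂ P.inner (ξ : V) ξ' η)).trans (map_add N.ι _ _))
      (fun c ξ η => by
        exact (congrArg N.ι (LinearMap.map_smulₛₗ₂ P.inner c (ξ : V) η)).trans (map_smul N.ι _ _))
      (fun ξ η η' => by
        exact (congrArg N.ι (map_add (P.inner (ξ : V)) η η')).trans (map_add N.ι _ _))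
      (fun c ξ η => by
        exact (congrArg N.ι (map_smul (P.inner (ξ : V)) c η)).trans (map_smul N.ι _ _))) 1
      (fun ξ η => by
        rw [one_mul]
        exact (N.norm_ι _).trans_le (P.toFun_inner_le N ξ η)))

theorem innerL_toCompl (ξ η : V) :
    P.innerL N (P.toCompl N ξ) (P.toCompl N η) = N.ι (P.inner ξ η) :=
  extendBilin_coe (P := P.Pre N) (Q := P.Pre N) _ (ξ : P.Pre N) (η : P.Pre N)

theorem innerL_self (ξ : P.Compl N) : ∃ b, P.innerL N ξ ξ = star b * b := by
  let := CStarAlgebra.spectralOrder N.Compl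
  let := CStarAlgebra.spectralOrderedRing N.Compl
  suffices h : 0 ≤ P.innerL N ξ ξ by
    exact CStarAlgebra.nonneg_iff_eq_star_mul_self.mp h
  refine induction_on ξ (isClosed_le ?_ ?_) fun ξ => ?_
  · fun_prop
  · fun_prop
  exact ((P.inner_self ξ).map N.ι).trans_eq (P.innerL_toCompl N ξ ξ).symm

instance : HilbertModule N.Compl (P.Compl N) where
  act := P.actL N
  inner := P.innerL N
  act_mul ξ a b := by
    refine induction_on ξ (isClosed_eq ?_ ?_) fun ξ => ?_
    · fun_prop
    · fun_prop
    refine induction_on_coeff a (isClosed_eq ?_ ?_) fun a => ?_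
    · fun_prop
    · fun_prop
    refine induction_on_coeff b (isClosed_eq ?_ ?_) fun b => ?_
    · fun_prop
    · fun_prop
    change P.actL N (P.toCompl N ξ) (N.ι a * N.ι b)
      = P.actL N (P.actL N (P.toCompl N ξ) (N.ι a)) (N.ι b)
    rw [← map_mul, actL_toCompl, actL_toCompl, P.act_mul]
    exact (P.actL_toCompl N _ b).symm
  inner_act ξ η a := by
    refine induction_on ξ (isClosed_eq ?_ ?_) fun ξ => ?_
    · fun_prop
    · fun_prop
    refine induction_on η (isClosed_eq ?_ ?_) fun η => ?_
    · fun_prop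
    · fun_prop
    refine induction_on_coeff a (isClosed_eq ?_ ?_) fun a => ?_
    · fun_prop
    · fun_prop
    change P.innerL N (P.toCompl N ξ) (P.actL N (P.toCompl N η) (N.ι a))
      = P.innerL N (P.toCompl N ξ) (P.toCompl N η) * N.ι a
    rw [actL_toCompl]
    refine (P.innerL_toCompl N ξ _).trans ?_
    rw [P.inner_act, map_mul, ← innerL_toCompl]
  star_inner ξ η := by
    refine induction_on ξ (isClosed_eq ?_ ?_) fun ξ => ?_
    · fun_prop
    · fun_prop
    refine induction_on η (isClosed_eq ?_ ?_) fun η => ?_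
    · fun_prop
    · fun_prop
    change star (P.innerL N (P.toCompl N ξ) (P.toCompl N η)) = P.innerL N (P.toCompl N η) (P.toCompl N ξ)
    rw [innerL_toCompl, innerL_toCompl, ← map_star, P.star_inner]
  inner_self := P.innerL_self N
  norm_sq ξ := by
    refine induction_on ξ (isClosed_eq ?_ ?_) fun ξ => ?_
    · fun_prop
    · fun_prop
    change _ = ‖P.innerL N (P.toCompl N ξ) (P.toCompl N ξ)‖
    rw [norm_toCompl_sq, innerL_toCompl, N.norm_ι]

variable {ℬ : Type*} [NonUnitalRing ℬ] [StarRing ℬ] [Module ℂ ℬ] [IsScalarTower ℂ ℬ ℬ]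
  [SMulCommClass ℂ ℬ ℬ] [StarModule ℂ ℬ] (N' : CStarSeminorm ℬ)

/-- The left action on the completion. -/
def leftL (l : ℬ →ₗ[ℂ] V →ₗ[ℂ] V)
    (hb : ∀ b ξ, N.toFun (P.inner (l b ξ) (l b ξ)) ≤ N'.toFun b ^ 2 * N.toFun (P.inner ξ ξ)) :
    N'.Compl →L[ℂ] P.Compl N →L[ℂ] P.Compl N :=
  extendBilin (P := N'.Pre) (Q := P.Pre N) (R := P.Compl N)
    (LinearMap.mkContinuous₂ (LinearMap.mk₂ ℂ (fun (b : N'.Pre) (ξ : P.Pre N) =>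
        P.toCompl N (l (b : ℬ) (ξ : V)))
      (fun b b' ξ => by
        exact (congrArg (P.toCompl N) (LinearMap.map_add₂ l (b : ℬ) b' (ξ : V))).trans
          (map_add (P.toCompl N) _ _))
      (fun c b ξ => by
        exact (congrArg (P.toCompl N) (LinearMap.map_smul₂ l c (b : ℬ) (ξ : V))).trans
          (map_smul (P.toCompl N) _ _))
      (fun b ξ ξ' => by
        exact (congrArg (P.toCompl N) (map_add (l (b : ℬ)) (ξ : V) ξ')).trans
          (map_add (P.toCompl N) _ _))
      (fun c b ξ => by
        exact (congrArg (P.toCompl N) (map_smul (l (b : ℬ)) c (ξ : V))).trans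
          (map_smul (P.toCompl N) _ _))) 1
      (fun b ξ => by
        rw [one_mul]
        refine (P.norm_toCompl N _).trans_le (Real.sqrt_le_iff.mpr
          ⟨mul_nonneg (nonneg_toFun N' _) (Real.sqrt_nonneg _), (hb b ξ).trans_eq ?_⟩)
        exact (congrArg (N'.toFun b ^ 2 * ·) (P.norm_sq_def N ξ).symm).trans (mul_pow _ _ _).symm))

theorem leftL_toCompl (l : ℬ →ₗ[ℂ] V →ₗ[ℂ] V)
    (hb : ∀ b ξ, N.toFun (P.inner (l b ξ) (l b ξ)) ≤ N'.toFun b ^ 2 * N.toFun (P.inner ξ ξ))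
    (b : ℬ) (ξ : V) :
    P.leftL N N' l hb (N'.ι b) (P.toCompl N ξ) = P.toCompl N (l b ξ : V) :=
  extendBilin_coe (P := N'.Pre) (Q := P.Pre N) _ (b : N'.Pre) (ξ : P.Pre N)

/-- The correspondence obtained by completion from a left action on a pre-Hilbert module. -/
@[reducible]
def complCorrespondence (l : ℬ →ₗ[ℂ] V →ₗ[ℂ] V)
    (hmul : ∀ b b' ξ, l (b * b') ξ = l b (l b' ξ))
    (hinner : ∀ b ξ η, P.inner (l b ξ) η = P.inner ξ (l (star b) η))
    (hb : ∀ b ξ, N.toFun (P.inner (l b ξ) (l b ξ)) ≤ N'.toFun b ^ 2 * N.toFun (P.inner ξ ξ)) :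
    Correspondence N'.Compl N.Compl (P.Compl N) where
  left := P.leftL N N' l hb
  left_mul a b ξ := by
    refine induction_on ξ (isClosed_eq ?_ ?_) fun ξ => ?_
    · fun_prop
    · fun_prop
    refine induction_on_coeff a (isClosed_eq ?_ ?_) fun a => ?_
    · fun_prop
    · fun_prop
    refine induction_on_coeff b (isClosed_eq ?_ ?_) fun b => ?_
    · fun_prop
    · fun_prop
    change P.leftL N N' l hb (N'.ι a * N'.ι b) (P.toCompl N ξ)
      = P.leftL N N' l hb (N'.ι a) (P.leftL N N' l hb (N'.ι b) (P.toCompl N ξ))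
    rw [← map_mul, leftL_toCompl, leftL_toCompl, hmul]
    exact (P.leftL_toCompl N N' l hb a _).symm
  inner_left a ξ η := by
    change P.innerL N (P.leftL N N' l hb a ξ) η = P.innerL N ξ (P.leftL N N' l hb (star a) η)
    refine induction_on ξ (isClosed_eq ?_ ?_) fun ξ => ?_
    · fun_prop
    · fun_prop
    refine induction_on η (isClosed_eq ?_ ?_) fun η => ?_
    · fun_prop
    · fun_prop
    refine induction_on_coeff a (isClosed_eq ?_ ?_) fun a => ?_
    · fun_prop
    · fun_prop
    rw [← map_star, leftL_toCompl, leftL_toCompl]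
    refine (P.innerL_toCompl N _ η).trans ((congrArg N.ι (hinner a ξ η)).trans ?_)
    exact (P.innerL_toCompl N ξ _).symm

end PreHilbertModule

end HilbertModules

/-! ### The module `E_alg` -/

section Frames

variable {X : Type u} [MetricSpace X] [BoundedGeometry X]
  {K : Type v} [NormedAddCommGroup K] [InnerProductSpace ℂ K]

theorem exists_frame (s : Set K) {n : ℕ} (hs : s.encard ≤ n) :
    ∃ e : Fin n → K, (∀ k, ‖e k‖ ≤ 1) ∧ ∀ v ∈ s, ∑ k, inner ℂ (e k) v • e k = v := by
  classical
  have hfin : s.Finite := Set.encard_lt_top_iff.mp (hs.trans_lt (ENat.natCast_lt_top n))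
  have : FiniteDimensional ℂ (Submodule.span ℂ s) := FiniteDimensional.span_of_finite ℂ hfin
  set d := Module.finrank ℂ (Submodule.span ℂ s) with hd
  have hdn : d ≤ n := by
    have h1 := finrank_span_finset_le_card (R := ℂ) hfin.toFinset
    rw [Set.Finite.coe_toFinset] at h1
    refine h1.trans ?_
    rw [hfin.encard_eq_coe_toFinset_card] at hs
    exact_mod_cast hs
  let b := stdOrthonormalBasis ℂ (Submodule.span ℂ s)
  have hinj : Function.Injective (Fin.castLE hdn) := Fin.castLE_injective hdn
  let e : Fin n → K := Function.extend (Fin.castLE hdn) (fun i => (b i : K)) 0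
  have he : ∀ i, e (Fin.castLE hdn i) = b i := fun i => hinj.extend_apply _ _ i
  have he' : ∀ k, k ∉ Set.range (Fin.castLE hdn) → e k = 0 := fun k hk =>
    Function.extend_apply' _ _ _ hk
  refine ⟨e, fun k => ?_, fun v hv => ?_⟩
  · by_cases hk : k ∈ Set.range (Fin.castLE hdn)
    · obtain ⟨i, rfl⟩ := hk
      rw [he]
      exact (b.orthonormal.1 i).le
    · rw [he' k hk]
      simp
  · have h1 := b.sum_repr' ⟨v, Submodule.subset_span hv⟩
    have h2 := congrArg (Submodule.subtype _) h1
    rw [map_sum] at h2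
    refine Eq.trans ?_ h2
    refine (Fintype.sum_of_injective _ hinj _ _ (fun k hk => ?_) fun i => ?_).symm
    · rw [he' k hk, smul_zero]
    · rw [he]
      rfl

variable [CompleteSpace K]

theorem exists_colOp_frame {ξ : L2 X ℂ →L[ℂ] L2 X K} (hξ : FinitePropagation (entry ξ)) :
    ∃ (n : ℕ) (e : Fin n → X → K) (he : ∀ k x, ‖e k x‖ ≤ 1),
      ∑ k, colOp (e k) (he k) ∘L ContinuousLinearMap.adjoint (colOp (e k) (he k)) ∘L ξ = ξ := by
  obtain ⟨R, hR, hR'⟩ := hξ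
  obtain ⟨n, hn⟩ := BoundedGeometry.exists_bound (X := X) R hR
  have h : ∀ x, ∃ e : Fin n → K, (∀ k, ‖e k‖ ≤ 1) ∧
      ∀ v ∈ (fun y => entry ξ x y 1) '' Metric.ball x R, ∑ k, inner ℂ (e k) v • e k = v :=
    fun x => exists_frame _ ((Set.encard_image_le _ _).trans (hn x))
  choose e he he' using h
  refine ⟨n, fun k x => e x k, fun k x => he x k, ext_entry fun x y => ?_⟩
  rw [entry_sum]
  ext
  rw [sum_apply]
  have h1 : ∀ k, entry (colOp (fun x => e x k) (fun x => he x k) ∘L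
      ContinuousLinearMap.adjoint (colOp (fun x => e x k) fun x => he x k) ∘L ξ) x y 1
      = inner ℂ (e x k) (entry ξ x y 1) • e x k := by
    intro k
    rw [← entry_adjoint_colOp_comp (fun x => e x k) (fun x => he x k) ξ x y 1]
    rfl
  simp only [h1]
  rcases le_or_gt R (dist x y) with h2 | h2
  · rw [hR' x y h2]
    simp
  · exact he' x _ ⟨y, by rwa [Metric.mem_ball, dist_comm], rfl⟩

end Frames

section Ealg

variable (X : Type u) [MetricSpace X] (K : Type v) [NormedAddCommGroup K] [InnerProductSpace ℂ K]

/-- The space `E_alg`: the bounded operators `ℓ²(X) → ℓ²(X, K)` whose matrix, with entries in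
`Hom(ℂ, K) = K`, has finite propagation. -/
def Ealg : Submodule ℂ (L2 X ℂ →L[ℂ] L2 X K) where
  carrier := {ξ | FinitePropagation (entry ξ)}
  add_mem' := FinitePropagation.add
  zero_mem' := FinitePropagation.zero
  smul_mem' := fun c _ hT => FinitePropagation.smul c hT

variable {X K} [CompleteSpace K]

/-- The inner product `(ξ | η) = ξ* η` of `E_alg`. -/
def ealgInner (ξ η : Ealg X K) : Cu X :=
  ⟨ContinuousLinearMap.adjoint (ξ : L2 X ℂ →L[ℂ] L2 X K) ∘L (η : L2 X ℂ →L[ℂ] L2 X K),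
    FinitePropagation.comp (FinitePropagation.adjoint ξ.2) η.2⟩

/-- The `(z, w)` entry of `(ξ | η)` is `∑_y ⟨ξ_yz, η_yw⟩`. -/
theorem hasSum_entry_ealgInner (ξ η : Ealg X K) (z w : X) :
    HasSum (fun y => inner ℂ (entry (ξ : L2 X ℂ →L[ℂ] L2 X K) y z 1)
      (entry (η : L2 X ℂ →L[ℂ] L2 X K) y w 1))
      (entry (ealgInner ξ η : L2 X ℂ →L[ℂ] L2 X ℂ) z w 1) := by
  have h := hasSum_entry_comp (ContinuousLinearMap.adjoint (ξ : L2 X ℂ →L[ℂ] L2 X K))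
    (η : L2 X ℂ →L[ℂ] L2 X K) z w 1
  have key : ∀ y, inner ℂ (entry (ξ : L2 X ℂ →L[ℂ] L2 X K) y z 1)
      (entry (η : L2 X ℂ →L[ℂ] L2 X K) y w 1)
      = entry (ContinuousLinearMap.adjoint (ξ : L2 X ℂ →L[ℂ] L2 X K)) z y
        (entry (η : L2 X ℂ →L[ℂ] L2 X K) y w 1) := ?_
  · rw [funext key]
    exact h
  intro y
  rw [entry_adjoint]
  have h1 := ContinuousLinearMap.adjoint_inner_right (entry (ξ : L2 X ℂ →L[ℂ] L2 X K) y z) 1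
    (entry (η : L2 X ℂ →L[ℂ] L2 X K) y w 1)
  rw [← h1]
  simp

theorem algPos_ealgInner [BoundedGeometry X] (ξ : Ealg X K) : AlgPos (ealgInner ξ ξ) := by
  obtain ⟨n, e, he, h⟩ := exists_colOp_frame ξ.2
  let T : Fin n → Cu X := fun k =>
    ⟨ContinuousLinearMap.adjoint (colOp (e k) (he k)) ∘L (ξ : L2 X ℂ →L[ℂ] L2 X K),
      FinitePropagation.comp (finitePropagation_colOp _ _).adjoint ξ.2⟩
  have h2 : ealgInner ξ ξ = ∑ k, star (T k) * T k := by
    apply Subtype.ext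
    rw [AddSubmonoidClass.coe_finsetSum]
    have h3 : ∀ k, ((star (T k) * T k : Cu X) : L2 X ℂ →L[ℂ] L2 X ℂ)
        = ContinuousLinearMap.adjoint (ξ : L2 X ℂ →L[ℂ] L2 X K) ∘L (colOp (e k) (he k) ∘L
          ContinuousLinearMap.adjoint (colOp (e k) (he k)) ∘L (ξ : L2 X ℂ →L[ℂ] L2 X K)) := by
      intro k
      change ContinuousLinearMap.adjoint (ContinuousLinearMap.adjoint (colOp (e k) (he k)) ∘L
        (ξ : L2 X ℂ →L[ℂ] L2 X K)) ∘L _ = _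
      rw [ContinuousLinearMap.adjoint_comp, ContinuousLinearMap.adjoint_adjoint]
      rfl
    simp only [h3]
    refine (congrArg (ContinuousLinearMap.adjoint (ξ : L2 X ℂ →L[ℂ] L2 X K) ∘L ·) h.symm).trans ?_
    ext1 f
    simp only [ContinuousLinearMap.comp_apply, sum_apply, map_sum]
  rw [h2]
  exact AlgPos.sum _ fun k _ => AlgPos.star_mul_self _

variable (X K)

/-- `E_alg` as a pre-Hilbert module over `ℂ_u[X]`: the right action is `ξ · T = ξ T` and the inner
product is `(ξ | η) = ξ* η`. -/
def preE [BoundedGeometry X] : PreHilbertModule (Cu X) (Ealg X K) where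
  act := LinearMap.mk₂ ℂ (fun ξ T => (⟨(ξ : L2 X ℂ →L[ℂ] L2 X K) ∘L (T : L2 X ℂ →L[ℂ] L2 X ℂ),
      FinitePropagation.comp ξ.2 T.2⟩ : Ealg X K))
    (fun ξ ξ' T => by apply Subtype.ext; ext1 f; rfl)
    (fun c ξ T => by apply Subtype.ext; ext1 f; rfl)
    (fun ξ T T' => by apply Subtype.ext; ext1 f; exact map_add (ξ : L2 X ℂ →L[ℂ] L2 X K) _ _)
    (fun c ξ T => by apply Subtype.ext; ext1 f; exact map_smul (ξ : L2 X ℂ →L[ℂ] L2 X K) _ _)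
  inner := LinearMap.mk₂'ₛₗ (starRingEnd ℂ) (RingHom.id ℂ) ealgInner
    (fun ξ ξ' η => by
      apply Subtype.ext
      ext1 f
      simp [ealgInner])
    (fun c ξ η => by
      apply Subtype.ext
      change ContinuousLinearMap.adjoint (c • (ξ : L2 X ℂ →L[ℂ] L2 X K)) ∘L _ = _
      rw [map_smulₛₗ]
      rfl)
    (fun ξ η η' => by
      apply Subtype.ext
      ext1 f
      simp [ealgInner])
    (fun c ξ η => by
      apply Subtype.ext
      ext1 f
      simp [ealgInner])
  act_mul ξ a b := by
    apply Subtype.ext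
    ext1 f
    rfl
  inner_act ξ η a := by
    apply Subtype.ext
    ext1 f
    rfl
  star_inner ξ η := by
    apply Subtype.ext
    change ContinuousLinearMap.adjoint (ContinuousLinearMap.adjoint (ξ : L2 X ℂ →L[ℂ] L2 X K) ∘L
      (η : L2 X ℂ →L[ℂ] L2 X K)) = ContinuousLinearMap.adjoint (η : L2 X ℂ →L[ℂ] L2 X K) ∘L
      (ξ : L2 X ℂ →L[ℂ] L2 X K)
    rw [ContinuousLinearMap.adjoint_comp, ContinuousLinearMap.adjoint_adjoint]
  inner_self := algPos_ealgInner

variable {X K}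

/-- The left multiplication of elements of `E_alg` by an operator of finite propagation. -/
def ealgMul (T : L2 X K →L[ℂ] L2 X K) (hT : FinitePropagation (entry T)) (ξ : Ealg X K) :
    Ealg X K :=
  ⟨T ∘L (ξ : L2 X ℂ →L[ℂ] L2 X K), hT.comp ξ.2⟩

variable (X K)

/-- The left action of `Uℂ[X]` on `E_alg` by matrix multiplication. -/
def ealgLeft [BoundedGeometry X] : UCalg X K →ₗ[ℂ] Ealg X K →ₗ[ℂ] Ealg X K :=
  LinearMap.mk₂ ℂ (fun T ξ => ealgMul (T : L2 X K →L[ℂ] L2 X K) T.2.1 ξ)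
    (fun T T' ξ => by apply Subtype.ext; ext1 f; rfl)
    (fun c T ξ => by apply Subtype.ext; ext1 f; rfl)
    (fun T ξ ξ' => by apply Subtype.ext; ext1 f; exact map_add (T : L2 X K →L[ℂ] L2 X K) _ _)
    (fun c T ξ => by apply Subtype.ext; ext1 f; exact map_smul (T : L2 X K →L[ℂ] L2 X K) _ _)

variable {X K}

/-- The left multiplication by `T` is bounded, in a purely algebraic sense. -/
def LeftBounded (T : L2 X K →L[ℂ] L2 X K) : Prop :=
  ∃ hT : FinitePropagation (entry T), ∃ C : ℝ, ∀ ξ : Ealg X K,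
    AlgPos ((C : ℂ) • ealgInner ξ ξ - ealgInner (ealgMul T hT ξ) (ealgMul T hT ξ))

theorem entry_id_self (x : X) :
    entry (ContinuousLinearMap.id ℂ (L2 X K)) x x = ContinuousLinearMap.id ℂ K := by
  ext k
  exact coord_incl_self x k

theorem entry_id_ne {x y : X} (h : x ≠ y) :
    entry (ContinuousLinearMap.id ℂ (L2 X K)) x y = 0 := by
  ext k
  exact coord_incl_ne h k

theorem leftBounded_of_diag [BoundedGeometry X] {V : L2 X K →L[ℂ] L2 X K}
    (hV : FinitePropagation (entry V))
    (h : ∀ x y, x ≠ y → entry (ContinuousLinearMap.adjoint V ∘L V) x y = 0) : LeftBounded V := by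
  have h1 : ∀ x, ∃ g : K →L[ℂ] K, (((‖V‖ ^ 2 : ℝ) : ℂ) • ContinuousLinearMap.id ℂ K)
      - entry (ContinuousLinearMap.adjoint V ∘L V) x x = star g * g := by
    intro x
    refine CStarAlgebra.nonneg_iff_eq_star_mul_self.mp ?_
    rw [ContinuousLinearMap.nonneg_iff_isPositive, ContinuousLinearMap.isPositive_iff_complex]
    intro k
    have h2 : inner ℂ ((((‖V‖ ^ 2 : ℝ) : ℂ) • ContinuousLinearMap.id ℂ K
        - entry (ContinuousLinearMap.adjoint V ∘L V) x x) k) k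
        = ((‖V‖ ^ 2 * ‖k‖ ^ 2 - ‖V (incl K x k)‖ ^ 2 : ℝ) : ℂ) := by
      have h3 : inner ℂ (entry (ContinuousLinearMap.adjoint V ∘L V) x x k) k
          = ((‖V (incl K x k)‖ ^ 2 : ℝ) : ℂ) := by
        rw [entry_apply, ← inner_incl_right]
        change inner ℂ (ContinuousLinearMap.adjoint V (V (incl K x k))) _ = _
        rw [ContinuousLinearMap.adjoint_inner_left, inner_self_eq_norm_sq_to_K]
        norm_cast
      rw [sub_apply, inner_sub_left, h3]
      simp [inner_self_eq_norm_sq_to_K, inner_smul_left]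
    rw [h2]
    refine ⟨congrArg _ (Complex.ofReal_re _), ?_⟩
    rw [RCLike.re_eq_complex_re, Complex.ofReal_re, sub_nonneg, ← mul_pow]
    gcongr
    rw [← norm_incl x k]
    exact V.le_opNorm _
  choose g hg using h1
  have hg2 : ∀ x, ‖g x‖ ≤ √(‖V‖ ^ 2 + ‖ContinuousLinearMap.adjoint V ∘L V‖) := by
    intro x
    refine Real.le_sqrt_of_sq_le ?_
    rw [sq, ← CStarRing.norm_star_mul_self, ← hg]
    refine (norm_sub_le _ _).trans (add_le_add ?_ (norm_entry_le _ x x))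
    rw [norm_smul, Complex.norm_real, norm_pow, norm_norm]
    exact mul_le_of_le_one_right (by positivity) ContinuousLinearMap.norm_id_le
  let G : L2 X K →L[ℂ] L2 X K := diagOp g (Real.sqrt_nonneg _) hg2
  have hG : FinitePropagation (entry G) := finitePropagation_of_diag fun x y hxy =>
    entry_diagOp_ne _ _ _ hxy
  have hGG : ContinuousLinearMap.adjoint G ∘L G
      = ((‖V‖ ^ 2 : ℝ) : ℂ) • ContinuousLinearMap.id ℂ _ - ContinuousLinearMap.adjoint V ∘L V := by
    refine ext_entry fun x y => ?_
    rw [entry_sub, entry_smul, entry_comp_diagOp, entry_adjoint]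
    by_cases hxy : x = y
    · subst hxy
      rw [entry_diagOp_self, entry_id_self]
      exact (hg x).symm
    · rw [entry_diagOp_ne _ _ _ (Ne.symm hxy), h x y hxy, entry_id_ne hxy]
      simp
  refine ⟨hV, ‖V‖ ^ 2, fun ξ => ?_⟩
  convert algPos_ealgInner (ealgMul G hG ξ) using 1
  apply Subtype.ext
  change ((‖V‖ ^ 2 : ℝ) : ℂ) • (ContinuousLinearMap.adjoint (ξ : L2 X ℂ →L[ℂ] L2 X K) ∘L
      (ξ : L2 X ℂ →L[ℂ] L2 X K))
    - ContinuousLinearMap.adjoint (V ∘L (ξ : L2 X ℂ →L[ℂ] L2 X K)) ∘L (V ∘L _)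
    = ContinuousLinearMap.adjoint (G ∘L (ξ : L2 X ℂ →L[ℂ] L2 X K)) ∘L (G ∘L _)
  rw [ContinuousLinearMap.adjoint_comp, ContinuousLinearMap.adjoint_comp]
  ext1 f
  have h3 := DFunLike.congr_fun hGG ((ξ : L2 X ℂ →L[ℂ] L2 X K) f)
  change ContinuousLinearMap.adjoint G (G _) = ((‖V‖ ^ 2 : ℝ) : ℂ) • _
    - ContinuousLinearMap.adjoint V (V _) at h3
  refine Eq.trans ?_ (congrArg (ContinuousLinearMap.adjoint (ξ : L2 X ℂ →L[ℂ] L2 X K)) h3).symm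
  rw [map_sub, map_smul]
  rfl

theorem LeftBounded.add [BoundedGeometry X] {S T : L2 X K →L[ℂ] L2 X K} (hS : LeftBounded S)
    (hT : LeftBounded T) : LeftBounded (S + T) := by
  obtain ⟨hS, C, hC⟩ := hS
  obtain ⟨hT, D, hD⟩ := hT
  have hST : FinitePropagation (entry (S - T)) := by
    have := hS.add (hT.smul (-1))
    rwa [neg_one_smul, ← sub_eq_add_neg] at this
  refine ⟨hS.add hT, 2 * (C + D), fun ξ => ?_⟩
  convert (((hC ξ).add (hC ξ)).add ((hD ξ).add (hD ξ))).add
    (algPos_ealgInner (ealgMul (S - T) hST ξ)) using 1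
  apply Subtype.ext
  change ((2 * (C + D) : ℝ) : ℂ) • (ContinuousLinearMap.adjoint (ξ : L2 X ℂ →L[ℂ] L2 X K) ∘L
      (ξ : L2 X ℂ →L[ℂ] L2 X K))
    - ContinuousLinearMap.adjoint ((S + T) ∘L (ξ : L2 X ℂ →L[ℂ] L2 X K)) ∘L ((S + T) ∘L
      (ξ : L2 X ℂ →L[ℂ] L2 X K))
    = (((C : ℂ) • (ContinuousLinearMap.adjoint (ξ : L2 X ℂ →L[ℂ] L2 X K) ∘L
      (ξ : L2 X ℂ →L[ℂ] L2 X K))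
    - ContinuousLinearMap.adjoint (S ∘L (ξ : L2 X ℂ →L[ℂ] L2 X K)) ∘L (S ∘L
      (ξ : L2 X ℂ →L[ℂ] L2 X K))) + ((C : ℂ) • (ContinuousLinearMap.adjoint
        (ξ : L2 X ℂ →L[ℂ] L2 X K) ∘L (ξ : L2 X ℂ →L[ℂ] L2 X K))
    - ContinuousLinearMap.adjoint (S ∘L (ξ : L2 X ℂ →L[ℂ] L2 X K)) ∘L (S ∘L
      (ξ : L2 X ℂ →L[ℂ] L2 X K)))) + (((D : ℂ) • (ContinuousLinearMap.adjoint
        (ξ : L2 X ℂ →L[ℂ] L2 X K) ∘L (ξ : L2 X ℂ →L[ℂ] L2 X K))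
    - ContinuousLinearMap.adjoint (T ∘L (ξ : L2 X ℂ →L[ℂ] L2 X K)) ∘L (T ∘L
      (ξ : L2 X ℂ →L[ℂ] L2 X K))) + ((D : ℂ) • (ContinuousLinearMap.adjoint
        (ξ : L2 X ℂ →L[ℂ] L2 X K) ∘L (ξ : L2 X ℂ →L[ℂ] L2 X K))
    - ContinuousLinearMap.adjoint (T ∘L (ξ : L2 X ℂ →L[ℂ] L2 X K)) ∘L (T ∘L
      (ξ : L2 X ℂ →L[ℂ] L2 X K))))
    + ContinuousLinearMap.adjoint ((S - T) ∘L (ξ : L2 X ℂ →L[ℂ] L2 X K)) ∘L ((S - T) ∘L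
      (ξ : L2 X ℂ →L[ℂ] L2 X K))
  rw [ContinuousLinearMap.add_comp, ContinuousLinearMap.sub_comp]
  generalize S ∘L (ξ : L2 X ℂ →L[ℂ] L2 X K) = s
  generalize T ∘L (ξ : L2 X ℂ →L[ℂ] L2 X K) = t
  simp only [map_add, map_sub, ContinuousLinearMap.add_comp, ContinuousLinearMap.sub_comp,
    ContinuousLinearMap.comp_add, ContinuousLinearMap.comp_sub]
  push_cast
  module

theorem LeftBounded.zero : LeftBounded (0 : L2 X K →L[ℂ] L2 X K) := by
  refine ⟨.zero, 0, fun ξ => ?_⟩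
  have h : ((0 : ℝ) : ℂ) • ealgInner ξ ξ - ealgInner (ealgMul 0 .zero ξ) (ealgMul 0 .zero ξ)
      = 0 := by
    apply Subtype.ext
    change ((0 : ℝ) : ℂ) • _ - ContinuousLinearMap.adjoint ((0 : L2 X K →L[ℂ] L2 X K) ∘L _) ∘L
      ((0 : L2 X K →L[ℂ] L2 X K) ∘L _) = 0
    simp
  rw [h]
  exact AddSubmonoid.zero_mem _

theorem leftBounded [BoundedGeometry X] {T : L2 X K →L[ℂ] L2 X K} (hT : FinitePropagation (entry T)) :
    LeftBounded T := by
  have hsum : ∀ {ι : Type} (s : Finset ι) (V : ι → L2 X K →L[ℂ] L2 X K),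
      (∀ i, LeftBounded (V i)) → LeftBounded (∑ i ∈ s, V i) := by
    classical
    intro ι s V hV
    induction s using Finset.induction_on with
    | empty => simpa using LeftBounded.zero
    | insert a s ha ih =>
      rw [Finset.sum_insert ha]
      exact (hV a).add ih
  obtain ⟨S, hS, hS'⟩ := id hT
  obtain ⟨N, c, hc⟩ := exists_colouring (X := X) (2 * S) (by positivity)
  rw [← sum_cut c T]
  refine hsum _ _ fun i => hsum _ _ fun j => leftBounded_of_diag (finitePropagation_cut hT _ _) ?_
  exact cut_diag hS' fun x hx y hy hd => hc x y (hx.trans hy.symm) hd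

end Ealg

/-! ### The Morita bimodule `E` -/

section MaxBound

variable {𝒜 : Type u} [NonUnitalRing 𝒜] [StarRing 𝒜] [Module ℂ 𝒜] [HasMaximalNorm 𝒜]
  {V : Type w} [AddCommGroup V] [Module ℂ V]
  {ℬ : Type w} [NonUnitalRing ℬ] [StarRing ℬ] [Module ℂ ℬ] [HasMaximalNorm ℬ]

theorem toFun_left_le_max (P : PreHilbertModule 𝒜 V) (l : ℬ →ₗ[ℂ] V →ₗ[ℂ] V)
    (hmul : ∀ b b' ξ, l (b * b') ξ = l b (l b' ξ))
    (hinner : ∀ b ξ η, P.inner (l b ξ) η = P.inner ξ (l (star b) η))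
    (hbd : ∀ b, ∃ C : ℝ, ∀ ξ, AlgPos ((C : ℂ) • P.inner ξ ξ - P.inner (l b ξ) (l b ξ)))
    (b : ℬ) (ξ : V) :
    (maximalSeminorm 𝒜).toFun (P.inner (l b ξ) (l b ξ))
      ≤ (maximalSeminorm ℬ).toFun b ^ 2 * (maximalSeminorm 𝒜).toFun (P.inner ξ ξ) := by
  refine sSup_repNorms_le _ fun H _ _ _ ρ => ?_
  have hre : ∀ (a : 𝒜), AlgPos a → ∀ h : H, 0 ≤ RCLike.re (inner ℂ h (ρ a h)) := by
    intro a ha h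
    have h1 := (ContinuousLinearMap.nonneg_iff_isPositive _).mp (ha.map ρ)
    exact h1.re_inner_nonneg_right h
  have key : ∀ h : H, RCLike.re (inner ℂ h (ρ (P.inner (l b ξ) (l b ξ)) h))
      ≤ (maximalSeminorm ℬ).toFun b ^ 2 * RCLike.re (inner ℂ h (ρ (P.inner ξ ξ) h)) := by
    intro h
    let cd : PreInnerProductSpace.Core ℂ V :=
      { inner := fun ξ η => inner ℂ h (ρ (P.inner ξ η) h)
        conj_inner_symm := fun ξ η => by
          rw [inner_conj_symm, ← P.star_inner, map_star, ContinuousLinearMap.star_eq_adjoint,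
            ContinuousLinearMap.adjoint_inner_left]
        re_inner_nonneg := fun ξ => hre _ (P.inner_self ξ) h
        add_left := fun ξ η ζ => by simp
        smul_left := fun ξ η c => by simp }
    let : SeminormedAddCommGroup V := InnerProductSpace.Core.toSeminormedAddCommGroup (c := cd)
    let : InnerProductSpace ℂ V := InnerProductSpace.ofCore cd
    have hn : ∀ ξ : V, ‖ξ‖ ^ 2 = RCLike.re (inner ℂ h (ρ (P.inner ξ ξ) h)) := fun ξ => by
      rw [@norm_sq_eq_re_inner ℂ]
      rfl
    have hC : ∀ b, ∃ C : ℝ, ∀ ξ : V, ‖l b ξ‖ ≤ C * ‖ξ‖ := by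
      intro b
      obtain ⟨C, hC⟩ := hbd b
      refine ⟨√(max C 0), fun ξ => ?_⟩
      have h1 := hre _ (hC ξ) h
      have h2 : ∀ z : ℂ, RCLike.re ((C : ℂ) * z) = C * RCLike.re z := Complex.re_ofReal_mul C
      rw [map_sub, map_smul, sub_apply, inner_sub_right, smul_apply, inner_smul_right, map_sub,
        h2, ← hn, ← hn, sub_nonneg] at h1
      refine abs_le_of_sq_le_sq' ?_ (by positivity) |>.2
      rw [mul_pow, Real.sq_sqrt (le_max_right _ _)]
      refine h1.trans ?_
      gcongr
      exact le_max_left _ _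
    choose C hC using hC
    let L : ℬ → V →L[ℂ] V := fun b => (l b).mkContinuous (C b) (hC b)
    have hfin := norm_le_of_preRep L (fun a b => by ext x; exact LinearMap.map_add₂ l a b x)
      (fun c a => by ext x; exact LinearMap.map_smul₂ l c a x) (fun a b => by ext x; exact hmul a b x)
      (fun a v w => by
        change inner ℂ h (ρ (P.inner (l a v) w) h) = inner ℂ h (ρ (P.inner v (l (star a) w)) h)
        rw [hinner]) b ξ
    rw [← hn, ← hn, ← mul_pow]
    exact pow_le_pow_left₀ (norm_nonneg _) hfin 2
  have h0 : 0 ≤ ρ (P.inner (l b ξ) (l b ξ)) := (P.inner_self _).map ρ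
  set M := (maximalSeminorm ℬ).toFun b ^ 2 * (maximalSeminorm 𝒜).toFun (P.inner ξ ξ) with hM
  have hM0 : 0 ≤ M := mul_nonneg (sq_nonneg _) (sSup_repNorms_nonneg _)
  have h1 : ρ (P.inner (l b ξ) (l b ξ)) ≤ (M : ℂ) • (1 : H →L[ℂ] H) := by
    rw [ContinuousLinearMap.le_def, ContinuousLinearMap.isPositive_iff_complex]
    intro h
    have hsa : inner ℂ ((ρ (P.inner (l b ξ) (l b ξ))) h) h
        = ((RCLike.re (inner ℂ h (ρ (P.inner (l b ξ) (l b ξ)) h)) : ℝ) : ℂ) := by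
      have h2 := (ContinuousLinearMap.isPositive_iff_complex _).mp
        ((ContinuousLinearMap.nonneg_iff_isPositive _).mp h0) h
      rw [← h2.1, ← inner_conj_symm h, RCLike.conj_re]
    have h2 : inner ℂ (((M : ℂ) • (1 : H →L[ℂ] H) - ρ (P.inner (l b ξ) (l b ξ))) h) h
        = ((M * ‖h‖ ^ 2 - RCLike.re (inner ℂ h (ρ (P.inner (l b ξ) (l b ξ)) h)) : ℝ) : ℂ) := by
      rw [sub_apply, inner_sub_left, hsa, smul_apply, one_apply_eq_self, inner_smul_left,
        inner_self_eq_norm_sq_to_K]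
      push_cast
      simp
    rw [h2]
    refine ⟨congrArg _ (Complex.ofReal_re _), ?_⟩
    rw [RCLike.re_eq_complex_re, Complex.ofReal_re, sub_nonneg]
    refine (key h).trans ?_
    rw [hM, mul_assoc]
    gcongr
    calc RCLike.re (inner ℂ h (ρ (P.inner ξ ξ) h)) ≤ ‖h‖ * ‖ρ (P.inner ξ ξ) h‖ :=
          re_inner_le_norm _ _
      _ ≤ ‖h‖ * (sSup (repNorms (P.inner ξ ξ)) * ‖h‖) := by
          gcongr
          exact (ρ _).le_of_opNorm_le (norm_rep_le _ ρ) h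
      _ = _ := by
          change _ = sSup (repNorms (P.inner ξ ξ)) * ‖h‖ ^ 2
          ring
  refine (CStarAlgebra.norm_le_norm_of_nonneg_of_le h0 h1).trans ?_
  rw [norm_smul, Complex.norm_real, Real.norm_of_nonneg hM0]
  exact mul_le_of_le_one_right hM0 ContinuousLinearMap.norm_id_le

end MaxBound

section Bimodule

variable {X : Type u} [MetricSpace X] [BoundedGeometry X]
  {K : Type v} [NormedAddCommGroup K] [InnerProductSpace ℂ K] [CompleteSpace K]

theorem ealgLeft_mul (S T : UCalg X K) (ξ : Ealg X K) :
    ealgLeft X K (S * T) ξ = ealgLeft X K S (ealgLeft X K T ξ) := rfl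

theorem preE_inner_left (T : UCalg X K) (ξ η : Ealg X K) :
    (preE X K).inner (ealgLeft X K T ξ) η = (preE X K).inner ξ (ealgLeft X K (star T) η) := by
  apply Subtype.ext
  change ContinuousLinearMap.adjoint ((T : L2 X K →L[ℂ] L2 X K) ∘L (ξ : L2 X ℂ →L[ℂ] L2 X K)) ∘L _
    = _
  rw [ContinuousLinearMap.adjoint_comp]
  rfl

theorem toFun_ealgLeft_le (s : Variant) (T : UCalg X K) (ξ : Ealg X K) :
    (s.seminorm (Cu X)).toFun ((preE X K).inner (ealgLeft X K T ξ) (ealgLeft X K T ξ))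
      ≤ (s.seminorm (UCalg X K)).toFun T ^ 2 * (s.seminorm (Cu X)).toFun ((preE X K).inner ξ ξ) := by
  cases s with
  | reduced =>
    have h : ∀ A : L2 X ℂ →L[ℂ] L2 X K, ‖ContinuousLinearMap.adjoint A ∘L A‖ = ‖A‖ ^ 2 := fun A =>
      (ContinuousLinearMap.norm_adjoint_comp_self A).trans (sq _).symm
    change ‖ContinuousLinearMap.adjoint ((T : L2 X K →L[ℂ] L2 X K) ∘L (ξ : L2 X ℂ →L[ℂ] L2 X K)) ∘L
      ((T : L2 X K →L[ℂ] L2 X K) ∘L (ξ : L2 X ℂ →L[ℂ] L2 X K))‖ ≤ ‖(T : L2 X K →L[ℂ] L2 X K)‖ ^ 2 *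
      ‖ContinuousLinearMap.adjoint (ξ : L2 X ℂ →L[ℂ] L2 X K) ∘L (ξ : L2 X ℂ →L[ℂ] L2 X K)‖
    rw [h, h, ← mul_pow]
    have h1 : ‖(T : L2 X K →L[ℂ] L2 X K) ∘L (ξ : L2 X ℂ →L[ℂ] L2 X K)‖
        ≤ ‖(T : L2 X K →L[ℂ] L2 X K)‖ * ‖(ξ : L2 X ℂ →L[ℂ] L2 X K)‖ :=
      ContinuousLinearMap.opNorm_comp_le _ _
    gcongr
  | maximal =>
    exact toFun_left_le_max (preE X K) (ealgLeft X K) ealgLeft_mul preE_inner_left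
      (fun T => (leftBounded T.2.1).2) T ξ

variable (X K)

/-- The Hilbert module `E` (in the reduced case) or `E_max` (in the maximal case) over the uniform
Roe algebra: the completion of `E_alg`. -/
abbrev EStar (s : Variant) : Type (max u v) := (preE X K).Compl (s.seminorm (Cu X))

/-- `E` as a bimodule: the uniform algebra acts on the left by matrix multiplication. -/
instance (s : Variant) : Correspondence (UCStar X K s) (CuStar X s) (EStar X K s) :=
  (preE X K).complCorrespondence (s.seminorm (Cu X)) (s.seminorm (UCalg X K)) (ealgLeft X K)
    ealgLeft_mul preE_inner_left (toFun_ealgLeft_le s)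

end Bimodule

/-! ### Suspensions -/

section Suspension

theorem zeroAtInfty_norm_le {E : Type*} [NormedAddCommGroup E] {f : C₀(ℝ, E)} {C : ℝ} (hC : 0 ≤ C) :
    ‖f‖ ≤ C ↔ ∀ t, ‖f t‖ ≤ C :=
  BoundedContinuousFunction.norm_le (f := f.toBCF) hC

theorem zeroAtInfty_norm_apply_le {E : Type*} [NormedAddCommGroup E] (f : C₀(ℝ, E)) (t : ℝ) :
    ‖f t‖ ≤ ‖f‖ :=
  (zeroAtInfty_norm_le (norm_nonneg f)).mp le_rfl t

variable {P Q R : Type*} [NormedAddCommGroup P] [NormedSpace ℂ P]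
  [NormedAddCommGroup Q] [NormedSpace ℂ Q] [NormedAddCommGroup R] [NormedSpace ℂ R]
  {σ : ℂ →+* ℂ} [RingHomIsometric σ]

/-- The pointwise application of a bounded bilinear map to functions vanishing at infinity. -/
def pointwise (f : P →SL[σ] Q →L[ℂ] R) : C₀(ℝ, P) →SL[σ] C₀(ℝ, Q) →L[ℂ] C₀(ℝ, R) :=
  LinearMap.mkContinuous₂ (LinearMap.mk₂'ₛₗ σ (RingHom.id ℂ)
    (fun p q =>
      { toFun := fun t => f (p t) (q t)
        continuous_toFun := (f.continuous.comp (map_continuous p)).clm_apply (map_continuous q)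
        zero_at_infty' := by
          have h1 : Filter.Tendsto (fun t => ‖f‖ * ‖p t‖ * ‖q t‖) (Filter.cocompact ℝ) (nhds 0) := by
            have hp := (ZeroAtInftyContinuousMapClass.zero_at_infty p).norm
            have hq := (ZeroAtInftyContinuousMapClass.zero_at_infty q).norm
            simpa using (hp.const_mul ‖f‖).mul hq
          exact squeeze_zero_norm (fun t => f.le_opNorm₂ (p t) (q t)) h1 })
    (fun p p' q => by ext t; simp)
    (fun c p q => by ext t; simp)
    (fun p q q' => by ext t; simp)
    (fun c p q => by ext t; simp)) ‖f‖
    (fun p q => (zeroAtInfty_norm_le (by positivity)).mpr fun t =>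
      (f.le_opNorm₂ (p t) (q t)).trans (by
        gcongr
        · exact zeroAtInfty_norm_apply_le p t
        · exact zeroAtInfty_norm_apply_le q t))

theorem pointwise_apply (f : P →SL[σ] Q →L[ℂ] R) (p : C₀(ℝ, P)) (q : C₀(ℝ, Q)) (t : ℝ) :
    pointwise f p q t = f (p t) (q t) := rfl

/-- The evaluation at a point as a *-homomorphism. -/
def evalStarHom (B : Type*) [NonUnitalCStarAlgebra B] (t : ℝ) : C₀(ℝ, B) →⋆ₙₐ[ℂ] B where
  toFun f := f t
  map_smul' _ _ := rfl
  map_zero' := rfl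
  map_add' _ _ := rfl
  map_mul' _ _ := rfl
  map_star' _ := rfl

theorem exists_star_mul_self_of_pointwise {B : Type*} [NonUnitalCStarAlgebra B] (f : C₀(ℝ, B))
    (h : ∀ t, ∃ b, f t = star b * b) : ∃ g, f = star g * g := by
  let := CStarAlgebra.spectralOrder B
  let := CStarAlgebra.spectralOrderedRing B
  let := CStarAlgebra.spectralOrder C₀(ℝ, B)
  let := CStarAlgebra.spectralOrderedRing C₀(ℝ, B)
  have h0 : ∀ t, 0 ≤ f t := fun t => CStarAlgebra.nonneg_iff_eq_star_mul_self.mpr (h t)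
  have hsa : IsSelfAdjoint f := by
    ext t
    exact (IsSelfAdjoint.of_nonneg (h0 t)).star_eq
  suffices hneg : f⁻ = 0 by
    refine CStarAlgebra.nonneg_iff_eq_star_mul_self.mp ?_
    rwa [CFC.negPart_eq_zero_iff f hsa] at hneg
  have hn : 0 ≤ f⁻ := CFC.negPart_nonneg f
  have hnsa : IsSelfAdjoint f⁻ := IsSelfAdjoint.of_nonneg hn
  have hmul : f⁻ * f * f⁻ = -(f⁻ * f⁻ * f⁻) := by
    have hd := CFC.posPart_sub_negPart f hsa
    calc f⁻ * f * f⁻ = f⁻ * (f⁺ - f⁻) * f⁻ := by rw [hd]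
      _ = f⁻ * (f⁺ * f⁻) - f⁻ * f⁻ * f⁻ := by rw [mul_sub, sub_mul, mul_assoc]
      _ = -(f⁻ * f⁻ * f⁻) := by rw [CFC.posPart_mul_negPart, mul_zero, zero_sub]
  ext t
  have hnt : 0 ≤ f⁻ t := by
    obtain ⟨g, hg⟩ := CStarAlgebra.nonneg_iff_eq_star_mul_self.mp hn
    rw [hg]
    exact star_mul_self_nonneg (g t)
  have hnsat : IsSelfAdjoint (f⁻ t) := IsSelfAdjoint.of_nonneg hnt
  have h1 : 0 ≤ f⁻ t * f t * f⁻ t := by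
    have := star_left_conjugate_nonneg (h0 t) (f⁻ t)
    rwa [hnsat.star_eq] at this
  have h2 : f⁻ t * f t * f⁻ t = -(f⁻ t * f⁻ t * f⁻ t) := congrArg (fun g => g t) hmul
  have h3 : 0 ≤ f⁻ t * f⁻ t * f⁻ t := by
    have := star_left_conjugate_nonneg hnt (f⁻ t)
    rwa [hnsat.star_eq] at this
  have h4 : f⁻ t * f⁻ t * f⁻ t = 0 := by
    rw [h2] at h1
    exact le_antisymm (by simpa using h1) h3
  have h5 : ‖f⁻ t‖ ^ 4 = 0 := by
    have h6 : ‖f⁻ t * f⁻ t‖ = ‖f⁻ t‖ * ‖f⁻ t‖ := by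
      conv_lhs => rw [← congrArg (· * f⁻ t) hnsat.star_eq]
      exact CStarRing.norm_star_mul_self
    have h7 : ‖(f⁻ t * f⁻ t) * (f⁻ t * f⁻ t)‖ = ‖f⁻ t * f⁻ t‖ * ‖f⁻ t * f⁻ t‖ := by
      have hs : star (f⁻ t * f⁻ t) = f⁻ t * f⁻ t := by rw [star_mul, hnsat.star_eq]
      conv_lhs => rw [← congrArg (· * (f⁻ t * f⁻ t)) hs]
      exact CStarRing.norm_star_mul_self
    rw [← mul_assoc, h4, zero_mul, norm_zero, h6] at h7
    rw [h7]
    ring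
  exact norm_eq_zero.mp (by simpa using h5)

theorem continuous_starHom {A B : Type*} [NonUnitalCStarAlgebra A] [NonUnitalCStarAlgebra B]
    (φ : A →⋆ₙₐ[ℂ] B) : Continuous φ :=
  AddMonoidHomClass.continuous_of_bound φ 1 fun a => by
    rw [one_mul]
    exact NonUnitalStarAlgHom.norm_apply_le φ a

/-- The suspension `C₀(ℝ, φ)` of a *-homomorphism `φ`. -/
def suspHom {A B : Type*} [NonUnitalCStarAlgebra A] [NonUnitalCStarAlgebra B] (φ : A →⋆ₙₐ[ℂ] B) :
    C₀(ℝ, A) →⋆ₙₐ[ℂ] C₀(ℝ, B) where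
  toFun f :=
    { toFun := fun t => φ (f t)
      continuous_toFun := (continuous_starHom φ).comp (map_continuous f)
      zero_at_infty' := by
        have h : Filter.Tendsto φ (nhds 0) (nhds 0) := by
          have := (continuous_starHom φ).tendsto 0
          rwa [map_zero] at this
        exact h.comp (ZeroAtInftyContinuousMapClass.zero_at_infty f) }
  map_smul' c f := by
    ext t
    exact map_smul φ c (f t)
  map_zero' := by
    ext t
    exact map_zero φ
  map_add' f g := by
    ext t
    exact map_add φ (f t) (g t)
  map_mul' f g := by
    ext t
    exact map_mul φ (f t) (g t)
  map_star' f := by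
    ext t
    exact map_star φ (f t)

/-- The suspension `C₀(ℝ, E)` of a Hilbert module, with pointwise operations. -/
instance {B E : Type*} [NonUnitalCStarAlgebra B] [NormedAddCommGroup E] [NormedSpace ℂ E]
    [CompleteSpace E] [HilbertModule B E] : HilbertModule C₀(ℝ, B) C₀(ℝ, E) where
  act := pointwise HilbertModule.act
  inner := pointwise HilbertModule.inner
  act_mul ξ a b := by
    ext t
    exact HilbertModule.act_mul (ξ t) (a t) (b t)
  inner_act ξ η a := by
    ext t
    exact HilbertModule.inner_act (ξ t) (η t) (a t)
  star_inner ξ η := by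
    ext t
    exact HilbertModule.star_inner (ξ t) (η t)
  inner_self ξ := exists_star_mul_self_of_pointwise _ fun t => HilbertModule.inner_self (ξ t)
  norm_sq ξ := by
    have hp : ∀ t, ‖ξ t‖ ^ 2 = ‖pointwise (HilbertModule.inner (A := B) (E := E)) ξ ξ t‖ := fun t =>
      HilbertModule.norm_sq (ξ t)
    refine le_antisymm ?_ ?_
    · refine (Real.le_sqrt (norm_nonneg _) (norm_nonneg _)).mp
        ((zeroAtInfty_norm_le (Real.sqrt_nonneg _)).mpr fun t => ?_)
      refine Real.le_sqrt_of_sq_le ((hp t).trans_le ?_)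
      exact zeroAtInfty_norm_apply_le _ t
    · refine (zeroAtInfty_norm_le (sq_nonneg _)).mpr fun t => (hp t).ge.trans ?_
      exact pow_le_pow_left₀ (norm_nonneg _) (zeroAtInfty_norm_apply_le ξ t) 2

/-- The suspension of a correspondence, with pointwise operations. -/
instance {A B E : Type*} [NonUnitalCStarAlgebra A] [NonUnitalCStarAlgebra B] [NormedAddCommGroup E]
    [NormedSpace ℂ E] [CompleteSpace E] [HilbertModule B E] [Correspondence A B E] :
    Correspondence C₀(ℝ, A) C₀(ℝ, B) C₀(ℝ, E) where
  left := pointwise (Correspondence.left B)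
  left_mul a b ξ := by
    ext t
    exact Correspondence.left_mul (B := B) (a t) (b t) (ξ t)
  inner_left a ξ η := by
    ext t
    exact Correspondence.inner_left (B := B) (a t) (ξ t) (η t)

end Suspension

/-! ### K-theory -/

section KTheory

variable {R : Type*} [Ring R] [StarRing R]

open Matrix in
/-- Murray-von Neumann equivalence of projections in (possibly different) matrix algebras. -/
def IsMvN {ι κ : Type*} [Fintype ι] [Fintype κ] (p : Matrix ι ι R) (q : Matrix κ κ R) : Prop :=
  ∃ v : Matrix κ ι R, vᴴ * v = p ∧ v * vᴴ = q

section MvN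

open Matrix

variable {ι κ μ ι' κ' : Type*} [Fintype ι] [Fintype κ] [Fintype μ] [Fintype ι'] [Fintype κ']

theorem IsMvN.refl {p : Matrix ι ι R} (hp : IsStarProjection p) : IsMvN p p :=
  ⟨p, by
    have h1 : pᴴ = p := hp.isSelfAdjoint
    have h2 : p * p = p := hp.isIdempotentElem
    rw [h1, h2], by
    have h1 : pᴴ = p := hp.isSelfAdjoint
    have h2 : p * p = p := hp.isIdempotentElem
    rw [h1, h2]⟩

theorem IsMvN.symm {p : Matrix ι ι R} {q : Matrix κ κ R} (h : IsMvN p q) : IsMvN q p := by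
  obtain ⟨v, h1, h2⟩ := h
  exact ⟨vᴴ, by rw [conjTranspose_conjTranspose, h2], by rw [conjTranspose_conjTranspose, h1]⟩

theorem IsMvN.trans {p : Matrix ι ι R} {q : Matrix κ κ R} {r : Matrix μ μ R}
    (hp : IsStarProjection p) (hr : IsStarProjection r) (h : IsMvN p q) (h' : IsMvN q r) :
    IsMvN p r := by
  obtain ⟨v, h1, h2⟩ := h
  obtain ⟨w, h3, h4⟩ := h'
  refine ⟨w * v, ?_, ?_⟩
  · have h5 : p * p = p := hp.isIdempotentElem
    calc (w * v)ᴴ * (w * v) = vᴴ * (wᴴ * w) * v := by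
          rw [conjTranspose_mul]; simp only [Matrix.mul_assoc]
      _ = (vᴴ * v) * (vᴴ * v) := by rw [h3, ← h2]; simp only [Matrix.mul_assoc]
      _ = p := by rw [h1, h5]
  · have h5 : r * r = r := hr.isIdempotentElem
    calc (w * v) * (w * v)ᴴ = w * (v * vᴴ) * wᴴ := by
          rw [conjTranspose_mul]; simp only [Matrix.mul_assoc]
      _ = (w * wᴴ) * (w * wᴴ) := by rw [h2, ← h3]; simp only [Matrix.mul_assoc]
      _ = r := by rw [h4, h5]

theorem isMvN_submatrix {p : Matrix ι ι R} (hp : IsStarProjection p) (e : κ ≃ ι) :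
    IsMvN (p.submatrix e e) p := by
  have h1 : pᴴ = p := hp.isSelfAdjoint
  have h2 : p * p = p := hp.isIdempotentElem
  refine ⟨p.submatrix id e, ?_, ?_⟩
  · rw [conjTranspose_submatrix, h1]
    have := submatrix_mul p p e (id : ι → ι) e Function.bijective_id
    rw [← this, h2]
  · rw [conjTranspose_submatrix, h1, submatrix_mul_equiv, h2, submatrix_id_id]

theorem isStarProjection_submatrix {p : Matrix ι ι R} (hp : IsStarProjection p) (e : κ ≃ ι) :
    IsStarProjection (p.submatrix e e) := by
  have h1 : pᴴ = p := hp.isSelfAdjoint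
  have h2 : p * p = p := hp.isIdempotentElem
  refine ⟨?_, ?_⟩
  · change p.submatrix e e * p.submatrix e e = _
    rw [submatrix_mul_equiv, h2]
  · change (p.submatrix e e)ᴴ = _
    rw [conjTranspose_submatrix, h1]

theorem isStarProjection_blocks {p : Matrix ι ι R} {q : Matrix κ κ R} (hp : IsStarProjection p)
    (hq : IsStarProjection q) : IsStarProjection (fromBlocks p 0 0 q) := by
  have h1 : pᴴ = p := hp.isSelfAdjoint
  have h2 : p * p = p := hp.isIdempotentElem
  have h3 : qᴴ = q := hq.isSelfAdjoint
  have h4 : q * q = q := hq.isIdempotentElem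
  refine ⟨?_, ?_⟩
  · change fromBlocks p 0 0 q * fromBlocks p 0 0 q = _
    rw [fromBlocks_multiply]
    simp [h2, h4]
  · change (fromBlocks p 0 0 q)ᴴ = _
    rw [fromBlocks_conjTranspose]
    simp [h1, h3]

theorem IsMvN.blocks {p : Matrix ι ι R} {q : Matrix κ κ R} {p' : Matrix ι' ι' R}
    {q' : Matrix κ' κ' R} (hp : IsMvN p p') (hq : IsMvN q q') :
    IsMvN (fromBlocks p 0 0 q) (fromBlocks p' 0 0 q') := by
  obtain ⟨v, h1, h2⟩ := hp
  obtain ⟨w, h3, h4⟩ := hq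
  refine ⟨fromBlocks v 0 0 w, ?_, ?_⟩
  · rw [fromBlocks_conjTranspose, fromBlocks_multiply]
    simp [h1, h3]
  · rw [fromBlocks_conjTranspose, fromBlocks_multiply]
    simp [h2, h4]

theorem IsMvN.map {S : Type*} [Ring S] [StarRing S] [Algebra ℂ R] [Algebra ℂ S] (φ : R →⋆ₐ[ℂ] S)
    {p : Matrix ι ι R} {q : Matrix κ κ R} (h : IsMvN p q) : IsMvN (p.map φ) (q.map φ) := by
  obtain ⟨v, h1, h2⟩ := h
  refine ⟨v.map φ, ?_, ?_⟩
  · rw [← Matrix.conjTranspose_map φ fun a => map_star φ a, ← Matrix.map_mul, h1]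
  · rw [← Matrix.conjTranspose_map φ fun a => map_star φ a, ← Matrix.map_mul, h2]

theorem blocks_map {S : Type*} [Ring S] [StarRing S] [Algebra ℂ R] [Algebra ℂ S] (φ : R →⋆ₐ[ℂ] S)
    (p : Matrix ι ι R) (q : Matrix κ κ R) (e : μ → ι ⊕ κ) :
    ((fromBlocks p 0 0 q).submatrix e e).map φ
      = (fromBlocks (p.map φ) 0 0 (q.map φ)).submatrix e e := by
  rw [← submatrix_map, fromBlocks_map]
  simp

end MvN

variable (R) in
/-- The projections in the matrix algebras over `R`. -/
structure MatProj where
  size : ℕ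
  val : Matrix (Fin size) (Fin size) R
  isProj : IsStarProjection val

theorem MatProj.ext' {p q : MatProj R} (h : p.size = q.size) (h' : p.val ≍ q.val) : p = q := by
  cases p
  cases q
  cases h
  cases h'
  rfl

variable (R) in
/-- Murray-von Neumann equivalence of projections in the matrix algebras over `R`. -/
instance matProjSetoid : Setoid (MatProj R) where
  r p q := IsMvN p.val q.val
  iseqv := ⟨fun p => .refl p.isProj, .symm, fun {p _ r} h h' => .trans p.isProj r.isProj h h'⟩

/-- The block sum of two projections. -/
def MatProj.sum (p q : MatProj R) : MatProj R where
  size := p.size + q.size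
  val := (Matrix.fromBlocks p.val 0 0 q.val).submatrix finSumFinEquiv.symm finSumFinEquiv.symm
  isProj := isStarProjection_submatrix (isStarProjection_blocks p.isProj q.isProj) _

theorem MatProj.isMvN_sum (p q : MatProj R) :
    IsMvN (p.sum q).val (Matrix.fromBlocks p.val 0 0 q.val) :=
  isMvN_submatrix (isStarProjection_blocks p.isProj q.isProj) _

theorem MatProj.isMvN_sum_left {p q : MatProj R} {ι : Type*} [Fintype ι] {a : Matrix ι ι R}
    (ha : IsStarProjection a) (h : IsMvN (Matrix.fromBlocks p.val 0 0 q.val) a) :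
    IsMvN (p.sum q).val a :=
  (p.isMvN_sum q).trans (p.sum q).isProj ha h

theorem MatProj.isMvN_sum_right {p q : MatProj R} {ι : Type*} [Fintype ι] {a : Matrix ι ι R}
    (ha : IsStarProjection a) (h : IsMvN a (Matrix.fromBlocks p.val 0 0 q.val)) :
    IsMvN a (p.sum q).val :=
  (MatProj.isMvN_sum_left ha h.symm).symm

/-- The identity matrix of size `n`, as a projection. -/
def MatProj.one (R : Type*) [Ring R] [StarRing R] (n : ℕ) : MatProj R where
  size := n
  val := 1
  isProj := ⟨mul_one _, star_one _⟩

variable (R) in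
/-- The monoid `V(R)` of Murray-von Neumann equivalence classes of projections over `R`. -/
def VMon : Type _ := Quotient (matProjSetoid R)

instance : Add (VMon R) := ⟨Quotient.map₂ MatProj.sum fun _ _ hp _ _ hq =>
  MatProj.isMvN_sum_left (MatProj.isProj _)
    (MatProj.isMvN_sum_right (isStarProjection_blocks (MatProj.isProj _) (MatProj.isProj _))
      (IsMvN.blocks hp hq))⟩

instance : Zero (VMon R) := ⟨(⟦MatProj.one R 0⟧ : Quotient (matProjSetoid R))⟩

instance : AddCommMonoid (VMon R) where
  nsmul := nsmulRec
  add_assoc a b c := by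
    induction a, b, c using Quotient.inductionOn₃ with | _ p q r
    refine Quotient.sound ?_
    have h1 : IsMvN ((p.sum q).sum r).val
        (Matrix.fromBlocks (Matrix.fromBlocks p.val 0 0 q.val) 0 0 r.val) :=
      MatProj.isMvN_sum_left
        (isStarProjection_blocks (isStarProjection_blocks p.isProj q.isProj) r.isProj)
        ((p.isMvN_sum q).blocks (.refl r.isProj))
    have h2 : IsMvN (p.sum (q.sum r)).val
        (Matrix.fromBlocks p.val 0 0 (Matrix.fromBlocks q.val 0 0 r.val)) :=
      MatProj.isMvN_sum_left
        (isStarProjection_blocks p.isProj (isStarProjection_blocks q.isProj r.isProj))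
        ((IsMvN.refl p.isProj).blocks (q.isMvN_sum r))
    have h3 : IsMvN (Matrix.fromBlocks (Matrix.fromBlocks p.val 0 0 q.val) 0 0 r.val)
        (Matrix.fromBlocks p.val 0 0 (Matrix.fromBlocks q.val 0 0 r.val)) := by
      convert isMvN_submatrix
        (isStarProjection_blocks p.isProj (isStarProjection_blocks q.isProj r.isProj))
        (Equiv.sumAssoc (Fin p.size) (Fin q.size) (Fin r.size)) using 1
      ext i j
      rcases i with (i | i) | i <;> rcases j with (j | j) | j <;> rfl
    exact (h1.trans (MatProj.isProj _)
      (isStarProjection_blocks p.isProj (isStarProjection_blocks q.isProj r.isProj)) h3).trans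
      (MatProj.isProj _) (MatProj.isProj _) h2.symm
  add_comm a b := by
    induction a, b using Quotient.inductionOn₂ with | _ p q
    refine Quotient.sound ?_
    refine MatProj.isMvN_sum_left (MatProj.isProj _) (MatProj.isMvN_sum_right
      (isStarProjection_blocks p.isProj q.isProj) ?_)
    convert isMvN_submatrix (isStarProjection_blocks q.isProj p.isProj)
      (Equiv.sumComm (Fin p.size) (Fin q.size)) using 1
    ext i j
    rcases i with i | i <;> rcases j with j | j <;> rfl
  zero_add a := by
    induction a using Quotient.inductionOn with | _ p
    refine Quotient.sound ?_
    refine MatProj.isMvN_sum_left p.isProj ?_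
    refine IsMvN.symm ?_
    convert isMvN_submatrix (isStarProjection_blocks (MatProj.one R 0).isProj p.isProj)
      (Equiv.emptySum (Fin 0) (Fin p.size)).symm using 1
    ext i j
    rfl
  add_zero a := by
    induction a using Quotient.inductionOn with | _ p
    refine Quotient.sound ?_
    refine MatProj.isMvN_sum_left p.isProj ?_
    refine IsMvN.symm ?_
    convert isMvN_submatrix (isStarProjection_blocks p.isProj (MatProj.one R 0).isProj)
      (Equiv.sumEmpty (Fin p.size) (Fin 0)).symm using 1
    ext i j
    rfl

variable (R) in
/-- The Grothendieck group of `V(R)`; this is `K₀(R)` if `R` is a unital C*-algebra. -/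
abbrev KUnital : Type _ := Algebra.GrothendieckAddGroup (VMon R)

/-- The class of a projection. -/
def KUnital.of (p : MatProj R) : KUnital R := Algebra.GrothendieckAddGroup.of (⟦p⟧ : VMon R)

section Functoriality

variable [Algebra ℂ R] {S : Type*} [Ring S] [StarRing S] [Algebra ℂ S]

open Matrix in
/-- The image of a projection under a unital *-homomorphism. -/
def MatProj.map (φ : R →⋆ₐ[ℂ] S) (p : MatProj R) : MatProj S where
  size := p.size
  val := p.val.map φ
  isProj := by
    have h1 : p.valᴴ = p.val := p.isProj.isSelfAdjoint
    have h2 : p.val * p.val = p.val := p.isProj.isIdempotentElem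
    refine ⟨?_, ?_⟩
    · change p.val.map φ * p.val.map φ = _
      rw [← Matrix.map_mul, h2]
    · change (p.val.map φ)ᴴ = _
      rw [← conjTranspose_map φ fun a => map_star φ a, h1]

/-- The map `V(R) → V(S)` induced by a unital *-homomorphism. -/
def VMon.map (φ : R →⋆ₐ[ℂ] S) : VMon R →+ VMon S where
  toFun := Quotient.map (MatProj.map φ) fun _ _ h => IsMvN.map φ h
  map_zero' := by
    refine Quotient.sound ⟨(0 : Matrix (Fin 0) (Fin 0) S), ?_, ?_⟩
    · ext i
      exact i.elim0
    · ext i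
      exact i.elim0
  map_add' a b := by
    induction a, b using Quotient.inductionOn₂ with | _ p q
    refine congrArg (Quotient.mk _) ?_
    have h : ((p.sum q).map φ).val = ((p.map φ).sum (q.map φ)).val := blocks_map φ _ _ _
    exact MatProj.ext' rfl (heq_of_eq h)

/-- The map on Grothendieck groups induced by a unital *-homomorphism. -/
def KUnital.map (φ : R →⋆ₐ[ℂ] S) : KUnital R →+ KUnital S :=
  Algebra.GrothendieckAddGroup.lift (Algebra.GrothendieckAddGroup.of.comp (VMon.map φ))

theorem KUnital.map_of (φ : R →⋆ₐ[ℂ] S) (p : MatProj R) :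
    KUnital.map φ (.of p) = .of (p.map φ) :=
  DFunLike.congr_fun (Algebra.GrothendieckAddGroup.lift.symm_apply_apply
    (Algebra.GrothendieckAddGroup.of.comp (VMon.map φ))) (⟦p⟧ : VMon R)

theorem KUnital.hom_ext {G : Type*} [AddCommGroup G] {f g : KUnital R →+ G}
    (h : ∀ p, f (.of p) = g (.of p)) : f = g := by
  refine Algebra.GrothendieckAddGroup.lift.symm.injective (AddMonoidHom.ext fun a => ?_)
  induction a using Quotient.inductionOn with | _ p
  exact h p

end Functoriality

end KTheory

section KZero

variable (A : Type*) [NonUnitalCStarAlgebra A]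

/-- The canonical character of the unitization of `A`. -/
def augmentation : Unitization ℂ A →⋆ₐ[ℂ] ℂ where
  __ := Unitization.fstHom ℂ A
  map_star' _ := rfl

/-- The group `K₀(A)`: the kernel of the map `K₀(A⁺) → K₀(ℂ)`, where `A⁺` is the unitization. -/
def K0 : Type _ := (KUnital.map (augmentation A)).ker

instance : AddCommGroup (K0 A) := inferInstanceAs (AddCommGroup (KUnital.map (augmentation A)).ker)

/-- The group `K₁(A) = K₀(C₀(ℝ, A))`. -/
abbrev K1 : Type _ := K0 C₀(ℝ, A)

variable {A} {B : Type*} [NonUnitalCStarAlgebra B]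

/-- The inclusion of `K₀(A)` in `K₀(A⁺)`. -/
def K0.incl : K0 A →+ KUnital (Unitization ℂ A) := (KUnital.map (augmentation A)).ker.subtype

theorem augmentation_starMap (φ : A →⋆ₙₐ[ℂ] B) (x : Unitization ℂ A) :
    augmentation B (Unitization.starMap φ x) = augmentation A x := by
  induction x using Unitization.ind with
  | _ r a =>
    rw [map_add, map_add, map_add, Unitization.starMap_inr, Unitization.starMap_inl]
    rfl

theorem map_augmentation_starMap (φ : A →⋆ₙₐ[ℂ] B) :
    (KUnital.map (augmentation B)).comp (KUnital.map (Unitization.starMap φ))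
      = KUnital.map (augmentation A) := by
  refine KUnital.hom_ext fun p => ?_
  rw [AddMonoidHom.comp_apply, KUnital.map_of, KUnital.map_of, KUnital.map_of]
  refine congrArg KUnital.of (MatProj.ext' rfl (heq_of_eq ?_))
  ext i j
  exact augmentation_starMap φ (p.val i j)

/-- The map on `K₀` induced by a *-homomorphism. -/
def K0.map (φ : A →⋆ₙₐ[ℂ] B) : K0 A →+ K0 B :=
  ((KUnital.map (Unitization.starMap φ)).comp K0.incl).codRestrict _ fun x => by
    exact (DFunLike.congr_fun (map_augmentation_starMap φ) (K0.incl x)).trans x.2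

/-- The map on `K₁` induced by a *-homomorphism. -/
def K1.map (φ : A →⋆ₙₐ[ℂ] B) : K1 A →+ K1 B := K0.map (suspHom φ)

end KZero

/-! ### Fredholm operators and the map on K-theory induced by a correspondence -/

section Fredholm

/-- A bundled Hilbert module over `A`. -/
structure HilbMod (A : Type u) [NonUnitalCStarAlgebra A] where
  carrier : Type w
  [normedAddCommGroup : NormedAddCommGroup carrier]
  [normedSpace : NormedSpace ℂ carrier]
  [completeSpace : CompleteSpace carrier]
  [hilbertModule : HilbertModule A carrier]

attribute [instance] HilbMod.normedAddCommGroup HilbMod.normedSpace HilbMod.completeSpace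
  HilbMod.hilbertModule

instance (A : Type u) [NonUnitalCStarAlgebra A] : CoeSort (HilbMod.{u, w} A) (Type w) :=
  ⟨HilbMod.carrier⟩

variable {A : Type u} [NonUnitalCStarAlgebra A]

/-- The inner product of a Hilbert module. -/
def HilbMod.ip (M : HilbMod.{u, w} A) (m m' : M) : A := HilbertModule.inner m m'

/-- `G` is the adjoint of `F`. -/
def IsAdjointPair {M N : HilbMod.{u, w} A} (F : M →L[ℂ] N) (G : N →L[ℂ] M) : Prop :=
  ∀ m n, N.ip (F m) n = M.ip m (G n)

/-- The compact operator `θ_{n, m} : M → N`, `x ↦ n · ⟨m, x⟩`. -/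
def theta {M N : HilbMod.{u, w} A} (n : N) (m : M) : M →L[ℂ] N :=
  HilbertModule.act (A := A) n ∘L HilbertModule.inner (A := A) (E := M) m

/-- The compact operators between Hilbert modules: the closed linear span of the `θ_{n, m}`. -/
def compactOps (M N : HilbMod.{u, w} A) : Submodule ℂ (M →L[ℂ] N) :=
  (Submodule.span ℂ {T | ∃ n m, T = theta n m}).topologicalClosure

/-- An operator between Hilbert modules is Fredholm if it is adjointable and invertible modulo
compact operators, with an adjointable inverse. -/
def IsFredholm {M N : HilbMod.{u, w} A} (F : M →L[ℂ] N) : Prop :=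
  ∃ (F' : N →L[ℂ] M) (G : N →L[ℂ] M) (G' : M →L[ℂ] N), IsAdjointPair F F' ∧ IsAdjointPair G G' ∧
    ContinuousLinearMap.id ℂ M - G ∘L F ∈ compactOps M M ∧
    ContinuousLinearMap.id ℂ N - F ∘L G ∈ compactOps N N

/-- The right action of the unitization of `A` on a Hilbert module over `A`. -/
def HilbMod.actU (M : HilbMod.{u, w} A) (m : M) (a : Unitization ℂ A) : M :=
  a.fst • m + HilbertModule.act m a.snd

/-- The right `A⁺`-module `M ⊕ (A⁺)ⁿ`, with its action of `A⁺`. -/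
def HilbMod.actSum (M : HilbMod.{u, w} A) {n : ℕ} (g : M × (Fin n → Unitization ℂ A))
    (a : Unitization ℂ A) : M × (Fin n → Unitization ℂ A) :=
  (M.actU g.1 a, fun j => g.2 j * a)

/-- `HasIndex F x` says that `F` is a Fredholm operator between Hilbert `A`-modules and that
`x ∈ K₀(A)` is its index. Concretely, choose `y : (A⁺)ⁿ → N` such that
`(F, y) : M ⊕ (A⁺)ⁿ → N` is surjective with finitely generated projective kernel over the
unitization `A⁺`; then `x = [ker (F, y)] - [(A⁺)ⁿ]`. The kernel is represented by a projection `P`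
over `A⁺` through an isomorphism `(A⁺)ᵏ / ker P ≅ ker (F, y)`, `d ↦ ∑ i, g i · d i`. -/
def HasIndex {M N : HilbMod.{u, w} A} (F : M →L[ℂ] N) (x : K0 A) : Prop :=
  IsFredholm F ∧ ∃ (n : ℕ) (y : Fin n → N) (P : MatProj (Unitization ℂ A))
    (g : Fin P.size → M × (Fin n → Unitization ℂ A)),
    (∀ z : N, ∃ c : M × (Fin n → Unitization ℂ A), F c.1 + ∑ j, N.actU (y j) (c.2 j) = z) ∧
    (∀ d : Fin P.size → Unitization ℂ A,
      ∑ i, M.actSum (g i) (d i) = 0 ↔ P.val.mulVec d = 0) ∧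
    (∀ c : M × (Fin n → Unitization ℂ A), F c.1 + ∑ j, N.actU (y j) (c.2 j) = 0 ↔
      ∃ d : Fin P.size → Unitization ℂ A, ∑ i, M.actSum (g i) (d i) = c) ∧
    K0.incl x = KUnital.of P - KUnital.of (MatProj.one (Unitization ℂ A) n)

variable {B : Type v} [NonUnitalCStarAlgebra B]

/-- `t` exhibits `M'` as the interior tensor product `M ⊗_A E`: the elementary tensors `t m e` have
the inner products `⟨t m e, t m' e'⟩ = ⟨e, ⟨m, m'⟩ e'⟩` and span a dense subspace. -/
def IsInteriorTensor (E : HilbMod.{v, w} B) [Correspondence A B E] (M : HilbMod.{u, w} A)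
    (M' : HilbMod.{v, w} B) (t : M → E → M') : Prop :=
  (∀ m e m' e', M'.ip (t m e) (t m' e') = E.ip e (Correspondence.left (A := A) B (M.ip m m') e')) ∧
  Dense (Submodule.span ℂ {z : M' | ∃ m e, z = t m e} : Set M')

/-- The relation between `x ∈ K₀(A)` and `y ∈ K₀(B)` that defines the homomorphism
`E_* : K₀(A) → K₀(B)` of an `A`-`B`-correspondence `E` (acting by compact operators): `x` is the index
of a Fredholm operator `F : M → N` of Hilbert `A`-modules, and `y` is the index of
`F ⊗ 1 : M ⊗_A E → N ⊗_A E`. -/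
def ExelRel (E : HilbMod.{v, w} B) [Correspondence A B E] (x : K0 A) (y : K0 B) : Prop :=
  ∃ (M N : HilbMod.{u, w} A) (F : M →L[ℂ] N) (M' N' : HilbMod.{v, w} B)
    (t : M → E → M') (t' : N → E → N') (F' : M' →L[ℂ] N'),
    IsInteriorTensor E M M' t ∧ IsInteriorTensor E N N' t' ∧ (∀ m e, F' (t m e) = t' (F m) e) ∧
    HasIndex F x ∧ HasIndex F' y

variable (A B) in
/-- `f : K₀(A) → K₀(B)` is the map `E_*` induced by the correspondence `E`. -/
def IsExelMap (E : Type w) [NormedAddCommGroup E] [NormedSpace ℂ E] [CompleteSpace E]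
    [HilbertModule B E] [inst : Correspondence A B E] (f : K0 A → K0 B) : Prop :=
  ∀ x y, @ExelRel A _ B _ ⟨E⟩ inst x y ↔ f x = y

variable (A B) in
/-- `f : K₁(A) → K₁(B)` is the map `E_*` induced by the correspondence `E`, that is, the map on
`K₀` induced by its suspension. -/
def IsExelMap₁ (E : Type w) [NormedAddCommGroup E] [NormedSpace ℂ E] [CompleteSpace E]
    [HilbertModule B E] [Correspondence A B E] (f : K1 A → K1 B) : Prop :=
  IsExelMap C₀(ℝ, A) C₀(ℝ, B) C₀(ℝ, E) f

end Fredholm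

end UniformRoe

end

open UniformRoe

/-!
Write `B = C*_u(X)` and `A = UC*(X)`, in either norm. Unit vectors `η x` give an isometry
`V : ℓ²(X) → ℓ²(X, H₀)`, and `i_P (T) = V T V*` identifies `B` with the corner `p A p`, where
`p = V V*` is a multiplier of `A`. The map `ξ ↦ ξ V*` embeds `E` in `A` as `A p`
(`bimoduleRealization`): the inner product becomes `star x * y` and the left action becomes
multiplication.

*The map induced by `i_P` undoes `E_*`.* For a Hilbert `A`-module `M`, the tensor product `M ⊗ E` is
the closed subspace `M · E` of `M`, a module over `B = p A p` (`exists_descent`). As the corner is full,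
compact operators are limits of operators of finite rank with vectors in `M · E` (`compactOps_le`), so
that a Fredholm operator `F` has a parametrix, modulo such operators of finite rank, that restricts to a
parametrix of `F ⊗ 1`. An index is computed from a parametrix by an explicit idempotent matrix
(`represents_ker`), and the matrix of `F ⊗ 1` has the matrix of `F` as its image in `A`. Hence
`i_P` sends the index of `F ⊗ 1` to the index of `F` (`exists_hasIndex_map`, `ExelRel.map_eq`). The index
itself is well defined by Schanuel's lemma (`exists_schanuel_equiv`, `HasIndex.unique`).

*The map induced by `i_P` is surjective.* Every class in `K₀(A)` is the index of an operator between
modules `P A^J` (`K0.exists_hasIndex`), and the tensor products exist (`exists_isInteriorTensor`), so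
that every class is related to some class of `K₀(B)` (`exists_exelRel`).

*The map induced by `i_P` is injective.* For every `x`, complete `η x` to an orthonormal system with
`n + 1` elements. The resulting isometries `V_k` embed the matrix algebra over `B` of size `n + 1` in
`A`, and the given corner becomes the corner of the matrices. Finitely many elements of `Uℂ[X]` are
almost contained in such a subalgebra: up to a small uniform error, the columns of an operator take
their values in subspaces of `H₀` of bounded dimension, because balls have boundedly many points and the
entries are uniformly close to entries of bounded rank (`exists_subspaces`). An operator of controlled
propagation with small entries has small norm in either completion, because a colouring of `X`
reduces it to boundedly many operators that are diagonal up to a partial bijection of `X`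
(`exists_toFun_le`). A partial isometry over `A` that kills a class of `K₀(B)` can therefore be replaced
by one over a matrix algebra over `B`, and K-theory is stable (`HasCornerFrames.map_injective`).

*Suspension.* The realization and the embeddings of matrix algebras are applied pointwise. A function
vanishing at infinity has a relatively compact image, which again is almost contained in a matrix
algebra over `B` (`HasCompactCornerFrames.susp`).

The relation between classes that defines `E_*` does not mention the vectors `η x`, so all choices of
these vectors give the same inverse (`exists_isExelMap`).
-/

open Matrix MulOpposite

noncomputable section

namespace UniformRoe

/-! ### Projections and idempotents in C*-algebras -/

section CStarProjections

variable {S : Type*} [CStarAlgebra S]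

theorem isUnit_one_add_mul_star_self (a : S) : IsUnit (1 + a * star a) := by
  let := CStarAlgebra.spectralOrder S
  let := CStarAlgebra.spectralOrderedRing S
  have h : IsStrictlyPositive (1 + a * star a) :=
    IsStrictlyPositive.add_nonneg isStrictlyPositive_one (mul_star_self_nonneg a)
  exact h.isUnit

/-- Kaplansky's formula: the range projection of an idempotent `e` of a C*-algebra is
`e e* (1 + (e - e*)(e* - e))⁻¹`. -/
theorem exists_rangeProjection {e : S} (he : e * e = e) :
    ∃ p : S, IsStarProjection p ∧ e * p = p ∧ p * e = e := by
  have hes : star e * star e = star e := by rw [← star_mul, he]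
  have hz : IsUnit (1 + (e - star e) * star (e - star e)) := isUnit_one_add_mul_star_self _
  set z : S := 1 + (e - star e) * star (e - star e) with hzdef
  have hz' : z = 1 + e * star e - e - star e + star e * e := by
    rw [hzdef, star_sub, star_star, sub_mul, mul_sub, mul_sub, he, hes]
    abel
  have hez : e * z = e * star e * e := by
    rw [hz', mul_add, mul_sub, mul_sub, mul_add, mul_one, he, ← mul_assoc, ← mul_assoc, he]
    abel
  have hze : z * e = e * star e * e := by
    rw [hz', add_mul, sub_mul, sub_mul, add_mul, one_mul, he, mul_assoc (star e), he]
    abel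
  have hzs : star z = z := by
    rw [hzdef, star_add, star_one, star_mul, star_star]
  obtain ⟨c, hc⟩ := hz
  have hzc : z * (↑c⁻¹ : S) = 1 := by rw [← hc]; simp
  have hcz : (↑c⁻¹ : S) * z = 1 := by rw [← hc]; simp
  set i : S := ↑c⁻¹ with hi
  have his : star i = i := by
    have h1 : star i * z = 1 := by rw [← hzs, ← star_mul, hzc, star_one]
    calc star i = star i * (z * i) := by rw [hzc, mul_one]
      _ = i := by rw [← mul_assoc, h1, one_mul]
  have hie : i * e = e * i := by
    calc i * e = i * (e * z) * i := by rw [mul_assoc, mul_assoc e, hzc, mul_one]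
      _ = i * z * e * i := by rw [hez, ← hze, ← mul_assoc]
      _ = e * i := by rw [hcz, one_mul]
  have hise : i * star e = star e * i := by
    have := congrArg star hie
    rw [star_mul, star_mul, his] at this
    exact this.symm
  have hpe : e * star e * i * e = e := by
    calc e * star e * i * e = e * star e * e * i := by rw [mul_assoc _ i, hie, ← mul_assoc]
      _ = e * (z * i) := by rw [← hez, mul_assoc]
      _ = e := by rw [hzc, mul_one]
  have hep : e * (e * star e * i) = e * star e * i := by rw [← mul_assoc, ← mul_assoc, he]
  refine ⟨e * star e * i, ⟨?_, ?_⟩, hep, hpe⟩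
  · calc e * star e * i * (e * star e * i) = e * star e * i * e * (star e * i) := by
          simp only [mul_assoc]
      _ = e * star e * i := by rw [hpe, mul_assoc]
  · change star (e * star e * i) = _
    rw [star_mul, star_mul, star_star, his, ← mul_assoc, hie, mul_assoc e i, hise, mul_assoc]

/-- Algebraically equivalent projections of a C*-algebra are Murray-von Neumann equivalent: with
`x = q u p` and `y = p v q` mutually inverse, the polar part of `x` is `x (y y* + 1 - p) ^ (1/2)`. -/
theorem exists_partialIsometry {p q u v : S} (hp : IsStarProjection p) (hq : IsStarProjection q)
    (hvu : v * u = p) (huv : u * v = q) : ∃ w, star w * w = p ∧ w * star w = q := by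
  let := CStarAlgebra.spectralOrder S
  let := CStarAlgebra.spectralOrderedRing S
  have hpp : p * p = p := hp.isIdempotentElem
  have hqq : q * q = q := hq.isIdempotentElem
  have hps : star p = p := hp.isSelfAdjoint
  have hqs : star q = q := hq.isSelfAdjoint
  set x := q * u with hx
  set y := v * q with hy
  have hup : u * p = q * u := by rw [← hvu, ← mul_assoc, huv]
  have hpv : p * v = v * q := by rw [← hvu, mul_assoc, huv]
  have hxp : x * p = x := by rw [hx, mul_assoc, hup, ← mul_assoc, hqq]
  have hpy : p * y = y := by rw [hy, ← mul_assoc, hpv, mul_assoc, hqq]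
  have hyx : y * x = p := by
    rw [hy, hx, mul_assoc, ← mul_assoc q, hqq, ← hup, ← mul_assoc, hvu, hpp]
  have hxy : x * y = q := by
    rw [hy, hx, mul_assoc, ← mul_assoc u, huv, hqq, hqq]
  have hpx : p * star x = star x := by rw [← hps, ← star_mul, hxp]
  have hyp : star y * p = star y := by rw [← hps, ← star_mul, hpy]
  set k := y * star y + (1 - p) with hk
  have hk0 : 0 ≤ k := add_nonneg (mul_star_self_nonneg y) (by
    have h : star (1 - p) * (1 - p) = 1 - p := by
      rw [star_sub, star_one, hps, sub_mul, mul_sub, mul_sub, hpp]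
      simp
    rw [← h]
    exact star_mul_self_nonneg _)
  have hkp : k * p = p * k := by
    rw [hk, add_mul, mul_add, mul_assoc, hyp, ← mul_assoc, hpy, sub_mul, mul_sub, hpp]
    simp
  set s := CFC.sqrt k with hs
  have hss : s * s = k := CFC.sqrt_mul_sqrt_self k hk0
  have hsa : star s = s := (IsSelfAdjoint.of_nonneg (CFC.sqrt_nonneg k)).star_eq
  have hsp : s * p = p * s := Commute.cfcₙ_nnreal (show Commute k p from hkp) _
  have hxk : x * k = star y := by
    rw [hk, mul_add, ← mul_assoc, hxy, mul_sub, mul_one, hxp, sub_self, add_zero, ← hqs,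
      ← star_mul, hy, mul_assoc, hqq]
  have hxxk : star x * x * k = p := by
    rw [mul_assoc, hxk, ← star_mul, hyx, hps]
  refine ⟨x * s, ?_, ?_⟩
  · have hkh : k * (star x * x + (1 - p)) = 1 := by
      have h1 : k * (star x * x) = p := by
        have := congrArg star hxxk
        rwa [star_mul, star_mul, star_star, hps, (IsSelfAdjoint.of_nonneg hk0).star_eq] at this
      have h2 : k * (1 - p) = 1 - p := by
        have h4 : star y * (1 - p) = 0 := by rw [mul_sub, mul_one, hyp, sub_self]
        have h5 : (1 - p) * (1 - p) = 1 - p := by simp [mul_sub, sub_mul, hpp]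
        rw [hk, add_mul, mul_assoc, h4, mul_zero, zero_add, h5]
      rw [mul_add, h1, h2]
      abel
    have h3 : star (x * s) * (x * s) * s = p * s := by
      rw [star_mul, hsa, ← hsp]
      calc s * star x * (x * s) * s = s * (star x * x * (s * s)) := by simp only [mul_assoc]
        _ = s * p := by rw [hss, hxxk]
    calc star (x * s) * (x * s) = star (x * s) * (x * s) * (s * s * (star x * x + (1 - p))) := by
          rw [hss, hkh, mul_one]
      _ = star (x * s) * (x * s) * s * (s * (star x * x + (1 - p))) := by simp only [mul_assoc]
      _ = p * (s * s * (star x * x + (1 - p))) := by rw [h3]; simp only [mul_assoc]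
      _ = p := by rw [hss, hkh, mul_one]
  · rw [star_mul, hsa]
    calc x * s * (s * star x) = x * (s * s) * star x := by simp only [mul_assoc]
      _ = star (x * y) := by rw [hss, hxk, star_mul x y]
      _ = q := by rw [hxy, hqs]

end CStarProjections

section MatrixProjections

variable {R : Type*} [CStarAlgebra R] {ι κ : Type*} [Fintype ι] [Fintype κ] [DecidableEq ι]
  [DecidableEq κ]

theorem exists_matrix_rangeProjection {e : Matrix ι ι R} (he : e * e = e) :
    ∃ p : Matrix ι ι R, IsStarProjection p ∧ e * p = p ∧ p * e = e := by
  let := CStarAlgebra.spectralOrder R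
  let := CStarAlgebra.spectralOrderedRing R
  exact exists_rangeProjection (S := CStarMatrix ι ι R) he

theorem exists_matrix_partialIsometry {p q u v : Matrix ι ι R} (hp : IsStarProjection p)
    (hq : IsStarProjection q) (hvu : v * u = p) (huv : u * v = q) :
    ∃ w : Matrix ι ι R, wᴴ * w = p ∧ w * wᴴ = q := by
  let := CStarAlgebra.spectralOrder R
  let := CStarAlgebra.spectralOrderedRing R
  exact exists_partialIsometry (S := CStarMatrix ι ι R) hp hq hvu huv

/-- Over a C*-algebra, algebraic equivalence of matrix projections implies Murray-von Neumann
equivalence. -/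
theorem isMvN_of_algEquiv {p : Matrix ι ι R} {q : Matrix κ κ R} (hp : IsStarProjection p)
    (hq : IsStarProjection q) {u : Matrix κ ι R} {v : Matrix ι κ R} (hvu : v * u = p)
    (huv : u * v = q) : IsMvN p q := by
  have hpp : p * p = p := hp.isIdempotentElem
  have hqq : q * q = q := hq.isIdempotentElem
  have hps : pᴴ = p := hp.isSelfAdjoint
  have hqs : qᴴ = q := hq.isSelfAdjoint
  have h0 : IsStarProjection (0 : Matrix ι ι R) := ⟨mul_zero _, star_zero _⟩
  have h0' : IsStarProjection (0 : Matrix κ κ R) := ⟨mul_zero _, star_zero _⟩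
  -- Both projections become corners of one algebra of matrices over `ι ⊕ κ`.
  obtain ⟨w, h1, h2⟩ := exists_matrix_partialIsometry
    (isStarProjection_blocks hp h0') (isStarProjection_blocks h0 hq)
    (u := fromBlocks 0 0 u 0) (v := fromBlocks 0 v 0 0)
    (by rw [fromBlocks_multiply]; simp [hvu]) (by rw [fromBlocks_multiply]; simp [huv])
  obtain ⟨a, b, c, d, rfl⟩ : ∃ a b c d, w = fromBlocks a b c d :=
    ⟨_, _, _, _, (fromBlocks_toBlocks w).symm⟩
  set P0 : Matrix (ι ⊕ κ) (ι ⊕ κ) R := fromBlocks p 0 0 0 with hP0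
  set Q0 : Matrix (ι ⊕ κ) (ι ⊕ κ) R := fromBlocks 0 0 0 q with hQ0
  have hPP : P0 * P0 = P0 := (isStarProjection_blocks hp h0').isIdempotentElem
  have hQQ : Q0 * Q0 = Q0 := (isStarProjection_blocks h0 hq).isIdempotentElem
  have hPs : P0ᴴ = P0 := (isStarProjection_blocks hp h0').isSelfAdjoint
  have hQs : Q0ᴴ = Q0 := (isStarProjection_blocks h0 hq).isSelfAdjoint
  set w := fromBlocks a b c d with hw
  have hcut : Q0 * w * P0 = fromBlocks 0 0 (q * c * p) 0 := by
    rw [hP0, hQ0, hw, fromBlocks_multiply, fromBlocks_multiply]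
    simp
  have e1 : (Q0 * w * P0)ᴴ * (Q0 * w * P0) = P0 := by
    calc (Q0 * w * P0)ᴴ * (Q0 * w * P0) = P0 * (wᴴ * (Q0 * Q0) * w) * P0 := by
          rw [conjTranspose_mul, conjTranspose_mul, hPs, hQs]; simp only [Matrix.mul_assoc]
      _ = P0 * ((wᴴ * w) * (wᴴ * w)) * P0 := by rw [hQQ, ← h2]; simp only [Matrix.mul_assoc]
      _ = P0 := by rw [h1, hPP, hPP, hPP]
  have e2 : (Q0 * w * P0) * (Q0 * w * P0)ᴴ = Q0 := by
    calc (Q0 * w * P0) * (Q0 * w * P0)ᴴ = Q0 * (w * (P0 * P0) * wᴴ) * Q0 := by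
          rw [conjTranspose_mul, conjTranspose_mul, hPs, hQs]; simp only [Matrix.mul_assoc]
      _ = Q0 * ((w * wᴴ) * (w * wᴴ)) * Q0 := by rw [hPP, ← h1]; simp only [Matrix.mul_assoc]
      _ = Q0 := by rw [h2, hQQ, hQQ, hQQ]
  rw [hcut, fromBlocks_conjTranspose, fromBlocks_multiply, fromBlocks_inj] at e1 e2
  exact ⟨q * c * p, by simpa using e1.1, by simpa using e2.2.2.2⟩

end MatrixProjections

/-! ### Classes of idempotents in K-theory -/

section Classes

variable {R : Type*} [Ring R] [StarRing R] {ι κ : Type*} [Fintype ι] [Fintype κ]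

/-- The class of a projection matrix with an arbitrary finite index set. -/
def projClass (p : Matrix ι ι R) (hp : IsStarProjection p) : KUnital R :=
  KUnital.of ⟨Fintype.card ι, p.submatrix (Fintype.equivFin ι).symm (Fintype.equivFin ι).symm,
    isStarProjection_submatrix hp _⟩

theorem projClass_eq_of {p : Matrix ι ι R} (hp : IsStarProjection p) (q : MatProj R)
    (h : IsMvN p q.val) : projClass p hp = KUnital.of q := by
  have : (⟦⟨Fintype.card ι, p.submatrix (Fintype.equivFin ι).symm (Fintype.equivFin ι).symm,
      isStarProjection_submatrix hp _⟩⟧ : VMon R) = ⟦q⟧ :=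
    Quotient.sound ((isMvN_submatrix hp _).trans (isStarProjection_submatrix hp _) q.isProj h)
  exact congrArg Algebra.GrothendieckAddGroup.of this

theorem projClass_eq {p : Matrix ι ι R} {q : Matrix κ κ R} (hp : IsStarProjection p)
    (hq : IsStarProjection q) (h : IsMvN p q) : projClass p hp = projClass q hq :=
  projClass_eq_of hp _
    (h.trans hp (isStarProjection_submatrix hq _) (isMvN_submatrix hq _).symm)

theorem of_eq_projClass (p : MatProj R) : KUnital.of p = projClass p.val p.isProj :=
  (projClass_eq_of _ _ (.refl p.isProj)).symm

/-- The Murray-von Neumann equivalence class of a projection. -/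
def MatProj.vclass (p : MatProj R) : VMon R := Quotient.mk _ p

theorem of_sum (p q : MatProj R) : KUnital.of (p.sum q) = KUnital.of p + KUnital.of q :=
  map_add Algebra.GrothendieckAddGroup.of (p.vclass) q.vclass

theorem projClass_blocks {p : Matrix ι ι R} {q : Matrix κ κ R} (hp : IsStarProjection p)
    (hq : IsStarProjection q) :
    projClass (fromBlocks p 0 0 q) (isStarProjection_blocks hp hq)
      = projClass p hp + projClass q hq := by
  unfold projClass
  rw [← of_sum]
  refine projClass_eq_of (isStarProjection_blocks hp hq) (MatProj.sum _ _) ?_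
  refine MatProj.isMvN_sum_right (isStarProjection_blocks hp hq) ?_
  exact IsMvN.blocks (isMvN_submatrix hp _).symm (isMvN_submatrix hq _).symm

theorem isStarProjection_one_matrix [DecidableEq ι] : IsStarProjection (1 : Matrix ι ι R) :=
  ⟨mul_one _, star_one _⟩

theorem isMvN_blocks_compl [DecidableEq ι] {r : Matrix ι ι R} (hr : IsStarProjection r) :
    IsMvN (fromBlocks r 0 0 (1 - r)) (1 : Matrix ι ι R) := by
  have hrr : r * r = r := hr.isIdempotentElem
  have hrs : rᴴ = r := hr.isSelfAdjoint
  refine ⟨fromCols r (1 - r), ?_, ?_⟩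
  · rw [conjTranspose_fromCols_eq_fromRows_conjTranspose, fromRows_mul_fromCols]
    simp [hrs, hrr, Matrix.mul_sub, Matrix.sub_mul]
  · rw [conjTranspose_fromCols_eq_fromRows_conjTranspose, fromCols_mul_fromRows]
    simp [hrs, hrr, Matrix.mul_sub, Matrix.sub_mul]

/-- Projections with the same class become equivalent after adding an identity matrix. -/
theorem exists_isMvN_of_of_eq {p q : MatProj R} (h : KUnital.of p = KUnital.of q) :
    ∃ m : ℕ, IsMvN (fromBlocks p.val 0 0 (1 : Matrix (Fin m) (Fin m) R))
      (fromBlocks q.val 0 0 (1 : Matrix (Fin m) (Fin m) R)) := by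
  obtain ⟨c, hc⟩ : ∃ c : VMon R, c + p.vclass = c + q.vclass := by
    obtain ⟨c, hc⟩ :=
      ((AddLocalization.addMonoidOf (⊤ : AddSubmonoid (VMon R))).eq_iff_exists).mp h
    exact ⟨c.1, hc⟩
  obtain ⟨r, rfl⟩ : ∃ r : MatProj R, r.vclass = c := Quotient.exists_rep c
  -- Adding the complement of `r` to `r` gives an identity matrix.
  let r' : MatProj R := ⟨r.size, 1 - r.val, r.isProj.one_sub⟩
  have h1 : r.vclass + r'.vclass = (MatProj.one R r.size).vclass :=
    Quotient.sound (MatProj.isMvN_sum_left (q := r') isStarProjection_one_matrix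
      (isMvN_blocks_compl r.isProj))
  have h2 : p.vclass + (MatProj.one R r.size).vclass = q.vclass + (MatProj.one R r.size).vclass := by
    have hc' : r.vclass + p.vclass = r.vclass + q.vclass := hc
    rw [← h1, ← add_assoc, ← add_assoc, add_comm _ r.vclass, hc', add_comm r.vclass]
  have h3 : IsMvN (p.sum (MatProj.one R r.size)).val (q.sum (MatProj.one R r.size)).val :=
    Quotient.exact h2
  refine ⟨r.size, ?_⟩
  have hp := isStarProjection_blocks p.isProj (isStarProjection_one_matrix (R := R) (ι := Fin r.size))
  have hq := isStarProjection_blocks q.isProj (isStarProjection_one_matrix (R := R) (ι := Fin r.size))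
  exact ((MatProj.isMvN_sum p (MatProj.one R r.size)).symm.trans hp (MatProj.isProj _) h3).trans hp
    hq (MatProj.isMvN_sum q (MatProj.one R r.size))

theorem projClass_map [Algebra ℂ R] {S : Type*} [Ring S] [StarRing S] [Algebra ℂ S]
    (φ : R →⋆ₐ[ℂ] S) {p : Matrix ι ι R} (hp : IsStarProjection p)
    (hp' : IsStarProjection (p.map φ)) :
    KUnital.map φ (projClass p hp) = projClass (p.map φ) hp' := by
  rw [projClass, KUnital.map_of]
  rfl

end Classes

section AlgEq

variable {R : Type*} [Ring R] {ι κ μ ι' κ' : Type*} [Fintype ι] [Fintype κ] [Fintype μ]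
  [Fintype ι'] [Fintype κ']

/-- Algebraic equivalence of idempotent matrices. -/
def AlgEq (e : Matrix ι ι R) (f : Matrix κ κ R) : Prop :=
  ∃ (u : Matrix κ ι R) (v : Matrix ι κ R), v * u = e ∧ u * v = f

theorem AlgEq.symm {e : Matrix ι ι R} {f : Matrix κ κ R} (h : AlgEq e f) : AlgEq f e := by
  obtain ⟨u, v, h1, h2⟩ := h
  exact ⟨v, u, h2, h1⟩

theorem AlgEq.trans {e : Matrix ι ι R} {f : Matrix κ κ R} {g : Matrix μ μ R}
    (he : IsIdempotentElem e) (hg : IsIdempotentElem g) (h : AlgEq e f) (h' : AlgEq f g) :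
    AlgEq e g := by
  obtain ⟨u, v, h1, h2⟩ := h
  obtain ⟨x, y, h3, h4⟩ := h'
  refine ⟨x * u, v * y, ?_, ?_⟩
  · calc v * y * (x * u) = v * (y * x) * u := by simp only [Matrix.mul_assoc]
      _ = (v * u) * (v * u) := by rw [h3, ← h2]; simp only [Matrix.mul_assoc]
      _ = e := by rw [h1, he]
  · calc x * u * (v * y) = x * (u * v) * y := by simp only [Matrix.mul_assoc]
      _ = (x * y) * (x * y) := by rw [h2, ← h3]; simp only [Matrix.mul_assoc]
      _ = g := by rw [h4, hg]

theorem AlgEq.blocks {e : Matrix ι ι R} {f : Matrix κ κ R} {e' : Matrix ι' ι' R}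
    {f' : Matrix κ' κ' R} (h : AlgEq e e') (h' : AlgEq f f') :
    AlgEq (fromBlocks e 0 0 f) (fromBlocks e' 0 0 f') := by
  obtain ⟨u, v, h1, h2⟩ := h
  obtain ⟨x, y, h3, h4⟩ := h'
  refine ⟨fromBlocks u 0 0 x, fromBlocks v 0 0 y, ?_, ?_⟩
  · rw [fromBlocks_multiply]
    simp [h1, h3]
  · rw [fromBlocks_multiply]
    simp [h2, h4]

theorem AlgEq.map {S : Type*} [Ring S] (φ : R →+* S) {e : Matrix ι ι R} {f : Matrix κ κ R}
    (h : AlgEq e f) : AlgEq (e.map φ) (f.map φ) := by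
  obtain ⟨u, v, h1, h2⟩ := h
  exact ⟨u.map φ, v.map φ, by rw [← Matrix.map_mul, h1], by rw [← Matrix.map_mul, h2]⟩

theorem IsMvN.algEq [StarRing R] {p : Matrix ι ι R} {q : Matrix κ κ R} (h : IsMvN p q) :
    AlgEq p q := by
  obtain ⟨v, h1, h2⟩ := h
  exact ⟨v, vᴴ, h1, h2⟩

theorem isIdempotentElem_blocks {e : Matrix ι ι R} {f : Matrix κ κ R} (he : IsIdempotentElem e)
    (hf : IsIdempotentElem f) : IsIdempotentElem (fromBlocks e 0 0 f) := by
  change fromBlocks e 0 0 f * fromBlocks e 0 0 f = _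
  rw [fromBlocks_multiply]
  simp [he.eq, hf.eq]

theorem isIdempotentElem_map {S : Type*} [Ring S] (φ : R →+* S) {e : Matrix ι ι R}
    (he : IsIdempotentElem e) : IsIdempotentElem (e.map φ) := by
  change e.map φ * e.map φ = _
  rw [← Matrix.map_mul, he.eq]

end AlgEq

section IdemClass

variable {R : Type*} [CStarAlgebra R] {ι κ : Type*} [Fintype ι] [Fintype κ]

theorem exists_algEq_isStarProjection {e : Matrix ι ι R} (he : IsIdempotentElem e) :
    ∃ p : Matrix ι ι R, IsStarProjection p ∧ AlgEq e p := by
  classical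
  obtain ⟨p, hp, h1, h2⟩ := exists_matrix_rangeProjection he.eq
  exact ⟨p, hp, e, p, h2, h1⟩

/-- The class in K-theory of an idempotent matrix over a C*-algebra: that of any projection
equivalent to it, such as its range projection. -/
def idemClass (e : Matrix ι ι R) (he : IsIdempotentElem e) : KUnital R :=
  projClass _ (exists_algEq_isStarProjection he).choose_spec.1

theorem idemClass_eq_projClass {e : Matrix ι ι R} (he : IsIdempotentElem e) {p : Matrix κ κ R}
    (hp : IsStarProjection p) (h : AlgEq e p) : idemClass e he = projClass p hp := by
  classical
  have h' := (exists_algEq_isStarProjection he).choose_spec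
  obtain ⟨u, v, h1, h2⟩ := h'.2.symm.trans h'.1.isIdempotentElem hp.isIdempotentElem h
  exact projClass_eq _ _ (isMvN_of_algEquiv h'.1 hp h1 h2)

theorem idemClass_eq {e : Matrix ι ι R} {f : Matrix κ κ R} (he : IsIdempotentElem e)
    (hf : IsIdempotentElem f) (h : AlgEq e f) : idemClass e he = idemClass f hf := by
  have h' := (exists_algEq_isStarProjection hf).choose_spec
  exact idemClass_eq_projClass he h'.1 (h.trans he h'.1.isIdempotentElem h'.2)

theorem projClass_eq_idemClass {p : Matrix ι ι R} (hp : IsStarProjection p) :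
    projClass p hp = idemClass p hp.isIdempotentElem :=
  (idemClass_eq_projClass _ hp ((IsMvN.refl hp).algEq)).symm

theorem of_eq_idemClass (p : MatProj R) :
    KUnital.of p = idemClass p.val p.isProj.isIdempotentElem := by
  rw [of_eq_projClass, projClass_eq_idemClass]

theorem idemClass_blocks {e : Matrix ι ι R} {f : Matrix κ κ R} (he : IsIdempotentElem e)
    (hf : IsIdempotentElem f) :
    idemClass (fromBlocks e 0 0 f) (isIdempotentElem_blocks he hf)
      = idemClass e he + idemClass f hf := by
  obtain ⟨p, hp, h1⟩ := exists_algEq_isStarProjection he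
  obtain ⟨q, hq, h2⟩ := exists_algEq_isStarProjection hf
  rw [idemClass_eq_projClass he hp h1, idemClass_eq_projClass hf hq h2, ← projClass_blocks hp hq]
  exact idemClass_eq_projClass _ _ (h1.blocks h2)

theorem idemClass_map {S : Type*} [CStarAlgebra S] (φ : R →⋆ₐ[ℂ] S) {e : Matrix ι ι R}
    (he : IsIdempotentElem e) (he' : IsIdempotentElem (e.map φ)) :
    KUnital.map φ (idemClass e he) = idemClass (e.map φ) he' := by
  obtain ⟨p, hp, h1⟩ := exists_algEq_isStarProjection he
  have hp' : IsStarProjection (p.map φ) := by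
    refine ⟨isIdempotentElem_map (φ : R →+* S) hp.isIdempotentElem, ?_⟩
    change (p.map φ)ᴴ = _
    rw [← conjTranspose_map φ fun a => map_star φ a]
    exact congrArg (fun q => q.map φ) hp.isSelfAdjoint
  rw [idemClass_eq_projClass he hp h1, projClass_map φ hp hp']
  exact (idemClass_eq_projClass he' hp' (h1.map (φ : R →+* S))).symm

theorem isIdempotentElem_one_matrix [DecidableEq ι] : IsIdempotentElem (1 : Matrix ι ι R) :=
  mul_one _

theorem of_one (n : ℕ) : KUnital.of (MatProj.one R n)
    = idemClass (1 : Matrix (Fin n) (Fin n) R) isIdempotentElem_one_matrix :=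
  of_eq_idemClass _

end IdemClass

/-! ### Finitely generated projective right modules -/

section RightModules

variable {R : Type*} [Ring R] {ι κ μ : Type*} [Fintype ι] [Fintype κ] [Fintype μ]

set_option linter.unusedSectionVars false

/-- Multiplication of column vectors by a matrix, linear for the right module structure. -/
def mulVecR (e : Matrix κ ι R) : (ι → R) →ₗ[Rᵐᵒᵖ] (κ → R) where
  toFun := e.mulVec
  map_add' := e.mulVec_add
  map_smul' a x := by
    ext i
    simp [Matrix.mulVec, dotProduct, Finset.sum_mul, mul_assoc]

theorem mulVecR_apply (e : Matrix κ ι R) (x : ι → R) : mulVecR e x = e.mulVec x := rfl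

theorem mulVecR_mul (e : Matrix κ ι R) (f : Matrix ι μ R) :
    mulVecR (e * f) = mulVecR e ∘ₗ mulVecR f := by
  ext x
  simp [mulVecR_apply, Matrix.mulVec_mulVec]

/-- The matrix of a right linear map. -/
def toMat [DecidableEq ι] (f : (ι → R) →ₗ[Rᵐᵒᵖ] (κ → R)) : Matrix κ ι R :=
  fun k i => f (Pi.single i 1) k

theorem mulVecR_toMat [DecidableEq ι] (f : (ι → R) →ₗ[Rᵐᵒᵖ] (κ → R)) : mulVecR (toMat f) = f := by
  refine LinearMap.ext fun x => ?_
  have hx : x = ∑ i, op (x i) • (Pi.single i 1 : ι → R) := by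
    ext j
    simp [Pi.single_apply, Finset.sum_apply]
  rw [mulVecR_apply]
  conv_rhs => rw [hx, map_sum]
  ext k
  simp [Matrix.mulVec, dotProduct, toMat, Finset.sum_apply]

theorem mulVecR_injective [DecidableEq ι] {e f : Matrix κ ι R} (h : mulVecR e = mulVecR f) :
    e = f := by
  ext k i
  have := congrFun (LinearMap.congr_fun h (Pi.single i 1)) k
  simpa [mulVecR_apply] using this

variable {M N : Type*} [AddCommGroup M] [Module Rᵐᵒᵖ M] [AddCommGroup N] [Module Rᵐᵒᵖ N]

/-- The right module `M` is isomorphic to the range of the idempotent matrix `e`; the isomorphism is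
given by the embedding of `M` in a free module and a retraction. -/
def Represents (M : Type*) [AddCommGroup M] [Module Rᵐᵒᵖ M] (e : Matrix ι ι R) : Prop :=
  ∃ (i : M →ₗ[Rᵐᵒᵖ] (ι → R)) (p : (ι → R) →ₗ[Rᵐᵒᵖ] M),
    p ∘ₗ i = LinearMap.id ∧ i ∘ₗ p = mulVecR e

theorem Represents.isIdempotentElem {e : Matrix ι ι R} (h : Represents M e) :
    IsIdempotentElem e := by
  classical
  obtain ⟨i, p, h1, h2⟩ := h
  refine mulVecR_injective ?_
  rw [mulVecR_mul, ← h2]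
  calc i ∘ₗ p ∘ₗ i ∘ₗ p = i ∘ₗ (p ∘ₗ i) ∘ₗ p := rfl
    _ = i ∘ₗ p := by rw [h1, LinearMap.id_comp]

theorem Represents.algEq {e : Matrix ι ι R} {f : Matrix κ κ R} (h : Represents M e)
    (h' : Represents N f) (φ : M ≃ₗ[Rᵐᵒᵖ] N) : AlgEq e f := by
  classical
  obtain ⟨i, p, h1, h2⟩ := h
  obtain ⟨j, q, h3, h4⟩ := h'
  refine ⟨toMat (j ∘ₗ φ.toLinearMap ∘ₗ p), toMat (i ∘ₗ φ.symm.toLinearMap ∘ₗ q), ?_, ?_⟩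
  · refine mulVecR_injective ?_
    rw [mulVecR_mul, mulVecR_toMat, mulVecR_toMat, ← h2]
    ext x
    have := LinearMap.congr_fun h3 (φ (p (Pi.single x 1)))
    simp only [LinearMap.comp_apply, LinearMap.id_apply] at this
    simp [this]
  · refine mulVecR_injective ?_
    rw [mulVecR_mul, mulVecR_toMat, mulVecR_toMat, ← h4]
    ext x
    have := LinearMap.congr_fun h1 (φ.symm (q (Pi.single x 1)))
    simp only [LinearMap.comp_apply, LinearMap.id_apply] at this
    simp [this]

theorem Represents.congr {e : Matrix ι ι R} (h : Represents M e) (φ : N ≃ₗ[Rᵐᵒᵖ] M) :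
    Represents N e := by
  obtain ⟨i, p, h1, h2⟩ := h
  refine ⟨i ∘ₗ φ.toLinearMap, φ.symm.toLinearMap ∘ₗ p, ?_, ?_⟩
  · ext x
    have := LinearMap.congr_fun h1 (φ x)
    simp only [LinearMap.comp_apply, LinearMap.id_apply] at this
    simp [this]
  · rw [← h2]
    ext x
    simp

/-- Reindexing `Rⁿ⁺ᵐ = Rⁿ × Rᵐ`, for right modules. -/
def sumPi (R ι κ : Type*) [Ring R] : (ι ⊕ κ → R) ≃ₗ[Rᵐᵒᵖ] (ι → R) × (κ → R) :=
  LinearEquiv.sumArrowLequivProdArrow ι κ Rᵐᵒᵖ R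

theorem Represents.prod {e : Matrix ι ι R} {f : Matrix κ κ R} (h : Represents M e)
    (h' : Represents N f) : Represents (M × N) (fromBlocks e 0 0 f) := by
  obtain ⟨i, p, h1, h2⟩ := h
  obtain ⟨j, q, h3, h4⟩ := h'
  refine ⟨(sumPi R ι κ).symm.toLinearMap ∘ₗ i.prodMap j, p.prodMap q ∘ₗ (sumPi R ι κ).toLinearMap,
    ?_, ?_⟩
  · refine LinearMap.ext fun x => ?_
    have e1 := LinearMap.congr_fun h1 x.1
    have e2 := LinearMap.congr_fun h3 x.2
    simp only [LinearMap.comp_apply, LinearMap.id_apply, LinearEquiv.coe_coe,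
      LinearEquiv.apply_symm_apply, LinearMap.prodMap_apply] at e1 e2 ⊢
    rw [e1, e2]
  · refine LinearMap.ext fun x => ?_
    have e1 := LinearMap.congr_fun h2 (x ∘ Sum.inl)
    have e2 := LinearMap.congr_fun h4 (x ∘ Sum.inr)
    rw [mulVecR_apply, fromBlocks_mulVec]
    rw [LinearMap.comp_apply, mulVecR_apply] at e1 e2
    change Sum.elim (i (p (x ∘ Sum.inl))) (j (q (x ∘ Sum.inr))) = _
    rw [e1, e2]
    simp

theorem represents_pi [DecidableEq ι] : Represents (ι → R) (1 : Matrix ι ι R) :=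
  ⟨LinearMap.id, LinearMap.id, rfl, by
    refine LinearMap.ext fun x => ?_
    simp [mulVecR_apply]⟩

theorem represents_range {e : Matrix ι ι R} (he : IsIdempotentElem e) :
    Represents (LinearMap.range (mulVecR e)) e := by
  refine ⟨Submodule.subtype _, (mulVecR e).rangeRestrict, ?_, ?_⟩
  · ext ⟨x, y, rfl⟩ : 2
    change mulVecR e (mulVecR e y) = mulVecR e y
    rw [← LinearMap.comp_apply, ← mulVecR_mul, he.eq]
  · rfl

variable {P P' : Type*} [AddCommGroup P] [Module Rᵐᵒᵖ P] [AddCommGroup P'] [Module Rᵐᵒᵖ P']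

/-- The right linear map `c ↦ ∑ i, x i · c i`. -/
def vecMap (x : ι → M) : (ι → R) →ₗ[Rᵐᵒᵖ] M where
  toFun c := ∑ i, op (c i) • x i
  map_add' c d := by simp [add_smul, Finset.sum_add_distrib]
  map_smul' a c := by simp [mul_smul, Finset.smul_sum]

theorem vecMap_apply (x : ι → M) (c : ι → R) : vecMap x c = ∑ i, op (c i) • x i := rfl

theorem vecMap_single [DecidableEq ι] (x : ι → M) (i : ι) (a : R) :
    vecMap x (Pi.single i a) = op a • x i := by
  rw [vecMap_apply, Finset.sum_eq_single i] <;> simp +contextual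

theorem eq_vecMap [DecidableEq ι] (f : (ι → R) →ₗ[Rᵐᵒᵖ] M) :
    f = vecMap fun i => f (Pi.single i 1) := by
  refine LinearMap.ext fun x => ?_
  have hx : x = ∑ i, op (x i) • (Pi.single i 1 : ι → R) := by
    ext j
    simp [Pi.single_apply, Finset.sum_apply]
  conv_lhs => rw [hx, map_sum]
  simp [vecMap_apply]

theorem exists_lift_pi {f : M →ₗ[Rᵐᵒᵖ] N} (hf : Function.Surjective f)
    (y : (ι → R) →ₗ[Rᵐᵒᵖ] N) : ∃ s : (ι → R) →ₗ[Rᵐᵒᵖ] M, f ∘ₗ s = y := by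
  classical
  choose s hs using fun i : ι => hf (y (Pi.single i 1))
  refine ⟨vecMap s, ?_⟩
  rw [eq_vecMap y, eq_vecMap (f ∘ₗ vecMap s)]
  simp [vecMap_single, hs]

/-- If `T` is surjective and `y` lifts through `T`, then the kernel of `(T, y)` is the direct sum of
the kernel of `T` and the domain of `y`. -/
def kerCoprodEquiv (T : M →ₗ[Rᵐᵒᵖ] N) (s : P →ₗ[Rᵐᵒᵖ] M) :
    LinearMap.ker (T.coprod (T ∘ₗ s)) ≃ₗ[Rᵐᵒᵖ] LinearMap.ker T × P where
  toFun z := (⟨z.1.1 + s z.1.2, by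
    rw [LinearMap.mem_ker, map_add]
    exact z.2⟩, z.1.2)
  invFun z := ⟨(z.1.1 - s z.2, z.2), by simp⟩
  map_add' x y := by
    refine Prod.ext (Subtype.ext ?_) rfl
    simp
    abel
  map_smul' a x := by
    refine Prod.ext (Subtype.ext ?_) rfl
    simp
  left_inv x := by
    refine Subtype.ext (Prod.ext ?_ rfl)
    simp
  right_inv x := by
    refine Prod.ext (Subtype.ext ?_) rfl
    simp

/-- The kernels of `(T, y, y')` and `(T, y', y)` agree. -/
def kerSwapEquiv (T : M →ₗ[Rᵐᵒᵖ] N) (y : P →ₗ[Rᵐᵒᵖ] N) (y' : P' →ₗ[Rᵐᵒᵖ] N) :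
    LinearMap.ker ((T.coprod y).coprod y') ≃ₗ[Rᵐᵒᵖ] LinearMap.ker ((T.coprod y').coprod y) where
  toFun z := ⟨((z.1.1.1, z.1.2), z.1.1.2), (add_right_comm _ _ _).trans z.2⟩
  invFun z := ⟨((z.1.1.1, z.1.2), z.1.1.2), (add_right_comm _ _ _).trans z.2⟩
  map_add' _ _ := rfl
  map_smul' _ _ := rfl
  left_inv _ := rfl
  right_inv _ := rfl

/-- Reparametrizing the second summand does not change the kernel. -/
def kerCoprodCongr (T : M →ₗ[Rᵐᵒᵖ] N) (y : P →ₗ[Rᵐᵒᵖ] N) (φ : P' ≃ₗ[Rᵐᵒᵖ] P) :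
    LinearMap.ker (T.coprod (y ∘ₗ φ.toLinearMap)) ≃ₗ[Rᵐᵒᵖ] LinearMap.ker (T.coprod y) where
  toFun z := ⟨(z.1.1, φ z.1.2), z.2⟩
  invFun z := ⟨(z.1.1, φ.symm z.1.2), by
    have := z.2
    rw [LinearMap.mem_ker, LinearMap.coprod_apply] at this ⊢
    rwa [LinearMap.comp_apply, LinearEquiv.coe_coe, φ.apply_symm_apply]⟩
  map_add' a b := Subtype.ext (Prod.ext rfl (map_add φ _ _))
  map_smul' a b := Subtype.ext (Prod.ext rfl (map_smul φ _ _))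
  left_inv z := Subtype.ext (Prod.ext rfl (φ.symm_apply_apply _))
  right_inv z := Subtype.ext (Prod.ext rfl (φ.apply_symm_apply _))

theorem represents_of_ker_eq {e : Matrix ι ι R} (he : IsIdempotentElem e)
    (g : (ι → R) →ₗ[Rᵐᵒᵖ] M) (hg : LinearMap.ker g = LinearMap.ker (mulVecR e)) :
    Represents (LinearMap.range g) e :=
  (represents_range he).congr (g.quotKerEquivRange.symm.trans
    ((Submodule.quotEquivOfEq _ _ hg).trans (mulVecR e).quotKerEquivRange))

/-- A submodule represented by `e` is the range of a map with the same kernel as `e`. -/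
theorem Represents.exists_vecMap [DecidableEq ι] {e : Matrix ι ι R} {K : Submodule Rᵐᵒᵖ M}
    (h : Represents K e) : ∃ g : ι → M,
      (∀ d : ι → R, vecMap g d = 0 ↔ mulVecR e d = 0) ∧ ∀ c, c ∈ K ↔ ∃ d : ι → R, vecMap g d = c := by
  obtain ⟨i, p, h1, h2⟩ := h
  refine ⟨fun j => (p (Pi.single j 1)).1, ?_⟩
  have hg : ∀ d, vecMap (fun j => (p (Pi.single j 1)).1) d = (p d).1 := fun d =>
    (LinearMap.congr_fun (eq_vecMap (Submodule.subtype _ ∘ₗ p)) d).symm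
  have hpi : ∀ c, p (i c) = c := LinearMap.congr_fun h1
  refine ⟨fun d => ?_, fun c => ⟨fun h => ⟨i ⟨c, h⟩, ?_⟩, ?_⟩⟩
  · rw [hg, ← h2, LinearMap.comp_apply]
    refine ⟨fun h => ?_, fun h => ?_⟩
    · rw [Subtype.ext (a1 := p d) (a2 := 0) h, map_zero]
    · rw [← hpi (p d), h, map_zero]
      rfl
  · rw [hg, hpi]
  · rintro ⟨d, rfl⟩
    rw [hg]
    exact (p d).2

/-- Schanuel's lemma, for two ways of making a map surjective. -/
theorem exists_schanuel_equiv (F : M →ₗ[Rᵐᵒᵖ] N) (y : (ι → R) →ₗ[Rᵐᵒᵖ] N)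
    (y' : (κ → R) →ₗ[Rᵐᵒᵖ] N) (h : Function.Surjective (F.coprod y))
    (h' : Function.Surjective (F.coprod y')) :
    Nonempty ((LinearMap.ker (F.coprod y) × (κ → R)) ≃ₗ[Rᵐᵒᵖ]
      (LinearMap.ker (F.coprod y') × (ι → R))) := by
  obtain ⟨s, rfl⟩ := exists_lift_pi h y'
  obtain ⟨s', hs'⟩ := exists_lift_pi h' y
  have e1 := kerCoprodEquiv (F.coprod y) s
  have e2 := kerCoprodEquiv (F.coprod (F.coprod y ∘ₗ s)) s'
  rw [hs'] at e2
  exact ⟨(e1.symm.trans (kerSwapEquiv F y _)).trans e2⟩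

end RightModules

section IsClass

variable {R : Type*} [CStarAlgebra R] {ι : Type*} [Fintype ι] {M N : Type*} [AddCommGroup M]
  [Module Rᵐᵒᵖ M] [AddCommGroup N] [Module Rᵐᵒᵖ N]

/-- `x` is the class in K-theory of the finitely generated projective right module `M`. -/
def IsClass (M : Type*) [AddCommGroup M] [Module Rᵐᵒᵖ M] (x : KUnital R) : Prop :=
  ∃ (n : ℕ) (e : Matrix (Fin n) (Fin n) R) (h : Represents M e), x = idemClass e h.isIdempotentElem

theorem Represents.isClass {e : Matrix ι ι R} (h : Represents M e) :
    IsClass M (idemClass e h.isIdempotentElem) := by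
  classical
  let s := Fintype.equivFin ι
  let φ : (ι → R) ≃ₗ[Rᵐᵒᵖ] (Fin (Fintype.card ι) → R) := LinearEquiv.funCongrLeft Rᵐᵒᵖ R s.symm
  obtain ⟨i, p, h1, h2⟩ := h
  have h' : Represents M (toMat ((φ.toLinearMap ∘ₗ i) ∘ₗ p ∘ₗ φ.symm.toLinearMap)) := by
    refine ⟨φ.toLinearMap ∘ₗ i, p ∘ₗ φ.symm.toLinearMap, ?_, (mulVecR_toMat _).symm⟩
    rw [← h1]
    refine LinearMap.ext fun x => ?_
    simp
  exact ⟨_, _, h', idemClass_eq _ _ (Represents.algEq ⟨i, p, h1, h2⟩ h' (.refl _ _))⟩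

theorem Represents.of_algEq {κ : Type*} [Fintype κ] {e : Matrix ι ι R} {f : Matrix κ κ R}
    (h : Represents M e) (hf : IsIdempotentElem f) (hef : AlgEq e f) : Represents M f := by
  obtain ⟨u, v, rfl, rfl⟩ := hef
  obtain ⟨i, p, h1, h2⟩ := h
  refine ⟨mulVecR u ∘ₗ i, p ∘ₗ mulVecR v, ?_, ?_⟩
  · calc (p ∘ₗ mulVecR v) ∘ₗ mulVecR u ∘ₗ i = p ∘ₗ (mulVecR v ∘ₗ mulVecR u) ∘ₗ i := rfl
      _ = (p ∘ₗ i) ∘ₗ (p ∘ₗ i) := by rw [← mulVecR_mul, ← h2]; rfl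
      _ = LinearMap.id := by rw [h1, LinearMap.id_comp]
  · calc (mulVecR u ∘ₗ i) ∘ₗ p ∘ₗ mulVecR v = mulVecR u ∘ₗ (i ∘ₗ p) ∘ₗ mulVecR v := rfl
      _ = mulVecR (u * v * (u * v)) := by
        rw [h2, ← mulVecR_mul, ← mulVecR_mul]
        simp only [Matrix.mul_assoc]
      _ = mulVecR (u * v) := by rw [hf.eq]

theorem IsClass.exists_matProj {x : KUnital R} (h : IsClass M x) :
    ∃ P : MatProj R, Represents M P.val ∧ x = KUnital.of P := by
  obtain ⟨n, e, h1, rfl⟩ := h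
  obtain ⟨p, hp, h2⟩ := exists_algEq_isStarProjection h1.isIdempotentElem
  refine ⟨⟨n, p, hp⟩, h1.of_algEq hp.isIdempotentElem h2, ?_⟩
  rw [of_eq_idemClass]
  exact idemClass_eq _ _ h2

theorem IsClass.eq {x y : KUnital R} (h : IsClass M x) (h' : IsClass N y) (φ : M ≃ₗ[Rᵐᵒᵖ] N) :
    x = y := by
  obtain ⟨n, e, h1, rfl⟩ := h
  obtain ⟨m, f, h2, rfl⟩ := h'
  exact idemClass_eq _ _ (h1.algEq h2 φ)

theorem IsClass.congr {x : KUnital R} (h : IsClass M x) (φ : N ≃ₗ[Rᵐᵒᵖ] M) : IsClass N x := by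
  obtain ⟨n, e, h1, rfl⟩ := h
  exact (h1.congr φ).isClass

theorem IsClass.prod {x y : KUnital R} (h : IsClass M x) (h' : IsClass N y) :
    IsClass (M × N) (x + y) := by
  obtain ⟨n, e, h1, rfl⟩ := h
  obtain ⟨m, f, h2, rfl⟩ := h'
  rw [← idemClass_blocks]
  exact (h1.prod h2).isClass

variable (R ι) in
/-- The class of the free module with basis indexed by `ι`. -/
def freeClass : KUnital R := by
  classical
  exact idemClass (1 : Matrix ι ι R) isIdempotentElem_one_matrix

theorem isClass_pi : IsClass (ι → R) (freeClass R ι) := by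
  classical
  exact represents_pi.isClass

theorem of_one_eq_freeClass (n : ℕ) : KUnital.of (MatProj.one R n) = freeClass R (Fin n) := by
  rw [of_one, freeClass]
  congr!

end IsClass

/-! ### The index of a Fredholm operator -/

section Index

universe u w

variable {A : Type u} [NonUnitalCStarAlgebra A]

/-- Hilbert modules over `A` are right modules over the unitization of `A`. -/
instance (M : HilbMod.{u, w} A) : Module (Unitization ℂ A)ᵐᵒᵖ M where
  smul a m := M.actU m a.unop
  one_smul m := by
    change M.actU m 1 = m
    simp [HilbMod.actU]
  mul_smul a b m := by
    change M.actU m (b.unop * a.unop) = M.actU (M.actU m b.unop) a.unop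
    simp only [HilbMod.actU, Unitization.fst_mul, Unitization.snd_mul, map_add, map_smul,
      HilbertModule.act_mul, _root_.add_apply, _root_.smul_apply,
      mul_smul, smul_add]
    rw [smul_comm a.unop.fst b.unop.fst m]
    abel
  smul_zero a := by
    change M.actU 0 a.unop = 0
    simp [HilbMod.actU]
  smul_add a m m' := by
    change M.actU (m + m') a.unop = M.actU m a.unop + M.actU m' a.unop
    simp only [HilbMod.actU, map_add, smul_add, _root_.add_apply]
    abel
  add_smul a b m := by
    change M.actU m (a.unop + b.unop) = M.actU m a.unop + M.actU m b.unop
    simp only [HilbMod.actU, Unitization.fst_add, Unitization.snd_add, map_add, add_smul]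
    abel
  zero_smul m := by
    change M.actU m 0 = 0
    simp [HilbMod.actU]

variable {M N : HilbMod.{u, w} A}

/-- An operator that respects the action of `A` is linear over the unitization. -/
def toLinR (F : M →L[ℂ] N) (hF : ∀ m (a : A), F (HilbertModule.act m a) = HilbertModule.act (F m) a) :
    M →ₗ[(Unitization ℂ A)ᵐᵒᵖ] N where
  toFun := F
  map_add' := F.map_add
  map_smul' a m := by
    change F (M.actU m a.unop) = N.actU (F m) a.unop
    simp [HilbMod.actU, hF]

theorem ip_act_right (M : HilbMod.{u, w} A) (m m' : M) (a : A) :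
    M.ip m (HilbertModule.act m' a) = M.ip m m' * a :=
  HilbertModule.inner_act m m' a

theorem star_ip (M : HilbMod.{u, w} A) (m m' : M) : star (M.ip m m') = M.ip m' m :=
  HilbertModule.star_inner m m'

theorem ip_act_left (M : HilbMod.{u, w} A) (m m' : M) (a : A) :
    M.ip (HilbertModule.act m a) m' = star a * M.ip m m' := by
  rw [← star_ip, ip_act_right, star_mul, star_ip]

theorem ip_self_eq_zero {m : M} (h : M.ip m m = 0) : m = 0 := by
  have := HilbertModule.norm_sq (A := A) m
  rw [show HilbertModule.inner m m = M.ip m m from rfl, h, norm_zero] at this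
  simpa using this

theorem ip_ext {m m' : M} (h : ∀ n, M.ip m n = M.ip m' n) : m = m' := by
  refine sub_eq_zero.mp (ip_self_eq_zero (A := A) ?_)
  have := h (m - m')
  unfold HilbMod.ip at this ⊢
  rw [map_sub HilbertModule.inner m m', _root_.sub_apply, this, sub_self]

theorem IsAdjointPair.symm {F : M →L[ℂ] N} {G : N →L[ℂ] M} (h : IsAdjointPair F G) :
    IsAdjointPair G F := fun n m => by rw [← star_ip, ← h, star_ip]

/-- Adjointable operators are module maps. -/
theorem IsAdjointPair.map_act {F : M →L[ℂ] N} {G : N →L[ℂ] M} (h : IsAdjointPair F G) (m : M)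
    (a : A) : F (HilbertModule.act m a) = HilbertModule.act (F m) a :=
  ip_ext fun n => by rw [h, ip_act_left, ip_act_left, h]

theorem IsFredholm.map_act {F : M →L[ℂ] N} (h : IsFredholm F) (m : M) (a : A) :
    F (HilbertModule.act m a) = HilbertModule.act (F m) a := by
  obtain ⟨F', G, G', h1, -⟩ := h
  exact h1.map_act m a

/-- The index in terms of the class of the kernel of a surjection `(F, y)`, without reference to the
projection that represents this kernel. -/
theorem exists_isClass_of_hasIndex {F : M →L[ℂ] N} {x : K0 A} (h : HasIndex F x) :
    ∃ (n : ℕ) (y : (Fin n → Unitization ℂ A) →ₗ[(Unitization ℂ A)ᵐᵒᵖ] N),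
      Function.Surjective ((toLinR F h.1.map_act).coprod y) ∧
      IsClass (LinearMap.ker ((toLinR F h.1.map_act).coprod y))
        (K0.incl x + freeClass (Unitization ℂ A) (Fin n)) := by
  obtain ⟨hF, n, y, P, g, h1, h2, h3, h4⟩ := h
  have e1 : LinearMap.range (vecMap g) = LinearMap.ker ((toLinR F hF.map_act).coprod (vecMap y)) :=
    Submodule.ext fun c => (h3 c).symm
  refine ⟨n, vecMap y, h1, ?_⟩
  have h5 : K0.incl x + freeClass (Unitization ℂ A) (Fin n) = idemClass P.val
      P.isProj.isIdempotentElem := by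
    rw [h4, of_one_eq_freeClass, sub_add_cancel, of_eq_idemClass]
  rw [h5, ← e1]
  exact (represents_of_ker_eq P.isProj.isIdempotentElem (vecMap g)
    (Submodule.ext fun d => h2 d)).isClass

theorem hasIndex_of_isClass {F : M →L[ℂ] N} (hF : IsFredholm F) {x : K0 A} {ι : Type*} [Fintype ι]
    (y : (ι → Unitization ℂ A) →ₗ[(Unitization ℂ A)ᵐᵒᵖ] N)
    (hy : Function.Surjective ((toLinR F hF.map_act).coprod y))
    (hx : IsClass (LinearMap.ker ((toLinR F hF.map_act).coprod y))
      (K0.incl x + freeClass (Unitization ℂ A) ι)) : HasIndex F x := by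
  classical
  set R := Unitization ℂ A
  set n := Fintype.card ι
  let φ : (Fin n → R) ≃ₗ[Rᵐᵒᵖ] (ι → R) := LinearEquiv.funCongrLeft Rᵐᵒᵖ R (Fintype.equivFin ι)
  have hn : freeClass R (Fin n) = freeClass R ι := isClass_pi.eq isClass_pi φ
  set y' := fun j => y (φ (Pi.single j 1)) with hy'
  have hyy : vecMap y' = y ∘ₗ φ.toLinearMap := (eq_vecMap (y ∘ₗ φ.toLinearMap)).symm
  have ψ := kerCoprodCongr (toLinR F hF.map_act) y φ
  have hs : Function.Surjective ((toLinR F hF.map_act).coprod (y ∘ₗ φ.toLinearMap)) := fun z => by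
    obtain ⟨c, rfl⟩ := hy z
    refine ⟨(c.1, φ.symm c.2), ?_⟩
    simp
  rw [← hyy] at ψ hs
  obtain ⟨P, h1, h2⟩ := (hx.congr ψ).exists_matProj
  obtain ⟨g, h3, h4⟩ := h1.exists_vecMap
  refine ⟨hF, n, y', P, g, hs, h3, h4, ?_⟩
  rw [of_one_eq_freeClass, ← h2, hn, add_sub_cancel_right]

theorem K0.incl_injective : Function.Injective (K0.incl (A := A)) := Subtype.val_injective

/-- The kernels of two surjections `(F, y)` and `(F, y')` agree up to free summands by Schanuel's lemma,
so that the index does not depend on `y`. -/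
theorem HasIndex.unique {F : M →L[ℂ] N} {x x' : K0 A} (h : HasIndex F x) (h' : HasIndex F x') :
    x = x' := by
  obtain ⟨n, y, h1, h2⟩ := exists_isClass_of_hasIndex h
  obtain ⟨n', y', h3, h4⟩ := exists_isClass_of_hasIndex h'
  obtain ⟨φ⟩ := exists_schanuel_equiv _ y y' h1 h3
  have := (h2.prod (isClass_pi (ι := Fin n'))).eq (h4.prod (isClass_pi (ι := Fin n))) φ
  rw [add_assoc, add_assoc, add_comm (freeClass _ (Fin n'))] at this
  exact K0.incl_injective (add_right_cancel this)

end Index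

/-! ### Elements of `K₀` of a nonunital algebra -/

section Representatives

universe u

theorem exists_of_sub_of {R : Type*} [Ring R] [StarRing R] (x : KUnital R) :
    ∃ p q : MatProj R, x = KUnital.of p - KUnital.of q := by
  induction x using AddLocalization.induction_on with | _ y
  obtain ⟨a, s, hs⟩ := y
  obtain ⟨p, rfl⟩ : ∃ p : MatProj R, p.vclass = a := Quotient.exists_rep a
  obtain ⟨q, rfl⟩ : ∃ p : MatProj R, p.vclass = s := Quotient.exists_rep s
  refine ⟨p, q, ?_⟩
  rw [eq_sub_iff_add_eq, AddLocalization.mk_eq_addMonoidOf_mk'_apply]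
  exact (AddLocalization.addMonoidOf _).mk'_spec _ _

variable {A : Type u} [NonUnitalCStarAlgebra A]

theorem idemClass_add_compl {R : Type*} [CStarAlgebra R] {ι : Type*} [Fintype ι] [DecidableEq ι]
    {e : Matrix ι ι R} (he : IsIdempotentElem e) :
    idemClass e he + idemClass (1 - e) he.one_sub = freeClass R ι := by
  rw [← idemClass_blocks, freeClass]
  have : AlgEq (fromBlocks e 0 0 (1 - e)) (1 : Matrix ι ι R) := by
    refine ⟨fromCols e (1 - e), fromRows e (1 - e), ?_, ?_⟩
    · rw [fromRows_mul_fromCols]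
      simp [he.eq, Matrix.mul_sub, Matrix.sub_mul]
    · rw [fromCols_mul_fromRows]
      simp [he.eq, Matrix.mul_sub, Matrix.sub_mul]
  refine (idemClass_eq (isIdempotentElem_blocks he he.one_sub) isIdempotentElem_one_matrix
    this).trans ?_
  congr!

theorem map_freeClass {R S : Type*} [CStarAlgebra R] [CStarAlgebra S] (φ : R →⋆ₐ[ℂ] S) (ι : Type*)
    [Fintype ι] : KUnital.map φ (freeClass R ι) = freeClass S ι := by
  classical
  have h : (1 : Matrix ι ι R).map φ = 1 := Matrix.map_one _ (map_zero φ) (map_one φ)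
  rw [freeClass, idemClass_map φ _ (h ▸ isIdempotentElem_one_matrix), freeClass]
  congr 1

theorem freeClass_sum (R : Type*) [CStarAlgebra R] (ι κ : Type*) [Fintype ι] [Fintype κ] :
    freeClass R (ι ⊕ κ) = freeClass R ι + freeClass R κ :=
  isClass_pi.eq (isClass_pi.prod isClass_pi) (sumPi R ι κ)

/-- Every element of `K₀(A)` is of the form `[P] - [1]`, where the scalar part of the projection `P`
is equivalent to an identity matrix. -/
theorem K0.exists_eq_sub (x : K0 A) : ∃ (ι κ : Type) (_ : Fintype ι) (_ : Fintype κ)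
    (_ : DecidableEq ι) (_ : DecidableEq κ) (P : Matrix ι ι (Unitization ℂ A))
    (hP : IsStarProjection P) (w : Matrix κ ι ℂ),
    wᴴ * w = P.map (augmentation A) ∧ w * wᴴ = 1 ∧
    K0.incl x = idemClass P hP.isIdempotentElem - freeClass (Unitization ℂ A) κ := by
  obtain ⟨p, q, hpq⟩ := exists_of_sub_of (K0.incl x)
  set R := Unitization ℂ A
  have hq := idemClass_add_compl q.isProj.isIdempotentElem
  rw [← of_eq_idemClass] at hq
  let r : MatProj R := p.sum ⟨q.size, 1 - q.val, q.isProj.one_sub⟩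
  have hr : K0.incl x = KUnital.of r - KUnital.of (MatProj.one R q.size) := by
    rw [of_sum, of_one_eq_freeClass, ← hq, hpq, of_eq_idemClass ⟨q.size, 1 - q.val, _⟩]
    abel
  have h0 : KUnital.of (r.map (augmentation A)) = KUnital.of ((MatProj.one R q.size).map (augmentation A)) := by
    have h := x.2
    rw [AddMonoidHom.mem_ker] at h
    rw [← sub_eq_zero, ← KUnital.map_of, ← KUnital.map_of, ← map_sub, ← hr]
    exact h
  obtain ⟨m, w, h1, h2⟩ := exists_isMvN_of_of_eq h0
  have hε1 : (1 : Matrix (Fin m) (Fin m) R).map (augmentation A) = 1 :=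
    Matrix.map_one _ (map_zero _) (map_one _)
  have hP := isStarProjection_blocks r.isProj (isStarProjection_one_matrix (R := R) (ι := Fin m))
  refine ⟨Fin r.size ⊕ Fin m, Fin q.size ⊕ Fin m, inferInstance, inferInstance, inferInstance,
    inferInstance, fromBlocks r.val 0 0 1, hP, w, ?_, ?_, ?_⟩
  · refine h1.trans ?_
    rw [fromBlocks_map, hε1]
    simp only [Matrix.map_zero _ (map_zero _)]
    rfl
  · refine h2.trans ?_
    have : ((MatProj.one R q.size).map (augmentation A)).val = 1 :=
      Matrix.map_one _ (map_zero _) (map_one _)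
    rw [this]
    exact fromBlocks_one
  · rw [idemClass_blocks r.isProj.isIdempotentElem isIdempotentElem_one_matrix, hr,
      of_eq_idemClass r, of_one_eq_freeClass, freeClass_sum, ← of_one m, of_one_eq_freeClass]
    abel

theorem K0.exists_incl_eq {c : KUnital (Unitization ℂ A)} (hc : KUnital.map (augmentation A) c = 0) :
    ∃ x : K0 A, K0.incl x = c :=
  ⟨⟨c, hc⟩, rfl⟩

theorem K0.incl_map {B : Type*} [NonUnitalCStarAlgebra B] (φ : A →⋆ₙₐ[ℂ] B) (x : K0 A) :
    K0.incl (K0.map φ x) = KUnital.map (Unitization.starMap φ) (K0.incl x) := rfl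

end Representatives

/-! ### Kernels from parametrices of finite rank -/

section Parametrix

set_option linter.unusedSectionVars false

variable {R : Type*} [Ring R] {ι κ : Type*} [Fintype ι] [Fintype κ] [DecidableEq ι] [DecidableEq κ]
  {M N : Type*} [AddCommGroup M] [Module Rᵐᵒᵖ M] [AddCommGroup N] [Module Rᵐᵒᵖ N]

/-- The operator `V Π U` on `Rᵏ ⊕ Rⁿ`, where `U (a, c) = (Z a - G X c, c)`, where `Π` is the projection
of `M ⊕ Rⁿ` onto the kernel of `(F, X)` along the range of `(G, Y)`, and `V (m, c) = (W m, c)`. -/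
def indexMap (F : M →ₗ[Rᵐᵒᵖ] N) (G : N →ₗ[Rᵐᵒᵖ] M) (X : (ι → R) →ₗ[Rᵐᵒᵖ] N)
    (Y : N →ₗ[Rᵐᵒᵖ] (ι → R)) (Z : (κ → R) →ₗ[Rᵐᵒᵖ] M) (W : M →ₗ[Rᵐᵒᵖ] (κ → R)) :
    (κ ⊕ ι → R) →ₗ[Rᵐᵒᵖ] (κ ⊕ ι → R) :=
  (sumPi R κ ι).symm.toLinearMap ∘ₗ W.prodMap LinearMap.id ∘ₗ
    (LinearMap.id - G.prod Y ∘ₗ F.coprod X) ∘ₗ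
    (Z.coprod (-(G ∘ₗ X))).prod (LinearMap.snd _ _ _) ∘ₗ (sumPi R κ ι).toLinearMap

/-- The matrix of `indexMap`. -/
def indexMat (F : M →ₗ[Rᵐᵒᵖ] N) (G : N →ₗ[Rᵐᵒᵖ] M) (X : (ι → R) →ₗ[Rᵐᵒᵖ] N)
    (Y : N →ₗ[Rᵐᵒᵖ] (ι → R)) (Z : (κ → R) →ₗ[Rᵐᵒᵖ] M) (W : M →ₗ[Rᵐᵒᵖ] (κ → R)) :
    Matrix (κ ⊕ ι) (κ ⊕ ι) R :=
  toMat (indexMap F G X Y Z W)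

variable {F : M →ₗ[Rᵐᵒᵖ] N} {G : N →ₗ[Rᵐᵒᵖ] M} {X : (ι → R) →ₗ[Rᵐᵒᵖ] N}
  {Y : N →ₗ[Rᵐᵒᵖ] (ι → R)} {Z : (κ → R) →ₗ[Rᵐᵒᵖ] M} {W : M →ₗ[Rᵐᵒᵖ] (κ → R)}

theorem surjective_coprod (h₁ : F ∘ₗ G + X ∘ₗ Y = LinearMap.id) :
    Function.Surjective (F.coprod X) := fun n =>
  ⟨(G n, Y n), LinearMap.congr_fun h₁ n⟩

/-- If `G` inverts `F` up to operators that factor through free modules, then the kernel of the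
surjection `(F, X)` is represented by `indexMat`. -/
theorem represents_ker (h₁ : F ∘ₗ G + X ∘ₗ Y = LinearMap.id) (h₂ : G ∘ₗ F + Z ∘ₗ W = LinearMap.id) :
    Represents (LinearMap.ker (F.coprod X)) (indexMat F G X Y Z W) := by
  have hT : ∀ n, F.coprod X (G n, Y n) = n := LinearMap.congr_fun h₁
  let U := (Z.coprod (-(G ∘ₗ X))).prod (LinearMap.snd Rᵐᵒᵖ (κ → R) (ι → R)) ∘ₗ
    (sumPi R κ ι).toLinearMap
  let V := (sumPi R κ ι).symm.toLinearMap ∘ₗ W.prodMap (LinearMap.id (R := Rᵐᵒᵖ) (M := ι → R))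
  let Q := LinearMap.id - G.prod Y ∘ₗ F.coprod X
  have hQ : ∀ z, F.coprod X (Q z) = 0 := fun z => by
    change F.coprod X (z - (G (F.coprod X z), Y (F.coprod X z))) = 0
    rw [map_sub, hT, sub_self]
  have hQ' : ∀ z, F.coprod X z = 0 → Q z = z := fun z hz => by
    change z - (G (F.coprod X z), Y (F.coprod X z)) = z
    rw [hz]
    simp
  refine ⟨V ∘ₗ Submodule.subtype _, LinearMap.codRestrict _ (Q ∘ₗ U) fun z => hQ _, ?_,
    (mulVecR_toMat _).symm⟩
  refine LinearMap.ext fun z => Subtype.ext ?_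
  have hz : F z.1.1 + X z.1.2 = 0 := z.2
  have hUV : U (V z.1) = z.1 := by
    have h3 : G (F z.1.1) + Z (W z.1.1) = z.1.1 := LinearMap.congr_fun h₂ z.1.1
    refine Prod.ext ?_ ?_
    · change Z (W z.1.1) + -(G (X z.1.2)) = z.1.1
      rw [eq_neg_of_add_eq_zero_right hz, map_neg, neg_neg, add_comm, h3]
    · rfl
  change Q (U (V z.1)) = z.1
  rw [hUV, hQ' _ z.2]

/-- The index matrix is natural: data over `S` that correspond to data over `R` through `φ` have a matrix
that `φ` sends to the matrix over `R`. -/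
theorem indexMat_map {S : Type*} [Ring S] {M' N' : Type*} [AddCommGroup M'] [Module Sᵐᵒᵖ M']
    [AddCommGroup N'] [Module Sᵐᵒᵖ N'] {F' : M' →ₗ[Sᵐᵒᵖ] N'} {G' : N' →ₗ[Sᵐᵒᵖ] M'}
    {X' : (ι → S) →ₗ[Sᵐᵒᵖ] N'} {Y' : N' →ₗ[Sᵐᵒᵖ] (ι → S)} {Z' : (κ → S) →ₗ[Sᵐᵒᵖ] M'}
    {W' : M' →ₗ[Sᵐᵒᵖ] (κ → S)} (φ : S →+* R) (j : M' →+ M) (k : N' →+ N)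
    (hF : ∀ m, F (j m) = k (F' m)) (hG : ∀ n, G (k n) = j (G' n))
    (hX : ∀ c : ι → S, X (φ ∘ c) = k (X' c)) (hY : ∀ n, Y (k n) = φ ∘ Y' n)
    (hZ : ∀ c : κ → S, Z (φ ∘ c) = j (Z' c)) (hW : ∀ m, W (j m) = φ ∘ W' m) :
    (indexMat F' G' X' Y' Z' W').map φ = indexMat F G X Y Z W := by
  have key : ∀ c : κ ⊕ ι → S,
      indexMap F G X Y Z W (φ ∘ c) = φ ∘ indexMap F' G' X' Y' Z' W' c := by
    intro c
    have h1 : ∀ (M₀ : M') (c₀ : ι → S), F.coprod X (j M₀, φ ∘ c₀) = k (F'.coprod X' (M₀, c₀)) :=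
      fun M₀ c₀ => by simp [hF, hX]
    set a : κ → S := c ∘ Sum.inl
    set b : ι → S := c ∘ Sum.inr
    set m₀ := Z' a + -(G' (X' b))
    have h2 : Z (φ ∘ a) + -(G (X (φ ∘ b))) = j m₀ := by simp [m₀, hZ, hX, hG]
    set n₀ := F'.coprod X' (m₀, b)
    change Sum.elim (W (Z (φ ∘ a) + -(G (X (φ ∘ b))) -
        G (F.coprod X (Z (φ ∘ a) + -(G (X (φ ∘ b))), φ ∘ b))))
        (φ ∘ b - Y (F.coprod X (Z (φ ∘ a) + -(G (X (φ ∘ b))), φ ∘ b)))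
      = φ ∘ Sum.elim (W' (m₀ - G' n₀)) (b - Y' n₀)
    rw [h2, h1, hG, hY, ← map_sub, hW]
    ext i
    cases i <;> simp [n₀]
  ext a b
  have : φ ∘ (Pi.single b 1 : κ ⊕ ι → S) = Pi.single b 1 := by
    ext i
    simp only [Function.comp_apply, Pi.single_apply]
    split_ifs <;> simp
  change φ (indexMap F' G' X' Y' Z' W' (Pi.single b 1) a) = indexMap F G X Y Z W (Pi.single b 1) a
  rw [← this, key]
  rfl

/-- The scalar part of the index matrix is constant if `Y` and `W` have no scalar part, so that the
difference of the index matrix and the identity matrix of size `n` gives a class in `K₀` of the nonunital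
algebra. -/
theorem indexMat_map_eq_blocks {S : Type*} [Ring S] (ε : R →+* S) (hY : ∀ n i, ε (Y n i) = 0)
    (hW : ∀ m i, ε (W m i) = 0) :
    (indexMat F G X Y Z W).map ε = fromBlocks 0 0 0 1 := by
  ext a b
  change ε (indexMap F G X Y Z W (Pi.single b 1) a) = _
  rcases a with a | a
  · refine (hW _ a).trans ?_
    rcases b with b | b <;> rfl
  · change ε ((Pi.single b 1 : κ ⊕ ι → R) (Sum.inr a) - Y _ a) = _
    rw [map_sub, hY, sub_zero]
    rcases b with b | b
    · simp
    · simp [Pi.single_apply, Matrix.one_apply]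

end Parametrix

section Index

universe u w

variable {A : Type u} [NonUnitalCStarAlgebra A] {M N : HilbMod.{u, w} A}

theorem idemClass_congr {R : Type*} [CStarAlgebra R] {ι : Type*} [Fintype ι] {e f : Matrix ι ι R}
    (h : e = f) (he : IsIdempotentElem e) : idemClass e he = idemClass f (h ▸ he) := by
  subst h
  rfl

theorem idemClass_fromBlocks_one {R : Type*} [CStarAlgebra R] {ι κ : Type*} [Fintype ι] [Fintype κ]
    [DecidableEq ι] (h : IsIdempotentElem (fromBlocks (0 : Matrix κ κ R) 0 0 (1 : Matrix ι ι R))) :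
    idemClass _ h = freeClass R ι := by
  rw [freeClass]
  refine (idemClass_eq h isIdempotentElem_one_matrix ⟨fromCols 0 (1 : Matrix ι ι R), fromRows 0 1, ?_, ?_⟩).trans ?_
  · rw [fromRows_mul_fromCols]
    simp
  · rw [fromCols_mul_fromRows]
    simp
  · congr!

/-- The map `n ↦ (⟨y i, n⟩)ᵢ` from a Hilbert module to a free module over the unitization. -/
def rowMap {ι : Type*} (y : ι → N) : N →ₗ[(Unitization ℂ A)ᵐᵒᵖ] (ι → Unitization ℂ A) where
  toFun n i := (N.ip (y i) n : A)
  map_add' a b := by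
    ext i : 1
    simp [HilbMod.ip]
  map_smul' a n := by
    ext i : 1
    change ((N.ip (y i) (N.actU n a.unop) : A) : Unitization ℂ A) = (N.ip (y i) n : A) * a.unop
    generalize a.unop = b
    induction b using Unitization.ind with
    | _ r b =>
      rw [mul_add, ← Unitization.inr_mul, ← ip_act_right]
      simp [HilbMod.actU, HilbMod.ip, Unitization.inr_mul_inl]

/-- The map `c ↦ ∑ i, x i · c i` from a free module over the unitization to a Hilbert module. -/
def colMap {ι : Type*} [Fintype ι] (x : ι → N) :
    (ι → Unitization ℂ A) →ₗ[(Unitization ℂ A)ᵐᵒᵖ] N :=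
  vecMap x

/-- The index of `F`, computed from an inverse up to operators of finite rank. -/
theorem exists_hasIndex {F : M →L[ℂ] N} (hF : IsFredholm F) {ι κ : Type*} [Fintype ι] [Fintype κ]
    [DecidableEq ι] [DecidableEq κ] {G : N →ₗ[(Unitization ℂ A)ᵐᵒᵖ] M} {x y : ι → N} {z w : κ → M}
    (h₁ : toLinR F hF.map_act ∘ₗ G + colMap x ∘ₗ rowMap y = LinearMap.id)
    (h₂ : G ∘ₗ toLinR F hF.map_act + colMap z ∘ₗ rowMap w = LinearMap.id) :
    ∃ c : K0 A, HasIndex F c ∧ K0.incl c = idemClass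
      (indexMat (toLinR F hF.map_act) G (colMap x) (rowMap y) (colMap z) (rowMap w))
      (represents_ker h₁ h₂).isIdempotentElem - freeClass (Unitization ℂ A) ι := by
  have he := (represents_ker h₁ h₂).isIdempotentElem
  have hε := indexMat_map_eq_blocks (F := toLinR F hF.map_act) (G := G) (X := colMap x)
    (Y := rowMap y) (Z := colMap z) (W := rowMap w) (augmentation A : Unitization ℂ A →+* ℂ)
    (fun _ _ => rfl) (fun _ _ => rfl)
  have he' := isIdempotentElem_map (augmentation A : Unitization ℂ A →+* ℂ) he
  obtain ⟨c, hc⟩ := K0.exists_incl_eq (A := A) (c := idemClass _ he - freeClass _ ι) (by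
    rw [map_sub, map_freeClass, idemClass_map _ he he', sub_eq_zero]
    exact (idemClass_congr hε he').trans (idemClass_fromBlocks_one (hε ▸ he')))
  refine ⟨c, hasIndex_of_isClass hF (colMap x) (surjective_coprod h₁) ?_, hc⟩
  rw [hc, sub_add_cancel]
  exact (represents_ker h₁ h₂).isClass

end Index

/-! ### Operators of finite rank -/

section FiniteRank

universe u w

variable {A : Type u} [NonUnitalCStarAlgebra A] {M N L : HilbMod.{u, w} A}

theorem IsAdjointPair.id : IsAdjointPair (ContinuousLinearMap.id ℂ M) (ContinuousLinearMap.id ℂ M) :=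
  fun _ _ => rfl

theorem IsAdjointPair.comp {S : N →L[ℂ] L} {S' : L →L[ℂ] N} {T : M →L[ℂ] N} {T' : N →L[ℂ] M}
    (hS : IsAdjointPair S S') (hT : IsAdjointPair T T') : IsAdjointPair (S ∘L T) (T' ∘L S') :=
  fun _ _ => (hS _ _).trans (hT _ _)

theorem IsAdjointPair.add {S T : M →L[ℂ] N} {S' T' : N →L[ℂ] M} (hS : IsAdjointPair S S')
    (hT : IsAdjointPair T T') : IsAdjointPair (S + T) (S' + T') := fun m n => by
  have h1 := hS m n
  have h2 := hT m n
  unfold HilbMod.ip at *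
  rw [_root_.add_apply, _root_.add_apply, map_add, map_add, _root_.add_apply, h1, h2]

theorem IsAdjointPair.sub {S T : M →L[ℂ] N} {S' T' : N →L[ℂ] M} (hS : IsAdjointPair S S')
    (hT : IsAdjointPair T T') : IsAdjointPair (S - T) (S' - T') := fun m n => by
  have h1 := hS m n
  have h2 := hT m n
  unfold HilbMod.ip at *
  rw [_root_.sub_apply, _root_.sub_apply, map_sub, map_sub, _root_.sub_apply, h1, h2]

theorem IsAdjointPair.zero : IsAdjointPair (0 : M →L[ℂ] N) 0 := fun m n => by
  unfold HilbMod.ip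
  simp

theorem theta_apply (n : N) (m x : M) : theta n m x = HilbertModule.act n (M.ip m x) := rfl

theorem theta_smul (c : ℂ) (n : N) (m : M) : c • theta n m = theta (c • n) m := by
  ext x
  simp [theta]

theorem isAdjointPair_theta (n : N) (m : M) : IsAdjointPair (theta n m) (theta m n) := fun x y => by
  rw [theta_apply, theta_apply, ip_act_left, ip_act_right, star_ip]

theorem comp_theta {S : N →L[ℂ] L}
    (hS : ∀ n (a : A), S (HilbertModule.act n a) = HilbertModule.act (S n) a) (n : N) (m : M) :
    S ∘L theta n m = theta (S n) m :=
  ContinuousLinearMap.ext fun _ => hS _ _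

theorem theta_comp {S : L →L[ℂ] M} {S' : M →L[ℂ] L} (hS : IsAdjointPair S S') (n : N) (m : M) :
    theta n m ∘L S = theta n (S' m) :=
  ContinuousLinearMap.ext fun x => congrArg (HilbertModule.act n) (hS.symm m x).symm

theorem norm_adjoint_le {S : M →L[ℂ] N} {S' : N →L[ℂ] M} (h : IsAdjointPair S S') :
    ‖S'‖ ≤ ‖HilbertModule.inner (A := A) (E := N)‖ * ‖S‖ := by
  refine ContinuousLinearMap.opNorm_le_bound _ (by positivity) fun n => ?_
  rcases (norm_nonneg (S' n)).eq_or_lt with h0 | h0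
  · rw [← h0]
    positivity
  refine le_of_mul_le_mul_right ?_ h0
  calc ‖S' n‖ * ‖S' n‖ = ‖M.ip (S' n) (S' n)‖ := by
        rw [← sq]
        exact HilbertModule.norm_sq (S' n)
    _ = ‖N.ip (S (S' n)) n‖ := by rw [h]
    _ ≤ ‖HilbertModule.inner (A := A) (E := N)‖ * ‖S (S' n)‖ * ‖n‖ :=
        (HilbertModule.inner (A := A) (E := N)).le_opNorm₂ _ _
    _ ≤ ‖HilbertModule.inner (A := A) (E := N)‖ * (‖S‖ * ‖S' n‖) * ‖n‖ := by
        gcongr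
        exact S.le_opNorm _
    _ = ‖HilbertModule.inner (A := A) (E := N)‖ * ‖S‖ * ‖n‖ * ‖S' n‖ := by ring

/-- The span of the operators `θ_{n, m}` with `m ∈ V` and `n ∈ W`. -/
def finiteRank (V : Submodule ℂ M) (W : Submodule ℂ N) : Submodule ℂ (M →L[ℂ] N) :=
  Submodule.span ℂ {T | ∃ n ∈ W, ∃ m ∈ V, T = theta n m}

variable {V : Submodule ℂ M} {W : Submodule ℂ N} {U : Submodule ℂ L}

theorem comp_mem_finiteRank {S : N →L[ℂ] L}
    (hS : ∀ n (a : A), S (HilbertModule.act n a) = HilbertModule.act (S n) a)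
    (hU : ∀ n ∈ W, S n ∈ U) {T : M →L[ℂ] N} (hT : T ∈ finiteRank V W) :
    S ∘L T ∈ finiteRank V U := by
  induction hT using Submodule.span_induction with
  | mem T hT =>
    obtain ⟨n, hn, m, hm, rfl⟩ := hT
    exact Submodule.subset_span ⟨S n, hU n hn, m, hm, comp_theta hS n m⟩
  | zero => rw [ContinuousLinearMap.comp_zero]; exact zero_mem _
  | add T₁ T₂ _ _ h₁ h₂ => rw [ContinuousLinearMap.comp_add]; exact add_mem h₁ h₂
  | smul c T _ h => rw [ContinuousLinearMap.comp_smul]; exact Submodule.smul_mem _ c h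

theorem mem_finiteRank_comp {S : L →L[ℂ] M} {S' : M →L[ℂ] L} (hS : IsAdjointPair S S')
    (hU : ∀ m ∈ V, S' m ∈ U) {T : M →L[ℂ] N} (hT : T ∈ finiteRank V W) :
    T ∘L S ∈ finiteRank U W := by
  induction hT using Submodule.span_induction with
  | mem T hT =>
    obtain ⟨n, hn, m, hm, rfl⟩ := hT
    exact Submodule.subset_span ⟨n, hn, S' m, hU m hm, theta_comp hS n m⟩
  | zero => rw [ContinuousLinearMap.zero_comp]; exact zero_mem _
  | add T₁ T₂ _ _ h₁ h₂ => rw [ContinuousLinearMap.add_comp]; exact add_mem h₁ h₂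
  | smul c T _ h => rw [ContinuousLinearMap.smul_comp]; exact Submodule.smul_mem _ c h

theorem exists_sum_theta {T : M →L[ℂ] N} (hT : T ∈ finiteRank V W) :
    ∃ (n : ℕ) (x : Fin n → N) (y : Fin n → M), (∀ i, x i ∈ W) ∧ (∀ i, y i ∈ V) ∧
      T = ∑ i, theta (x i) (y i) := by
  induction hT using Submodule.span_induction with
  | mem T hT =>
    obtain ⟨n, hn, m, hm, rfl⟩ := hT
    exact ⟨1, fun _ => n, fun _ => m, fun _ => hn, fun _ => hm, by simp⟩
  | zero => exact ⟨0, Fin.elim0, Fin.elim0, fun i => i.elim0, fun i => i.elim0, by simp⟩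
  | add T₁ T₂ _ _ h₁ h₂ =>
    obtain ⟨n, x, y, hx, hy, rfl⟩ := h₁
    obtain ⟨n', x', y', hx', hy', rfl⟩ := h₂
    refine ⟨n + n', Fin.append x x', Fin.append y y', fun i => ?_, fun i => ?_, ?_⟩
    · refine Fin.addCases (fun i => ?_) (fun i => ?_) i <;> simp [hx, hx']
    · refine Fin.addCases (fun i => ?_) (fun i => ?_) i <;> simp [hy, hy']
    · simp [Fin.sum_univ_add]
  | smul c T _ h =>
    obtain ⟨n, x, y, hx, hy, rfl⟩ := h
    refine ⟨n, fun i => c • x i, y, fun i => W.smul_mem c (hx i), hy, ?_⟩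
    simp [Finset.smul_sum, theta_smul]

theorem exists_isAdjointPair_of_mem_finiteRank {T : M →L[ℂ] N} (hT : T ∈ finiteRank V W) :
    ∃ T', IsAdjointPair T T' := by
  obtain ⟨n, x, y, -, -, rfl⟩ := exists_sum_theta hT
  have (s : Finset (Fin n)) : IsAdjointPair (∑ i ∈ s, theta (x i) (y i)) (∑ i ∈ s, theta (y i) (x i)) := by
    classical
    induction s using Finset.induction_on with
    | empty => simpa using IsAdjointPair.zero
    | insert i s hi h =>
      rw [Finset.sum_insert hi, Finset.sum_insert hi]
      exact (isAdjointPair_theta _ _).add h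
  exact ⟨_, this _⟩

/-- An adjointable operator close to the identity has an adjointable inverse. -/
theorem exists_inverse_one_sub {S S' : M →L[ℂ] M} (h : IsAdjointPair S S') (hS : ‖S‖ < 1)
    (hS' : ‖S'‖ < 1) : ∃ D D' : M →L[ℂ] M, IsAdjointPair D D' ∧
      (ContinuousLinearMap.id ℂ M - S) ∘L D = ContinuousLinearMap.id ℂ M ∧
      D ∘L (ContinuousLinearMap.id ℂ M - S) = ContinuousLinearMap.id ℂ M := by
  let D := (Units.oneSub S hS)⁻¹
  let D' := (Units.oneSub S' hS')⁻¹
  have h1 : (1 - S) * D = 1 := (Units.oneSub S hS).mul_inv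
  have h2 : (D : M →L[ℂ] M) * (1 - S) = 1 := (Units.oneSub S hS).inv_mul
  have h3 : (1 - S') * D' = 1 := (Units.oneSub S' hS').mul_inv
  refine ⟨D, D', fun m n => ?_, h1, h2⟩
  have e1 : (1 - S) ((D : M →L[ℂ] M) m) = m := DFunLike.congr_fun h1 m
  have e2 : (1 - S') ((D' : M →L[ℂ] M) n) = n := DFunLike.congr_fun h3 n
  conv_lhs => rw [← e2]
  conv_rhs => rw [← e1]
  exact ((IsAdjointPair.id.sub h) _ _).symm

/-- An inverse of `F` modulo limits of operators of finite rank can be improved to an inverse modulo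
operators of finite rank. -/
theorem exists_parametrix {F : M →L[ℂ] N} {F' : N →L[ℂ] M} {G : N →L[ℂ] M} {G' : M →L[ℂ] N}
    (hF : IsAdjointPair F F') (hG : IsAdjointPair G G')
    (hMM : ∀ S S' : M →L[ℂ] M, IsAdjointPair S S' → ∀ m ∈ V, S m ∈ V)
    (hMN : ∀ (S : M →L[ℂ] N) (S' : N →L[ℂ] M), IsAdjointPair S S' → ∀ m ∈ V, S m ∈ W)
    (hNM : ∀ (S : N →L[ℂ] M) (S' : M →L[ℂ] N), IsAdjointPair S S' → ∀ m ∈ W, S m ∈ V)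
    (hNN : ∀ S S' : N →L[ℂ] N, IsAdjointPair S S' → ∀ m ∈ W, S m ∈ W)
    (h₁ : ContinuousLinearMap.id ℂ M - G ∘L F ∈ (finiteRank V V).topologicalClosure)
    (h₂ : ContinuousLinearMap.id ℂ N - F ∘L G ∈ (finiteRank W W).topologicalClosure) :
    ∃ (H : N →L[ℂ] M) (H' : M →L[ℂ] N), IsAdjointPair H H' ∧
      ContinuousLinearMap.id ℂ M - H ∘L F ∈ finiteRank V V ∧
      ContinuousLinearMap.id ℂ N - F ∘L H ∈ finiteRank W W := by
  have key : ∀ {L : HilbMod.{u, w} A} {U : Submodule ℂ L} {S S' : L →L[ℂ] L}, IsAdjointPair S S' →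
      ContinuousLinearMap.id ℂ L - S ∈ (finiteRank U U).topologicalClosure →
      ∃ K ∈ finiteRank U U, ∃ D D' : L →L[ℂ] L, IsAdjointPair D D' ∧
        (S + K) ∘L D = ContinuousLinearMap.id ℂ L ∧ D ∘L (S + K) = ContinuousLinearMap.id ℂ L := by
    intro L U S S' hS h
    set C := ‖HilbertModule.inner (A := A) (E := L)‖ with hC
    have hC0 : 0 ≤ C := by positivity
    obtain ⟨K, hK, hlt⟩ := Metric.mem_closure_iff.mp h (1 / (C + 1)) (by positivity)
    rw [dist_eq_norm] at hlt
    obtain ⟨K', hK'⟩ := exists_isAdjointPair_of_mem_finiteRank hK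
    have had := (IsAdjointPair.id.sub hS).sub hK'
    have hlt' : ‖ContinuousLinearMap.id ℂ L - S - K‖ * (C + 1) < 1 := by
      rwa [lt_div_iff₀ (by positivity)] at hlt
    obtain ⟨D, D', hD, h3, h4⟩ := exists_inverse_one_sub had
      (by nlinarith [norm_nonneg (ContinuousLinearMap.id ℂ L - S - K)])
      ((norm_adjoint_le had).trans_lt
        (by nlinarith [norm_nonneg (ContinuousLinearMap.id ℂ L - S - K)]))
    have e : ContinuousLinearMap.id ℂ L - (ContinuousLinearMap.id ℂ L - S - K) = S + K := by abel
    rw [e] at h3 h4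
    exact ⟨K, hK, D, D', hD, h3, h4⟩
  obtain ⟨K₁, hK₁, D₁, D₁', hD₁, -, h4⟩ := key (hG.comp hF) h₁
  obtain ⟨K₂, hK₂, D₂, D₂', hD₂, h5, -⟩ := key (hF.comp hG) h₂
  have hH : IsAdjointPair (G ∘L D₂) (D₂' ∘L G') := hG.comp hD₂
  have hG₁ : IsAdjointPair (D₁ ∘L G) (G' ∘L D₁') := hD₁.comp hG
  -- The left inverse `D₁ G` and the right inverse `G D₂` agree up to finite rank.
  have hr : ContinuousLinearMap.id ℂ N - F ∘L G ∘L D₂ ∈ finiteRank W W := by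
    have e : ContinuousLinearMap.id ℂ N - F ∘L G ∘L D₂ = K₂ ∘L D₂ := by
      rw [← h5, ContinuousLinearMap.add_comp]
      exact add_sub_cancel_left _ _
    rw [e]
    exact mem_finiteRank_comp hD₂ (hNN _ _ hD₂.symm) hK₂
  have hl : ContinuousLinearMap.id ℂ M - D₁ ∘L G ∘L F ∈ finiteRank V V := by
    have e : ContinuousLinearMap.id ℂ M - D₁ ∘L G ∘L F = D₁ ∘L K₁ := by
      rw [← h4, ContinuousLinearMap.comp_add]
      exact add_sub_cancel_left _ _
    rw [e]
    exact comp_mem_finiteRank hD₁.map_act (hMM _ _ hD₁) hK₁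
  have hd : G ∘L D₂ - D₁ ∘L G ∈ finiteRank W V := by
    have e : G ∘L D₂ - D₁ ∘L G = (ContinuousLinearMap.id ℂ M - D₁ ∘L G ∘L F) ∘L (G ∘L D₂)
        - (D₁ ∘L G) ∘L (ContinuousLinearMap.id ℂ N - F ∘L G ∘L D₂) := by
      ext x
      simp
    rw [e]
    exact sub_mem (mem_finiteRank_comp hH (hMN _ _ hH.symm) hl)
      (comp_mem_finiteRank hG₁.map_act (hNM _ _ hG₁) hr)
  refine ⟨G ∘L D₂, D₂' ∘L G', hH, ?_, hr⟩
  have e : ContinuousLinearMap.id ℂ M - (G ∘L D₂) ∘L F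
      = (ContinuousLinearMap.id ℂ M - D₁ ∘L G ∘L F) - (G ∘L D₂ - D₁ ∘L G) ∘L F := by
    ext x
    simp
  rw [e]
  exact sub_mem hl (mem_finiteRank_comp hF (hNM _ _ hF.symm) hd)

theorem continuous_theta_left (m : M) : Continuous fun n : N => theta n m := by
  change Continuous fun n : N => (ContinuousLinearMap.compL ℂ M A N
    (HilbertModule.act (A := A) n)) (HilbertModule.inner (A := A) (E := M) m)
  fun_prop

/-- The vectors `n · a` with `a ∈ A` are dense in `N`. -/
theorem mem_closure_range_act (n : N) :
    n ∈ closure (Set.range fun a : A => (HilbertModule.act n a : N)) := by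
  let := CStarAlgebra.spectralOrder A
  let := CStarAlgebra.spectralOrderedRing A
  set a := N.ip n n with ha
  have hl := CStarAlgebra.increasingApproximateUnit A
  refine Metric.mem_closure_iff.mpr fun ε hε => ?_
  have h1 : ∀ᶠ u in CStarAlgebra.approximateUnit A, dist (a * u) a < ε ^ 2 / 2 :=
    (hl.tendsto_mul_left a).eventually (Metric.ball_mem_nhds _ (by positivity))
  obtain ⟨u, hu1, hu2, hu3⟩ := (h1.and (hl.eventually_star_eq.and hl.eventually_norm)).exists
  refine ⟨_, ⟨u, rfl⟩, ?_⟩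
  rw [dist_eq_norm] at hu1 ⊢
  have h2 : N.ip (n - HilbertModule.act n u) (n - HilbertModule.act n u)
      = u * (a * u - a) - (a * u - a) := by
    have e1 : ∀ x y z : N, N.ip (x - y) z = N.ip x z - N.ip y z := fun x y z => by
      unfold HilbMod.ip
      rw [map_sub, _root_.sub_apply]
    have e2 : ∀ x y z : N, N.ip x (y - z) = N.ip x y - N.ip x z := fun x y z => by
      unfold HilbMod.ip
      rw [map_sub]
    rw [e1, e2, e2, ip_act_right, ip_act_left, ip_act_left, ip_act_right, hu2, mul_sub]
    abel
  refine lt_of_pow_lt_pow_left₀ 2 hε.le ?_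
  calc ‖n - HilbertModule.act n u‖ ^ 2 = ‖u * (a * u - a) - (a * u - a)‖ := by
        rw [← h2]
        exact HilbertModule.norm_sq _
    _ ≤ ‖u‖ * ‖a * u - a‖ + ‖a * u - a‖ :=
        (norm_sub_le _ _).trans (add_le_add_left (norm_mul_le _ _) _)
    _ ≤ 1 * ‖a * u - a‖ + ‖a * u - a‖ := by gcongr
    _ < ε ^ 2 := by linarith

end FiniteRank

/-! ### Interior tensor products inside Hilbert modules -/

section Descent

universe v w

variable {A : Type w} [NonUnitalCStarAlgebra A] {B : Type v} [NonUnitalCStarAlgebra B]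

theorem norm_map_of_injective {φ : B →⋆ₙₐ[ℂ] A} (hφ : Function.Injective φ) (b : B) :
    ‖φ b‖ = ‖b‖ :=
  NonUnitalStarAlgHom.norm_map φ hφ b

/-- A realization of the correspondence `E` inside the algebra `A`, such that the inner product
becomes `star x * y` and the elements `x * star y` span a dense subspace of `A`. Here `B` is a
subalgebra of `A` through `φ`. -/
structure CornerEmbedding (φ : B →⋆ₙₐ[ℂ] A) (E : HilbMod.{v, w} B) [Correspondence A B E] where
  toFun : E →L[ℂ] A
  injective : Function.Injective φ
  map_left : ∀ (a : A) (e : E), toFun (Correspondence.left B a e) = a * toFun e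
  star_mul : ∀ e e' : E, star (toFun e) * toFun e' = φ (E.ip e e')
  map_act : ∀ (e : E) (b : B), toFun (HilbertModule.act e b) = toFun e * φ b
  dense : ∀ a : A,
    a ∈ (Submodule.span ℂ {x | ∃ e e', x = toFun e * star (toFun e')}).topologicalClosure

variable {φ : B →⋆ₙₐ[ℂ] A} {E : HilbMod.{v, w} B} [Correspondence A B E]

/-- A realization of the interior tensor product `M ⊗ E` as the closed subspace `M · E` of `M`. -/
structure Descent (κ : CornerEmbedding φ E) (M : HilbMod.{w, w} A) (M' : HilbMod.{v, w} B) where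
  j : M' →L[ℂ] M
  ip_map : ∀ z z', M.ip (j z) (j z') = φ (M'.ip z z')
  act_mem : ∀ (m : M) (e : E), ∃ z, j z = HilbertModule.act m (κ.toFun e)
  dense : ∀ z, j z ∈ (Submodule.span ℂ
    {x : M | ∃ m e, x = HilbertModule.act m (κ.toFun e)}).topologicalClosure

variable {κ : CornerEmbedding φ E} {M N : HilbMod.{w, w} A} {M' N' : HilbMod.{v, w} B}

namespace Descent

variable (d : Descent κ M M') (d' : Descent κ N N')

theorem norm_map (z : M') : ‖d.j z‖ = ‖z‖ := by
  have h1 : ‖d.j z‖ ^ 2 = ‖M.ip (d.j z) (d.j z)‖ := HilbertModule.norm_sq (A := A) _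
  have h2 : ‖z‖ ^ 2 = ‖M'.ip z z‖ := HilbertModule.norm_sq (A := B) _
  rw [d.ip_map, norm_map_of_injective κ.injective, ← h2] at h1
  exact (sq_eq_sq₀ (norm_nonneg _) (norm_nonneg _)).mp h1

theorem isometry : Isometry d.j := AddMonoidHomClass.isometry_of_norm _ d.norm_map

theorem injective : Function.Injective d.j := d.isometry.injective

theorem isClosed_range : IsClosed (Set.range d.j) := d.isometry.isClosedEmbedding.isClosed_range

theorem map_act (z : M') (b : B) :
    d.j (HilbertModule.act z b) = HilbertModule.act (d.j z) (φ b) := by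
  have h1 : ∀ z', M.ip (d.j z') (d.j (HilbertModule.act z b) - HilbertModule.act (d.j z) (φ b)) = 0 := by
    intro z'
    have := ip_act_right M (d.j z') (d.j z) (φ b)
    have h2 := d.ip_map z' (HilbertModule.act z b)
    rw [ip_act_right, map_mul, ← d.ip_map] at h2
    unfold HilbMod.ip at *
    rw [map_sub, this, h2, sub_self]
  refine sub_eq_zero.mp (ip_self_eq_zero (A := A) ?_)
  set x := d.j (HilbertModule.act z b) - HilbertModule.act (d.j z) (φ b) with hx
  have h3 : M.ip x x = M.ip (d.j (HilbertModule.act z b)) x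
      - M.ip (HilbertModule.act (d.j z) (φ b)) x := by
    unfold HilbMod.ip
    conv_lhs => rw [hx]
    rw [map_sub HilbertModule.inner, _root_.sub_apply]
  rw [h3, ip_act_left, h1, h1, mul_zero, sub_zero]

theorem map_theta (z : N') (z' x : M') :
    d'.j (theta z z' x) = theta (d'.j z) (d.j z') (d.j x) := by
  rw [theta_apply, theta_apply, d'.map_act, d.ip_map]

/-- Module maps preserve the subspaces `M · E`. -/
theorem exists_map_eq {S : M →L[ℂ] N}
    (hS : ∀ m (a : A), S (HilbertModule.act m a) = HilbertModule.act (S m) a) (z : M') :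
    ∃ z', d'.j z' = S (d.j z) := by
  have h := d.dense z
  have hle : (Submodule.span ℂ {x : M | ∃ m e, x = HilbertModule.act m (κ.toFun e)}).topologicalClosure
      ≤ (LinearMap.range (d'.j : N' →ₗ[ℂ] N)).comap (S : M →ₗ[ℂ] N) := by
    refine Submodule.topologicalClosure_minimal _ (Submodule.span_le.mpr ?_) ?_
    · rintro x ⟨m, e, rfl⟩
      obtain ⟨z', hz'⟩ := d'.act_mem (S m) e
      exact ⟨z', hz'.trans (hS _ _).symm⟩
    · exact d'.isClosed_range.preimage S.continuous
  exact hle h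

/-- The restriction of a module map to the subspaces `M · E`. -/
theorem exists_restrict {S : M →L[ℂ] N}
    (hS : ∀ m (a : A), S (HilbertModule.act m a) = HilbertModule.act (S m) a) :
    ∃ S' : M' →L[ℂ] N', ∀ z, d'.j (S' z) = S (d.j z) := by
  choose f hf using d.exists_map_eq d' hS
  refine ⟨LinearMap.mkContinuous ⟨⟨f, fun x y => d'.injective ?_⟩, fun c x => d'.injective ?_⟩ ‖S‖
    fun x => ?_, hf⟩
  · simp [hf]
  · simp [hf]
  · change ‖f x‖ ≤ _
    rw [← d'.norm_map, hf, ← d.norm_map x]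
    exact S.le_opNorm _

/-- The subspace `M · E`. -/
def space : Submodule ℂ M := LinearMap.range (d.j : M' →ₗ[ℂ] M)

theorem map_mem_space {S : M →L[ℂ] N} {S' : N →L[ℂ] M} (h : IsAdjointPair S S') (m : M)
    (hm : m ∈ d.space) : S m ∈ d'.space := by
  obtain ⟨z, rfl⟩ := hm
  exact d.exists_map_eq d' h.map_act z

/-- As the elements `x * star y` with `x` and `y` in `E` span a dense subspace of `A`, the compact
operators are limits of operators of finite rank with vectors in `M · E`. -/
theorem compactOps_le : compactOps M N ≤ (finiteRank d.space d'.space).topologicalClosure := by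
  refine Submodule.topologicalClosure_minimal _ (Submodule.span_le.mpr ?_)
    (Submodule.isClosed_topologicalClosure _)
  rintro T ⟨n, m, rfl⟩
  have h1 : ∀ a : A, theta (HilbertModule.act n a : N) m
      ∈ (finiteRank d.space d'.space).topologicalClosure := by
    intro a
    let f : A →ₗ[ℂ] (M →L[ℂ] N) :=
      { toFun := fun a => theta (HilbertModule.act n a : N) m
        map_add' := fun a b => by
          ext x
          simp [theta]
        map_smul' := fun c a => by
          ext x
          simp [theta] }
    have hf : Continuous f := (continuous_theta_left m).comp (HilbertModule.act (A := A) n).continuous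
    have hle : (Submodule.span ℂ
        {x | ∃ e e', x = κ.toFun e * star (κ.toFun e')}).topologicalClosure
        ≤ ((finiteRank d.space d'.space).topologicalClosure).comap f := by
      refine Submodule.topologicalClosure_minimal _ (Submodule.span_le.mpr ?_) ?_
      · rintro x ⟨e, e', rfl⟩
        refine Submodule.le_topologicalClosure _ (Submodule.subset_span ?_)
        refine ⟨HilbertModule.act n (κ.toFun e), d'.act_mem n e, HilbertModule.act m (κ.toFun e'),
          d.act_mem m e', ?_⟩
        ext x
        change HilbertModule.act (HilbertModule.act n (κ.toFun e * star (κ.toFun e'))) (M.ip m x)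
          = HilbertModule.act (HilbertModule.act n (κ.toFun e))
            (M.ip (HilbertModule.act m (κ.toFun e')) x)
        rw [ip_act_left, ← HilbertModule.act_mul, ← HilbertModule.act_mul, mul_assoc]
      · exact (Submodule.isClosed_topologicalClosure _).preimage hf
    exact hle (κ.dense a)
  have hc : IsClosed {n : N | theta n m ∈ (finiteRank d.space d'.space).topologicalClosure} :=
    (Submodule.isClosed_topologicalClosure _).preimage (continuous_theta_left m)
  exact closure_minimal (by rintro _ ⟨a, rfl⟩; exact h1 a) hc (mem_closure_range_act (A := A) n)

theorem restrict_mem_finiteRank {T : M →L[ℂ] N} (hT : T ∈ finiteRank d.space d'.space)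
    {T' : M' →L[ℂ] N'} (h : ∀ z, d'.j (T' z) = T (d.j z)) :
    T' ∈ Submodule.span ℂ {T | ∃ (n : N') (m : M'), T = theta n m} := by
  obtain ⟨n, x, y, hx, hy, rfl⟩ := exists_sum_theta hT
  choose x' hx' using hx
  choose y' hy' using hy
  have : T' = ∑ i, theta (x' i) (y' i) := by
    ext z
    refine d'.injective ?_
    rw [h, _root_.sum_apply, _root_.sum_apply, map_sum]
    refine Finset.sum_congr rfl fun i _ => ?_
    rw [d.map_theta d', ← hx', ← hy']
    rfl
  rw [this]
  exact Submodule.sum_mem _ fun i _ => Submodule.subset_span ⟨_, _, rfl⟩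

theorem restrict_mem_compactOps {T : M →L[ℂ] N} (hT : T ∈ compactOps M N)
    {T' : M' →L[ℂ] N'} (h : ∀ z, d'.j (T' z) = T (d.j z)) : T' ∈ compactOps M' N' := by
  refine Metric.mem_closure_iff.mpr fun ε hε => ?_
  obtain ⟨K, hK, hlt⟩ := Metric.mem_closure_iff.mp (d.compactOps_le d' hT) ε hε
  obtain ⟨K₀, hK₀⟩ := exists_isAdjointPair_of_mem_finiteRank hK
  obtain ⟨K', hK'⟩ := d.exists_restrict d' hK₀.map_act
  refine ⟨K', d.restrict_mem_finiteRank d' hK hK', lt_of_le_of_lt ?_ hlt⟩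
  rw [dist_eq_norm, dist_eq_norm]
  refine ContinuousLinearMap.opNorm_le_bound _ (norm_nonneg _) fun z => ?_
  rw [← d'.norm_map, ← d.norm_map z, _root_.sub_apply, map_sub, h, hK', ← _root_.sub_apply]
  exact (T - K).le_opNorm _

theorem restrict_isAdjointPair {S : M →L[ℂ] N} {T : N →L[ℂ] M} (hST : IsAdjointPair S T)
    {S' : M' →L[ℂ] N'} {T' : N' →L[ℂ] M'} (hS : ∀ z, d'.j (S' z) = S (d.j z))
    (hT : ∀ z, d.j (T' z) = T (d'.j z)) : IsAdjointPair S' T' := fun x y =>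
  κ.injective (by rw [← d'.ip_map, hS, hST, ← hT, d.ip_map])

end Descent

theorem colMap_rowMap {A : Type w} [NonUnitalCStarAlgebra A] {M N : HilbMod.{w, v} A} {ι : Type*}
    [Fintype ι] (x : ι → N) (y : ι → M) (m : M) :
    colMap x (rowMap y m) = (∑ i, theta (x i) (y i)) m := by
  rw [_root_.sum_apply]
  refine Finset.sum_congr rfl fun i _ => ?_
  change N.actU (x i) (M.ip (y i) m : A) = _
  simp [HilbMod.actU, theta_apply]

theorem Descent.map_colMap (d : Descent κ M M') {ι : Type*} [Fintype ι] (x : ι → M')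
    (c : ι → Unitization ℂ B) :
    d.j (colMap x c) = colMap (fun i => d.j (x i)) (Unitization.starMap φ ∘ c) := by
  refine (map_sum d.j _ _).trans (Finset.sum_congr rfl fun i _ => ?_)
  change d.j (M'.actU (x i) (c i)) = M.actU (d.j (x i)) (Unitization.starMap φ (c i))
  simp [HilbMod.actU, d.map_act, Unitization.algebraMap_eq_inl]

theorem Descent.rowMap_map (d : Descent κ M M') {ι : Type*} (y : ι → M') (z : M') :
    rowMap (fun i => d.j (y i)) (d.j z) = Unitization.starMap φ ∘ rowMap y z := by
  ext i : 1
  change ((M.ip (d.j (y i)) (d.j z) : A) : Unitization ℂ A)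
    = Unitization.starMap φ ((M'.ip (y i) z : B) : Unitization ℂ B)
  rw [d.ip_map, Unitization.starMap_inr]

theorem K0.map_eq_of_incl_eq {ι κ : Type*} [Fintype ι] [Fintype κ] {b : K0 B} {a : K0 A}
    {e : Matrix ι ι (Unitization ℂ B)} {f : Matrix ι ι (Unitization ℂ A)} (he : IsIdempotentElem e)
    (hf : IsIdempotentElem f)
    (hef : e.map (Unitization.starMap φ : Unitization ℂ B →+* Unitization ℂ A) = f)
    (hb : K0.incl b = idemClass e he - freeClass (Unitization ℂ B) κ)
    (ha : K0.incl a = idemClass f hf - freeClass (Unitization ℂ A) κ) : K0.map φ b = a := by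
  subst hef
  refine K0.incl_injective ?_
  rw [K0.incl_map, hb, ha, map_sub, map_freeClass]
  exact congrArg (· - _) (idemClass_map _ he hf)

/-- If a parametrix of `F` restricts to a parametrix of `F'`, with remainders of finite rank given by the
same vectors, then the index of `F'` is sent to the index of `F`: both are given by the same matrix. -/
theorem exists_hasIndex_map_of_parametrix (d : Descent κ M M') (d' : Descent κ N N') {F : M →L[ℂ] N}
    {F' : M' →L[ℂ] N'} (hF : IsFredholm F) (hF' : IsFredholm F')
    (hFF' : ∀ z, d'.j (F' z) = F (d.j z)) {H : N →ₗ[(Unitization ℂ A)ᵐᵒᵖ] M}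
    {H' : N' →ₗ[(Unitization ℂ B)ᵐᵒᵖ] M'} (hH : ∀ z, d.j (H' z) = H (d'.j z)) {m n : ℕ}
    {x y : Fin n → N'} {z w : Fin m → M'}
    (h₁ : toLinR F hF.map_act ∘ₗ H + colMap (fun i => d'.j (x i)) ∘ₗ rowMap (fun i => d'.j (y i))
      = LinearMap.id)
    (h₂ : H ∘ₗ toLinR F hF.map_act + colMap (fun i => d.j (z i)) ∘ₗ rowMap (fun i => d.j (w i))
      = LinearMap.id)
    (h₃ : toLinR F' hF'.map_act ∘ₗ H' + colMap x ∘ₗ rowMap y = LinearMap.id)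
    (h₄ : H' ∘ₗ toLinR F' hF'.map_act + colMap z ∘ₗ rowMap w = LinearMap.id) :
    ∃ y : K0 B, HasIndex F' y ∧ HasIndex F (K0.map φ y) := by
  obtain ⟨c, hc, hc'⟩ := exists_hasIndex hF' h₃ h₄
  obtain ⟨b, hb, hb'⟩ := exists_hasIndex hF h₁ h₂
  refine ⟨c, hc, ?_⟩
  have hmat := indexMat_map (F' := toLinR F' hF'.map_act) (G' := H') (X' := colMap x)
    (Y' := rowMap y) (Z' := colMap z) (W' := rowMap w) (F := toLinR F hF.map_act)
    (G := H) (X := colMap fun i => d'.j (x i))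
    (Y := rowMap fun i => d'.j (y i)) (Z := colMap fun i => d.j (z i))
    (W := rowMap fun i => d.j (w i))
    (Unitization.starMap φ : Unitization ℂ B →+* Unitization ℂ A)
    (d.j : M' →ₗ[ℂ] M).toAddMonoidHom (d'.j : N' →ₗ[ℂ] N).toAddMonoidHom
    (fun m => (hFF' m).symm) (fun n => (hH n).symm) (fun c => (d'.map_colMap x c).symm)
    (fun n => d'.rowMap_map y n) (fun c => (d.map_colMap z c).symm) (fun m => d.rowMap_map w m)
  rwa [K0.map_eq_of_incl_eq _ _ hmat hc' hb']

/-- The index of `F ⊗ 1` is mapped to the index of `F` by `φ`. -/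
theorem exists_hasIndex_map (d : Descent κ M M') (d' : Descent κ N N') {F : M →L[ℂ] N}
    {F' : M' →L[ℂ] N'} (hFF' : ∀ z, d'.j (F' z) = F (d.j z)) (hF : IsFredholm F) :
    ∃ y : K0 B, HasIndex F' y ∧ HasIndex F (K0.map φ y) := by
  have hF₀ := hF
  obtain ⟨Fs, G, Gs, h1, h2, h3, h4⟩ := hF₀
  -- The restriction of `F` is a Fredholm operator.
  have hF' : IsFredholm F' := by
    obtain ⟨Fs', hFs'⟩ := d'.exists_restrict d h1.symm.map_act
    obtain ⟨G', hG'⟩ := d'.exists_restrict d h2.map_act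
    obtain ⟨Gs', hGs'⟩ := d.exists_restrict d' h2.symm.map_act
    refine ⟨Fs', G', Gs', d.restrict_isAdjointPair d' h1 hFF' hFs',
      d'.restrict_isAdjointPair d h2 hG' hGs', d.restrict_mem_compactOps d h3 fun z => ?_,
      d'.restrict_mem_compactOps d' h4 fun z => ?_⟩
    · simp [hG', hFF']
    · simp [hG', hFF']
  obtain ⟨H, H', hH, h5, h6⟩ := exists_parametrix (V := d.space) (W := d'.space) h1 h2
    (fun S S' h => d.map_mem_space d h) (fun S S' h => d.map_mem_space d' h)
    (fun S S' h => d'.map_mem_space d h) (fun S S' h => d'.map_mem_space d' h)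
    (d.compactOps_le d h3) (d'.compactOps_le d' h4)
  obtain ⟨k, z, w, hz, hw, h5⟩ := exists_sum_theta h5
  obtain ⟨n, x, y, hx, hy, h6⟩ := exists_sum_theta h6
  choose z' hz' using hz
  choose w' hw' using hw
  choose x' hx' using hx
  choose y' hy' using hy
  obtain rfl : (fun i => d.j (z' i)) = z := funext hz'
  obtain rfl : (fun i => d.j (w' i)) = w := funext hw'
  obtain rfl : (fun i => d'.j (x' i)) = x := funext hx'
  obtain rfl : (fun i => d'.j (y' i)) = y := funext hy'
  obtain ⟨G', hG'⟩ := d'.exists_restrict d hH.map_act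
  have hG'a : ∀ n (b : B), G' (HilbertModule.act n b) = HilbertModule.act (G' n) b := fun n b =>
    d.injective (by rw [hG', d'.map_act, hH.map_act, d.map_act, hG'])
  have e1 : ∀ n, F (H n) + colMap (fun i => d'.j (x' i)) (rowMap (fun i => d'.j (y' i)) n) = n := by
    intro n
    rw [colMap_rowMap, ← h6]
    simp
  have e2 : ∀ m, H (F m) + colMap (fun i => d.j (z' i)) (rowMap (fun i => d.j (w' i)) m) = m := by
    intro m
    rw [colMap_rowMap, ← h5]
    simp
  have e3 : ∀ n, F' (G' n) + colMap x' (rowMap y' n) = n := fun n => d'.injective (by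
    rw [map_add, hFF', hG', d'.map_colMap, ← d'.rowMap_map, e1])
  have e4 : ∀ m, G' (F' m) + colMap z' (rowMap w' m) = m := fun m => d.injective (by
    rw [map_add, hG', hFF', d.map_colMap, ← d.rowMap_map, e2])
  exact exists_hasIndex_map_of_parametrix d d' hF hF' hFF' (H := toLinR H hH.map_act)
    (H' := toLinR G' hG'a) hG' (LinearMap.ext e1) (LinearMap.ext e2) (LinearMap.ext e3)
    (LinearMap.ext e4)

/-- An interior tensor product with `E` can be realized as the closed subspace `M · E` of `M`. -/
theorem exists_descent (κ : CornerEmbedding φ E) {t : M → E → M'} (ht : IsInteriorTensor E M M' t) :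
    ∃ d : Descent κ M M', ∀ m e, d.j (t m e) = HilbertModule.act m (κ.toFun e) := by
  let e₀ : (M × E →₀ ℂ) →ₗ[ℂ] M' := Finsupp.linearCombination ℂ fun p => t p.1 p.2
  let f₀ : (M × E →₀ ℂ) →ₗ[ℂ] M :=
    Finsupp.linearCombination ℂ fun p => HilbertModule.act p.1 (κ.toFun p.2)
  have hrange : Set.range e₀ = Submodule.span ℂ {z : M' | ∃ m e, z = t m e} := by
    have : {z : M' | ∃ m e, z = t m e} = Set.range fun p : M × E => t p.1 p.2 := by
      ext z
      simp [eq_comm]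
    rw [this, ← Finsupp.range_linearCombination]
    rfl
  have hdense : DenseRange e₀ := by
    rw [DenseRange, hrange]
    exact ht.2
  have hip : ∀ l l', M.ip (f₀ l) (f₀ l') = φ (M'.ip (e₀ l) (e₀ l')) := by
    intro l l'
    unfold HilbMod.ip
    induction l using Finsupp.induction_linear with
    | zero => simp
    | add a b ha hb => simp [map_add, ha, hb]
    | single p c =>
      induction l' using Finsupp.induction_linear with
      | zero => simp
      | add a b ha hb => simp [map_add, ha, hb]
      | single q c' =>
        have h : M.ip (HilbertModule.act p.1 (κ.toFun p.2)) (HilbertModule.act q.1 (κ.toFun q.2))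
            = φ (M'.ip (t p.1 p.2) (t q.1 q.2)) := by
          rw [ht.1, ← κ.star_mul, κ.map_left, ip_act_left, ip_act_right]
        unfold HilbMod.ip at h
        simp [e₀, f₀, h]
  have hnorm : ∀ l, ‖f₀ l‖ = ‖e₀ l‖ := by
    intro l
    have h1 : ‖f₀ l‖ ^ 2 = ‖M.ip (f₀ l) (f₀ l)‖ := HilbertModule.norm_sq (A := A) _
    have h2 : ‖e₀ l‖ ^ 2 = ‖M'.ip (e₀ l) (e₀ l)‖ := HilbertModule.norm_sq (A := B) _
    rw [hip, norm_map_of_injective κ.injective, ← h2] at h1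
    exact (sq_eq_sq₀ (norm_nonneg _) (norm_nonneg _)).mp h1
  have hext := LinearMap.extendOfNorm_eq (f := f₀) (e := e₀) hdense
    ⟨1, fun l => by rw [one_mul, hnorm]⟩
  set j : M' →L[ℂ] M := f₀.extendOfNorm e₀
  have hj : ∀ m e, j (t m e) = HilbertModule.act m (κ.toFun e) := fun m e => by
    have := hext (Finsupp.single (m, e) 1)
    simpa [e₀, f₀] using this
  refine ⟨⟨j, fun z z' => ?_, fun m e => ⟨_, hj m e⟩, fun z => ?_⟩, hj⟩
  · refine hdense.induction_on₂ (p := fun z z' => M.ip (j z) (j z') = φ (M'.ip z z')) ?_ ?_ z z'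
    · refine isClosed_eq ?_ ((continuous_starHom φ).comp ?_)
      · change Continuous fun p : M' × M' => (HilbertModule.inner (A := A) (j p.1)) (j p.2)
        fun_prop
      · change Continuous fun p : M' × M' => (HilbertModule.inner (A := B) p.1) p.2
        fun_prop
    · intro l l'
      rw [hext, hext, hip]
  · refine hdense.induction_on (p := fun z => j z ∈ _) z
      ((Submodule.isClosed_topologicalClosure _).preimage j.continuous) fun l => ?_
    rw [hext]
    refine Submodule.le_topologicalClosure _ ?_
    induction l using Finsupp.induction_linear with
    | zero => simp
    | add a b ha hb => rw [map_add]; exact add_mem ha hb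
    | single p c =>
      rw [Finsupp.linearCombination_single]
      exact Submodule.smul_mem _ _ (Submodule.subset_span ⟨_, _, rfl⟩)

/-- `φ_*` takes any value of `E_*` at `x` to `x`. -/
theorem ExelRel.map_eq (κ : CornerEmbedding φ E) {x : K0 A} {y : K0 B} (h : ExelRel E x y) :
    K0.map φ y = x := by
  obtain ⟨M, N, F, M', N', t, t', F', ht, ht', hF, hx, hy⟩ := h
  obtain ⟨d, hd⟩ := exists_descent κ ht
  obtain ⟨d', hd'⟩ := exists_descent κ ht'
  have hFF' : ∀ z, d'.j (F' z) = F (d.j z) := by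
    have h1 : IsClosed {z | d'.j (F' z) = F (d.j z)} :=
      isClosed_eq (d'.j.continuous.comp F'.continuous) (F.continuous.comp d.j.continuous)
    have h2 : (Submodule.span ℂ {z : M' | ∃ m e, z = t m e} : Set M') ⊆
        {z | d'.j (F' z) = F (d.j z)} := by
      have : Submodule.span ℂ {z : M' | ∃ m e, z = t m e} ≤
          LinearMap.eqLocus ((d'.j ∘L F' : M' →L[ℂ] N) : M' →ₗ[ℂ] N) (F ∘L d.j : M' →L[ℂ] N) := by
        refine Submodule.span_le.mpr ?_
        rintro z ⟨m, e, rfl⟩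
        change d'.j (F' (t m e)) = F (d.j (t m e))
        rw [hF, hd, hd', hx.1.map_act]
      exact this
    intro z
    exact closure_minimal h2 h1 (ht.2 z)
  obtain ⟨c, hc, hc'⟩ := exists_hasIndex_map d d' hFF' hx.1
  rw [hy.unique hc, hx.unique hc']

end Descent

/-! ### Closed submodules as Hilbert modules -/

section Submodules

universe u v w

attribute [local instance] CStarAlgebra.spectralOrder CStarAlgebra.spectralOrderedRing

/-- An element of a C*-subalgebra that is positive in the larger algebra is positive: otherwise its
negative part `n` would give a negative element `n * c * n` that is positive in the larger algebra. -/
theorem exists_eq_star_mul_self_of_map {A B : Type*} [NonUnitalCStarAlgebra A]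
    [NonUnitalCStarAlgebra B] {φ : B →⋆ₙₐ[ℂ] A} (hφ : Function.Injective φ) {c : B} {a : A}
    (h : φ c = star a * a) : ∃ b, c = star b * b := by
  have hc : IsSelfAdjoint c := hφ (by rw [map_star, h, star_mul, star_star])
  set n := c⁻ with hn
  have hn0 : 0 ≤ n := CFC.negPart_nonneg c
  have hns : star n = n := (IsSelfAdjoint.of_nonneg hn0).star_eq
  have hcn : n * c * n = -(n * n * n) := by
    conv_lhs => rw [← CFC.posPart_sub_negPart c hc]
    rw [mul_sub, CFC.negPart_mul_posPart, zero_sub, neg_mul]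
  -- `φ (n³)` is both positive and negative.
  have h1 : star (φ (CFC.sqrt n * n)) * φ (CFC.sqrt n * n) = φ (n * n * n) := by
    rw [← map_star, ← map_mul, star_mul, hns, (IsSelfAdjoint.of_nonneg (CFC.sqrt_nonneg n)).star_eq]
    congr 1
    calc n * CFC.sqrt n * (CFC.sqrt n * n) = n * (CFC.sqrt n * CFC.sqrt n) * n := by
          simp only [mul_assoc]
      _ = n * n * n := by rw [CFC.sqrt_mul_sqrt_self n hn0]
  have h2 : φ (n * n * n) = -(star (a * φ n) * (a * φ n)) := by
    have : star (a * φ n) * (a * φ n) = φ n * (star a * a) * φ n := by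
      rw [star_mul, ← map_star, hns]
      simp only [mul_assoc]
    rw [this, ← h, ← map_mul, ← map_mul, hcn, map_neg, neg_neg]
  have h3 : φ (n * n * n) = 0 := by
    refine le_antisymm ?_ ?_
    · rw [h2, neg_nonpos]
      exact star_mul_self_nonneg _
    · rw [← h1]
      exact star_mul_self_nonneg _
  have h4 : n * n * n = 0 := hφ (by rw [h3, map_zero])
  have h5 : n * n = 0 := by
    rw [← CStarRing.star_mul_self_eq_zero_iff, star_mul, hns, ← mul_assoc, h4, zero_mul]
  have h6 : n = 0 := by rw [← CStarRing.star_mul_self_eq_zero_iff, hns, h5]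
  have h7 : 0 ≤ c := by
    rw [← CFC.posPart_sub_negPart c hc, ← hn, h6, sub_zero]
    exact CFC.posPart_nonneg c
  exact CStarAlgebra.nonneg_iff_eq_star_mul_self.mp h7

/-- A C*-algebra as a Hilbert module over itself. -/
def selfMod (C : Type w) [NonUnitalCStarAlgebra C] : HilbMod.{w, w} C where
  carrier := C
  hilbertModule :=
    { act := ContinuousLinearMap.mul ℂ C
      inner := (LinearMap.mk₂'ₛₗ (starRingEnd ℂ) (RingHom.id ℂ) (fun a b : C => star a * b)
        (fun a b c => by rw [star_add, add_mul])
        (fun r a b => by rw [star_smul, smul_mul_assoc]; rfl)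
        (fun a b c => mul_add _ _ _) (fun r a b => mul_smul_comm _ _ _)).mkContinuous₂ 1 fun a b => by
          rw [one_mul]
          exact (norm_mul_le _ _).trans_eq (by rw [norm_star])
      act_mul := fun ξ a b => (mul_assoc ξ a b).symm
      inner_act := fun ξ η a => (mul_assoc (star ξ) η a).symm
      star_inner := fun ξ η => by
        change star (star ξ * η) = star η * ξ
        rw [star_mul, star_star]
      inner_self := fun ξ => ⟨ξ, rfl⟩
      norm_sq := fun ξ => by
        rw [sq]
        exact (CStarRing.norm_star_mul_self (x := ξ)).symm }

variable {A : Type u} [NonUnitalCStarAlgebra A] {B : Type v} [NonUnitalCStarAlgebra B]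

/-- A closed subspace `S` of a Hilbert `A`-module is a Hilbert module over a subalgebra `B` of `A`
if it is stable under `B` and if its inner products lie in `B`. -/
def HilbMod.ofClosed (M : HilbMod.{u, w} A) {φ : B →⋆ₙₐ[ℂ] A} (hφ : Function.Injective φ)
    (S : Submodule ℂ M) (hS : IsClosed (S : Set M))
    (hact : ∀ s ∈ S, ∀ b, HilbertModule.act s (φ b) ∈ S)
    (hip : ∀ s ∈ S, ∀ s' ∈ S, ∃ b, φ b = M.ip s s') : HilbMod.{v, w} B :=
  have : CompleteSpace S := hS.completeSpace_coe
  have hip' : ∀ s s' : S, φ (hip s s.2 s' s'.2).choose = M.ip s s' := fun s s' =>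
    (hip s s.2 s' s'.2).choose_spec
  { carrier := S
    hilbertModule :=
      { act := (LinearMap.mk₂' ℂ ℂ (fun (s : S) (b : B) =>
            (⟨HilbertModule.act (s : M) (φ b), hact s s.2 b⟩ : S))
          (fun s s' b => Subtype.ext (by simp)) (fun c s b => Subtype.ext (by simp))
          (fun s b b' => Subtype.ext (by simp)) (fun c s b => Subtype.ext (by simp))).mkContinuous₂
          ‖HilbertModule.act (A := A) (E := M)‖ fun s b => by
            refine ((HilbertModule.act (A := A) (E := M)).le_opNorm₂ _ _).trans_eq ?_
            rw [norm_map_of_injective hφ]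
            rfl
        inner := (LinearMap.mk₂'ₛₗ (starRingEnd ℂ) (RingHom.id ℂ) (fun s s' : S =>
            (hip s s.2 s' s'.2).choose)
          (fun s s' t => hφ <| by
            rw [map_add, hip', hip', hip']
            simp [HilbMod.ip])
          (fun c s t => hφ <| by
            rw [map_smul, hip', hip']
            simp [HilbMod.ip])
          (fun s s' t => hφ <| by
            rw [map_add, hip', hip', hip']
            simp [HilbMod.ip])
          (fun c s t => hφ <| by
            rw [map_smul, hip', hip']
            simp [HilbMod.ip])).mkContinuous₂
          ‖HilbertModule.inner (A := A) (E := M)‖ fun s s' => by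
            refine Eq.trans_le ?_ ((HilbertModule.inner (A := A) (E := M)).le_opNorm₂ _ _)
            change ‖(hip s s.2 s' s'.2).choose‖ = _
            rw [← norm_map_of_injective hφ, hip']
            rfl
        act_mul := fun s a b => Subtype.ext (by
          change HilbertModule.act (s : M) (φ (a * b)) = _
          rw [map_mul, HilbertModule.act_mul]
          rfl)
        inner_act := fun s t a => hφ (by
          refine (hip' _ _).trans ?_
          refine (ip_act_right M (s : M) (t : M) (φ a)).trans ?_
          rw [map_mul]
          exact congrArg (· * φ a) (hip' s t).symm)
        star_inner := fun s t => hφ (by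
          rw [map_star]
          refine (congrArg star (hip' s t)).trans ?_
          rw [star_ip]
          exact (hip' t s).symm)
        inner_self := fun s => by
          obtain ⟨a, ha⟩ := HilbertModule.inner_self (A := A) (s : M)
          exact exists_eq_star_mul_self_of_map hφ ((hip' s s).trans ha)
        norm_sq := fun s => by
          change ‖(s : M)‖ ^ 2 = ‖(hip s s.2 s s.2).choose‖
          rw [← norm_map_of_injective hφ, hip', HilbertModule.norm_sq (A := A)]
          rfl } }

variable (M : HilbMod.{u, w} A) {φ : B →⋆ₙₐ[ℂ] A} (hφ : Function.Injective φ)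
    (S : Submodule ℂ M) (hS : IsClosed (S : Set M))
    (hact : ∀ s ∈ S, ∀ b, HilbertModule.act s (φ b) ∈ S)
    (hip : ∀ s ∈ S, ∀ s' ∈ S, ∃ b, φ b = M.ip s s')

/-- The inclusion of a closed submodule. -/
def HilbMod.ofClosedL : M.ofClosed hφ S hS hact hip →L[ℂ] M := S.subtypeL

theorem HilbMod.ofClosed_ip (s t : M.ofClosed hφ S hS hact hip) :
    φ ((M.ofClosed hφ S hS hact hip).ip s t)
      = M.ip (M.ofClosedL hφ S hS hact hip s) (M.ofClosedL hφ S hS hact hip t) :=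
  (hip _ s.2 _ t.2).choose_spec

end Submodules

/-! ### Every class is the index of a Fredholm operator -/

section Columns

universe u

attribute [local instance] CStarAlgebra.spectralOrder CStarAlgebra.spectralOrderedRing

variable {A : Type u} [NonUnitalCStarAlgebra A] {J : Type} [Fintype J] [DecidableEq J] (o : J)

theorem augmentation_apply (a : Unitization ℂ A) : augmentation A a = a.fst := rfl

variable (A) in
/-- The embedding of `A` in a corner of a matrix algebra over its unitization. -/
def cornerHom : A →⋆ₙₐ[ℂ] CStarMatrix J J (Unitization ℂ A) where
  toFun a := CStarMatrix.ofMatrix (Matrix.single o o (a : Unitization ℂ A))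
  map_smul' c a := by
    have : (Matrix.single o o ((c • a : A) : Unitization ℂ A) : Matrix J J (Unitization ℂ A))
        = c • Matrix.single o o (a : Unitization ℂ A) := by
      rw [Unitization.inr_smul, Matrix.smul_single]
    exact this
  map_zero' := by
    change Matrix.single o o ((0 : A) : Unitization ℂ A) = 0
    rw [Unitization.inr_zero, Matrix.single_zero]
  map_add' a b := by
    have : (Matrix.single o o ((a + b : A) : Unitization ℂ A) : Matrix J J (Unitization ℂ A))
        = Matrix.single o o (a : Unitization ℂ A) + Matrix.single o o (b : Unitization ℂ A) := by
      rw [Unitization.inr_add, Matrix.single_add]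
    exact this
  map_mul' a b := by
    have : (Matrix.single o o ((a * b : A) : Unitization ℂ A) : Matrix J J (Unitization ℂ A))
        = Matrix.single o o (a : Unitization ℂ A) * Matrix.single o o (b : Unitization ℂ A) := by
      rw [Unitization.inr_mul, Matrix.single_mul_single_same]
    exact this
  map_star' a := by
    change Matrix.single o o ((star a : A) : Unitization ℂ A) = (Matrix.single o o _)ᴴ
    rw [Matrix.conjTranspose_single, Unitization.inr_star]

theorem cornerHom_apply (a : A) (i j : J) :
    cornerHom A o a i j = if o = i ∧ o = j then (a : Unitization ℂ A) else 0 := rfl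

theorem cornerHom_injective : Function.Injective (cornerHom A o) := fun a b h => by
  have := congrFun (congrFun h o) o
  rw [cornerHom_apply, cornerHom_apply] at this
  simpa using this

/-- The matrices `T` with entries in `A` and columns other than the one with index `o` equal to `0`
that satisfy `P * T = T`. -/
def colSub (P : CStarMatrix J J (Unitization ℂ A)) :
    Submodule ℂ (CStarMatrix J J (Unitization ℂ A)) where
  carrier := {T | P * T = T ∧ (∀ i j, (T i j).fst = 0) ∧ ∀ i j, j ≠ o → T i j = 0}
  zero_mem' := ⟨mul_zero P, fun _ _ => rfl, fun _ _ _ => rfl⟩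
  add_mem' {S T} hS hT := ⟨by rw [mul_add, hS.1, hT.1], fun i j => by
    rw [CStarMatrix.add_apply, Unitization.fst_add, hS.2.1, hT.2.1, add_zero], fun i j hj => by
    rw [CStarMatrix.add_apply, hS.2.2 i j hj, hT.2.2 i j hj, add_zero]⟩
  smul_mem' c T hT := ⟨by rw [mul_smul_comm, hT.1], fun i j => by
    rw [CStarMatrix.smul_apply, Unitization.fst_smul, hT.2.1, smul_zero], fun i j hj => by
    rw [CStarMatrix.smul_apply, hT.2.2 i j hj, smul_zero]⟩

theorem isClosed_colSub (P : CStarMatrix J J (Unitization ℂ A)) :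
    IsClosed (colSub o P : Set (CStarMatrix J J (Unitization ℂ A))) := by
  have hc : ∀ i j, Continuous fun T : CStarMatrix J J (Unitization ℂ A) => T i j := fun i j =>
    (continuous_apply j).comp (continuous_apply i)
  have hf : Continuous fun a : Unitization ℂ A => a.fst :=
    Unitization.uniformEquivProd.continuous.fst
  have h1 : IsClosed {T : CStarMatrix J J (Unitization ℂ A) | P * T = T} :=
    isClosed_eq (continuous_const.mul continuous_id) continuous_id
  have h2 : IsClosed (⋂ i : J, ⋂ j : J,
      {T : CStarMatrix J J (Unitization ℂ A) | (T i j).fst = 0}) :=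
    isClosed_iInter fun i => isClosed_iInter fun j =>
      isClosed_eq (hf.comp (hc i j)) continuous_const
  have h3 : IsClosed (⋂ i : J, ⋂ j : J, ⋂ _ : j ≠ o,
      {T : CStarMatrix J J (Unitization ℂ A) | T i j = 0}) :=
    isClosed_iInter fun i => isClosed_iInter fun j => isClosed_iInter fun _ =>
      isClosed_eq (hc i j) continuous_const
  convert h1.inter (h2.inter h3) using 1
  ext T
  simp only [Set.mem_inter_iff, Set.mem_iInter, Set.mem_ofPred_eq]
  rfl

theorem fst_sum {ι : Type*} (s : Finset ι) (f : ι → Unitization ℂ A) :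
    (∑ i ∈ s, f i).fst = ∑ i ∈ s, (f i).fst :=
  map_sum (augmentation A) f s

variable {o} in
theorem mul_mem_colSub {P T X : CStarMatrix J J (Unitization ℂ A)}
    (hT : ∀ i j, (T i j).fst = 0) (hT' : ∀ i j, j ≠ o → T i j = 0) (hX : P * X = X) :
    X * T ∈ colSub o P := by
  refine ⟨by rw [← mul_assoc, hX], fun i j => ?_, fun i j hj => ?_⟩
  · rw [CStarMatrix.mul_apply, fst_sum]
    exact Finset.sum_eq_zero fun k _ => by rw [Unitization.fst_mul, hT, mul_zero]
  · rw [CStarMatrix.mul_apply]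
    exact Finset.sum_eq_zero fun k _ => by rw [hT' k j hj, mul_zero]

theorem mul_cornerHom_apply (T : CStarMatrix J J (Unitization ℂ A)) (a : A) (i j : J) :
    (T * cornerHom A o a) i j = if o = j then T i o * (a : Unitization ℂ A) else 0 := by
  rw [CStarMatrix.mul_apply, Finset.sum_eq_single o]
  · rw [cornerHom_apply]
    by_cases h : o = j <;> simp [h]
  · intro k _ hk
    rw [cornerHom_apply, if_neg fun h => hk h.1.symm, mul_zero]
  · simp

/-- The Hilbert module `P A^J`, realized by matrices with a single non-zero column. -/
def colMod (P : CStarMatrix J J (Unitization ℂ A)) : HilbMod.{u, u} A :=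
  (selfMod (CStarMatrix J J (Unitization ℂ A))).ofClosed (cornerHom_injective (A := A) o)
    (colSub o P) (isClosed_colSub o P)
    (fun (T : CStarMatrix J J (Unitization ℂ A)) hT b => by
      refine ⟨?_, fun i j => ?_, fun i j hj => ?_⟩
      · change P * (T * cornerHom A o b) = _
        rw [← mul_assoc, hT.1]
        rfl
      · change ((T * cornerHom A o b : CStarMatrix J J (Unitization ℂ A)) i j).fst = 0
        rw [mul_cornerHom_apply]
        split_ifs
        · rw [Unitization.fst_mul, hT.2.1, zero_mul]
        · rfl
      · change (T * cornerHom A o b : CStarMatrix J J (Unitization ℂ A)) i j = 0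
        rw [mul_cornerHom_apply, if_neg fun h => hj h.symm])
    (fun (S : CStarMatrix J J (Unitization ℂ A)) hS (T : CStarMatrix J J (Unitization ℂ A)) hT => by
      refine ⟨((star S * T : CStarMatrix J J (Unitization ℂ A)) o o).snd, ?_⟩
      change _ = (star S * T : CStarMatrix J J (Unitization ℂ A))
      ext i j : 1
      have hfst : ∀ i j, ((star S * T : CStarMatrix J J (Unitization ℂ A)) i j).fst = 0 := by
        intro i j
        rw [CStarMatrix.mul_apply, fst_sum]
        exact Finset.sum_eq_zero fun k _ => by rw [Unitization.fst_mul, hT.2.1, mul_zero]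
      rw [cornerHom_apply]
      split_ifs with h
      · obtain ⟨rfl, rfl⟩ := h
        exact Unitization.ext (hfst _ _).symm rfl
      · rw [CStarMatrix.mul_apply]
        refine (Finset.sum_eq_zero fun k _ => ?_).symm
        by_cases hi : o = i
        · rw [hT.2.2 k j fun hj => h ⟨hi, hj.symm⟩, mul_zero]
        · rw [CStarMatrix.star_apply, hS.2.2 k i fun h => hi h.symm, star_zero, zero_mul])

/-- The inclusion of `P A^J` in the matrix algebra. -/
def colIncl (P : CStarMatrix J J (Unitization ℂ A)) :
    colMod o P →L[ℂ] CStarMatrix J J (Unitization ℂ A) :=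
  HilbMod.ofClosedL _ _ _ _ _ _

variable {o}

theorem colIncl_mem {P : CStarMatrix J J (Unitization ℂ A)} (m : colMod o P) :
    colIncl o P m ∈ colSub o P := Subtype.property (p := (· ∈ colSub o P)) m

theorem colIncl_injective {P : CStarMatrix J J (Unitization ℂ A)} :
    Function.Injective (colIncl o P) := Subtype.val_injective (p := (· ∈ colSub o P))

theorem colIncl_ip {P : CStarMatrix J J (Unitization ℂ A)} (m m' : colMod o P) :
    cornerHom A o ((colMod o P).ip m m') = star (colIncl o P m) * colIncl o P m' :=
  HilbMod.ofClosed_ip _ _ _ _ _ _ m m'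

theorem colIncl_act {P : CStarMatrix J J (Unitization ℂ A)} (m : colMod o P) (a : A) :
    colIncl o P (HilbertModule.act m a) = colIncl o P m * cornerHom A o a := rfl

/-- An element of `P A^J`. -/
def colMk {P : CStarMatrix J J (Unitization ℂ A)} (T : CStarMatrix J J (Unitization ℂ A))
    (hT : T ∈ colSub o P) : colMod o P := (⟨T, hT⟩ : colSub o P)

theorem colIncl_mk {P : CStarMatrix J J (Unitization ℂ A)} (T : CStarMatrix J J (Unitization ℂ A))
    (hT : T ∈ colSub o P) : colIncl o P (colMk T hT) = T := rfl

/-- Left multiplication by a matrix as an operator `P A^J → Q A^J`. -/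
def leftOp (P Q : CStarMatrix J J (Unitization ℂ A)) (X : CStarMatrix J J (Unitization ℂ A))
    (hX : Q * X = X) : colMod o P →L[ℂ] colMod o Q :=
  ((ContinuousLinearMap.mul ℂ (CStarMatrix J J (Unitization ℂ A)) X) ∘L colIncl o P).codRestrict
    (colSub o Q) fun m => mul_mem_colSub (colIncl_mem m).2.1 (colIncl_mem m).2.2 hX

theorem colIncl_leftOp {P Q X : CStarMatrix J J (Unitization ℂ A)} (hX : Q * X = X)
    (m : colMod o P) : colIncl o Q (leftOp P Q X hX m) = X * colIncl o P m := rfl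

theorem isAdjointPair_leftOp {P Q X : CStarMatrix J J (Unitization ℂ A)} (hX : Q * X = X)
    (hX' : P * star X = star X) :
    IsAdjointPair (leftOp (o := o) P Q X hX) (leftOp Q P (star X) hX') := fun m n =>
  cornerHom_injective o (by
    rw [colIncl_ip, colIncl_ip, colIncl_leftOp, colIncl_leftOp, star_mul, mul_assoc])

theorem ofMatrix_single_mul_star (i j : J) (b c : A) :
    (CStarMatrix.ofMatrix (Matrix.single i o (b : Unitization ℂ A))) *
      star (CStarMatrix.ofMatrix (Matrix.single j o (c : Unitization ℂ A)))
      = CStarMatrix.ofMatrix (Matrix.single i j ((b * star c : A) : Unitization ℂ A)) := by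
  have : (Matrix.single i o (b : Unitization ℂ A) : Matrix J J (Unitization ℂ A)) *
      (Matrix.single j o (c : Unitization ℂ A))ᴴ
      = Matrix.single i j ((b * star c : A) : Unitization ℂ A) := by
    rw [Matrix.conjTranspose_single, Matrix.single_mul_single_same, Unitization.inr_mul,
      Unitization.inr_star]
  exact this

theorem mul_single_mem (P : CStarMatrix J J (Unitization ℂ A)) (hP : P * P = P) (i : J) (b : A) :
    P * CStarMatrix.ofMatrix (Matrix.single i o (b : Unitization ℂ A)) ∈ colSub o P := by
  refine mul_mem_colSub (fun k l => ?_) (fun k l hl => ?_) hP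
  · change (Matrix.single i o (b : Unitization ℂ A) k l).fst = 0
    rw [Matrix.single_apply]
    split_ifs <;> rfl
  · change Matrix.single i o (b : Unitization ℂ A) k l = 0
    rw [Matrix.single_apply, if_neg fun h => hl h.2.symm]

/-- Left multiplication by a matrix with entries in `A` is compact. -/
theorem leftOp_mem_compactOps {P Q X : CStarMatrix J J (Unitization ℂ A)} (hP : IsStarProjection P)
    (hQ : IsStarProjection Q) (hX : Q * X = X) (hX' : X * P = X) (hA : ∀ i j, (X i j).fst = 0) :
    leftOp (o := o) P Q X hX ∈ compactOps (colMod o P) (colMod o Q) := by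
  have hQQ : Q * Q = Q := hQ.isIdempotentElem.eq
  have hPP : P * P = P := hP.isIdempotentElem.eq
  -- Operators given by a matrix with a single entry.
  have key : ∀ (i j : J) (a : A),
      leftOp (o := o) P Q (Q * CStarMatrix.ofMatrix (Matrix.single i j (a : Unitization ℂ A)) * P)
        (by rw [← mul_assoc, ← mul_assoc, hQQ]) ∈ compactOps (colMod o P) (colMod o Q) := by
    intro i j a
    have ha : a ∈ Submodule.span ℂ {a : A | 0 ≤ a} := by
      rw [CStarAlgebra.span_nonneg]
      trivial
    induction ha using Submodule.span_induction with
    | mem a ha =>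
      obtain ⟨b, rfl⟩ := CStarAlgebra.nonneg_iff_eq_star_mul_self.mp (Set.mem_ofPred.mp ha)
      refine Submodule.le_topologicalClosure _ (Submodule.subset_span
        ⟨colMk _ (mul_single_mem Q hQQ i (star b)), colMk _ (mul_single_mem P hPP j (star b)), ?_⟩)
      refine ContinuousLinearMap.ext fun m => colIncl_injective ?_
      rw [colIncl_leftOp, theta_apply]
      refine Eq.trans ?_ (colIncl_act _ _).symm
      rw [colIncl_mk]
      refine Eq.trans ?_ (congrArg _ (colIncl_ip _ _).symm)
      rw [colIncl_mk, star_mul, hP.isSelfAdjoint.star_eq]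
      simp only [← mul_assoc]
      rw [mul_assoc Q (CStarMatrix.ofMatrix (Matrix.single i o ((star b : A) : Unitization ℂ A))),
        ofMatrix_single_mul_star, star_star]
    | zero =>
      convert Submodule.zero_mem _ using 1
      refine ContinuousLinearMap.ext fun m => colIncl_injective ?_
      rw [colIncl_leftOp, Unitization.inr_zero, Matrix.single_zero]
      change Q * 0 * P * _ = 0
      rw [mul_zero, zero_mul, zero_mul]
    | add a b _ _ ha hb =>
      convert Submodule.add_mem _ ha hb using 1
      refine ContinuousLinearMap.ext fun m => colIncl_injective ?_
      rw [_root_.add_apply, map_add]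
      simp only [colIncl_leftOp]
      rw [Unitization.inr_add, Matrix.single_add, ← add_mul, ← add_mul, ← mul_add]
      rfl
    | smul c a _ ha =>
      convert Submodule.smul_mem _ c ha using 1
      refine ContinuousLinearMap.ext fun m => colIncl_injective ?_
      rw [_root_.smul_apply, map_smul]
      simp only [colIncl_leftOp]
      rw [Unitization.inr_smul, ← Matrix.smul_single, ← smul_mul_assoc, ← smul_mul_assoc,
        ← mul_smul_comm]
      rfl
  have hsum : X = ∑ i, ∑ j, Q * CStarMatrix.ofMatrix
      (Matrix.single i j (((X i j).snd : A) : Unitization ℂ A)) * P := by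
    have : X = ∑ i, ∑ j, CStarMatrix.ofMatrix
        (Matrix.single i j (((X i j).snd : A) : Unitization ℂ A)) := by
      conv_lhs => rw [show X = CStarMatrix.ofMatrix X from rfl, Matrix.matrix_eq_sum_single X]
      refine Finset.sum_congr rfl fun i _ => Finset.sum_congr rfl fun j _ => ?_
      refine congrArg (fun z => Matrix.single i j z) ?_
      exact Unitization.ext (hA i j) rfl
    conv_lhs => rw [← hX', ← hX, this]
    simp only [Finset.mul_sum, Finset.sum_mul]
  have : leftOp (o := o) P Q X hX = ∑ i, ∑ j, leftOp (o := o) P Q (Q * CStarMatrix.ofMatrix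
      (Matrix.single i j (((X i j).snd : A) : Unitization ℂ A)) * P)
        (by rw [← mul_assoc, ← mul_assoc, hQQ]) := by
    refine ContinuousLinearMap.ext fun m => colIncl_injective ?_
    simp only [_root_.sum_apply, map_sum, colIncl_leftOp]
    conv_lhs => rw [hsum]
    simp only [Finset.sum_mul]
  rw [this]
  exact Submodule.sum_mem _ fun i _ => Submodule.sum_mem _ fun j _ => key i j _

end Columns

section ColumnIndex

universe u

attribute [local instance] CStarAlgebra.spectralOrder CStarAlgebra.spectralOrderedRing

/-- A direct summand of a finitely generated projective module has a class in K-theory. -/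
theorem Represents.exists_fst {R : Type*} [CStarAlgebra R] {ι : Type*} [Fintype ι] {M N : Type*}
    [AddCommGroup M] [Module Rᵐᵒᵖ M] [AddCommGroup N] [Module Rᵐᵒᵖ N] {e : Matrix ι ι R}
    (h : Represents (M × N) e) : ∃ x : KUnital R, IsClass M x := by
  classical
  obtain ⟨i, p, h1, -⟩ := h
  have h' : Represents M (toMat ((i ∘ₗ LinearMap.inl Rᵐᵒᵖ M N) ∘ₗ LinearMap.fst Rᵐᵒᵖ M N ∘ₗ p)) := by
    refine ⟨i ∘ₗ LinearMap.inl Rᵐᵒᵖ M N, LinearMap.fst Rᵐᵒᵖ M N ∘ₗ p, ?_, (mulVecR_toMat _).symm⟩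
    refine LinearMap.ext fun m => ?_
    have := LinearMap.congr_fun h1 (m, 0)
    simp only [LinearMap.comp_apply, LinearMap.id_apply] at this
    simp [this]
  exact ⟨_, h'.isClass⟩

variable {A : Type u} [NonUnitalCStarAlgebra A] {J : Type} [Fintype J] [DecidableEq J] {o : J}

/-- The elements of `P A^J` as column vectors. -/
def colVec (o : J) (P : CStarMatrix J J (Unitization ℂ A)) :
    colMod o P →ₗ[(Unitization ℂ A)ᵐᵒᵖ] (J → Unitization ℂ A) where
  toFun m i := colIncl o P m i o
  map_add' m m' := by
    ext i : 1
    rw [map_add]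
    rfl
  map_smul' a m := by
    ext i : 1
    change colIncl o P ((colMod o P).actU m a.unop) i o = colIncl o P m i o * a.unop
    rw [HilbMod.actU, map_add, map_smul, colIncl_act, CStarMatrix.add_apply, CStarMatrix.smul_apply,
      mul_cornerHom_apply, if_pos rfl]
    conv_rhs => rw [← Unitization.inl_fst_add_inr_snd_eq a.unop, mul_add]
    congr 1
    rw [show Unitization.inl a.unop.fst = algebraMap ℂ (Unitization ℂ A) a.unop.fst from rfl,
      ← Algebra.commutes, ← Algebra.smul_def]

theorem colVec_injective {P : CStarMatrix J J (Unitization ℂ A)} :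
    Function.Injective (colVec o P) := fun m m' h => colIncl_injective (by
  ext i j : 1
  by_cases hj : j = o
  · subst hj
    exact congrFun h i
  · rw [(colIncl_mem m).2.2 i j hj, (colIncl_mem m').2.2 i j hj])

theorem mulVec_colVec {P : Matrix J J (Unitization ℂ A)} (m : colMod o (CStarMatrix.ofMatrix P)) :
    P.mulVec (colVec o _ m) = colVec o _ m :=
  funext fun i => congrFun (congrFun (colIncl_mem m).1 i) o

theorem colVec_leftOp {P Q X : Matrix J J (Unitization ℂ A)}
    (hX : CStarMatrix.ofMatrix Q * CStarMatrix.ofMatrix X = CStarMatrix.ofMatrix X)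
    (m : colMod o (CStarMatrix.ofMatrix P)) :
    colVec o _ (leftOp _ _ _ hX m) = X.mulVec (colVec o _ m) := rfl

theorem exists_colVec {P : Matrix J J (Unitization ℂ A)} {v : J → Unitization ℂ A}
    (hv : P.mulVec v = v) (hv' : ∀ i, (v i).fst = 0) :
    ∃ m : colMod o (CStarMatrix.ofMatrix P), colVec o _ m = v := by
  let T : CStarMatrix J J (Unitization ℂ A) := fun i j => if j = o then v i else 0
  have hT : ∀ i j, T i j = if j = o then v i else 0 := fun _ _ => rfl
  refine ⟨colMk T ⟨?_, fun i j => ?_, fun i j hj => ?_⟩, ?_⟩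
  · ext i j : 1
    rw [CStarMatrix.mul_apply]
    simp only [hT]
    split_ifs
    · exact congrFun hv i
    · simp
  · rw [hT]
    split_ifs
    · exact hv' i
    · rfl
  · rw [hT, if_neg hj]
  · ext i : 1
    change T i o = v i
    rw [hT, if_pos rfl]

omit [DecidableEq J] in
theorem fst_mulVec (z : Matrix J J (Unitization ℂ A)) (v : J → Unitization ℂ A) (i : J) :
    (z.mulVec v i).fst = (z.map (augmentation A)).mulVec (fun j => (v j).fst) i := by
  rw [Matrix.mulVec, dotProduct, fst_sum]
  rfl

/-- If `w` is a scalar partial isometry from the scalar part of `P` to the scalar part of `Q`, then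
`Q w P : P A^J → Q A^J` is a Fredholm operator of index `[P] - [Q]`. -/
theorem exists_hasIndex_of_projections {P Q : Matrix J J (Unitization ℂ A)}
    (hP : IsStarProjection P) (hQ : IsStarProjection Q) (w : Matrix J J ℂ)
    (h1 : wᴴ * w = P.map (augmentation A)) (h2 : w * wᴴ = Q.map (augmentation A)) (o : J)
    (x : K0 A) (hx : K0.incl x = idemClass P hP.isIdempotentElem - idemClass Q hQ.isIdempotentElem) :
    ∃ F : colMod o (CStarMatrix.ofMatrix P) →L[ℂ] colMod o (CStarMatrix.ofMatrix Q),
      HasIndex F x := by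
  have hPP : P * P = P := hP.isIdempotentElem.eq
  have hQQ : Q * Q = Q := hQ.isIdempotentElem.eq
  have hPs : Pᴴ = P := hP.isSelfAdjoint.star_eq
  have hQs : Qᴴ = Q := hQ.isSelfAdjoint.star_eq
  set W : Matrix J J (Unitization ℂ A) := w.map (algebraMap ℂ _) with hW
  set X := Q * W * P with hX
  have hXs : Xᴴ = P * Wᴴ * Q := by
    rw [hX, conjTranspose_mul, conjTranspose_mul, hPs, hQs, Matrix.mul_assoc]
  have hQX : Q * X = X := by simp only [hX, ← Matrix.mul_assoc, hQQ]
  have hXP : X * P = X := by simp only [hX, Matrix.mul_assoc, hPP]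
  have hPX : P * Xᴴ = Xᴴ := by simp only [hXs, ← Matrix.mul_assoc, hPP]
  have hXQ : Xᴴ * Q = Xᴴ := by simp only [hXs, Matrix.mul_assoc, hQQ]
  -- The scalar parts of these matrices.
  let ε : Matrix J J (Unitization ℂ A) →+* Matrix J J ℂ :=
    (RingHomClass.toRingHom (augmentation A)).mapMatrix
  have hεP : ε P = wᴴ * w := h1.symm
  have hεQ : ε Q = w * wᴴ := h2.symm
  have hεW : ε W = w := by
    ext i j
    change augmentation A (algebraMap ℂ _ (w i j)) = w i j
    exact (augmentation A).toAlgHom.commutes _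
  have hεW' : ε Wᴴ = wᴴ := by
    ext i j
    change augmentation A (star (W j i)) = star (w j i)
    rw [map_star]
    exact congrArg star (congrFun (congrFun hεW j) i)
  have hp : (wᴴ * w) * (wᴴ * w) = wᴴ * w := by rw [← hεP, ← map_mul, hPP]
  have hq : (w * wᴴ) * (w * wᴴ) = w * wᴴ := by rw [← hεQ, ← map_mul, hQQ]
  have hεX : ε X = w * wᴴ * w := by
    rw [hX, map_mul, map_mul, hεP, hεQ, hεW]
    calc w * wᴴ * w * (wᴴ * w) = (w * wᴴ) * (w * wᴴ) * w := by simp only [Matrix.mul_assoc]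
      _ = w * wᴴ * w := by rw [hq]
  have hεX' : ε Xᴴ = wᴴ * w * wᴴ := by
    rw [hXs, map_mul, map_mul, hεP, hεQ, hεW']
    calc wᴴ * w * wᴴ * (w * wᴴ) = (wᴴ * w) * (wᴴ * w) * wᴴ := by simp only [Matrix.mul_assoc]
      _ = wᴴ * w * wᴴ := by rw [hp]
  have hz1 : ε (P - Xᴴ * X) = 0 := by
    rw [map_sub, map_mul, hεX, hεX', hεP]
    have : wᴴ * w * wᴴ * (w * wᴴ * w) = (wᴴ * w) * (wᴴ * w) * (wᴴ * w) := by
      simp only [Matrix.mul_assoc]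
    rw [this, hp, hp, sub_self]
  have hz2 : ε (Q - X * Xᴴ) = 0 := by
    rw [map_sub, map_mul, hεX, hεX', hεQ]
    have : w * wᴴ * w * (wᴴ * w * wᴴ) = (w * wᴴ) * (w * wᴴ) * (w * wᴴ) := by
      simp only [Matrix.mul_assoc]
    rw [this, hq, hq, sub_self]
  set z := Q - X * Xᴴ with hz
  have hzA : ∀ i j, (z i j).fst = 0 := fun i j => congrFun (congrFun hz2 i) j
  have hQz : Q * z = z := by rw [hz, Matrix.mul_sub, hQQ, ← Matrix.mul_assoc, hQX]
  have hzQ : z * Q = z := by rw [hz, Matrix.sub_mul, hQQ, Matrix.mul_assoc, hXQ]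
  let F : colMod o (CStarMatrix.ofMatrix P) →L[ℂ] colMod o (CStarMatrix.ofMatrix Q) :=
    leftOp _ _ (CStarMatrix.ofMatrix X) hQX
  let G : colMod o (CStarMatrix.ofMatrix Q) →L[ℂ] colMod o (CStarMatrix.ofMatrix P) :=
    leftOp _ _ (CStarMatrix.ofMatrix Xᴴ) hPX
  have hFG : IsAdjointPair F G := isAdjointPair_leftOp hQX hPX
  have hF : IsFredholm F := by
    refine ⟨G, G, F, hFG, hFG.symm, ?_, ?_⟩
    · have : ContinuousLinearMap.id ℂ (colMod o (CStarMatrix.ofMatrix P)) - G ∘L F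
          = leftOp _ _ (CStarMatrix.ofMatrix (P - Xᴴ * X)) (by
            change P * (P - Xᴴ * X) = P - Xᴴ * X
            rw [Matrix.mul_sub, hPP, ← Matrix.mul_assoc, hPX]) := by
        refine ContinuousLinearMap.ext fun m => colVec_injective ?_
        rw [_root_.sub_apply, map_sub, colVec_leftOp, Matrix.sub_mulVec, mulVec_colVec,
          ← Matrix.mulVec_mulVec]
        rfl
      rw [this]
      refine leftOp_mem_compactOps hP hP _ ?_ fun i j => congrFun (congrFun hz1 i) j
      change (P - Xᴴ * X) * P = P - Xᴴ * X
      rw [Matrix.sub_mul, hPP, Matrix.mul_assoc, hXP]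
    · have : ContinuousLinearMap.id ℂ (colMod o (CStarMatrix.ofMatrix Q)) - F ∘L G
          = leftOp _ _ (CStarMatrix.ofMatrix z) hQz := by
        refine ContinuousLinearMap.ext fun m => colVec_injective ?_
        rw [_root_.sub_apply, map_sub]
        refine Eq.trans ?_ (colVec_leftOp (Q := Q) hQz m).symm
        change colVec o _ m - X.mulVec (Xᴴ.mulVec (colVec o _ m))
          = (Q - X * Xᴴ).mulVec (colVec o _ m)
        rw [Matrix.sub_mulVec, mulVec_colVec, Matrix.mulVec_mulVec]
      rw [this]
      exact leftOp_mem_compactOps hQ hQ _ hzQ hzA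
  refine ⟨F, ?_⟩
  -- The columns of `z` complete `F` to a surjection.
  have hcol : ∀ j, ∃ m : colMod o (CStarMatrix.ofMatrix Q), colVec o _ m = fun i => z i j := fun j =>
    exists_colVec (funext fun i => congrFun (congrFun hQz i) j) fun i => hzA i j
  choose c hc using hcol
  have hy : ∀ d, colVec o _ (vecMap c d) = z.mulVec d := by
    intro d
    ext i : 1
    rw [vecMap_apply, map_sum, Finset.sum_apply, Matrix.mulVec, dotProduct]
    refine Finset.sum_congr rfl fun j _ => ?_
    rw [map_smul, hc]
    rfl
  set T := (toLinR F hF.map_act).coprod (vecMap c) with hT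
  have hTv : ∀ k, colVec o _ (T k) = X.mulVec (colVec o _ k.1) + z.mulVec k.2 := by
    intro k
    rw [hT, LinearMap.coprod_apply, map_add, hy]
    rfl
  have hsec : ∀ v, Q.mulVec v = v → X.mulVec (Xᴴ.mulVec v) + z.mulVec v = v := by
    intro v hv
    rw [Matrix.mulVec_mulVec, ← Matrix.add_mulVec, hz, add_sub_cancel, hv]
  have hPX' : ∀ v, P.mulVec (Xᴴ.mulVec v) = Xᴴ.mulVec v := fun v => by
    rw [Matrix.mulVec_mulVec, hPX]
  have hfst : ∀ v : J → Unitization ℂ A, (∀ i, (v i).fst = 0) → ∀ i, (Xᴴ.mulVec v i).fst = 0 := by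
    intro v hv i
    rw [fst_mulVec, funext hv]
    exact congrFun (Matrix.mulVec_zero _) i
  refine hasIndex_of_isClass hF (vecMap c) (fun n => ?_) ?_
  · obtain ⟨m, hm⟩ := exists_colVec (o := o) (hPX' (colVec o _ n))
      (hfst _ fun i => (colIncl_mem n).2.1 i o)
    refine ⟨(m, colVec o _ n), colVec_injective ?_⟩
    exact (hTv _).trans (by rw [hm, hsec _ (mulVec_colVec n)])
  · -- The kernel of the completed map, plus the range of `Q`, is the range of `P` plus a free module.
    let Φ : (LinearMap.ker T × LinearMap.range (mulVecR Q)) →ₗ[(Unitization ℂ A)ᵐᵒᵖ]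
        LinearMap.range (mulVecR P) × (J → Unitization ℂ A) :=
      { toFun := fun k => (⟨colVec o _ k.1.1.1 + mulVecR Xᴴ k.2.1, by
          refine LinearMap.mem_range.mpr ⟨colVec o _ k.1.1.1 + mulVecR Xᴴ k.2.1, ?_⟩
          rw [map_add]
          exact congrArg₂ _ (mulVec_colVec _) (hPX' _)⟩, k.1.1.2 + k.2.1)
        map_add' := fun k k' => by
          refine Prod.ext (Subtype.ext ?_) ?_
          · change colVec o _ (k.1.1.1 + k'.1.1.1) + mulVecR Xᴴ (k.2.1 + k'.2.1) = (_ + _) + (_ + _)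
            rw [map_add, map_add]
            abel
          · change (k.1.1.2 + k'.1.1.2) + (k.2.1 + k'.2.1) = (_ + _) + (_ + _)
            abel
        map_smul' := fun a k => by
          refine Prod.ext (Subtype.ext ?_) ?_
          · change colVec o _ (a • k.1.1.1) + mulVecR Xᴴ (a • k.2.1) = a • (_ + _)
            rw [map_smul, map_smul, smul_add]
          · change a • k.1.1.2 + a • k.2.1 = a • (_ + _)
            rw [smul_add] }
    have hrange : ∀ v : LinearMap.range (mulVecR Q), Q.mulVec v.1 = v.1 := by
      rintro ⟨_, v, rfl⟩
      change Q.mulVec (Q.mulVec v) = Q.mulVec v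
      rw [Matrix.mulVec_mulVec, hQQ]
    have hrange' : ∀ v : LinearMap.range (mulVecR P), P.mulVec v.1 = v.1 := by
      rintro ⟨_, v, rfl⟩
      change P.mulVec (P.mulVec v) = P.mulVec v
      rw [Matrix.mulVec_mulVec, hPP]
    have hbij : Function.Bijective Φ := by
      constructor
      · refine (injective_iff_map_eq_zero Φ).mpr fun k hk => ?_
        have e1 : colVec o _ k.1.1.1 = -(Xᴴ.mulVec k.2.1) :=
          eq_neg_of_add_eq_zero_left (congrArg (fun z => (Prod.fst z).1) hk)
        have e2 : k.1.1.2 = -k.2.1 := eq_neg_of_add_eq_zero_left (congrArg Prod.snd hk)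
        have e3 := hTv k.1.1
        rw [k.1.2, map_zero, e1, e2, Matrix.mulVec_neg, Matrix.mulVec_neg, ← neg_add,
          hsec _ (hrange _)] at e3
        have e4 : k.2.1 = 0 := neg_eq_zero.mp e3.symm
        refine Prod.ext (Subtype.ext (Prod.ext (colVec_injective (o := o) ?_) ?_)) (Subtype.ext e4)
        · rw [e1, e4, Matrix.mulVec_zero, neg_zero]
          exact (map_zero _).symm
        · rw [e2, e4, neg_zero]
          rfl
      · rintro ⟨v, d⟩
        set n := X.mulVec v.1 + z.mulVec d with hn
        have hQn : Q.mulVec n = n := by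
          rw [hn, Matrix.mulVec_add, Matrix.mulVec_mulVec, Matrix.mulVec_mulVec, hQX, hQz]
        have hv0 : ∀ i, ((v.1 - Xᴴ.mulVec n) i).fst = 0 := by
          have : v.1 - Xᴴ.mulVec n = (P - Xᴴ * X).mulVec v.1 - (Xᴴ * z).mulVec d := by
            rw [Matrix.sub_mulVec, hrange', hn, Matrix.mulVec_add, Matrix.mulVec_mulVec,
              Matrix.mulVec_mulVec]
            abel
          intro i
          rw [this, Pi.sub_apply, ← augmentation_apply, map_sub, augmentation_apply, augmentation_apply,
            fst_mulVec, fst_mulVec]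
          change (ε (P - Xᴴ * X)).mulVec _ i - (ε (Xᴴ * z)).mulVec _ i = 0
          rw [map_mul, hz1, hz2, Matrix.mul_zero, Matrix.zero_mulVec, Matrix.zero_mulVec]
          simp
        obtain ⟨m, hm⟩ := exists_colVec (o := o) (P := P) (v := v.1 - Xᴴ.mulVec n)
          (by rw [Matrix.mulVec_sub, hrange', hPX']) hv0
        refine ⟨(⟨(m, d - n), ?_⟩, ⟨n, ⟨n, hQn⟩⟩), ?_⟩
        · refine colVec_injective (o := o) ?_
          rw [hTv, map_zero, hm, Matrix.mulVec_sub, Matrix.mulVec_sub]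
          have := hsec n hQn
          calc X.mulVec v.1 - X.mulVec (Xᴴ.mulVec n) + (z.mulVec d - z.mulVec n)
              = (X.mulVec v.1 + z.mulVec d) - (X.mulVec (Xᴴ.mulVec n) + z.mulVec n) := by abel
            _ = 0 := by rw [this, ← hn, sub_self]
        · refine Prod.ext (Subtype.ext ?_) ?_
          · change colVec o _ m + Xᴴ.mulVec n = v.1
            rw [hm, sub_add_cancel]
          · change d - n + n = d
            rw [sub_add_cancel]
    let Ψ := LinearEquiv.ofBijective Φ hbij
    have r1 := (represents_range hP.isIdempotentElem).prod
      (represents_pi (R := Unitization ℂ A) (ι := J))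
    obtain ⟨k, hk⟩ := (r1.congr Ψ).exists_fst
    have h := (hk.prod (represents_range hQ.isIdempotentElem).isClass).eq
      ((represents_range hP.isIdempotentElem).isClass.prod (isClass_pi (ι := J))) Ψ
    have hk' : K0.incl x + freeClass (Unitization ℂ A) J = k := by
      rw [hx, eq_sub_of_add_eq h]
      abel
    rw [hk']
    exact hk

end ColumnIndex

section ExistsIndex

universe u v w

attribute [local instance] CStarAlgebra.spectralOrder CStarAlgebra.spectralOrderedRing

theorem idemClass_zero {R : Type*} [CStarAlgebra R] {ι : Type*} [Fintype ι]
    (h : IsIdempotentElem (0 : Matrix ι ι R)) : idemClass (0 : Matrix ι ι R) h = 0 := by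
  have h2 := idemClass_blocks h h
  rw [idemClass_eq (f := (0 : Matrix ι ι R)) _ h ⟨0, 0, by
    rw [Matrix.fromBlocks_zero]; simp, by simp⟩] at h2
  exact left_eq_add.mp h2

/-- Every element of `K₀(A)` is the index of a Fredholm operator. -/
theorem K0.exists_hasIndex {A : Type u} [NonUnitalCStarAlgebra A] (x : K0 A) :
    ∃ (M N : HilbMod.{u, u} A) (F : M →L[ℂ] N), HasIndex F x := by
  obtain ⟨ι, κ, _, _, _, _, P, hP, w, h1, h2, hx⟩ := x.exists_eq_sub
  -- Move both projections into one matrix algebra, indexed by a type with a distinguished point.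
  have h0 : ∀ (μ : Type) [Fintype μ], IsStarProjection (0 : Matrix μ μ (Unitization ℂ A)) :=
    fun μ _ => ⟨by simp [IsIdempotentElem], by simp [IsSelfAdjoint]⟩
  have hQ : IsStarProjection (fromBlocks (1 : Matrix κ κ (Unitization ℂ A)) 0 0
      (0 : Matrix Unit Unit (Unitization ℂ A))) :=
    isStarProjection_blocks isStarProjection_one_matrix (h0 Unit)
  have hP' := isStarProjection_blocks hP (h0 (κ ⊕ Unit))
  have hQ' := isStarProjection_blocks (h0 ι) hQ
  have hw := exists_hasIndex_of_projections hP' hQ' (fromBlocks 0 0 (fromRows w 0) 0)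
    (by
      rw [fromBlocks_conjTranspose, fromBlocks_multiply, fromBlocks_map,
        conjTranspose_fromRows_eq_fromCols_conjTranspose, fromCols_mul_fromRows, h1]
      simp)
    (by
      rw [fromBlocks_conjTranspose, fromBlocks_multiply, fromBlocks_map,
        conjTranspose_fromRows_eq_fromCols_conjTranspose, fromRows_mul_fromCols, h2, fromBlocks_map]
      simp)
    (Sum.inr (Sum.inr ())) x (by
      rw [hx, idemClass_blocks hP.isIdempotentElem (h0 _).isIdempotentElem,
        idemClass_blocks (h0 _).isIdempotentElem hQ.isIdempotentElem,
        idemClass_blocks isIdempotentElem_one_matrix (h0 _).isIdempotentElem]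
      simp only [idemClass_zero, add_zero, zero_add, freeClass]
      congr!)
  obtain ⟨F, hF⟩ := hw
  exact ⟨_, _, F, hF⟩

end ExistsIndex

section ExistsTensor

universe v w

variable {A : Type w} [NonUnitalCStarAlgebra A] {B : Type v} [NonUnitalCStarAlgebra B]
  {φ : B →⋆ₙₐ[ℂ] A} {E : HilbMod.{v, w} B} [Correspondence A B E]

/-- The interior tensor product of `M` with `E` exists: it is the closed subspace `M · E` of `M`. -/
theorem exists_isInteriorTensor (κ : CornerEmbedding φ E) (M : HilbMod.{w, w} A) :
    ∃ (M' : HilbMod.{v, w} B) (t : M → E → M'), IsInteriorTensor E M M' t := by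
  set S₀ : Submodule ℂ M := Submodule.span ℂ {x : M | ∃ m e, x = HilbertModule.act m (κ.toFun e)}
    with hS₀
  have hclosed : IsClosed (S₀.topologicalClosure : Set M) := Submodule.isClosed_topologicalClosure _
  have hact : ∀ s ∈ S₀.topologicalClosure, ∀ b : B,
      HilbertModule.act s (φ b) ∈ S₀.topologicalClosure := by
    intro s hs b
    have hle : S₀.topologicalClosure ≤ S₀.topologicalClosure.comap
        (((HilbertModule.act (A := A) (E := M)).flip (φ b) : M →L[ℂ] M) : M →ₗ[ℂ] M) := by
      refine Submodule.topologicalClosure_minimal _ (Submodule.span_le.mpr ?_)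
        (hclosed.preimage (ContinuousLinearMap.continuous _))
      rintro _ ⟨m, e, rfl⟩
      refine Submodule.le_topologicalClosure _ (Submodule.subset_span
        ⟨m, HilbertModule.act e b, ?_⟩)
      rw [κ.map_act, HilbertModule.act_mul]
      rfl
    exact hle hs
  have hrange : IsClosed (Set.range φ) :=
    (AddMonoidHomClass.isometry_of_norm φ
      (norm_map_of_injective κ.injective)).isClosedEmbedding.isClosed_range
  let R : Submodule ℂ A := LinearMap.range (φ : B →ₗ[ℂ] A)
  have hR : IsClosed (R : Set A) := hrange
  have hip : ∀ s ∈ S₀.topologicalClosure, ∀ s' ∈ S₀.topologicalClosure, ∃ b, φ b = M.ip s s' := by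
    have key : ∀ m e, ∀ s' ∈ S₀.topologicalClosure,
        M.ip (HilbertModule.act m (κ.toFun e)) s' ∈ R := by
      intro m e s' hs'
      have hle : S₀.topologicalClosure ≤ R.comap
          ((HilbertModule.inner (A := A) (HilbertModule.act m (κ.toFun e)) : M →L[ℂ] A) :
            M →ₗ[ℂ] A) := by
        refine Submodule.topologicalClosure_minimal _ (Submodule.span_le.mpr ?_)
          (hR.preimage (ContinuousLinearMap.continuous _))
        rintro _ ⟨m', e', rfl⟩
        refine ⟨E.ip e (Correspondence.left B (M.ip m m') e'), ?_⟩
        change φ _ = M.ip _ _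
        rw [ip_act_left, ip_act_right, ← κ.star_mul, κ.map_left]
      exact hle hs'
    intro s hs s' hs'
    have hstar : ∀ a ∈ R, star a ∈ R := by
      rintro _ ⟨b, rfl⟩
      exact ⟨star b, map_star φ b⟩
    have hle : S₀.topologicalClosure ≤ R.comap
        ((HilbertModule.inner (A := A) s' : M →L[ℂ] A) : M →ₗ[ℂ] A) := by
      refine Submodule.topologicalClosure_minimal _ (Submodule.span_le.mpr ?_)
        (hR.preimage (ContinuousLinearMap.continuous _))
      rintro _ ⟨m, e, rfl⟩
      have := hstar _ (key m e s' hs')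
      rwa [star_ip] at this
    have := hstar _ (hle hs)
    change star (M.ip s' s) ∈ R at this
    rwa [star_ip] at this
  refine ⟨M.ofClosed κ.injective _ hclosed hact hip, fun m e =>
    (⟨HilbertModule.act m (κ.toFun e), Submodule.le_topologicalClosure _
      (Submodule.subset_span ⟨m, e, rfl⟩)⟩ : S₀.topologicalClosure), fun m e m' e' => ?_, ?_⟩
  · refine κ.injective ((HilbMod.ofClosed_ip _ _ _ _ _ _ _ _).trans ?_)
    rw [← κ.star_mul, κ.map_left]
    change M.ip (HilbertModule.act m (κ.toFun e)) (HilbertModule.act m' (κ.toFun e')) = _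
    rw [ip_act_left, ip_act_right]
  · intro z
    rw [Metric.mem_closure_iff]
    intro ε hε
    obtain ⟨s, hs, hlt⟩ := Metric.mem_closure_iff.mp (show z.1 ∈ closure (S₀ : Set M) from z.2) ε hε
    refine ⟨(⟨s, Submodule.le_topologicalClosure _ hs⟩ : S₀.topologicalClosure), ?_, hlt⟩
    have key : ∀ s (hs : s ∈ S₀), (⟨s, Submodule.le_topologicalClosure _ hs⟩ : S₀.topologicalClosure)
        ∈ Submodule.span ℂ {z : S₀.topologicalClosure | ∃ m e, z = ⟨HilbertModule.act m (κ.toFun e),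
          Submodule.le_topologicalClosure _ (Submodule.subset_span ⟨m, e, rfl⟩)⟩} := by
      intro s hs
      induction hs using Submodule.span_induction with
      | mem x hx =>
        obtain ⟨m, e, rfl⟩ := hx
        exact Submodule.subset_span ⟨m, e, rfl⟩
      | zero => exact Submodule.zero_mem _
      | add x y hx hy h1 h2 => exact Submodule.add_mem _ h1 h2
      | smul c x hx h1 => exact Submodule.smul_mem _ c h1
    exact key s hs

/-- The relation that defines `E_*` has a value at every element. -/
theorem exists_exelRel (κ : CornerEmbedding φ E) (x : K0 A) : ∃ y : K0 B, ExelRel E x y := by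
  obtain ⟨M, N, F, hF⟩ := x.exists_hasIndex
  obtain ⟨M', t, ht⟩ := exists_isInteriorTensor κ M
  obtain ⟨N', t', ht'⟩ := exists_isInteriorTensor κ N
  obtain ⟨d, hd⟩ := exists_descent κ ht
  obtain ⟨d', hd'⟩ := exists_descent κ ht'
  obtain ⟨F', hF'⟩ := d.exists_restrict d' hF.1.map_act
  obtain ⟨y, hy, -⟩ := exists_hasIndex_map d d' hF' hF.1
  refine ⟨y, M, N, F, M', N', t, t', F', ht, ht', fun m e => d'.injective ?_, hF, hy⟩
  rw [hF', hd, hd', hF.1.map_act]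

end ExistsTensor

/-! ### Stability of K-theory -/

section Perturbation

/-- If `u : p → q` is almost a partial isometry from the projection `p` onto the projection `q`, then
`p` and `q` are equivalent. -/
theorem exists_equiv_of_norm_sub_lt {S : Type*} [CStarAlgebra S] {p q u : S}
    (hp : IsStarProjection p) (hq : IsStarProjection q) (hqu : q * u = u) (hup : u * p = u)
    (h1 : ‖star u * u - p‖ < 1) (h2 : ‖u * star u - q‖ < 1) : ∃ v, v * u = p ∧ u * v = q := by
  have hpp : p * p = p := hp.isIdempotentElem.eq
  have hqq : q * q = q := hq.isIdempotentElem.eq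
  have hpu : p * star u = star u := by
    rw [← hp.isSelfAdjoint.star_eq, ← star_mul, hup]
  have huq : star u * q = star u := by
    conv_lhs => rw [← hq.isSelfAdjoint.star_eq, ← star_mul, hqu]
  have hx : IsUnit (1 - (p - star u * u)) := isUnit_one_sub_of_norm_lt_one (by rwa [norm_sub_rev])
  have hy : IsUnit (1 - (q - u * star u)) := isUnit_one_sub_of_norm_lt_one (by rwa [norm_sub_rev])
  obtain ⟨x, hx⟩ := hx
  obtain ⟨y, hy⟩ := hy
  have hxp : (x : S) * p = star u * u := by
    rw [hx, sub_mul, sub_mul, one_mul, hpp, mul_assoc, hup]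
    abel
  have hpx : p * (x : S) = star u * u := by
    rw [hx, mul_sub, mul_sub, mul_one, hpp, ← mul_assoc, hpu]
    abel
  have hi : (↑x⁻¹ : S) * (star u * u) = p := by rw [← hxp, ← mul_assoc, Units.inv_mul, one_mul]
  have hi' : (star u * u) * (↑x⁻¹ : S) = p := by rw [← hpx, mul_assoc, Units.mul_inv, mul_one]
  refine ⟨↑x⁻¹ * star u, by rw [mul_assoc, hi], ?_⟩
  have hyf : (y : S) * (u * (↑x⁻¹ * star u)) = u * star u := by
    have : (y : S) * u = u * (star u * u) := by
      rw [hy, sub_mul, sub_mul, one_mul, hqu, ← mul_assoc]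
      abel
    calc (y : S) * (u * (↑x⁻¹ * star u)) = (y * u) * ↑x⁻¹ * star u := by simp only [mul_assoc]
      _ = u * ((star u * u) * ↑x⁻¹) * star u := by rw [this]; simp only [mul_assoc]
      _ = u * star u := by rw [hi', hup]
  have hyq : (y : S) * q = u * star u := by
    rw [hy, sub_mul, sub_mul, one_mul, hqq, mul_assoc, huq]
    abel
  exact y.isUnit.mul_left_cancel (hyf.trans hyq.symm)

theorem AlgEq.submatrix {R : Type*} [Ring R] {ι κ : Type*} [Fintype ι] [Fintype κ]
    {f g : Matrix ι ι R} (h : AlgEq f g) (e : κ ≃ ι) :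
    AlgEq (f.submatrix e e) (g.submatrix e e) := by
  obtain ⟨u, v, rfl, rfl⟩ := h
  exact ⟨u.submatrix e e, v.submatrix e e, Matrix.submatrix_mul_equiv .., Matrix.submatrix_mul_equiv ..⟩

theorem AlgEq.comp {R : Type*} [Ring R] {ι κ : Type*} [Fintype ι] [Fintype κ] [DecidableEq κ]
    {f g : Matrix ι ι (Matrix κ κ R)} (h : AlgEq f g) :
    AlgEq (Matrix.compRingEquiv ι κ R f) (Matrix.compRingEquiv ι κ R g) := by
  obtain ⟨u, v, rfl, rfl⟩ := h
  exact ⟨Matrix.compRingEquiv ι κ R u, Matrix.compRingEquiv ι κ R v, (map_mul _ _ _).symm,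
    (map_mul _ _ _).symm⟩

end Perturbation

section MatrixStability

universe v

attribute [local instance] CStarAlgebra.spectralOrder CStarAlgebra.spectralOrderedRing

variable {B : Type v} [NonUnitalCStarAlgebra B] (κ : Type) [Fintype κ] [DecidableEq κ]

variable (B) in
/-- The algebra of matrices over `B` indexed by `κ` and one distinguished element. -/
abbrev MatAlg : Type v := CStarMatrix (Option κ) (Option κ) B

variable (B) in
/-- The corner embedding of `B` in a matrix algebra. -/
def cornerEmb : B →⋆ₙₐ[ℂ] MatAlg B κ where
  toFun b := CStarMatrix.ofMatrix (Matrix.single none none b)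
  map_smul' c a := (Matrix.smul_single c none none a).symm
  map_zero' := Matrix.single_zero _ _
  map_add' a b := Matrix.single_add _ _ a b
  map_mul' a b := (Matrix.single_mul_single_same (i := (none : Option κ)) (j := (none : Option κ)) (k := (none : Option κ)) (c := a) (d := b)).symm
  map_star' a := (Matrix.conjTranspose_single none none a).symm

variable (B) in
/-- The unitization of a matrix algebra over `B`, as matrices over the unitization of `B`. -/
def matUnit : Unitization ℂ (MatAlg B κ) →ₐ[ℂ] Matrix (Option κ) (Option κ) (Unitization ℂ B) :=
  Unitization.lift
    { toFun := fun X => Matrix.map X fun b : B => (b : Unitization ℂ B)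
      map_smul' := fun c X => Matrix.ext fun i j => Unitization.inr_smul ℂ c (X i j)
      map_zero' := Matrix.ext fun i j => Unitization.inr_zero ℂ
      map_add' := fun X Y => Matrix.ext fun i j => Unitization.inr_add ℂ (X i j) (Y i j)
      map_mul' := fun X Y => Matrix.ext fun i j => by
        change (((X * Y : MatAlg B κ) i j : B) : Unitization ℂ B) = _
        rw [CStarMatrix.mul_apply, Matrix.mul_apply]
        refine (map_sum (Unitization.inrNonUnitalAlgHom ℂ B) _ _).trans
          (Finset.sum_congr rfl fun k _ => ?_)
        exact Unitization.inr_mul ℂ (X i k) (Y k j) }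

theorem matUnit_apply (x : Unitization ℂ (MatAlg B κ)) (k l : Option κ) :
    matUnit B κ x k l = (if k = l then algebraMap ℂ (Unitization ℂ B) x.fst else 0)
      + ((x.snd k l : B) : Unitization ℂ B) := by
  change (algebraMap ℂ (Matrix (Option κ) (Option κ) (Unitization ℂ B)) x.fst
    + Matrix.map x.snd fun b : B => (b : Unitization ℂ B)) k l = _
  rw [Matrix.add_apply, Matrix.algebraMap_matrix_apply]
  rfl

theorem starMap_fst {A B : Type*} [NonUnitalCStarAlgebra A] [NonUnitalCStarAlgebra B]
    (φ : A →⋆ₙₐ[ℂ] B) (x : Unitization ℂ A) : (Unitization.starMap φ x).fst = x.fst :=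
  augmentation_starMap φ x

theorem starMap_snd {A B : Type*} [NonUnitalCStarAlgebra A] [NonUnitalCStarAlgebra B]
    (φ : A →⋆ₙₐ[ℂ] B) (x : Unitization ℂ A) : (Unitization.starMap φ x).snd = φ x.snd := by
  conv_lhs => rw [← Unitization.inl_fst_add_inr_snd_eq x, map_add, Unitization.starMap_inr,
    Unitization.starMap_inl, Unitization.algebraMap_eq_inl]
  simp

/-- The corner embedding `B → M_n(B)` detects the classes of projections with given scalar part. -/
theorem idemClass_eq_of_cornerEmb {ι : Type} [Fintype ι] [DecidableEq ι]
    {P : Matrix ι ι (Unitization ℂ B)} (hP : IsIdempotentElem P)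
    (he : IsIdempotentElem ((P.map (augmentation B)).map (algebraMap ℂ (Unitization ℂ B))))
    (h : AlgEq (P.map (Unitization.starMap (cornerEmb B κ)))
      ((P.map (augmentation B)).map (algebraMap ℂ (Unitization ℂ (MatAlg B κ))))) :
    idemClass P hP = idemClass _ he := by
  set e := (P.map (augmentation B)).map (algebraMap ℂ (Unitization ℂ B)) with he'
  let s : ι ⊕ ι × κ ≃ ι × Option κ :=
    { toFun := Sum.elim (fun i => (i, none)) fun p => (p.1, some p.2)
      invFun := fun p => p.2.elim (Sum.inl p.1) fun k => Sum.inr (p.1, k)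
      left_inv := by rintro (i | ⟨i, k⟩) <;> rfl
      right_inv := by rintro ⟨i, _ | k⟩ <;> rfl }
  have hD : IsIdempotentElem (Matrix.blockDiagonal fun _ : κ => e) := by
    rw [IsIdempotentElem, ← Matrix.blockDiagonal_mul, he.eq]
  have h2 := ((h.map (matUnit B κ).toRingHom).comp).submatrix s
  have e1 : (Matrix.compRingEquiv _ _ _ ((P.map (Unitization.starMap (cornerEmb B κ))).map
      (matUnit B κ).toRingHom)).submatrix s s
        = fromBlocks P 0 0 (Matrix.blockDiagonal fun _ : κ => e) := by
    have hPij : ∀ i j, P i j = algebraMap ℂ (Unitization ℂ B) (P i j).fst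
        + ((P i j).snd : Unitization ℂ B) := fun i j =>
      (Unitization.inl_fst_add_inr_snd_eq (P i j)).symm
    have key : ∀ i k j l, (Matrix.compRingEquiv _ _ _ ((P.map
        (Unitization.starMap (cornerEmb B κ))).map (matUnit B κ).toRingHom)) (i, k) (j, l)
        = (if k = l then e i j else 0)
          + ((Matrix.single (none : Option κ) none (P i j).snd k l : B) : Unitization ℂ B) := by
      intro i k j l
      change matUnit B κ (Unitization.starMap (cornerEmb B κ) (P i j)) k l = _
      rw [matUnit_apply, starMap_fst, starMap_snd]
      rfl
    refine Matrix.ext fun p q => ?_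
    rcases p with i | ⟨i, k⟩ <;> rcases q with j | ⟨j, l⟩
    · refine (key i none j none).trans ?_
      rw [if_pos rfl, Matrix.single_apply_same]
      exact (hPij i j).symm
    · refine (key i none j (some l)).trans ?_
      simp
    · refine (key i (some k) j none).trans ?_
      simp
    · refine (key i (some k) j (some l)).trans ?_
      simp [Matrix.blockDiagonal_apply]
  have e2 : (Matrix.compRingEquiv _ _ _ (((P.map (augmentation B)).map
      (algebraMap ℂ (Unitization ℂ (MatAlg B κ)))).map (matUnit B κ).toRingHom)).submatrix s s
        = fromBlocks e 0 0 (Matrix.blockDiagonal fun _ : κ => e) := by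
    have key : ∀ i k j l, (Matrix.compRingEquiv _ _ _ (((P.map (augmentation B)).map
      (algebraMap ℂ (Unitization ℂ (MatAlg B κ)))).map (matUnit B κ).toRingHom)) (i, k) (j, l)
        = if k = l then e i j else 0 := by
      intro i k j l
      change matUnit B κ (algebraMap ℂ _ (augmentation B (P i j))) k l = _
      rw [AlgHom.commutes, Matrix.algebraMap_matrix_apply]
      rfl
    refine Matrix.ext fun p q => ?_
    rcases p with i | ⟨i, k⟩ <;> rcases q with j | ⟨j, l⟩
    · exact (key i none j none).trans (if_pos rfl)
    · refine (key i none j (some l)).trans ?_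
      simp
    · refine (key i (some k) j none).trans ?_
      simp
    · refine (key i (some k) j (some l)).trans ?_
      simp [Matrix.blockDiagonal_apply]
  rw [e1, e2] at h2
  have h3 := idemClass_eq (isIdempotentElem_blocks hP hD) (isIdempotentElem_blocks he hD) h2
  rw [idemClass_blocks hP hD, idemClass_blocks he hD] at h3
  exact add_right_cancel h3

end MatrixStability

/-! ### Injectivity of the map induced by a corner -/

section Frames

universe v w

attribute [local instance] CStarAlgebra.spectralOrder CStarAlgebra.spectralOrderedRing

variable {A : Type w} [NonUnitalCStarAlgebra A] {B : Type v} [NonUnitalCStarAlgebra B]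

/-- An embedding of `M_n(B)` in `A` that extends the embedding `φ` of the corner, given by the
images of the multiples of the matrix units, together with the compressions to the matrix entries.
The indices are the elements of `κ` and one distinguished element. -/
structure CornerFrame (φ : B →⋆ₙₐ[ℂ] A) (κ : Type) [DecidableEq κ] where
  unit : Option κ → Option κ → B →L[ℂ] A
  compress : Option κ → Option κ → A →L[ℂ] B
  unit_mul : ∀ k l l' m b c, unit k l b * unit l' m c = if l = l' then unit k m (b * c) else 0
  star_unit : ∀ k l b, star (unit k l b) = unit l k (star b)
  unit_none : ∀ b, unit none none b = φ b
  compress_unit : ∀ k l k' l' b, compress k l (unit k' l' b) = if k = k' ∧ l = l' then b else 0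

/-- Finitely many elements of `A` are almost contained in a matrix algebra over `B`. -/
def HasCornerFrames (φ : B →⋆ₙₐ[ℂ] A) : Prop :=
  ∀ K : Set A, K.Finite → ∀ ε : ℝ, 0 < ε → ∃ (n : ℕ) (F : CornerFrame φ (Fin n)),
    ∀ a ∈ K, ‖∑ k, ∑ l, F.unit k l (F.compress k l a) - a‖ < ε

namespace CornerFrame

variable {φ : B →⋆ₙₐ[ℂ] A} {κ : Type} [Fintype κ] [DecidableEq κ] (F : CornerFrame φ κ)

/-- The embedding of the matrix algebra. -/
def hom : MatAlg B κ →⋆ₙₐ[ℂ] A where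
  toFun X := ∑ k, ∑ l, F.unit k l (X k l)
  map_smul' c X := by
    simp only [MonoidHom.id_apply, Finset.smul_sum, CStarMatrix.smul_apply, map_smul]
  map_zero' := by simp only [CStarMatrix.zero_apply, map_zero, Finset.sum_const_zero]
  map_add' X Y := by simp only [CStarMatrix.add_apply, map_add, Finset.sum_add_distrib]
  map_mul' X Y := by
    have h : ∀ k l l' m, F.unit k l (X k l) * F.unit l' m (Y l' m)
        = if l = l' then F.unit k m (X k l * Y l' m) else 0 := fun k l l' m => F.unit_mul _ _ _ _ _ _
    simp only [Finset.sum_mul_sum, h, CStarMatrix.mul_apply, map_sum]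
    refine Finset.sum_congr rfl fun k _ => ?_
    have : ∀ l' : Option κ, ∑ l, ∑ m, (if l = l' then F.unit k m (X k l * Y l' m) else 0)
        = ∑ m, F.unit k m (X k l' * Y l' m) := fun l' => by
      rw [Finset.sum_eq_single l'] <;> simp +contextual
    rw [Finset.sum_comm]
    exact Finset.sum_congr rfl fun l' _ => (this l').symm
  map_star' X := by
    simp only [star_sum, F.star_unit, CStarMatrix.star_apply]
    exact Finset.sum_comm

theorem hom_apply (X : MatAlg B κ) : F.hom X = ∑ k, ∑ l, F.unit k l (X k l) := rfl

theorem hom_cornerEmb (b : B) : F.hom (cornerEmb B κ b) = φ b := by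
  have h : ∀ k l, cornerEmb B κ b k l = if none = k ∧ none = l then b else 0 := fun _ _ => rfl
  simp only [hom_apply, h]
  rw [Finset.sum_eq_single none, Finset.sum_eq_single none, if_pos ⟨rfl, rfl⟩, F.unit_none]
  · intro l _ hl
    rw [if_neg fun h => hl h.2.symm, map_zero]
  · simp
  · intro k _ hk
    refine Finset.sum_eq_zero fun l _ => ?_
    rw [if_neg fun h => hk h.1.symm, map_zero]
  · simp

theorem hom_injective : Function.Injective F.hom := by
  refine (injective_iff_map_eq_zero F.hom).mpr fun X hX => ?_
  ext k l : 1
  have h := congrArg (F.compress k l) hX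
  rw [hom_apply, map_zero, map_sum] at h
  simp only [map_sum, F.compress_unit] at h
  rw [Finset.sum_eq_single k, Finset.sum_eq_single l, if_pos ⟨rfl, rfl⟩] at h
  · exact h
  · intro l' _ hl
    rw [if_neg fun h => hl h.2.symm]
  · simp
  · intro k' _ hk
    exact Finset.sum_eq_zero fun l' _ => if_neg fun h => hk h.1.symm
  · simp

end CornerFrame

/-- An approximation of a partial isometry from `p` to `q` is almost a partial isometry. -/
theorem norm_star_mul_self_sub_lt {S : Type*} [NonUnitalCStarAlgebra S] {p q v V : S}
    (hp : IsStarProjection p) (hq : IsStarProjection q) (h1 : star v * v = p) (h2 : v * star v = q)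
    (hV : ‖V - v‖ < 1 / 4) :
    ‖star (q * V * p) * (q * V * p) - p‖ < 1 ∧ ‖(q * V * p) * star (q * V * p) - q‖ < 1 := by
  have hpp : p * p = p := hp.isIdempotentElem.eq
  have hv : v * p = v := by
    have : star (v - v * p) * (v - v * p) = 0 := by
      rw [star_sub, star_mul, hp.isSelfAdjoint.star_eq, sub_mul, mul_sub, mul_sub, h1,
        ← mul_assoc (star v), h1, mul_assoc p, h1, hpp, mul_assoc p, ← mul_assoc (star v), h1, hpp, hpp]
      abel
    exact (sub_eq_zero.mp ((CStarRing.star_mul_self_eq_zero_iff _).mp this)).symm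
  have hqv : q * v = v := by rw [← h2, mul_assoc, h1, hv]
  have hv1 : ‖v‖ ≤ 1 := by
    have h := CStarRing.norm_star_mul_self (x := v)
    rw [h1] at h
    nlinarith [norm_nonneg v, hp.norm_le]
  set x := q * V * p with hx
  have hxv : ‖x - v‖ < 1 / 4 := by
    have : x - v = q * (V - v) * p := by rw [mul_sub, sub_mul, hqv, hv]
    rw [this]
    refine lt_of_le_of_lt ?_ hV
    calc ‖q * (V - v) * p‖ ≤ ‖q * (V - v)‖ * ‖p‖ := norm_mul_le _ _
      _ ≤ ‖q * (V - v)‖ * 1 := by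
        gcongr
        exact hp.norm_le
      _ ≤ ‖q‖ * ‖V - v‖ := by rw [mul_one]; exact norm_mul_le _ _
      _ ≤ 1 * ‖V - v‖ := by
        gcongr
        exact hq.norm_le
      _ = ‖V - v‖ := one_mul _
  have hx1 : ‖x‖ ≤ 5 / 4 := by
    calc ‖x‖ = ‖(x - v) + v‖ := by rw [sub_add_cancel]
      _ ≤ ‖x - v‖ + ‖v‖ := norm_add_le _ _
      _ ≤ 5 / 4 := by linarith
  have hsv : ‖star x - star v‖ < 1 / 4 := by rwa [← star_sub, norm_star]
  constructor
  · have : star x * x - p = (star x - star v) * x + star v * (x - v) := by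
      rw [← h1, sub_mul, mul_sub]; abel
    rw [this]
    calc _ ≤ ‖star x - star v‖ * ‖x‖ + ‖star v‖ * ‖x - v‖ :=
          (norm_add_le _ _).trans (add_le_add (norm_mul_le _ _) (norm_mul_le _ _))
      _ ≤ (1 / 4) * (5 / 4) + 1 * (1 / 4) := by
        gcongr
        rwa [norm_star]
      _ < 1 := by norm_num
  · have : x * star x - q = (x - v) * star x + v * (star x - star v) := by
      rw [← h2, sub_mul, mul_sub]; abel
    rw [this]
    calc _ ≤ ‖x - v‖ * ‖star x‖ + ‖v‖ * ‖star x - star v‖ :=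
          (norm_add_le _ _).trans (add_le_add (norm_mul_le _ _) (norm_mul_le _ _))
      _ ≤ (1 / 4) * (5 / 4) + 1 * (1 / 4) := by
        gcongr
        rwa [norm_star]
      _ < 1 := by norm_num

theorem exists_norm_lt_of_forall_norm_lt {R : Type*} [CStarAlgebra R] {ι : Type*} [Fintype ι]
    (v : CStarMatrix ι ι R) {ε : ℝ} (hε : 0 < ε) :
    ∃ δ : ℝ, 0 < δ ∧ ∀ V : CStarMatrix ι ι R, (∀ i j, ‖V i j - v i j‖ < δ) → ‖V - v‖ < ε := by
  have hc : Continuous fun f : ι → ι → R => (CStarMatrix.ofMatrix f : CStarMatrix ι ι R) :=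
    continuous_id
  obtain ⟨δ, hδ, h⟩ := Metric.continuous_iff.mp hc v ε hε
  refine ⟨δ, hδ, fun V hV => ?_⟩
  rw [← dist_eq_norm]
  refine h (fun i j => V i j) ((dist_pi_lt_iff hδ).mpr fun i => (dist_pi_lt_iff hδ).mpr fun j => ?_)
  rw [dist_eq_norm]
  exact hV i j

/-- Idempotents with the same class are stably equivalent. -/
theorem exists_algEq_of_idemClass_eq {R : Type*} [CStarAlgebra R] {ι κ : Type*} [Fintype ι]
    [Fintype κ] {e : Matrix ι ι R} {f : Matrix κ κ R} (he : IsIdempotentElem e)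
    (hf : IsIdempotentElem f) (h : idemClass e he = idemClass f hf) :
    ∃ m, AlgEq (fromBlocks e 0 0 (1 : Matrix (Fin m) (Fin m) R))
      (fromBlocks f 0 0 (1 : Matrix (Fin m) (Fin m) R)) := by
  obtain ⟨p, hp, hp'⟩ := (represents_range he).isClass.exists_matProj
  obtain ⟨q, hq, hq'⟩ := (represents_range hf).isClass.exists_matProj
  obtain ⟨m, hm⟩ := exists_isMvN_of_of_eq (hp'.symm.trans (h.trans hq'))
  have h1 : IsIdempotentElem (1 : Matrix (Fin m) (Fin m) R) := isIdempotentElem_one_matrix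
  have hep := ((represents_range he).algEq hp (LinearEquiv.refl _ _)).blocks
    (⟨1, 1, mul_one _, mul_one _⟩ : AlgEq (1 : Matrix (Fin m) (Fin m) R) 1)
  have hfq := ((represents_range hf).algEq hq (LinearEquiv.refl _ _)).blocks
    (⟨1, 1, mul_one _, mul_one _⟩ : AlgEq (1 : Matrix (Fin m) (Fin m) R) 1)
  have i1 := isIdempotentElem_blocks he h1
  have i2 := isIdempotentElem_blocks hf h1
  have i3 := isIdempotentElem_blocks q.isProj.isIdempotentElem h1
  exact ⟨m, (hep.trans i1 i3 hm.algEq).trans i1 i2 hfq.symm⟩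

theorem isStarProjection_matrix_map {R S : Type*} [CStarAlgebra R] [CStarAlgebra S] (f : R →⋆ₐ[ℂ] S)
    {ι : Type*} [Fintype ι] {p : Matrix ι ι R} (hp : IsStarProjection p) :
    IsStarProjection (p.map f) := by
  refine ⟨isIdempotentElem_map (f : R →+* S) hp.isIdempotentElem, ?_⟩
  change (p.map f)ᴴ = _
  rw [← conjTranspose_map f fun a => map_star f a]
  exact congrArg (fun q => q.map f) hp.isSelfAdjoint

theorem isStarProjection_map_algebraMap (R : Type*) [CStarAlgebra R] {ι : Type*} [Fintype ι]
    {p : Matrix ι ι ℂ} (hp : IsStarProjection p) : IsStarProjection (p.map (algebraMap ℂ R)) :=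
  isStarProjection_matrix_map (StarAlgHom.ofId ℂ R) hp

/-- If the projection `P` is equivalent to its scalar part over `A`, then it represents the
same class as its scalar part over `B`. The equivalence can be chosen so that its scalar part is that
of `P`; approximated by a matrix over `M_n(B)`, it becomes an equivalence over `M_n(B)`. -/
theorem HasCornerFrames.idemClass_eq_scalar {φ : B →⋆ₙₐ[ℂ] A} (hφ : HasCornerFrames φ) {ι : Type}
    [Fintype ι] [DecidableEq ι] {P : Matrix ι ι (Unitization ℂ B)} (hP : IsStarProjection P)
    (he : IsIdempotentElem ((P.map (augmentation B)).map (algebraMap ℂ (Unitization ℂ B))))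
    (h : AlgEq (P.map (Unitization.starMap φ))
      ((P.map (augmentation B)).map (algebraMap ℂ (Unitization ℂ A)))) :
    idemClass P hP.isIdempotentElem = idemClass _ he := by
  set e : Matrix ι ι ℂ := P.map (augmentation B) with he'
  have hep : IsStarProjection e := isStarProjection_matrix_map (augmentation B) hP
  have hpA := isStarProjection_matrix_map (Unitization.starMap φ) hP
  have heA := isStarProjection_map_algebraMap (Unitization ℂ A) hep
  set eA : Matrix ι ι (Unitization ℂ A) := e.map (algebraMap ℂ _) with heA'
  obtain ⟨x, y, hyx, hxy⟩ := h
  obtain ⟨v₁, hv₁, hv₁'⟩ := exists_matrix_partialIsometry hpA heA hyx hxy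
  -- Correct the scalar part of the partial isometry.
  let εA : Matrix ι ι (Unitization ℂ A) →+* Matrix ι ι ℂ :=
    (RingHomClass.toRingHom (augmentation A)).mapMatrix
  let σ : Matrix ι ι ℂ →+* Matrix ι ι (Unitization ℂ A) := (algebraMap ℂ (Unitization ℂ A)).mapMatrix
  have hσs : ∀ X, σ Xᴴ = (σ X)ᴴ := fun X => by
    ext i j : 1
    change algebraMap ℂ _ (star (X j i)) = star (algebraMap ℂ _ (X j i))
    exact algebraMap_star_comm _
  have hεs : ∀ X, εA Xᴴ = (εA X)ᴴ := fun X => by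
    ext i j : 1
    exact map_star (augmentation A) (X j i)
  have hεσ : ∀ X, εA (σ X) = X := fun X => by
    ext i j : 1
    exact (augmentation A).toAlgHom.commutes _
  set w := εA v₁ with hw
  have hw1 : wᴴ * w = e := by
    rw [hw, ← hεs, ← map_mul, hv₁]
    ext i j : 1
    exact augmentation_starMap φ (P i j)
  have hw2 : w * wᴴ = e := by
    rw [hw, ← hεs, ← map_mul, hv₁']
    exact hεσ e
  set v : Matrix ι ι (Unitization ℂ A) := σ wᴴ * v₁ with hv
  have hee : eA * eA = eA := heA.isIdempotentElem.eq
  have hvs : vᴴ = v₁ᴴ * σ w := by rw [hv, conjTranspose_mul, ← hσs, conjTranspose_conjTranspose]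
  have hvp : vᴴ * v = P.map (Unitization.starMap φ) := by
    have hpp := hpA.isIdempotentElem.eq
    calc vᴴ * v = v₁ᴴ * (σ w * σ wᴴ) * v₁ := by rw [hvs, hv]; simp only [Matrix.mul_assoc]
      _ = v₁ᴴ * (v₁ * v₁ᴴ) * v₁ := by rw [← map_mul, hw2, hv₁']; rfl
      _ = (v₁ᴴ * v₁) * (v₁ᴴ * v₁) := by simp only [Matrix.mul_assoc]
      _ = P.map (Unitization.starMap φ) := by rw [hv₁]; exact hpp
  have hve : v * vᴴ = eA := by
    have hee' : e * e = e := hep.isIdempotentElem.eq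
    calc v * vᴴ = σ wᴴ * (v₁ * v₁ᴴ) * σ w := by rw [hvs, hv]; simp only [Matrix.mul_assoc]
      _ = σ (wᴴ * e * w) := by rw [hv₁', map_mul, map_mul]; rfl
      _ = σ ((wᴴ * w) * (wᴴ * w)) := by rw [← hw2]; simp only [Matrix.mul_assoc]
      _ = eA := by rw [hw1, hee']; rfl
  have hvε : εA v = e := by rw [hv, map_mul, hεσ, ← hw, hw1]
  -- Approximate the entries of the partial isometry.
  obtain ⟨δ, hδ, hclose⟩ := exists_norm_lt_of_forall_norm_lt (CStarMatrix.ofMatrix v)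
    (ε := 1 / 4) (by norm_num)
  obtain ⟨n, F, hF⟩ := hφ (Set.range fun p : ι × ι => (v p.1 p.2).snd) (Set.finite_range _) δ hδ
  let Θ : Unitization ℂ (MatAlg B (Fin n)) →⋆ₐ[ℂ] Unitization ℂ A := Unitization.starMap F.hom
  have hΘ : Function.Injective Θ := Unitization.starMap_injective F.hom_injective
  let M : CStarMatrix ι ι (Unitization ℂ (MatAlg B (Fin n))) →⋆ₙₐ[ℂ]
      CStarMatrix ι ι (Unitization ℂ A) :=
    CStarMatrix.mapₙₐ (Θ : Unitization ℂ (MatAlg B (Fin n)) →⋆ₙₐ[ℂ] Unitization ℂ A)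
  have hM : ∀ X i j, M X i j = Θ (X i j) := fun _ _ _ => rfl
  have hMinj : Function.Injective M := fun X Y hXY => by
    ext i j : 1
    exact hΘ (by rw [← hM, hXY, hM])
  let V : CStarMatrix ι ι (Unitization ℂ (MatAlg B (Fin n))) := fun i j =>
    algebraMap ℂ _ (e i j) +
      ((CStarMatrix.ofMatrix fun k l => F.compress k l (v i j).snd : MatAlg B (Fin n)) :
        Unitization ℂ (MatAlg B (Fin n)))
  have hVv : ‖M V - CStarMatrix.ofMatrix v‖ < 1 / 4 := by
    refine hclose _ fun i j => ?_
    have h1 : M V i j = algebraMap ℂ _ (e i j) +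
        ((∑ k, ∑ l, F.unit k l (F.compress k l (v i j).snd) : A) : Unitization ℂ A) := by
      change Θ (algebraMap ℂ _ (e i j) + _) = _
      rw [map_add, AlgHomClass.commutes]
      exact congrArg _ (Unitization.starMap_inr _ _)
    have h2 : v i j = algebraMap ℂ _ (e i j) + ((v i j).snd : Unitization ℂ A) := by
      have := congrFun (congrFun hvε i) j
      rw [← this]
      exact (Unitization.inl_fst_add_inr_snd_eq (v i j)).symm
    have h3 : M V i j - v i j = ((∑ k, ∑ l, F.unit k l (F.compress k l (v i j).snd)
        - (v i j).snd : A) : Unitization ℂ A) := by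
      refine (congrArg (M V i j - ·) h2).trans ?_
      rw [h1, Unitization.inr_sub]
      exact add_sub_add_left_eq_sub _ _ _
    refine lt_of_eq_of_lt ?_ (hF _ ⟨(i, j), rfl⟩)
    change ‖M V i j - v i j‖ = _
    rw [h3, Unitization.norm_inr]
  have hpD := isStarProjection_matrix_map (Unitization.starMap (cornerEmb B (Fin n))) hP
  have heD := isStarProjection_map_algebraMap (Unitization ℂ (MatAlg B (Fin n))) hep
  set pD : CStarMatrix ι ι (Unitization ℂ (MatAlg B (Fin n))) :=
    CStarMatrix.ofMatrix (P.map (Unitization.starMap (cornerEmb B (Fin n)))) with hpD'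
  set eD : CStarMatrix ι ι (Unitization ℂ (MatAlg B (Fin n))) :=
    CStarMatrix.ofMatrix (e.map (algebraMap ℂ _)) with heD'
  have hMp : M pD = CStarMatrix.ofMatrix (P.map (Unitization.starMap φ)) := by
    ext i j : 1
    change Θ (Unitization.starMap (cornerEmb B (Fin n)) (P i j)) = Unitization.starMap φ (P i j)
    refine Unitization.ext ?_ ?_
    · rw [starMap_fst, starMap_fst, starMap_fst]
    · rw [starMap_snd, starMap_snd, starMap_snd, F.hom_cornerEmb]
  have hMe : M eD = CStarMatrix.ofMatrix eA := by
    ext i j : 1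
    exact AlgHomClass.commutes Θ (e i j)
  have hpDs : IsStarProjection pD := hpD
  have heDs : IsStarProjection eD := heD
  have hMnorm : ∀ X, ‖M X‖ = ‖X‖ := NonUnitalStarAlgHom.norm_map M hMinj
  obtain ⟨h1, h2⟩ := norm_star_mul_self_sub_lt (S := CStarMatrix ι ι (Unitization ℂ A))
    (p := CStarMatrix.ofMatrix (P.map (Unitization.starMap φ))) (q := CStarMatrix.ofMatrix eA)
    hpA heA hvp hve hVv
  rw [← hMp, ← hMe, ← map_mul, ← map_mul, ← map_star, ← map_mul, ← map_sub, hMnorm] at h1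
  rw [← hMp, ← hMe, ← map_mul, ← map_mul, ← map_star, ← map_mul, ← map_sub, hMnorm] at h2
  obtain ⟨z, hz1, hz2⟩ := exists_equiv_of_norm_sub_lt hpDs heDs
    (by rw [← mul_assoc, ← mul_assoc, heDs.isIdempotentElem.eq])
    (by rw [mul_assoc, hpDs.isIdempotentElem.eq]) h1 h2
  exact idemClass_eq_of_cornerEmb (Fin n) hP.isIdempotentElem he ⟨_, z, hz1, hz2⟩

/-- If finitely many elements of `A` are almost contained in matrix algebras over `B`, then a partial
isometry over `A` that trivializes a class of `K₀(B)` can be moved to such a matrix algebra, so that the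
class is trivial by the stability of K-theory. -/
theorem HasCornerFrames.map_injective {φ : B →⋆ₙₐ[ℂ] A} (hφ : HasCornerFrames φ) :
    Function.Injective (K0.map φ) := by
  refine (injective_iff_map_eq_zero _).mpr fun y hy => ?_
  obtain ⟨ι, κ, _, _, _, _, P, hP, w, h1, h2, hx⟩ := y.exists_eq_sub
  have hpA := isIdempotentElem_map (Unitization.starMap φ : Unitization ℂ B →+* Unitization ℂ A)
    hP.isIdempotentElem
  have h3 : idemClass (P.map (Unitization.starMap φ)) hpA = idemClass (1 : Matrix κ κ _)
      isIdempotentElem_one_matrix := by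
    have := congrArg K0.incl hy
    rw [K0.incl_map, hx, map_sub, map_zero, map_freeClass, sub_eq_zero,
      idemClass_map _ hP.isIdempotentElem hpA] at this
    rw [this, freeClass]
    congr!
  obtain ⟨m, hm⟩ := exists_algEq_of_idemClass_eq _ _ h3
  set P₁ := fromBlocks P 0 0 (1 : Matrix (Fin m) (Fin m) (Unitization ℂ B)) with hP₁
  have hP₁' : IsStarProjection P₁ := isStarProjection_blocks hP isStarProjection_one_matrix
  -- The scalar part of `P₁` is equivalent to an identity matrix.
  have hscal : AlgEq (P₁.map (augmentation B)) (1 : Matrix (κ ⊕ Fin m) (κ ⊕ Fin m) ℂ) := by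
    have h4 : AlgEq (P.map (augmentation B)) (1 : Matrix κ κ ℂ) := ⟨w, wᴴ, h1, h2⟩
    have := h4.blocks (⟨1, 1, mul_one _, mul_one _⟩ : AlgEq (1 : Matrix (Fin m) (Fin m) ℂ) 1)
    rw [fromBlocks_one] at this
    rw [hP₁, fromBlocks_map, Matrix.map_one _ (map_zero _) (map_one _),
      Matrix.map_zero _ (map_zero _), Matrix.map_zero _ (map_zero _)]
    exact this
  have hA := hscal.map (algebraMap ℂ (Unitization ℂ A))
  have hB := hscal.map (algebraMap ℂ (Unitization ℂ B))
  rw [Matrix.map_one _ (map_zero _) (map_one _)] at hA hB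
  have hm' : AlgEq (P₁.map (Unitization.starMap φ))
      (1 : Matrix (κ ⊕ Fin m) (κ ⊕ Fin m) (Unitization ℂ A)) := by
    rw [hP₁, fromBlocks_map, Matrix.map_one _ (map_zero _) (map_one _),
      Matrix.map_zero _ (map_zero _), Matrix.map_zero _ (map_zero _)]
    rwa [fromBlocks_one] at hm
  have iφ := isIdempotentElem_map (Unitization.starMap φ : Unitization ℂ B →+* Unitization ℂ A)
    hP₁'.isIdempotentElem
  have iε := isIdempotentElem_map (augmentation B : Unitization ℂ B →+* ℂ) hP₁'.isIdempotentElem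
  have iA := isIdempotentElem_map (algebraMap ℂ (Unitization ℂ A)) iε
  have iB := isIdempotentElem_map (algebraMap ℂ (Unitization ℂ B)) iε
  have h5 := (hφ.idemClass_eq_scalar hP₁' iB (hm'.trans iφ iA hA.symm)).trans
    (idemClass_eq iB isIdempotentElem_one_matrix hB)
  rw [idemClass_blocks hP.isIdempotentElem isIdempotentElem_one_matrix] at h5
  have h6 : idemClass (1 : Matrix (κ ⊕ Fin m) (κ ⊕ Fin m) (Unitization ℂ B))
      isIdempotentElem_one_matrix = freeClass _ κ + idemClass (1 : Matrix (Fin m) (Fin m) _)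
        isIdempotentElem_one_matrix := by
    rw [freeClass, ← idemClass_blocks]
    exact idemClass_congr (by rw [← fromBlocks_one]; congr!) _
  rw [h6] at h5
  refine K0.incl_injective ?_
  rw [hx, add_right_cancel h5, sub_self, map_zero]

end Frames

/-! ### The map induced by a full corner -/

section Realization

universe v w

open scoped ZeroAtInfty

variable {A : Type w} [NonUnitalCStarAlgebra A] {B : Type v} [NonUnitalCStarAlgebra B]

/-- A realization of the correspondence `E` as a subspace `A p` of the algebra `A`, where `φ`
identifies `B` with the corner `p A p`; `emb` is the inclusion of `p A p` in `A p`. -/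
structure CornerRealization (φ : B →⋆ₙₐ[ℂ] A) (E : Type w) [NormedAddCommGroup E] [NormedSpace ℂ E]
    [CompleteSpace E] [HilbertModule B E] [Correspondence A B E] where
  toFun : E →L[ℂ] A
  emb : B →L[ℂ] E
  injective : Function.Injective φ
  map_left : ∀ (a : A) (e : E), toFun (Correspondence.left B a e) = a * toFun e
  star_mul : ∀ e e' : E, star (toFun e) * toFun e' = φ (HilbertModule.inner e e')
  toFun_emb : ∀ b, toFun (emb b) = φ b

/-- Compact subsets of `A` are almost contained in matrix algebras over `B`. -/
def HasCompactCornerFrames (φ : B →⋆ₙₐ[ℂ] A) : Prop :=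
  ∀ K : Set A, IsCompact K → ∀ ε : ℝ, 0 < ε → ∃ (n : ℕ) (F : CornerFrame φ (Fin n)),
    ∀ a ∈ K, ‖∑ k, ∑ l, F.unit k l (F.compress k l a) - a‖ < ε

variable {φ : B →⋆ₙₐ[ℂ] A} {E : Type w} [NormedAddCommGroup E] [NormedSpace ℂ E]
    [CompleteSpace E] [HilbertModule B E] [inst : Correspondence A B E]

theorem CornerRealization.map_act (κ : CornerRealization φ E) (e : E) (b : B) :
    κ.toFun (HilbertModule.act e b) = κ.toFun e * φ b := by
  set d := κ.toFun (HilbertModule.act e b) - κ.toFun e * φ b with hd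
  -- `d` is orthogonal to the range of the realization, and it belongs to this range.
  have h1 : ∀ e' : E, star (κ.toFun e') * d = 0 := fun e' => by
    rw [hd, mul_sub, ← mul_assoc, κ.star_mul, κ.star_mul, HilbertModule.inner_act, map_mul, sub_self]
  have h2 : d = κ.toFun (HilbertModule.act e b - Correspondence.left B (κ.toFun e) (κ.emb b)) := by
    rw [map_sub, κ.map_left, κ.toFun_emb]
  have h3 := h1 (HilbertModule.act e b - Correspondence.left B (κ.toFun e) (κ.emb b))
  rw [← h2] at h3
  exact sub_eq_zero.mp ((CStarRing.star_mul_self_eq_zero_iff d).mp h3)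

theorem CornerRealization.unit_mem (κ : CornerRealization φ E) {ι : Type} [DecidableEq ι]
    (F : CornerFrame φ ι) (k l : Option ι) (b : B) :
    F.unit k l b ∈ Submodule.span ℂ {x | ∃ e e' : E, x = κ.toFun e * star (κ.toFun e')} := by
  let := CStarAlgebra.spectralOrder B
  let := CStarAlgebra.spectralOrderedRing B
  have hb : b ∈ Submodule.span ℂ {b : B | 0 ≤ b} := by
    rw [CStarAlgebra.span_nonneg]
    trivial
  induction hb using Submodule.span_induction with
  | mem b hb =>
    -- A positive element is the fourth power of a self-adjoint one.
    have hb0 : 0 ≤ b := Set.mem_ofPred.mp hb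
    set r := CFC.sqrt b with hr
    set s := CFC.sqrt r with hs
    have hrr : r * r = b := CFC.sqrt_mul_sqrt_self b hb0
    have hss : s * s = r := CFC.sqrt_mul_sqrt_self r (CFC.sqrt_nonneg b)
    have hsa : star s = s := (IsSelfAdjoint.of_nonneg (CFC.sqrt_nonneg r)).star_eq
    have hu : ∀ m, κ.toFun (Correspondence.left B (F.unit m none s) (κ.emb s)) = F.unit m none r := by
      intro m
      rw [κ.map_left, κ.toFun_emb, ← F.unit_none, F.unit_mul, if_pos rfl, hss]
    refine Submodule.subset_span ⟨Correspondence.left B (F.unit k none s) (κ.emb s),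
      Correspondence.left B (F.unit l none s) (κ.emb s), ?_⟩
    rw [hu, hu, F.star_unit, F.unit_mul, if_pos rfl, ← hss, StarMul.star_mul, hsa, hss, hrr]
  | zero => rw [map_zero]; exact Submodule.zero_mem _
  | add a b _ _ ha hb => rw [map_add]; exact Submodule.add_mem _ ha hb
  | smul c a _ ha => rw [map_smul]; exact Submodule.smul_mem _ c ha

/-- A realization of `E` in `A`, for an algebra `A` that is approximated by matrix algebras over `B`,
is full. -/
def CornerRealization.toCornerEmbedding (κ : CornerRealization φ E) (h : HasCornerFrames φ) :
    @CornerEmbedding A _ B _ φ ⟨E⟩ inst :=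
  @CornerEmbedding.mk A _ B _ φ ⟨E⟩ inst κ.toFun κ.injective κ.map_left κ.star_mul κ.map_act
    fun a => by
      refine Metric.mem_closure_iff.mpr fun ε hε => ?_
      obtain ⟨n, F, hF⟩ := h {a} (Set.finite_singleton a) ε hε
      refine ⟨∑ k, ∑ l, F.unit k l (F.compress k l a), ?_, ?_⟩
      · exact Submodule.sum_mem _ fun k _ => Submodule.sum_mem _ fun l _ => κ.unit_mem F k l _
      · rw [dist_comm, dist_eq_norm]
        exact hF a rfl

/-- `E_*` is an isomorphism with inverse `φ_*`. -/
theorem CornerRealization.exelRel_iff (κ : CornerRealization φ E) (h : HasCornerFrames φ) :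
    Function.Bijective (K0.map φ) ∧
      ∀ x y, @ExelRel A _ B _ ⟨E⟩ inst x y ↔ K0.map φ y = x := by
  have hex := fun x : K0 A => @exists_exelRel A _ B _ φ ⟨E⟩ inst (κ.toCornerEmbedding h) x
  have hmap := fun (x : K0 A) (y : K0 B) =>
    @ExelRel.map_eq A _ B _ φ ⟨E⟩ inst (κ.toCornerEmbedding h) x y
  refine ⟨⟨h.map_injective, fun x => ?_⟩, fun x y => ⟨hmap x y, fun hxy => ?_⟩⟩
  · obtain ⟨y, hy⟩ := hex x
    exact ⟨y, hmap x y hy⟩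
  · obtain ⟨y', hy'⟩ := hex x
    rwa [h.map_injective (hxy.trans (hmap x y' hy').symm)]

/-- The pointwise application of a bounded linear map to functions vanishing at infinity. -/
def suspL {P Q : Type*} [NormedAddCommGroup P] [NormedSpace ℂ P] [NormedAddCommGroup Q]
    [NormedSpace ℂ Q] (f : P →L[ℂ] Q) : C₀(ℝ, P) →L[ℂ] C₀(ℝ, Q) :=
  LinearMap.mkContinuous
    { toFun := fun p =>
        { toFun := fun t => f (p t)
          continuous_toFun := f.continuous.comp (map_continuous p)
          zero_at_infty' := by
            have h := f.continuous.tendsto 0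
            rw [map_zero] at h
            exact h.comp (ZeroAtInftyContinuousMapClass.zero_at_infty p) }
      map_add' := fun p q => by ext t; exact map_add f _ _
      map_smul' := fun c p => by ext t; exact map_smul f _ _ } ‖f‖
    fun p => (zeroAtInfty_norm_le (by positivity)).mpr fun t =>
      (f.le_opNorm (p t)).trans (by
        gcongr
        exact zeroAtInfty_norm_apply_le p t)

/-- The suspension of a corner realization. -/
def CornerRealization.susp (κ : CornerRealization φ E) :
    CornerRealization (suspHom φ) C₀(ℝ, E) where
  toFun := suspL κ.toFun
  emb := suspL κ.emb
  injective f g h := by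
    ext t
    exact κ.injective (DFunLike.congr_fun h t)
  map_left a e := by
    ext t
    exact κ.map_left (a t) (e t)
  star_mul e e' := by
    ext t
    exact κ.star_mul (e t) (e' t)
  toFun_emb b := by
    ext t
    exact κ.toFun_emb (b t)

/-- The suspension of a frame. -/
def CornerFrame.susp {ι : Type} [DecidableEq ι] (F : CornerFrame φ ι) :
    CornerFrame (suspHom φ) ι where
  unit k l := suspL (F.unit k l)
  compress k l := suspL (F.compress k l)
  unit_mul k l l' m b c := by
    ext t
    refine (F.unit_mul k l l' m (b t) (c t)).trans ?_
    split_ifs <;> rfl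
  star_unit k l b := by
    ext t
    exact F.star_unit k l (b t)
  unit_none b := by
    ext t
    exact F.unit_none (b t)
  compress_unit k l k' l' b := by
    ext t
    refine (F.compress_unit k l k' l' (b t)).trans ?_
    split_ifs <;> rfl

theorem HasCompactCornerFrames.hasCornerFrames (h : HasCompactCornerFrames φ) : HasCornerFrames φ :=
  fun K hK => h K hK.isCompact

theorem HasCompactCornerFrames.susp (h : HasCompactCornerFrames φ) : HasCornerFrames (suspHom φ) := by
  intro K hK ε hε
  -- The values of finitely many functions vanishing at infinity form a compact set, with `0`.
  have hc : IsCompact (⋃ f ∈ K, insert (0 : A) (Set.range f)) :=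
    hK.isCompact_biUnion fun f _ =>
      (ZeroAtInftyContinuousMapClass.zero_at_infty f).isCompact_insert_range_of_cocompact
        (map_continuous f)
  obtain ⟨n, F, hF⟩ := h _ hc (ε / 2) (half_pos hε)
  refine ⟨n, F.susp, fun f hf => lt_of_le_of_lt ?_ (half_lt_self hε)⟩
  refine (zeroAtInfty_norm_le (half_pos hε).le).mpr fun t => ?_
  have h1 := (hF (f t) (Set.mem_biUnion hf (Set.mem_insert_of_mem _ ⟨t, rfl⟩))).le
  have h2 : (∑ k, ∑ l, F.susp.unit k l (F.susp.compress k l f) - f) t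
      = ∑ k, ∑ l, F.unit k l (F.compress k l (f t)) - f t := by
    have : ∀ g : C₀(ℝ, A), g t = evalStarHom A t g := fun _ => rfl
    rw [this, map_sub, map_sum]
    simp only [map_sum]
    rfl
  rwa [h2]

end Realization

/-! ### Corners and frames of completions -/

section CompletedCorners

universe v w

variable {𝒜 : Type v} [NonUnitalRing 𝒜] [StarRing 𝒜] [Module ℂ 𝒜] [IsScalarTower ℂ 𝒜 𝒜]
  [SMulCommClass ℂ 𝒜 𝒜] [StarModule ℂ 𝒜]
  {ℬ : Type w} [NonUnitalRing ℬ] [StarRing ℬ] [Module ℂ ℬ] [IsScalarTower ℂ ℬ ℬ]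
  [SMulCommClass ℂ ℬ ℬ] [StarModule ℂ ℬ]
  {V : Type w} [AddCommGroup V] [Module ℂ V]

namespace PreHilbertModule

variable (P : PreHilbertModule 𝒜 V) (N : CStarSeminorm 𝒜) (N' : CStarSeminorm ℬ)

/-- The extension to the completions of a bounded linear map from a pre-Hilbert module to a
*-algebra. -/
def liftL (r : V →ₗ[ℂ] ℬ) (hr : ∀ ξ, N'.toFun (r ξ) ^ 2 ≤ N.toFun (P.inner ξ ξ)) :
    P.Compl N →L[ℂ] N'.Compl :=
  ContinuousLinearMap.fromCompletion (α := P.Pre N) (β := N'.Compl)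
    (LinearMap.mkContinuous
      { toFun := fun ξ : P.Pre N => N'.ι (r ξ)
        map_add' := fun ξ ξ' => (congrArg N'.ι (map_add r (ξ : V) ξ')).trans (map_add N'.ι _ _)
        map_smul' := fun c ξ => (congrArg N'.ι (map_smul r c (ξ : V))).trans (map_smul N'.ι _ _) }
      1 fun ξ => by
        rw [one_mul]
        exact (N'.norm_ι _).trans_le (Real.le_sqrt_of_sq_le (hr ξ)))

variable {N'} in
theorem liftL_toCompl (r : V →ₗ[ℂ] ℬ) (hr : ∀ ξ, N'.toFun (r ξ) ^ 2 ≤ N.toFun (P.inner ξ ξ))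
    (ξ : V) : P.liftL N N' r hr (P.toCompl N ξ) = N'.ι (r ξ) :=
  ContinuousLinearMap.fromCompletion_apply_coe (α := P.Pre N) _ (ξ : P.Pre N)

variable (l : ℬ →ₗ[ℂ] V →ₗ[ℂ] V) (hmul : ∀ b b' ξ, l (b * b') ξ = l b (l b' ξ))
    (hinner : ∀ b ξ η, P.inner (l b ξ) η = P.inner ξ (l (star b) η))
    (hb : ∀ b ξ, N.toFun (P.inner (l b ξ) (l b ξ)) ≤ N'.toFun b ^ 2 * N.toFun (P.inner ξ ξ))
    {φ : 𝒜 →⋆ₙₐ[ℂ] ℬ} (hφ : ∀ a, N'.toFun (φ a) ≤ N.toFun a)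

/-- A realization of a pre-Hilbert module as a corner of a *-algebra extends to the completions. -/
def cornerRealization (r : V →ₗ[ℂ] ℬ) (v : V)
    (hr : ∀ ξ ξ', star (r ξ) * r ξ' = φ (P.inner ξ ξ'))
    (hl : ∀ b ξ, r (l b ξ) = b * r ξ) (hv : ∀ a, r (P.act v a) = φ a)
    (hinv : ∀ a, P.inner v (l (φ a) v) = a) :
    @CornerRealization N'.Compl _ N.Compl _ (CStarSeminorm.extend N N' φ hφ) (P.Compl N) _ _ _ _
      (P.complCorrespondence N N' l hmul hinner hb) :=
  have hr' : ∀ ξ, N'.toFun (r ξ) ^ 2 ≤ N.toFun (P.inner ξ ξ) := fun ξ => by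
    rw [sq, ← N'.cstar, hr]
    exact hφ _
  have hc := continuous_starHom (CStarSeminorm.extend N N' φ hφ)
  @CornerRealization.mk N'.Compl _ N.Compl _ (CStarSeminorm.extend N N' φ hφ) (P.Compl N) _ _ _ _
    (P.complCorrespondence N N' l hmul hinner hb) (P.liftL N N' r hr') (P.actL N (P.toCompl N v))
    (by
      refine Function.LeftInverse.injective
        (g := fun a => P.innerL N (P.toCompl N v) (P.leftL N N' l hb a (P.toCompl N v))) fun a => ?_
      refine induction_on_coeff a (isClosed_eq ?_ ?_) fun a => ?_
      · fun_prop
      · fun_prop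
      simp only [CStarSeminorm.extend_ι, leftL_toCompl, innerL_toCompl, hinv])
    (fun a ξ => by
      change P.liftL N N' r hr' (P.leftL N N' l hb a ξ) = a * P.liftL N N' r hr' ξ
      refine induction_on ξ (isClosed_eq ?_ ?_) fun ξ => ?_
      · fun_prop
      · fun_prop
      refine induction_on_coeff a (isClosed_eq ?_ ?_) fun b => ?_
      · fun_prop
      · fun_prop
      rw [leftL_toCompl, liftL_toCompl, liftL_toCompl, hl, map_mul])
    (fun ξ ξ' => by
      change _ = CStarSeminorm.extend N N' φ hφ (P.innerL N ξ ξ')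
      refine induction_on ξ (isClosed_eq ?_ ?_) fun ξ => ?_
      · fun_prop
      · fun_prop
      refine induction_on ξ' (isClosed_eq ?_ ?_) fun ξ' => ?_
      · fun_prop
      · fun_prop
      rw [liftL_toCompl, liftL_toCompl, innerL_toCompl, CStarSeminorm.extend_ι, ← hr, map_mul,
        map_star])
    (fun a => by
      refine induction_on_coeff a (isClosed_eq ?_ ?_) fun a => ?_
      · fun_prop
      · fun_prop
      rw [actL_toCompl, liftL_toCompl, CStarSeminorm.extend_ι, hv])

/-- Algebraic data that induce a corner frame on the completions: the matrix units are
`a ↦ real l (vec k · a)`, to be thought of as `V_k a V_l*`, and the compressions are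
`b ↦ ⟨vec k, b vec l⟩`, to be thought of as `V_k* b V_l`. -/
structure Frame (φ : 𝒜 →⋆ₙₐ[ℂ] ℬ) (κ : Type) [DecidableEq κ] where
  vec : Option κ → V
  real : Option κ → V →ₗ[ℂ] ℬ
  bound : ∀ k ξ, N'.toFun (real k ξ) ^ 2 ≤ N.toFun (P.inner ξ ξ)
  mul : ∀ k m n p a b, real m (P.act (vec k) a) * real p (P.act (vec n) b)
    = if m = n then real p (P.act (vec k) (a * b)) else 0
  star : ∀ k m a, star (real m (P.act (vec k) a)) = real k (P.act (vec m) (star a))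
  none : ∀ a, real none (P.act (vec none) a) = φ a
  compress : ∀ k m k' m' a, P.inner (vec k) (l (real m' (P.act (vec k') a)) (vec m))
    = if k = k' ∧ m = m' then a else 0

variable {P N N' l}

/-- The corner frame of the completions given by algebraic data. -/
def Frame.toCornerFrame {κ : Type} [DecidableEq κ] (F : P.Frame N N' l φ κ) :
    CornerFrame (CStarSeminorm.extend N N' φ hφ) κ where
  unit k m := P.liftL N N' (F.real m) (F.bound m) ∘L P.actL N (P.toCompl N (F.vec k))
  compress k m := P.innerL N (P.toCompl N (F.vec k)) ∘L
    (P.leftL N N' l hb).flip (P.toCompl N (F.vec m))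
  unit_mul k m n p a b := by
    refine induction_on_coeff a (isClosed_eq ?_ ?_) fun a => ?_
    · fun_prop
    · split_ifs <;> fun_prop
    refine induction_on_coeff b (isClosed_eq ?_ ?_) fun b => ?_
    · fun_prop
    · split_ifs <;> fun_prop
    simp only [ContinuousLinearMap.comp_apply, ← map_mul, actL_toCompl, liftL_toCompl, F.mul]
    split_ifs
    · rfl
    · exact map_zero _
  star_unit k m a := by
    refine induction_on_coeff a (isClosed_eq ?_ ?_) fun a => ?_
    · fun_prop
    · fun_prop
    simp only [ContinuousLinearMap.comp_apply, ← map_star, actL_toCompl, liftL_toCompl, F.star]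
  unit_none a := by
    refine induction_on_coeff a (isClosed_eq ?_ ?_) fun a => ?_
    · fun_prop
    · exact continuous_starHom _
    simp only [ContinuousLinearMap.comp_apply, actL_toCompl, liftL_toCompl, F.none,
      CStarSeminorm.extend_ι]
  compress_unit k m k' m' a := by
    refine induction_on_coeff a (isClosed_eq ?_ ?_) fun a => ?_
    · fun_prop
    · split_ifs <;> fun_prop
    simp only [ContinuousLinearMap.comp_apply, actL_toCompl, liftL_toCompl,
      ContinuousLinearMap.flip_apply, leftL_toCompl, innerL_toCompl, F.compress]
    split_ifs
    · rfl
    · exact map_zero _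

/-- Frames for which the compression to the matrix algebra is `b ↦ p b p`, with projections `p` that
form an approximate unit for the algebra, approximate all compact subsets of the completion. -/
theorem hasCompactCornerFrames
    (hb : ∀ b ξ, N.toFun (P.inner (l b ξ) (l b ξ)) ≤ N'.toFun b ^ 2 * N.toFun (P.inner ξ ξ))
    (h : ∀ (t : Set ℬ), t.Finite → ∀ ε : ℝ, 0 < ε → ∃ (n : ℕ) (F : P.Frame N N' l φ (Fin n)) (p : ℬ),
      star p = p ∧ p * p = p ∧
      (∀ b, ∑ k, ∑ m, F.real m (P.act (F.vec k) (P.inner (F.vec k) (l b (F.vec m)))) = p * b * p) ∧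
      ∀ b ∈ t, N'.toFun (b - p * b) < ε) :
    HasCompactCornerFrames (CStarSeminorm.extend N N' φ hφ) := by
  intro K hK ε hε
  obtain ⟨c, -, hcf, hKc⟩ := hK.finite_cover_balls (e := ε / 8) (by positivity)
  have hd : ∀ a : N'.Compl, ∃ b : ℬ, ‖a - N'.ι b‖ < ε / 8 := fun a => by
    obtain ⟨b, hb⟩ := N'.denseRange_ι.exists_dist_lt a (ε := ε / 8) (by positivity)
    exact ⟨b, by rwa [← dist_eq_norm]⟩
  choose b hb' using hd
  obtain ⟨n, F, p, hps, hpp, hF, hp⟩ := h ((b '' c) ∪ (fun a => star (b a)) '' c)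
    ((hcf.image _).union (hcf.image _)) (ε / 8) (by positivity)
  refine ⟨n, F.toCornerFrame hb hφ, fun a ha => ?_⟩
  have hp1 : ‖N'.ι p‖ ≤ 1 := by
    have h1 : ‖N'.ι p‖ * ‖N'.ι p‖ = ‖N'.ι p‖ := by
      rw [← CStarRing.norm_star_mul_self, ← map_star, hps, ← map_mul, hpp]
    by_contra hcon
    nlinarith
  have hsum : ∑ k, ∑ m, (F.toCornerFrame hb hφ).unit k m ((F.toCornerFrame hb hφ).compress k m a)
      = N'.ι p * a * N'.ι p := by
    refine induction_on_coeff a (isClosed_eq ?_ ?_) fun b => ?_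
    · fun_prop
    · fun_prop
    rw [← map_mul, ← map_mul, ← hF, map_sum]
    refine Finset.sum_congr rfl fun k _ => ?_
    rw [map_sum]
    refine Finset.sum_congr rfl fun m _ => ?_
    simp only [Frame.toCornerFrame, ContinuousLinearMap.comp_apply, actL_toCompl, liftL_toCompl,
      ContinuousLinearMap.flip_apply, leftL_toCompl, innerL_toCompl]
  rw [hsum]
  obtain ⟨a', ha', haa'⟩ := Set.mem_iUnion₂.mp (hKc ha)
  set q := N'.ι p with hq
  set x := N'.ι (b a') with hx
  have hqs : star q = q := by rw [hq, ← map_star, hps]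
  have h1 : ‖x - q * x‖ < ε / 8 := by
    have := hp (b a') (Or.inl ⟨a', ha', rfl⟩)
    rwa [← N'.norm_ι, map_sub, map_mul] at this
  have h2 : ‖x - x * q‖ < ε / 8 := by
    have := hp (star (b a')) (Or.inr ⟨a', ha', rfl⟩)
    rw [← N'.norm_ι, ← norm_star, ← map_star, star_sub, star_mul, star_star, hps, map_sub, map_mul]
      at this
    exact this
  have h3 : ‖a - x‖ < ε / 4 := by
    have e1 := hb' a'
    have e2 : ‖a - a'‖ < ε / 8 := by rw [← dist_eq_norm]; exact haa'
    have e3 := norm_add_le (a - a') (a' - x)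
    rw [sub_add_sub_cancel] at e3
    linarith
  have hqz : ∀ z : N'.Compl, ‖q * z‖ ≤ ‖z‖ := fun z =>
    (norm_mul_le _ _).trans (mul_le_of_le_one_left (norm_nonneg _) hp1)
  have hzq : ∀ z : N'.Compl, ‖z * q‖ ≤ ‖z‖ := fun z =>
    (norm_mul_le _ _).trans (mul_le_of_le_one_right (norm_nonneg _) hp1)
  have h4 : q * a * q - a = q * (a - x) * q - q * (x - x * q) - (x - q * x) - (a - x) := by
    noncomm_ring
  rw [h4]
  have e1 := (hzq (q * (a - x))).trans (hqz (a - x))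
  have e2 := hqz (x - x * q)
  have e3 := norm_sub_le (q * (a - x) * q - q * (x - x * q) - (x - q * x)) (a - x)
  have e4 := norm_sub_le (q * (a - x) * q - q * (x - x * q)) (x - q * x)
  have e5 := norm_sub_le (q * (a - x) * q) (q * (x - x * q))
  linarith

end PreHilbertModule

end CompletedCorners

/-! ### Orthonormal families -/

section OrthoFamilies

universe u v

open ContinuousLinearMap (adjoint)

variable (X : Type u) (K : Type v) [NormedAddCommGroup K] [InnerProductSpace ℂ K]

/-- Families of orthonormal systems in `K`, one for each point of `X`. -/
structure OrthoFamily (κ : Type) where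
  vec : κ → X → K
  orthonormal : ∀ x, Orthonormal ℂ fun k => vec k x

namespace OrthoFamily

variable {X K} {κ : Type} (e : OrthoFamily X K κ)

theorem norm_eq (k : κ) (x : X) : ‖e.vec k x‖ = 1 := (e.orthonormal x).1 k

variable [MetricSpace X]

/-- The isometry `V_k : ℓ²(X) → ℓ²(X, K)` given by the vectors of index `k`. -/
def op (k : κ) : L2 X ℂ →L[ℂ] L2 X K := colOp (e.vec k) fun x => (e.norm_eq k x).le

variable [CompleteSpace K]

theorem adjoint_op_op [DecidableEq κ] (k l : κ) (f : L2 X ℂ) :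
    adjoint (e.op k) (e.op l f) = if k = l then f else 0 := by
  have h : adjoint (e.op k) ∘L e.op l = if k = l then ContinuousLinearMap.id ℂ _ else 0 := by
    split_ifs with hkl
    · subst hkl
      exact adjoint_colOp_comp_colOp (e.vec k) (e.norm_eq k)
    · refine ext_entry fun x y => ?_
      ext
      refine (entry_adjoint_colOp_comp _ _ _ x y 1).trans ?_
      rw [entry_zero, _root_.zero_apply]
      by_cases hxy : x = y
      · subst hxy
        refine (congrArg (fun F => inner ℂ (e.vec k x) (F 1)) (entry_colOp_self _ _ x)).trans ?_
        simpa using (e.orthonormal x).2 hkl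
      · refine (congrArg (fun F => inner ℂ (e.vec k x) (F 1)) (entry_colOp_ne _ _ hxy)).trans ?_
        simp
  refine (DFunLike.congr_fun h f).trans ?_
  split_ifs <;> rfl

end OrthoFamily

end OrthoFamilies

/-! ### The bimodule as a corner of the uniform algebra -/

section Concrete

universe u v

open ContinuousLinearMap (adjoint)

variable {X : Type u} [MetricSpace X] [BoundedGeometry X]
  {K : Type v} [NormedAddCommGroup K] [InnerProductSpace ℂ K] [CompleteSpace K]

/-- The entries of `ξ V*`, for `ξ ∈ E_alg` and the diagonal `V` of a family of vectors, have rank at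
most one. -/
theorem comp_adjoint_colOp_mem (η : X → K) (hη : ∀ x, ‖η x‖ ≤ 1) (ξ : Ealg X K) :
    (ξ : L2 X ℂ →L[ℂ] L2 X K) ∘L adjoint (colOp η hη) ∈ UCalg X K := by
  have h : colOp η hη ∘L adjoint (ξ : L2 X ℂ →L[ℂ] L2 X K) ∈ UCalg X K := by
    rw [mem_UCalg']
    refine ⟨(finitePropagation_colOp η hη).comp (FinitePropagation.adjoint ξ.2), fun ε hε => ⟨1,
      fun x y => ⟨_, ?_, (by simpa using hε : ‖entry (colOp η hη ∘L
        adjoint (ξ : L2 X ℂ →L[ℂ] L2 X K)) x y - _‖ < ε)⟩⟩⟩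
    rw [colOp, entry_diagOp_comp]
    refine (LinearMap.rank_comp_le_left _
      (ContinuousLinearMap.toSpanSingleton ℂ (η x) : ℂ →ₗ[ℂ] K)).trans ?_
    refine (Submodule.rank_mono (t := ℂ ∙ η x) ?_).trans ?_
    · rintro _ ⟨c, rfl⟩
      exact Submodule.mem_span_singleton.mpr ⟨c, rfl⟩
    · simpa using rank_span_le ({η x} : Set K)
  have h2 := star_mem h
  rwa [ContinuousLinearMap.star_eq_adjoint, ContinuousLinearMap.adjoint_comp,
    ContinuousLinearMap.adjoint_adjoint] at h2

/-- The embedding `ξ ↦ ξ V*` of `E_alg` in `Uℂ[X]` given by a family of vectors. -/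
def ealgRealize (η : X → K) (hη : ∀ x, ‖η x‖ ≤ 1) : Ealg X K →ₗ[ℂ] UCalg X K where
  toFun ξ := ⟨(ξ : L2 X ℂ →L[ℂ] L2 X K) ∘L adjoint (colOp η hη), comp_adjoint_colOp_mem η hη ξ⟩
  map_add' _ _ := rfl
  map_smul' _ _ := rfl

theorem star_ealgRealize_mul (η : X → K) (hη : ∀ x, ‖η x‖ = 1) (ξ ξ' : Ealg X K) :
    star (ealgRealize η (fun x => (hη x).le) ξ) * ealgRealize η (fun x => (hη x).le) ξ'
      = iPalg η hη ((preE X K).inner ξ ξ') := by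
  apply Subtype.ext
  change adjoint ((ξ : L2 X ℂ →L[ℂ] L2 X K) ∘L adjoint (colOp η _)) ∘L
    ((ξ' : L2 X ℂ →L[ℂ] L2 X K) ∘L adjoint (colOp η _)) = _
  rw [ContinuousLinearMap.adjoint_comp, ContinuousLinearMap.adjoint_adjoint]
  rfl

/-- The realization of `E` as a corner of the uniform algebra given by unit vectors. -/
def bimoduleRealization (s : Variant) (η : X → K) (hη : ∀ x, ‖η x‖ = 1) :
    @CornerRealization (UCStar X K s) _ (CuStar X s) _ (iP s η hη) (EStar X K s) _ _ _ _ _ :=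
  (preE X K).cornerRealization (s.seminorm (Cu X)) (s.seminorm (UCalg X K)) (ealgLeft X K)
    ealgLeft_mul preE_inner_left (toFun_ealgLeft_le s) (norm_iPalg_le s η hη)
    (ealgRealize η fun x => (hη x).le) ⟨colOp η fun x => (hη x).le, finitePropagation_colOp _ _⟩
    (star_ealgRealize_mul η hη) (fun _ _ => rfl) (fun _ => rfl) fun T => by
      apply Subtype.ext
      ext1 f
      have h : ∀ g, adjoint (colOp η fun x => (hη x).le) (colOp η (fun x => (hη x).le) g) = g :=
        fun g => DFunLike.congr_fun (adjoint_colOp_comp_colOp η hη) g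
      exact (h _).trans (congrArg (T : L2 X ℂ →L[ℂ] L2 X ℂ) (h f))

/-! ### Frames of the uniform algebra -/

namespace OrthoFamily

variable {κ : Type} (e : OrthoFamily X K κ)

/-- The frame of `Uℂ[X]` given by an orthonormal family. -/
def frame (s : Variant) {κ : Type} [DecidableEq κ] (e : OrthoFamily X K (Option κ)) :
    (preE X K).Frame (s.seminorm (Cu X)) (s.seminorm (UCalg X K)) (ealgLeft X K)
      (iPalg (e.vec none) (e.norm_eq none)) κ where
  vec k := ⟨e.op k, finitePropagation_colOp _ _⟩
  real k := ealgRealize (e.vec k) fun x => (e.norm_eq k x).le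
  bound k ξ := by
    rw [sq, ← CStarSeminorm.cstar, star_ealgRealize_mul _ (e.norm_eq k)]
    exact norm_iPalg_le s _ _ _
  mul k m n p S T := by
    apply Subtype.ext
    ext1 f
    have h1 := e.adjoint_op_op m n ((T : L2 X ℂ →L[ℂ] L2 X ℂ) (adjoint (e.op p) f))
    refine (congrArg (fun g => e.op k ((S : L2 X ℂ →L[ℂ] L2 X ℂ) g)) h1).trans ?_
    split_ifs
    · rfl
    · simp
  star k m T := by
    apply Subtype.ext
    change adjoint (e.op k ∘L ((T : L2 X ℂ →L[ℂ] L2 X ℂ) ∘L adjoint (e.op m))) = _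
    rw [ContinuousLinearMap.adjoint_comp, ContinuousLinearMap.adjoint_comp,
      ContinuousLinearMap.adjoint_adjoint]
    rfl
  none T := rfl
  compress k m k' m' T := by
    apply Subtype.ext
    ext1 f
    have h1 := e.adjoint_op_op m' m f
    have h2 := e.adjoint_op_op k k' ((T : L2 X ℂ →L[ℂ] L2 X ℂ) (adjoint (e.op m') (e.op m f)))
    refine h2.trans ?_
    rw [h1]
    by_cases hk : k = k' <;> by_cases hm : m = m' <;> simp [hk, hm, eq_comm]

variable [Fintype κ]

/-- The projection onto the span of the orthonormal systems of an orthonormal family. -/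
def proj : UCalg X K :=
  ∑ k, ealgRealize (e.vec k) (fun x => (e.norm_eq k x).le) ⟨e.op k, finitePropagation_colOp _ _⟩

theorem proj_apply (f : L2 X K) :
    (e.proj : L2 X K →L[ℂ] L2 X K) f = ∑ k, e.op k (adjoint (e.op k) f) := by
  rw [proj, AddSubmonoidClass.coe_finsetSum, _root_.sum_apply]
  rfl

theorem star_proj : star e.proj = e.proj := by
  rw [proj, star_sum]
  refine Finset.sum_congr rfl fun k _ => ?_
  apply Subtype.ext
  change adjoint (e.op k ∘L adjoint (e.op k)) = _
  rw [ContinuousLinearMap.adjoint_comp, ContinuousLinearMap.adjoint_adjoint]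
  rfl

theorem proj_mul_proj : e.proj * e.proj = e.proj := by
  classical
  apply Subtype.ext
  ext1 f
  refine (e.proj_apply _).trans (Eq.trans ?_ (e.proj_apply f).symm)
  refine Finset.sum_congr rfl fun k _ => congrArg (e.op k) ?_
  refine (congrArg (adjoint (e.op k)) (e.proj_apply f)).trans ?_
  rw [map_sum]
  simp only [e.adjoint_op_op, Finset.sum_ite_eq, Finset.mem_univ, if_true]

theorem sum_frame (s : Variant) {κ : Type} [DecidableEq κ] [Fintype κ]
    (e : OrthoFamily X K (Option κ)) (T : UCalg X K) :
    ∑ k, ∑ m, (e.frame s).real m ((preE X K).act ((e.frame s).vec k)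
      ((preE X K).inner ((e.frame s).vec k) (ealgLeft X K T ((e.frame s).vec m))))
      = e.proj * T * e.proj := by
  rw [proj, Finset.sum_mul, Finset.sum_mul_sum]
  rfl

theorem proj_apply_apply (f : L2 X K) (x : X) :
    (e.proj : L2 X K →L[ℂ] L2 X K) f x = ∑ k, inner ℂ (e.vec k x) (f x) • e.vec k x := by
  rw [e.proj_apply, lp.coeFn_sum, Finset.sum_apply]
  refine Finset.sum_congr rfl fun k _ => ?_
  have h := inner_incl_left x (1 : ℂ) (adjoint (e.op k) f)
  rw [ContinuousLinearMap.adjoint_inner_right, op, colOp, diagOp_incl, inner_incl_left] at h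
  have h2 : (adjoint (e.op k) f : L2 X ℂ) x = inner ℂ (e.vec k x) (f x) := by
    simpa [op, colOp] using h.symm
  exact congrArg (· • e.vec k x) h2

theorem entry_sub_proj_mul (T : UCalg X K) (x y : X) (u : K) :
    entry ((T - e.proj * T : UCalg X K) : L2 X K →L[ℂ] L2 X K) x y u
      = entry (T : L2 X K →L[ℂ] L2 X K) x y u
        - ∑ k, inner ℂ (e.vec k x) (entry (T : L2 X K →L[ℂ] L2 X K) x y u) • e.vec k x :=
  congrArg (entry (T : L2 X K →L[ℂ] L2 X K) x y u - ·)
    (e.proj_apply_apply ((T : L2 X K →L[ℂ] L2 X K) (incl K y u)) x)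

end OrthoFamily

end Concrete

/-! ### Operators with small entries -/

section SmallEntries

universe u v

open ContinuousLinearMap (adjoint)

variable {X : Type u} {K : Type v} [NormedAddCommGroup K] [InnerProductSpace ℂ K]

theorem norm_le_of_diag {T : L2 X K →L[ℂ] L2 X K} (h : ∀ x y, x ≠ y → entry T x y = 0) {C : ℝ}
    (hC : 0 ≤ C) (hT : ∀ x, ‖entry T x x‖ ≤ C) : ‖T‖ ≤ C := by
  have h1 : T = diagOp (fun x => entry T x x) hC hT := by
    refine ext_entry fun x y => ?_
    by_cases hxy : x = y
    · subst hxy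
      rw [entry_diagOp_self]
    · rw [h x y hxy, entry_diagOp_ne _ _ _ hxy]
  rw [h1]
  exact norm_diagOp_le _ _ _

variable [MetricSpace X] [BoundedGeometry X] [CompleteSpace K]

theorem cut_comp_cut_mem {T : L2 X K →L[ℂ] L2 X K} (hT : T ∈ UCalg X K) (s t : Set X) :
    cut K s ∘L T ∘L cut K t ∈ UCalg X K := by
  classical
  rw [mem_UCalg'] at *
  refine ⟨finitePropagation_cut hT.1 s t, fun ε hε => ?_⟩
  obtain ⟨N, hN⟩ := hT.2 ε hε
  refine ⟨N, fun x y => ?_⟩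
  rw [entry_cut_comp_cut]
  split_ifs
  · exact hN x y
  · exact ⟨0, by simp, by simpa using hε⟩

variable (X K) in
/-- The diagonal operators in `Uℂ[X]`. -/
def diagAlg : NonUnitalStarSubalgebra ℂ (L2 X K →L[ℂ] L2 X K) where
  carrier := {T | T ∈ UCalg X K ∧ ∀ x y, x ≠ y → entry T x y = 0}
  add_mem' := fun {A B} hA hB => ⟨add_mem hA.1 hB.1, fun x y h => by
    rw [entry_add, hA.2 x y h, hB.2 x y h, add_zero]⟩
  zero_mem' := ⟨zero_mem _, fun x y _ => entry_zero x y⟩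
  mul_mem' := fun {A B} hA hB => ⟨mul_mem hA.1 hB.1, fun x y h => by
    ext k
    rw [_root_.zero_apply]
    refine (hasSum_entry_comp _ _ x y k).unique ?_
    convert hasSum_zero using 2 with z
    by_cases hz : x = z
    · rw [hB.2 z y (hz ▸ h)]; simp
    · rw [hA.2 x z hz]; simp⟩
  smul_mem' := fun r A hA => ⟨SMulMemClass.smul_mem r hA.1, fun x y h => by
    rw [entry_smul, hA.2 x y h, smul_zero]⟩
  star_mem' := fun {A} hA => ⟨star_mem hA.1, fun x y h => by
    rw [ContinuousLinearMap.star_eq_adjoint, entry_adjoint, hA.2 y x h.symm, map_zero]⟩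

theorem isClosed_diagAlg : IsClosed (diagAlg X K : Set (L2 X K →L[ℂ] L2 X K)) := by
  convert (isClosed_diag (X := X) (K := K) (K' := K)).inter
    (isClosed_approximable (X := X) (K := K)) using 1
  ext T
  exact ⟨fun h => ⟨h.2, (isUniform_iff.mp h.1).2⟩,
    fun h => ⟨mem_UCalg'.mpr ⟨finitePropagation_of_diag h.1, h.2⟩, h.1⟩⟩

/-- The diagonal operators form a C*-algebra, on which every C*-seminorm is dominated by the norm. -/
theorem toFun_le_of_diag (N : CStarSeminorm (UCalg X K)) (T : UCalg X K)
    (h : ∀ x y, x ≠ y → entry (T : L2 X K →L[ℂ] L2 X K) x y = 0) :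
    N.toFun T ≤ ‖(T : L2 X K →L[ℂ] L2 X K)‖ := by
  have hD : IsClosed (diagAlg X K : Set (L2 X K →L[ℂ] L2 X K)) := isClosed_diagAlg
  let j : diagAlg X K →⋆ₙₐ[ℂ] UCalg X K :=
    { toFun := fun a => ⟨a.1, a.2.1⟩
      map_smul' := fun _ _ => rfl
      map_zero' := rfl
      map_add' := fun _ _ => rfl
      map_mul' := fun _ _ => rfl
      map_star' := fun _ => rfl }
  have h1 := NonUnitalStarAlgHom.norm_apply_le (N.ι.comp j) (⟨T, T.2, h⟩ : diagAlg X K)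
  exact (N.norm_ι T).symm.trans_le h1

/-- A C*-seminorm of an operator of controlled propagation is controlled by the norms of its
entries. -/
theorem exists_toFun_le (N : CStarSeminorm (UCalg X K)) {S : ℝ} (hS : 0 < S) :
    ∃ C : ℝ, 0 < C ∧ ∀ T : UCalg X K,
      (∀ x y, S ≤ dist x y → entry (T : L2 X K →L[ℂ] L2 X K) x y = 0) → ∀ ε : ℝ, 0 ≤ ε →
      (∀ x y, ‖entry (T : L2 X K →L[ℂ] L2 X K) x y‖ ≤ ε) → N.toFun T ≤ C * ε := by
  classical
  obtain ⟨n, c, hc⟩ := exists_colouring (X := X) (2 * S) (by positivity)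
  refine ⟨(n : ℝ) * n + 1, by positivity, fun T hT ε hε hTε => ?_⟩
  let V : Fin n → Fin n → UCalg X K := fun i j =>
    ⟨cut K (c ⁻¹' {i}) ∘L (T : L2 X K →L[ℂ] L2 X K) ∘L cut K (c ⁻¹' {j}), cut_comp_cut_mem T.2 _ _⟩
  have hV : T = ∑ i, ∑ j, V i j := by
    apply Subtype.ext
    simp only [AddSubmonoidClass.coe_finsetSum]
    exact (sum_cut c (T : L2 X K →L[ℂ] L2 X K)).symm
  have hVe : ∀ i j x y, entry (V i j : L2 X K →L[ℂ] L2 X K) x y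
      = if x ∈ c ⁻¹' {i} ∧ y ∈ c ⁻¹' {j} then entry (T : L2 X K →L[ℂ] L2 X K) x y else 0 :=
    fun i j x y => entry_cut_comp_cut _ _ _ x y
  have hVε : ∀ i j x y, ‖entry (V i j : L2 X K →L[ℂ] L2 X K) x y‖ ≤ ε := fun i j x y => by
    rw [hVe]
    split_ifs
    · exact hTε x y
    · simpa using hε
  -- Each column of a block has at most one entry.
  have hVc : ∀ i j x z z', entry (V i j : L2 X K →L[ℂ] L2 X K) z x ≠ 0 →
      entry (V i j : L2 X K →L[ℂ] L2 X K) z' x ≠ 0 → z = z' := by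
    intro i j x z z' hz hz'
    rw [hVe] at hz hz'
    have h1 := (ite_ne_right_iff.mp hz).1
    have h2 := (ite_ne_right_iff.mp hz').1
    have h3 := (ite_ne_right_iff.mp hz).2
    have h4 := (ite_ne_right_iff.mp hz').2
    refine hc z z' (h1.1.trans h2.1.symm) ?_
    have h5 : dist z x < S := not_le.mp fun h => h3 (hT z x h)
    have h6 : dist z' x < S := not_le.mp fun h => h4 (hT z' x h)
    have := dist_triangle_right z z' x
    linarith
  have hVd : ∀ i j x, ‖entry ((star (V i j) * V i j : UCalg X K) : L2 X K →L[ℂ] L2 X K) x x‖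
      ≤ ε * ε := by
    intro i j x
    refine ContinuousLinearMap.opNorm_le_bound _ (by positivity) fun k => ?_
    have hsum := hasSum_entry_comp (adjoint (V i j : L2 X K →L[ℂ] L2 X K))
      (V i j : L2 X K →L[ℂ] L2 X K) x x k
    change ‖entry (adjoint (V i j : L2 X K →L[ℂ] L2 X K) ∘L (V i j : L2 X K →L[ℂ] L2 X K)) x x k‖ ≤ _
    by_cases h0 : ∃ z, entry (V i j : L2 X K →L[ℂ] L2 X K) z x ≠ 0
    · obtain ⟨z, hz⟩ := h0
      rw [hsum.unique (hasSum_single z fun z' hz' => by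
        have : entry (V i j : L2 X K →L[ℂ] L2 X K) z' x = 0 := by
          by_contra hcon
          exact hz' (hVc i j x z' z hcon hz)
        rw [this, _root_.zero_apply, map_zero]), entry_adjoint]
      refine (ContinuousLinearMap.le_opNorm _ _).trans ?_
      rw [LinearIsometryEquiv.norm_map, mul_assoc]
      refine mul_le_mul (hVε i j z x) ((ContinuousLinearMap.le_opNorm _ _).trans ?_) (norm_nonneg _) hε
      exact mul_le_mul_of_nonneg_right (hVε i j z x) (norm_nonneg _)
    · push Not at h0
      rw [hsum.unique (by
        convert (hasSum_zero : HasSum (fun _ : X => (0 : K)) 0) using 2 with z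
        rw [h0 z, _root_.zero_apply, map_zero]), norm_zero]
      positivity
  have hVn : ∀ i j, N.toFun (V i j) ≤ ε := by
    intro i j
    have hd : ∀ x y, x ≠ y →
        entry ((star (V i j) * V i j : UCalg X K) : L2 X K →L[ℂ] L2 X K) x y = 0 :=
      fun x y hxy => cut_diag hT (fun x hx y hy hd => hc x y (hx.trans hy.symm) hd) x y hxy
    have h1 := (toFun_le_of_diag N _ hd).trans
      (norm_le_of_diag hd (mul_self_nonneg ε) (hVd i j))
    rw [N.cstar] at h1
    exact abs_le_of_sq_le_sq' (by nlinarith) hε |>.2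
  rw [hV, ← N.norm_ι, map_sum]
  calc ‖∑ i, N.ι (∑ j, V i j)‖ ≤ ∑ _i : Fin n, ∑ _j : Fin n, ε := by
        refine (norm_sum_le _ _).trans (Finset.sum_le_sum fun i _ => ?_)
        rw [map_sum]
        refine (norm_sum_le _ _).trans (Finset.sum_le_sum fun j _ => ?_)
        rw [N.norm_ι]
        exact hVn i j
    _ = (n : ℝ) * n * ε := by simp [mul_assoc]
    _ ≤ ((n : ℝ) * n + 1) * ε := by nlinarith

end SmallEntries

/-! ### Matrix approximation of the uniform algebra -/

section Absorbing

universe u v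

open Module (finrank)

variable {K : Type v} [NormedAddCommGroup K] [InnerProductSpace ℂ K]

theorem exists_le_finrank_eq (hinf : ¬ FiniteDimensional ℂ K) (W : Submodule ℂ K)
    [FiniteDimensional ℂ W] {m : ℕ} (hm : finrank ℂ W ≤ m) :
    ∃ W' : Submodule ℂ K, W ≤ W' ∧ FiniteDimensional ℂ W' ∧ finrank ℂ W' = m := by
  induction m, hm using Nat.le_induction with
  | base => exact ⟨W, le_rfl, inferInstance, rfl⟩
  | succ m _ ih =>
    obtain ⟨W', hW, hf, hr⟩ := ih
    have hne : W' ≠ ⊤ := fun h => hinf (Module.Finite.of_surjective W'.subtype fun x =>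
      ⟨⟨x, h ▸ Submodule.mem_top⟩, rfl⟩)
    obtain ⟨x, -, hx⟩ := SetLike.exists_of_lt hne.lt_top
    refine ⟨W' ⊔ ℂ ∙ x, hW.trans le_sup_left, inferInstance,
      ?_⟩
    have hx0 : x ≠ 0 := fun h => hx (h ▸ W'.zero_mem)
    have h := Submodule.finrank_sup_add_finrank_inf_eq W' (ℂ ∙ x)
    rw [(Submodule.disjoint_span_singleton_of_notMem hx).eq_bot, finrank_bot, hr,
      finrank_span_singleton hx0] at h
    exact h

/-- A unit vector extends to an orthonormal system of prescribed size whose span contains a given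
subspace; the distance to the span is then at most the distance to the subspace. -/
theorem exists_orthonormal_extension (hinf : ¬ FiniteDimensional ℂ K) (W : Submodule ℂ K)
    [FiniteDimensional ℂ W] {n : ℕ} (hn : finrank ℂ W ≤ n) {η : K} (hη : ‖η‖ = 1) :
    ∃ e : Option (Fin n) → K, Orthonormal ℂ e ∧ e none = η ∧
      ∀ u : K, ∀ w ∈ W, ‖u - ∑ k, inner ℂ (e k) u • e k‖ ≤ ‖u - w‖ := by
  have hr : finrank ℂ (W ⊔ ℂ ∙ η : Submodule ℂ K) ≤ n + 1 := by
    refine (Submodule.finrank_add_le_finrank_add_finrank _ _).trans ?_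
    have := finrank_span_singleton (K := ℂ) (v := η) (norm_ne_zero_iff.mp (hη ▸ one_ne_zero))
    omega
  obtain ⟨U, hU, hf, hUr⟩ := exists_le_finrank_eq hinf (W ⊔ ℂ ∙ η) hr
  have hηU : η ∈ U := hU (le_sup_right (a := W) (Submodule.mem_span_singleton_self η))
  have hv : Orthonormal ℂ (({none} : Set (Option (Fin n))).domRestrict fun _ => (⟨η, hηU⟩ : U)) := by
    refine ⟨fun _ => hη, fun i j hij => absurd (Subsingleton.elim i j) hij⟩
  obtain ⟨b, hb⟩ := hv.exists_orthonormalBasis_extension_of_card_eq (by simpa using hUr)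
  refine ⟨fun k => b k, ?_, ?_, fun u w hw => ?_⟩
  · exact b.orthonormal.comp_linearIsometry U.subtypeₗᵢ
  · exact congrArg Subtype.val (hb none rfl)
  · have h1 := congrArg Subtype.val (b.orthogonalProjectionOnto_apply_eq_sum u)
    have h2 : ∑ k, inner ℂ (b k : K) u • (b k : K) = U.starProjection u := by
      refine Eq.trans ?_ h1.symm
      simp
    rw [h2, Submodule.starProjection_minimal]
    exact ciInf_le ⟨0, by rintro _ ⟨x, rfl⟩; exact norm_nonneg _⟩
      (⟨w, hU (le_sup_left (a := W) hw)⟩ : U)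

variable {X : Type u} [MetricSpace X] [BoundedGeometry X] [CompleteSpace K]

/-- The ranges of approximations of finite rank to the entries in one row of an element of `Uℂ[X]`
span a space of uniformly bounded dimension. -/
theorem exists_row_subspaces (T : UCalg X K) {ε : ℝ} (hε : 0 < ε) :
    ∃ (n : ℕ) (W : X → Submodule ℂ K), (∀ x, FiniteDimensional ℂ (W x)) ∧
      (∀ x, finrank ℂ (W x) ≤ n) ∧ ∀ x y u, ∃ w ∈ W x,
        ‖entry (T : L2 X K →L[ℂ] L2 X K) x y u - w‖ ≤ ε * ‖u‖ := by
  classical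
  obtain ⟨⟨S, hS, hS'⟩, happ⟩ := mem_UCalg'.mp T.2
  obtain ⟨N, hN⟩ := happ ε hε
  choose F hF hFε using hN
  obtain ⟨M, hM⟩ := BoundedGeometry.exists_bound (X := X) S hS
  have hfin : ∀ x, (Metric.ball x S).Finite := fun x =>
    Set.encard_lt_top_iff.mp ((hM x).trans_lt (ENat.natCast_lt_top M))
  have hcard : ∀ x, (hfin x).toFinset.card ≤ M := fun x => by
    have := hM x
    rw [(hfin x).encard_eq_coe_toFinset_card] at this
    exact_mod_cast this
  have hFd : ∀ x y, FiniteDimensional ℂ (LinearMap.range (F x y : K →ₗ[ℂ] K)) := fun x y =>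
    Module.rank_lt_aleph0_iff.mp ((hF x y).trans_lt (Cardinal.natCast_lt_aleph0))
  have hFr : ∀ x y, finrank ℂ (LinearMap.range (F x y : K →ₗ[ℂ] K)) ≤ N := fun x y =>
    Module.finrank_le_of_rank_le (hF x y)
  refine ⟨M * N, fun x => (hfin x).toFinset.sup fun y => LinearMap.range (F x y : K →ₗ[ℂ] K),
    fun x => Submodule.finiteDimensional_finset_sup _ _, fun x => ?_, fun x y u => ?_⟩
  · have key : ∀ s : Finset X,
        finrank ℂ (s.sup fun y => LinearMap.range (F x y : K →ₗ[ℂ] K) : Submodule ℂ K) ≤ s.card * N := by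
      intro s
      induction s using Finset.induction_on with
      | empty => simp
      | insert a s ha ih =>
        have := Submodule.finiteDimensional_finset_sup s
          fun y => LinearMap.range (F x y : K →ₗ[ℂ] K)
        rw [Finset.sup_insert, Finset.card_insert_of_notMem ha]
        refine (Submodule.finrank_add_le_finrank_add_finrank _ _).trans ?_
        have := hFr x a
        rw [add_mul, one_mul, add_comm (s.card * N)]
        exact add_le_add this ih
    exact (key _).trans (Nat.mul_le_mul_right _ (hcard x))
  · rcases lt_or_ge (dist x y) S with h | h
    · refine ⟨F x y u, ?_, ?_⟩
      · refine Finset.le_sup (f := fun y => LinearMap.range (F x y : K →ₗ[ℂ] K)) ?_ ⟨u, rfl⟩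
        rwa [Set.Finite.mem_toFinset, Metric.mem_ball, dist_comm]
      · rw [← norm_neg, neg_sub]
        exact (F x y - entry (T : L2 X K →L[ℂ] L2 X K) x y).le_of_opNorm_le (hFε x y).le u
    · refine ⟨0, Submodule.zero_mem _, ?_⟩
      rw [hS' x y h]
      simpa using by positivity

/-- Finitely many elements of `Uℂ[X]` are almost fixed by left multiplication with the projection of any
orthonormal family whose spans come at least as close to every vector as suitable subspaces of uniformly
bounded dimension. -/
theorem exists_subspaces (N : CStarSeminorm (UCalg X K)) (t : Set (UCalg X K)) (ht : t.Finite)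
    {ε : ℝ} (hε : 0 < ε) :
    ∃ (n : ℕ) (W : X → Submodule ℂ K), (∀ x, FiniteDimensional ℂ (W x)) ∧
      (∀ x, finrank ℂ (W x) ≤ n) ∧ ∀ (m : ℕ) (e : OrthoFamily X K (Option (Fin m))),
        (∀ x u, ∀ w ∈ W x, ‖u - ∑ k, inner ℂ (e.vec k x) u • e.vec k x‖ ≤ ‖u - w‖) →
        ∀ T ∈ t, N.toFun (T - e.proj * T) < ε := by
  induction t, ht using Set.Finite.induction_on with
  | empty => exact ⟨0, fun _ => ⊥, fun _ => inferInstance, fun _ => by simp, by simp⟩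
  | @insert T t _ _ ih =>
    obtain ⟨n, W, hWf, hWn, hW⟩ := ih
    obtain ⟨S, hS, hS'⟩ := (mem_UCalg'.mp T.2).1
    obtain ⟨C, hC, hC'⟩ := exists_toFun_le N hS
    obtain ⟨n', W', hWf', hWn', hW'⟩ := exists_row_subspaces T (ε := ε / (2 * C)) (by positivity)
    refine ⟨n + n', fun x => W x ⊔ W' x, fun x => inferInstance, fun x =>
      (Submodule.finrank_add_le_finrank_add_finrank _ _).trans (add_le_add (hWn x) (hWn' x)),
      fun m e he R hR => ?_⟩
    rcases hR with rfl | hR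
    · refine (hC' _ (fun x y h => ?_) (ε / (2 * C)) (by positivity) fun x y => ?_).trans_lt ?_
      · ext u
        rw [e.entry_sub_proj_mul, hS' x y h]
        simp
      · refine ContinuousLinearMap.opNorm_le_bound _ (by positivity) fun u => ?_
        obtain ⟨w, hw, hw'⟩ := hW' x y u
        rw [e.entry_sub_proj_mul]
        exact (he x _ w (le_sup_right (a := W x) hw)).trans hw'
      · have : C * (ε / (2 * C)) = ε / 2 := by field_simp
        rw [this]
        exact half_lt_self hε
    · exact hW m e (fun x u w hw => he x u w (le_sup_left (b := W' x) hw)) R hR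

/-- The uniform algebra is approximated by matrix algebras over the uniform Roe algebra. -/
theorem hasCompactCornerFrames_iP (hinf : ¬ FiniteDimensional ℂ K) (s : Variant) (η : X → K)
    (hη : ∀ x, ‖η x‖ = 1) :
    @HasCompactCornerFrames (UCStar X K s) _ (CuStar X s) _ (iP s η hη) := by
  refine PreHilbertModule.hasCompactCornerFrames (P := preE X K) (l := ealgLeft X K)
    (norm_iPalg_le s η hη) (toFun_ealgLeft_le s) fun t ht ε hε => ?_
  obtain ⟨n, W, hWf, hWn, hW⟩ := exists_subspaces (s.seminorm (UCalg X K)) t ht hε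
  have h := fun x => exists_orthonormal_extension hinf (W x) (hWn x) (hη x)
  choose e he he0 heW using h
  obtain rfl : (fun x => e x none) = η := funext he0
  let O : OrthoFamily X K (Option (Fin n)) := ⟨fun k x => e x k, he⟩
  exact ⟨n, O.frame s, O.proj, O.star_proj, O.proj_mul_proj, O.sum_frame s, hW n O heW⟩

end Absorbing

/-! ### The isomorphism in K-theory -/

section Isomorphism

universe u v w

variable {A : Type w} [NonUnitalCStarAlgebra A] {B : Type v} [NonUnitalCStarAlgebra B]

/-- If a correspondence is realized as a corner by each of several homomorphisms, then they all
induce the inverse of the map induced by the correspondence: the relation that defines this map does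
not involve the realizations. -/
theorem exists_isExelMap {ι : Type*} [Nonempty ι] (φ : ι → B →⋆ₙₐ[ℂ] A) (E : Type w)
    [NormedAddCommGroup E] [NormedSpace ℂ E] [CompleteSpace E] [HilbertModule B E]
    [Correspondence A B E] (κ : ∀ i, CornerRealization (φ i) E)
    (h : ∀ i, HasCompactCornerFrames (φ i)) :
    ∃ (E₀ : K0 A ≃+ K0 B) (E₁ : K1 A ≃+ K1 B),
      IsExelMap A B E (fun x => E₀ x) ∧ IsExelMap₁ A B E (fun x => E₁ x) ∧
      ∀ i, (∀ y, K0.map (φ i) y = E₀.symm y) ∧ ∀ y, K1.map (φ i) y = E₁.symm y := by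
  have h₀ := fun i => (κ i).exelRel_iff (h i).hasCornerFrames
  have h₁ := fun i => (κ i).susp.exelRel_iff (h i).susp
  let i₀ : ι := Classical.arbitrary ι
  refine ⟨(AddEquiv.ofBijective _ (h₀ i₀).1).symm, (AddEquiv.ofBijective _ (h₁ i₀).1).symm,
    fun x y => ?_, fun x y => ?_, fun i => ⟨fun y => ?_, fun y => ?_⟩⟩
  · refine ((h₀ i₀).2 x y).trans ?_
    rw [AddEquiv.symm_apply_eq]
    exact eq_comm
  · refine ((h₁ i₀).2 x y).trans ?_
    rw [AddEquiv.symm_apply_eq]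
    exact eq_comm
  · exact (((h₀ i₀).2 _ y).mp (((h₀ i).2 _ y).mpr rfl)).symm
  · exact (((h₁ i₀).2 _ y).mp (((h₁ i).2 _ y).mpr rfl)).symm

end Isomorphism

end UniformRoe

end

theorem mainTheorem5 {X : Type*} [MetricSpace X] [UniformlyDiscrete X] [BoundedGeometry X]
    {H₀ : Type*} [NormedAddCommGroup H₀] [InnerProductSpace ℂ H₀] [CompleteSpace H₀]
    [TopologicalSpace.SeparableSpace H₀] (hinf : ¬ FiniteDimensional ℂ H₀) (s : Variant) :
    ∃ (E₀ : K0 (UCStar X H₀ s) ≃+ K0 (CuStar X s)) (E₁ : K1 (UCStar X H₀ s) ≃+ K1 (CuStar X s)),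
      IsExelMap (UCStar X H₀ s) (CuStar X s) (EStar X H₀ s) (fun x => E₀ x) ∧
      IsExelMap₁ (UCStar X H₀ s) (CuStar X s) (EStar X H₀ s) (fun x => E₁ x) ∧
      ∀ (η : X → H₀) (hη : ∀ x, ‖η x‖ = 1),
        (∀ y : K0 (CuStar X s),
          K0.map (A := CuStar X s) (B := UCStar X H₀ s) (iP s η hη) y = E₀.symm y) ∧
        (∀ y : K1 (CuStar X s),
          K1.map (A := CuStar X s) (B := UCStar X H₀ s) (iP s η hη) y = E₁.symm y) := by
  have hne : Nonempty {η : X → H₀ // ∀ x, ‖η x‖ = 1} := by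
    have : Nontrivial H₀ := not_subsingleton_iff_nontrivial.mp fun h => hinf inferInstance
    obtain ⟨v, hv⟩ := exists_ne (0 : H₀)
    exact ⟨⟨fun _ => ((‖v‖ : ℂ)⁻¹) • v, fun _ => norm_smul_inv_norm hv⟩⟩
  have h := exists_isExelMap (A := UCStar X H₀ s) (B := CuStar X s)
    (fun η : {η : X → H₀ // ∀ x, ‖η x‖ = 1} => iP s η.1 η.2) (EStar X H₀ s)
    (fun η => bimoduleRealization s η.1 η.2) fun η => hasCompactCornerFrames_iP hinf s η.1 η.2
  exact h.elim fun E₀ h => h.elim fun E₁ h => ⟨E₀, E₁, h.1, h.2.1, fun η hη => h.2.2 ⟨η, hη⟩⟩
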